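/- Let $k$ be an algebraically closed field of characteristic $5$. **The algebras.** Let $\mathcal C$ be the Cayley algebra over $k$ (the unital composition algebra of dimension $8$, unique up to isomorphism, realized by Zorn vector matrices), with norm $n$, polar form $n(a,b)=n(a+b)-n(a)-n(b)$, and $\mathcal C^0=\{a: n(1,a)=0\}$. For $a,b\in\mathcal C$ put $D_{a,b}(c)=[[a,b],c]-3\bigl((ab)c-a(bc)\bigr)$. Let $K=ke\oplus U$ be the Kaplansky superalgebra: $K_{\bar 0}=ke$, $K_{\bar 1}=U$ is two dimensional with a nonzero alternating form $(\cdot|\cdot)$, and $e^2=e$, $ex=xe=\frac12x$, $xy=(x|y)e$ for $x,y\in U$; extend the form to $K$ by $(e|e)=\frac12$, $(e|U)=(U|e)=0$. Let $\mathcal J=k1\oplus(K\otimes K)$ be the ten dimensional Kac Jordan superalgebra, with unit $1$ and $$(a\otimes b)(c\otimes d)=(-1)^{\bar b\bar c}\Bigl(ac\otimes bd-\tfrac34(a|c)(b|d)1\Bigr)$$ for homogeneous $a,b,c,d\in K$; let $t:\mathcal J\to k$ be the linear form with $t(1)=1$, $t(K\otimes K)=0$, put $\mathcal J^0=\ker t$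 and $x*y=xy-t(xy)1$, let $L_x$ be the left multiplication by $x$, $[L_x,L_y]=L_xL_y-(-1)^{\bar x\bar y}L_yL_x$, and let $\mathrm{inder}\,\mathcal J$ be the span of the $[L_x,L_y]$ for homogeneous $x,y\in\mathcal J$. **The Tits construction.** Let $\mathcal T=\mathcal T(\mathcal C,\mathcal J)=\mathrm{der}\,\mathcal C\oplus(\mathcal C^0\otimes\mathcal J^0)\oplus\mathrm{inder}\,\mathcal J$, with the superanticommutative product for which $[\cdot,\cdot]$ is the commutator on $\mathrm{der}\,\mathcal C$ and the supercommutator on $\mathrm{inder}\,\mathcal J$, and $$[D,d]=0,\quad [D,a\otimes x]=D(a)\otimes x,\quad [d,a\otimes x]=a\otimes d(x),$$ $$[a\otimes x,b\otimes y]=t(xy)D_{a,b}+[a,b]\otimes x*y-2n(a,b)[L_x,L_y]$$ for $D\in\mathrm{der}\,\mathcal C$ and homogeneous $d\in\mathrm{inder}\,\mathcal J$, $a,b\in\mathcal C^0$, and homogeneous $x,y\in\mathcal J^0$. **The spin module.** Let $V=k^5$ with standard basis $v_1,\dots,v_5$, and $W=ku\oplus V\oplus V^*$ with $q(\alpha u+v+f)=-\alpha^2+f(v)$,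 $q(x,y)=q(x+y)-q(x)-q(y)$, and $\mathfrak{so}_{11}=\mathfrak{so}(W,q)$, spanned by the maps $\sigma_{x,y}=q(x,\cdot)y-q(y,\cdot)x$. The spin module is $S=\bigwedge V$ with the representation $\rho$ of $\mathfrak{so}_{11}$ that is the composition of the embedding $\sigma_{x,y}\mapsto-\frac12(x\cdot y-y\cdot x)$ into the even Clifford algebra $\mathrm{Cl}_{\bar 0}(W,q)$, the inverse of the isomorphism $\mathrm{Cl}(V\oplus V^*,q)\to\mathrm{Cl}_{\bar 0}(W,q)$, $x\mapsto u\cdot x$ (for $x\in V\oplus V^*$), and the homomorphism $\mathrm{Cl}(V\oplus V^*,q)\to\mathrm{End}_k(\bigwedge V)$, $v+f\mapsto l_v+df$, where $l_v$ is left multiplication by $v$ and $df$ is the odd superderivation of $\bigwedge V$ extending $f$. Let $b(s,t)=\Phi(\bar s\,t)$ on $S$, where $s\mapsto\bar s$ is the antiautomorphism of $\bigwedge V$ with $\bar v=-v$ for $v\in V$, and $\Phi:\bigwedge V\to k$ is the linear form with $\Phi(v_1\cdots v_5)=1$ that vanishes on $\bigwedge^rV$ for $r\neq5$. Let $\mathfrak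 g=\mathfrak{so}_{11}\oplus S$ be the superalgebra with even part $\mathfrak{so}_{11}$, odd part $S$, and product given by the bracket of $\mathfrak{so}_{11}$, by $[\sigma,s]=-[s,\sigma]=\rho(\sigma)(s)$, and by $[s,s']\in\mathfrak{so}_{11}$ with $$\tfrac12\mathrm{tr}\bigl(\sigma[s,s']\bigr)=b\bigl(\rho(\sigma)(s),s'\bigr)\qquad(\sigma\in\mathfrak{so}_{11},\ s,s'\in S),$$ where $\mathrm{tr}$ is the trace on $W$. **Theorem.** $\mathcal T(\mathcal C,\mathcal J)$ is a Lie superalgebra, and there are linear isomorphisms $\varphi_0:\mathcal T_{\bar 0}\to\mathfrak{so}_{11}$ and $\varphi_1:\mathcal T_{\bar 1}\to S$ such that: (i) $\varphi_0$ is an isomorphism of Lie algebras; (ii) $\varphi_1([x,y])=\rho(\varphi_0(x))(\varphi_1(y))$ for all $x\in\mathcal T_{\bar 0}$, $y\in\mathcal T_{\bar 1}$; that is, $\mathcal T_{\bar 1}$ is isomorphic to the spin module for $\mathcal T_{\bar 0}$; (iii) $\frac12\mathrm{tr}\bigl(\sigma\,\varphi_0([y,z])\bigr)=b\bigl(\rho(\sigma)(\varphi_1(y)),\varphi_1(z)\bigr)$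 for all $\sigma\in\mathfrak{so}_{11}$ and $y,z\in\mathcal T_{\bar 1}$; hence $\varphi_0\oplus\varphi_1$ is an isomorphism from $\mathcal T(\mathcal C,\mathcal J)$ onto the Lie superalgebra $\mathfrak g$. -/

import Mathlib

open scoped TensorProduct

attribute [local instance] LieRing.ofAssociativeRing

noncomputable section

/-! ## Superspaces and Lie superalgebras

A superspace is a pair of subspaces `T 0` (even) and `T 1` (odd), indexed by `ZMod 2`. -/

/-- The sign `(-1)^(i j)` of the sign rule, for parities `i`, `j`. -/
def koszulSign (i j : ZMod 2) : ℤ := if i = 1 ∧ j = 1 then -1 else 1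

/-- The superspace `T 0 ⊕ T 1` (the components being subspaces of some ambient space `A`) with the
product of a homogeneous element `x ∈ T i` and a homogeneous element `y ∈ T j` given by `br i j x y`
is a Lie superalgebra (over a field of characteristic different from 2 and 3): the product is
bilinear, superanticommutative and satisfies the super Jacobi identity. Linearity in the second
argument follows from `add_left`, `smul_left` and `skew`. -/
structure IsLieSuperalgebra {k A : Type*} [Field k] [AddCommGroup A] [Module k A]
    (T : ZMod 2 → Submodule k A) (br : ZMod 2 → ZMod 2 → A → A → A) : Prop where
  mem : ∀ i j, ∀ x ∈ T i, ∀ y ∈ T j, br i j x y ∈ T (i + j)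
  add_left : ∀ i j, ∀ x ∈ T i, ∀ x' ∈ T i, ∀ y ∈ T j,
    br i j (x + x') y = br i j x y + br i j x' y
  smul_left : ∀ i j, ∀ c : k, ∀ x ∈ T i, ∀ y ∈ T j, br i j (c • x) y = c • br i j x y
  skew : ∀ i j, ∀ x ∈ T i, ∀ y ∈ T j, br i j x y = -(koszulSign i j • br j i y x)
  jacobi : ∀ i j l, ∀ x ∈ T i, ∀ y ∈ T j, ∀ z ∈ T l,
    br i (j + l) x (br j l y z) =
      br (i + j) l (br i j x y) z + koszulSign i j • br j (i + l) y (br i l x z)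

/-! ## The Tits construction

The algebras `C` and `J` are given by their bilinear products `m` and `p`. -/

section Tits

variable {k C J : Type*} [Field k] [AddCommGroup C] [Module k C] [AddCommGroup J] [Module k J]

/-- The commutator `[a, b] = ab - ba` of an algebra with product `m`. -/
def algComm (m : C →ₗ[k] C →ₗ[k] C) : C →ₗ[k] C →ₗ[k] C := m - m.flip

/-- The map `(a, b) ↦ D_{a,b}`, where `D_{a,b}(c) = [[a,b],c] - 3 (a,b,c)` and
`(a,b,c) = (ab)c - a(bc)`. -/
def innerDer (m : C →ₗ[k] C →ₗ[k] C) : C →ₗ[k] C →ₗ[k] Module.End k C :=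
  (algComm m).compr₂ (algComm m) -
    (3 : k) • (m.compr₂ m - (LinearMap.mul k (Module.End k C)).compl₁₂ m m)

theorem innerDer_apply (m : C →ₗ[k] C →ₗ[k] C) (a b c : C) :
    innerDer m a b c =
      algComm m (algComm m a b) c - (3 : k) • (m (m a b) c - m a (m b c)) := rfl

/-- `der C`, the space of derivations of the algebra `C` with product `m`. -/
def derSpace (m : C →ₗ[k] C →ₗ[k] C) : Submodule k (Module.End k C) where
  carrier := {D | ∀ a b, D (m a b) = m (D a) b + m a (D b)}
  add_mem' := by
    intro D E hD hE a b
    simp only [LinearMap.add_apply, hD a b, hE a b, map_add]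
    abel
  zero_mem' := by intro a b; simp
  smul_mem' := by
    intro c D hD a b
    simp only [LinearMap.smul_apply, hD a b, map_smul, smul_add]

/-- `C⁰ = {a | n(1, a) = 0}`, where `n(a, b) = n(a + b) - n(a) - n(b)`. -/
def traceZero (n : QuadraticForm k C) (e : C) : Submodule k C :=
  LinearMap.ker (n.polarBilin e)

/-- The map `(x, y) ↦ L_x L_y - ε L_y L_x`, where `L_x` is the left multiplication by `x` for the
product `p`. For homogeneous `x`, `y` and `ε = (-1)^(|x||y|)` this is the supercommutator
`[L_x, L_y]`. -/
def leftComm (p : J →ₗ[k] J →ₗ[k] J) (ε : ℤ) : J →ₗ[k] J →ₗ[k] Module.End k J :=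
  (LinearMap.mul k (Module.End k J)).compl₁₂ p p -
    ε • ((LinearMap.mul k (Module.End k J)).compl₁₂ p p).flip

theorem leftComm_apply (p : J →ₗ[k] J →ₗ[k] J) (ε : ℤ) (x y z : J) :
    leftComm p ε x y z = p x (p y z) - ε • p y (p x z) := rfl

/-- The component of parity `i` of `inder J = [L_J, L_J]`: the span of all `[L_x, L_y]` with `x` and
`y` homogeneous and `|x| + |y| = i`. The component of `J` of parity `q` is `gr q`. -/
def innerDerSuper (p : J →ₗ[k] J →ₗ[k] J) (gr : ZMod 2 → Submodule k J) (i : ZMod 2) :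
    Submodule k (Module.End k J) :=
  ⨆ q : ZMod 2, Submodule.map₂ (leftComm p (koszulSign q (i - q))) (gr q) (gr (i - q))

/-- The product `(x, y) ↦ x * y = xy - t(xy) 1`. -/
def starMul (p : J →ₗ[k] J →ₗ[k] J) (u : J) (t : J →ₗ[k] k) : J →ₗ[k] J →ₗ[k] J :=
  p - p.compr₂ (t.smulRight u)

theorem starMul_apply (p : J →ₗ[k] J →ₗ[k] J) (u : J) (t : J →ₗ[k] k) (x y : J) :
    starMul p u t x y = p x y - t (p x y) • u := rfl

/-- The space `End C × (C ⊗ J) × End J`, in which the Tits construction lives. -/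
abbrev TitsAmbient (k C J : Type*) [Field k] [AddCommGroup C] [Module k C] [AddCommGroup J]
    [Module k J] : Type _ :=
  Module.End k C × (C ⊗[k] J) × Module.End k J

/-- The component of parity `i` of the superspace `T(C, J) = der C ⊕ (C⁰ ⊗ J⁰) ⊕ inder J`, where
`J⁰ = {x | t(x) = 0}` and `der C` is even. -/
def titsSpace (m : C →ₗ[k] C →ₗ[k] C) (n : QuadraticForm k C) (e : C)
    (p : J →ₗ[k] J →ₗ[k] J) (gr : ZMod 2 → Submodule k J) (t : J →ₗ[k] k) (i : ZMod 2) :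
    Submodule k (TitsAmbient k C J) :=
  Submodule.prod (if i = 0 then derSpace m else ⊥)
    ((Submodule.map₂ (TensorProduct.mk k C J) (traceZero n e) (gr i ⊓ LinearMap.ker t)).prod
      (innerDerSuper p gr i))

/-- The product of an element of parity `i` and an element of parity `j` in `T(C, J)`. With
`ε = (-1)^(i j)` it is given by
* `[D, D'] = D D' - D' D`, `[d, d'] = d d' - ε d' d`, `[D, d] = 0`,
* `[D, a ⊗ x] = D(a) ⊗ x = -[a ⊗ x, D]`, `[d, a ⊗ x] = a ⊗ d(x) = -ε [a ⊗ x, d]`,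
* `[a ⊗ x, b ⊗ y] = t(xy) D_{a,b} + [a,b] ⊗ x * y - 2 n(a,b) [L_x, L_y]`. -/
def titsBracket (m : C →ₗ[k] C →ₗ[k] C) (n : QuadraticForm k C)
    (p : J →ₗ[k] J →ₗ[k] J) (u : J) (t : J →ₗ[k] k) (i j : ZMod 2)
    (X Y : TitsAmbient k C J) : TitsAmbient k C J :=
  let ε := koszulSign i j
  ( X.1 * Y.1 - Y.1 * X.1
      + TensorProduct.rid k _ (TensorProduct.map₂ (innerDer m) (p.compr₂ t) X.2.1 Y.2.1),
    LinearMap.rTensor J X.1 Y.2.1 - LinearMap.rTensor J Y.1 X.2.1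
      + LinearMap.lTensor C X.2.2 Y.2.1 - ε • LinearMap.lTensor C Y.2.2 X.2.1
      + TensorProduct.map₂ (algComm m) (starMul p u t) X.2.1 Y.2.1,
    X.2.2 * Y.2.2 - ε • (Y.2.2 * X.2.2)
      - (2 : k) • TensorProduct.lid k _
          (TensorProduct.map₂ n.polarBilin (leftComm p ε) X.2.1 Y.2.1) )

theorem titsBracket_tmul_tmul (m : C →ₗ[k] C →ₗ[k] C) (n : QuadraticForm k C)
    (p : J →ₗ[k] J →ₗ[k] J) (u : J) (t : J →ₗ[k] k) (i j : ZMod 2) (a b : C) (x y : J) :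
    titsBracket m n p u t i j (0, a ⊗ₜ x, 0) (0, b ⊗ₜ y, 0) =
      (t (p x y) • innerDer m a b,
        algComm m a b ⊗ₜ[k] starMul p u t x y,
        -((2 * QuadraticMap.polar n a b) • leftComm p (koszulSign i j) x y)) := by
  simp [titsBracket, mul_smul]

end Tits

/-! ## The Cayley algebra, as the algebra of Zorn vector matrices -/

/-- Zorn vector matrices `(α, u; v, β)`, written as `((α, u), (v, β))`. -/
abbrev Cayley (k : Type*) : Type _ := (k × (Fin 3 → k)) × ((Fin 3 → k) × k)

section Cayley

variable (k : Type*) [Field k]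

/-- The product
`(α, u; v, β) (α', u'; v', β') = (αα' + u·v', αu' + β'u - v×v'; α'v + βv' + u×u', ββ' + v·u')`. -/
def cayleyMul : Cayley k →ₗ[k] Cayley k →ₗ[k] Cayley k :=
  LinearMap.mk₂ k
    (fun x y =>
      ((x.1.1 * y.1.1 + x.1.2 ⬝ᵥ y.2.1,
        x.1.1 • y.1.2 + y.2.2 • x.1.2 - crossProduct x.2.1 y.2.1),
       (y.1.1 • x.2.1 + x.2.2 • y.2.1 + crossProduct x.1.2 y.1.2,
        x.2.2 * y.2.2 + x.2.1 ⬝ᵥ y.1.2)))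
    (by
      intro x x' y
      ext <;> simp [add_mul, add_smul] <;> ring)
    (by
      intro c x y
      ext <;> simp <;> ring)
    (by
      intro x y y'
      ext <;> simp [mul_add, add_smul] <;> ring)
    (by
      intro c x y
      ext <;> simp <;> ring)

/-- The unit element of the Cayley algebra. -/
def cayleyOne : Cayley k := ((1, 0), (0, 1))

/-- The norm `n(α, u; v, β) = αβ - u·v` of the Cayley algebra. -/
def cayleyNorm : QuadraticForm k (Cayley k) :=
  LinearMap.BilinMap.toQuadraticMap
    (LinearMap.mk₂ k (fun x y : Cayley k => x.1.1 * y.2.2 - x.1.2 ⬝ᵥ y.2.1)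
      (by intro x x' y; simp [add_mul]; ring)
      (by intro c x y; simp [mul_sub, mul_assoc])
      (by intro x y y'; simp [mul_add]; ring)
      (by intro c x y; simp; ring))

theorem cayleyNorm_apply (x : Cayley k) :
    cayleyNorm k x = x.1.1 * x.2.2 - x.1.2 ⬝ᵥ x.2.1 := rfl

theorem cayleyMul_one_left (x : Cayley k) : cayleyMul k (cayleyOne k) x = x := by
  ext <;> simp [cayleyMul, cayleyOne]

theorem cayleyMul_one_right (x : Cayley k) : cayleyMul k x (cayleyOne k) = x := by
  ext <;> simp [cayleyMul, cayleyOne]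

theorem cayleyNorm_mul (x y : Cayley k) :
    cayleyNorm k (cayleyMul k x y) = cayleyNorm k x * cayleyNorm k y := by
  simp only [cayleyNorm_apply, cayleyMul, LinearMap.mk₂_apply, dotProduct, Fin.sum_univ_three,
    cross_apply, Pi.add_apply, Pi.sub_apply, Pi.smul_apply, smul_eq_mul, Matrix.cons_val_zero,
    Matrix.cons_val_one, Matrix.cons_val]
  ring

theorem cayleyNorm_nondegenerate (x : Cayley k)
    (h : ∀ y, QuadraticMap.polar (cayleyNorm k) x y = 0) : x = 0 := by
  have key : ∀ y : Cayley k, x.1.1 * y.2.2 + y.1.1 * x.2.2 - x.1.2 ⬝ᵥ y.2.1 - y.1.2 ⬝ᵥ x.2.1 = 0 := by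
    intro y
    rw [← h y]
    simp only [QuadraticMap.polar, cayleyNorm_apply, Prod.fst_add, Prod.snd_add, add_dotProduct,
      dotProduct_add]
    ring
  ext i
  · simpa using key ((0, 0), (0, 1))
  · simpa using key ((0, 0), (Pi.single i 1, 0))
  · simpa using key ((0, Pi.single i 1), (0, 0))
  · simpa using key ((1, 0), (0, 0))

end Cayley

/-! ## The Kaplansky superalgebra and the Kac Jordan superalgebra -/

/-- The space `K = k e ⊕ U` with `U = k²`; the pair `(α, v)` is `α e + v`. -/
abbrev Kaplansky (k : Type*) : Type _ := k × (Fin 2 → k)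

/-- The space `k 1 ⊕ (K ⊗ K)`; the pair `(α, z)` is `α 1 + z`. -/
abbrev Kac (k : Type*) [Field k] : Type _ := k × (Kaplansky k ⊗[k] Kaplansky k)

section Kac

variable (k : Type*) [Field k]

/-- The nonzero alternating form `(u | v) = u₀ v₁ - u₁ v₀` on `U = k²`, extended to the
supersymmetric form on `K` with `(e | e) = 1/2` and `(e | U) = (U | e) = 0`. -/
def kapForm : Kaplansky k →ₗ[k] Kaplansky k →ₗ[k] k :=
  LinearMap.mk₂ k
    (fun x y => (1 / 2 : k) * (x.1 * y.1) + (x.2 0 * y.2 1 - x.2 1 * y.2 0))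
    (by intro x x' y; simp; ring)
    (by intro c x y; simp; ring)
    (by intro x y y'; simp; ring)
    (by intro c x y; simp; ring)

/-- The product of the Kaplansky superalgebra: `e e = e`, `e v = v e = v / 2` and `u v = (u | v) e`
for `u, v ∈ U`. -/
def kapMul : Kaplansky k →ₗ[k] Kaplansky k →ₗ[k] Kaplansky k :=
  LinearMap.mk₂ k
    (fun x y => (x.1 * y.1 + (x.2 0 * y.2 1 - x.2 1 * y.2 0),
      (1 / 2 : k) • (x.1 • y.2 + y.1 • x.2)))
    (by intro x x' y; ext <;> simp <;> ring)
    (by intro c x y; ext <;> simp <;> ring)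
    (by intro x y y'; ext <;> simp <;> ring)
    (by intro c x y; ext <;> simp <;> ring)

/-- The projection of `K` onto its component of parity `i` (`k e` for `i = 0`, `U` for `i = 1`). -/
def kapProj (i : ZMod 2) : Kaplansky k →ₗ[k] Kaplansky k :=
  if i = 0 then LinearMap.inl k k (Fin 2 → k) ∘ₗ LinearMap.fst k k (Fin 2 → k)
  else LinearMap.inr k k (Fin 2 → k) ∘ₗ LinearMap.snd k k (Fin 2 → k)

/-- The component of parity `i` of `K`. -/
def kapGr (i : ZMod 2) : Submodule k (Kaplansky k) := LinearMap.range (kapProj k i)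

/-- For bilinear maps `f` and `g` on `K`, the bilinear map on `K ⊗ K` with
`(a ⊗ b, c ⊗ d) ↦ (-1)^(|b||c|) f(a, c) ⊗ g(b, d)` for homogeneous `a`, `b`, `c`, `d`. -/
def superMap₂ {P Q : Type*} [AddCommGroup P] [Module k P] [AddCommGroup Q] [Module k Q]
    (f : Kaplansky k →ₗ[k] Kaplansky k →ₗ[k] P) (g : Kaplansky k →ₗ[k] Kaplansky k →ₗ[k] Q) :
    Kaplansky k ⊗[k] Kaplansky k →ₗ[k] Kaplansky k ⊗[k] Kaplansky k →ₗ[k] P ⊗[k] Q :=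
  ∑ i : ZMod 2, ∑ j : ZMod 2, koszulSign i j •
    (TensorProduct.map₂ f g).compl₁₂ (LinearMap.lTensor (Kaplansky k) (kapProj k i))
      (LinearMap.rTensor (Kaplansky k) (kapProj k j))

theorem kapProj_of_mem {i : ZMod 2} {x : Kaplansky k} (hx : x ∈ kapGr k i) (j : ZMod 2) :
    kapProj k j x = if j = i then x else 0 := by
  obtain ⟨y, rfl⟩ := hx
  have h01 : ∀ i : ZMod 2, i = 0 ∨ i = 1 := by decide
  have h10 : (1 : ZMod 2) ≠ 0 := by decide
  rcases h01 i with rfl | rfl <;> rcases h01 j with rfl | rfl <;>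
    simp [kapProj, h10, h10.symm]

theorem superMap₂_tmul {P Q : Type*} [AddCommGroup P] [Module k P] [AddCommGroup Q] [Module k Q]
    (f : Kaplansky k →ₗ[k] Kaplansky k →ₗ[k] P) (g : Kaplansky k →ₗ[k] Kaplansky k →ₗ[k] Q)
    {i j : ZMod 2} (a : Kaplansky k) {b c : Kaplansky k} (d : Kaplansky k)
    (hb : b ∈ kapGr k i) (hc : c ∈ kapGr k j) :
    superMap₂ k f g (a ⊗ₜ b) (c ⊗ₜ d) = koszulSign i j • (f a c ⊗ₜ[k] g b d) := by
  have key : ∀ i' j' : ZMod 2,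
      koszulSign i' j' • (f a (kapProj k j' c) ⊗ₜ[k] g (kapProj k i' b) d) =
        if i' = i then (if j' = j then koszulSign i j • (f a c ⊗ₜ[k] g b d) else 0) else 0 := by
    intro i' j'
    rw [kapProj_of_mem k hb, kapProj_of_mem k hc]
    split_ifs <;> simp_all
  simp [superMap₂, LinearMap.sum_apply, key]

/-- The product of the Kac superalgebra `k 1 ⊕ (K ⊗ K)`: the element `1` is the unit, and
`(a ⊗ b)(c ⊗ d) = (-1)^(|b||c|) (ac ⊗ bd - (3/4) (a | c)(b | d) 1)` for homogeneous
`a`, `b`, `c`, `d` in `K`. -/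
def kacMul : Kac k →ₗ[k] Kac k →ₗ[k] Kac k :=
  LinearMap.mk₂ k
    (fun x y =>
      (x.1 * y.1 - (3 / 4 : k) *
          TensorProduct.lid k k (superMap₂ k (kapForm k) (kapForm k) x.2 y.2),
        x.1 • y.2 + y.1 • x.2 + superMap₂ k (kapMul k) (kapMul k) x.2 y.2))
    (by
      intro x x' y
      ext1
      · simp; ring
      · simp [add_smul, smul_add]; abel)
    (by
      intro c x y
      ext1
      · simp; ring
      · simp [smul_smul, mul_comm])
    (by
      intro x y y'
      ext1
      · simp; ring
      · simp [add_smul, smul_add]; abel)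
    (by
      intro c x y
      ext1
      · simp; ring
      · simp [smul_smul, mul_comm])

theorem kacMul_tmul {i j : ZMod 2} (a : Kaplansky k) {b c : Kaplansky k} (d : Kaplansky k)
    (hb : b ∈ kapGr k i) (hc : c ∈ kapGr k j) :
    kacMul k (0, a ⊗ₜ b) (0, c ⊗ₜ d) =
      koszulSign i j •
        ((0, kapMul k a c ⊗ₜ[k] kapMul k b d) -
          ((3 / 4 : k) * (kapForm k a c * kapForm k b d)) • ((1, 0) : Kac k)) := by
  have h : koszulSign i j = 1 ∨ koszulSign i j = -1 := by
    unfold koszulSign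
    split_ifs <;> simp
  rcases h with h | h <;> ext1 <;> simp [kacMul, superMap₂_tmul k _ _ a d hb hc, h]

/-- The unit element of the Kac superalgebra. -/
def kacOne : Kac k := (1, 0)

/-- The component of parity `i` of the Kac superalgebra. -/
def kacGr (i : ZMod 2) : Submodule k (Kac k) :=
  Submodule.prod (if i = 0 then ⊤ else ⊥)
    (⨆ q : ZMod 2, Submodule.map₂ (TensorProduct.mk k (Kaplansky k) (Kaplansky k))
      (kapGr k q) (kapGr k (i - q)))

/-- The normalized trace of the Kac superalgebra: `t(1) = 1` and `t(K ⊗ K) = 0`. -/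
def kacTrace : Kac k →ₗ[k] k := LinearMap.fst k k _

/-- The component of parity `i` of `T(C, J)`, for `C` the Cayley algebra and `J` the Kac
superalgebra. -/
def titsCayleyKac (i : ZMod 2) : Submodule k (TitsAmbient k (Cayley k) (Kac k)) :=
  titsSpace (cayleyMul k) (cayleyNorm k) (cayleyOne k) (kacMul k) (kacGr k) (kacTrace k) i

/-- The product of elements of parities `i` and `j` of `T(C, J)`, for `C` the Cayley algebra and `J`
the Kac superalgebra. -/
def titsCayleyKacBracket (i j : ZMod 2) (X Y : TitsAmbient k (Cayley k) (Kac k)) :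
    TitsAmbient k (Cayley k) (Kac k) :=
  titsBracket (cayleyMul k) (cayleyNorm k) (kacMul k) (kacOne k) (kacTrace k) i j X Y

end Kac

/-! ## The orthogonal Lie algebra of type `B` and its spin module -/

section Spin

variable (k : Type*) [Field k] (l : ℕ)

/-- The hyperbolic quadratic form `q(f + v) = f(v)` on `V* ⊕ V`, where `V = k^l`. -/
abbrev hypForm : QuadraticForm k (Module.Dual k (Fin l → k) × (Fin l → k)) :=
  QuadraticForm.dualProd k (Fin l → k)

/-- The space `W = (V* ⊕ V) ⊕ k u` of dimension `2 l + 1`; the pair `((f, v), α)` is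
`α u + v + f`. -/
abbrev OddSpace : Type _ := (Module.Dual k (Fin l → k) × (Fin l → k)) × k

/-- The quadratic form `q(α u + v + f) = -α² + f(v)` on `W`. -/
abbrev oddForm : QuadraticForm k (OddSpace k l) :=
  CliffordAlgebra.EquivEven.Q' (hypForm k l)

theorem oddForm_apply (f : Module.Dual k (Fin l → k)) (v : Fin l → k) (α : k) :
    oddForm k l ((f, v), α) = -α ^ 2 + f v := by
  simp [pow_two]
  ring

/-- The orthogonal Lie algebra `so_{2l+1} = so(W, q)`: the endomorphisms of `W` that are
skew-adjoint for the symmetric bilinear form `q(x, y) = q(x + y) - q(x) - q(y)`. -/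
abbrev soOdd : LieSubalgebra k (Module.End k (OddSpace k l)) :=
  skewAdjointLieSubalgebra (oddForm k l).polarBilin

/-- The spin module `S = ⋀ V`. -/
abbrev SpinSpace : Type _ := ExteriorAlgebra k (Fin l → k)

/-- The algebra homomorphism `Λ : Cl(V* ⊕ V, q) → End(⋀ V)` with `f + v ↦ l_v + df`, where `l_v` is
the left multiplication by `v` and `df` is the odd superderivation of `⋀ V` that extends `f`. -/
def cliffordAction :
    CliffordAlgebra (hypForm k l) →ₐ[k] Module.End k (SpinSpace k l) :=
  CliffordAlgebra.lift (hypForm k l)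
    ⟨(LinearMap.mul k (SpinSpace k l) ∘ₗ ExteriorAlgebra.ι k) ∘ₗ LinearMap.snd k _ _
        + CliffordAlgebra.contractLeft ∘ₗ LinearMap.fst k _ _, by
      rintro ⟨f, v⟩
      refine LinearMap.ext fun s => ?_
      have h : CliffordAlgebra.ι (0 : QuadraticForm k (Fin l → k)) v *
          (CliffordAlgebra.ι (0 : QuadraticForm k (Fin l → k)) v * s) = 0 := by
        rw [← mul_assoc, CliffordAlgebra.ι_sq_scalar]
        simp
      simp [CliffordAlgebra.contractLeft_ι_mul, CliffordAlgebra.contractLeft_contractLeft,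
        mul_add, h, Algebra.algebraMap_eq_smul_one]⟩

theorem cliffordAction_ι (f : Module.Dual k (Fin l → k)) (v : Fin l → k) (s : SpinSpace k l) :
    cliffordAction k l (CliffordAlgebra.ι _ (f, v)) s =
      ExteriorAlgebra.ι k v * s + CliffordAlgebra.contractLeft f s := by
  simp [cliffordAction]

/-- The commutator `[x, y]^· = x · y - y · x` of two vectors of `W`, in the even Clifford algebra of
`(W, q)`. -/
def cliffComm :
    OddSpace k l →ₗ[k] OddSpace k l →ₗ[k] CliffordAlgebra.even (oddForm k l) :=
  (CliffordAlgebra.even.ι (oddForm k l)).bilin - (CliffordAlgebra.even.ι (oddForm k l)).bilin.flip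

theorem cliffComm_apply (x y : OddSpace k l) :
    (cliffComm k l x y : CliffordAlgebra (oddForm k l)) =
      CliffordAlgebra.ι _ x * CliffordAlgebra.ι _ y -
        CliffordAlgebra.ι _ y * CliffordAlgebra.ι _ x := rfl

/-- The element `v_i` of the standard basis of `V`, in `W`. -/
def vecV (i : Fin l) : OddSpace k l := ((0, Pi.single i 1), 0)

/-- The element `f_i` of the dual basis of `V*`, in `W`. -/
def vecF (i : Fin l) : OddSpace k l := ((LinearMap.proj i, 0), 0)

/-- The element `u` of `W`. -/
def vecU : OddSpace k l := (0, 1)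

/-- `σ_{x,y} = q(x, ·) y - q(y, ·) x`. -/
def sigmaMap (x y : OddSpace k l) : Module.End k (OddSpace k l) :=
  ((oddForm k l).polarBilin x).smulRight y - ((oddForm k l).polarBilin y).smulRight x

/-- The embedding of `so(W, q)` into the even Clifford algebra of `(W, q)`: the linear map with
`σ_{x,y} ↦ -(1/2) [x, y]^·` (see `soToClifford_sigmaMap`), written through the basis `v_i`, `f_i`,
`u` of `W` and its dual basis `f_i`, `v_i`, `-u/2` for the bilinear form of `q`. -/
def soToClifford (φ : Module.End k (OddSpace k l)) : CliffordAlgebra.even (oddForm k l) :=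
  -(1 / 4 : k) •
    (∑ i, cliffComm k l (vecF k l i) (φ (vecV k l i))
      + ∑ i, cliffComm k l (vecV k l i) (φ (vecF k l i))
      - (1 / 2 : k) • cliffComm k l (vecU k l) (φ (vecU k l)))

theorem oddForm_polar (f g : Module.Dual k (Fin l → k)) (v w : Fin l → k) (α β : k) :
    QuadraticMap.polar (oddForm k l) ((f, v), α) ((g, w), β) = f w + g v - 2 * α * β := by
  simp [QuadraticMap.polar]
  ring

theorem dual_expansion (h2 : (2 : k) ≠ 0) (x : OddSpace k l) :
    ∑ i, QuadraticMap.polar (oddForm k l) x (vecV k l i) • vecF k l i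
      + ∑ i, QuadraticMap.polar (oddForm k l) x (vecF k l i) • vecV k l i
      - (1 / 2 : k) • QuadraticMap.polar (oddForm k l) x (vecU k l) • vecU k l = x := by
  obtain ⟨⟨f, v⟩, α⟩ := x
  have e : vecU k l = ((0, 0), 1) := rfl
  simp only [e, vecV, vecF, oddForm_polar]
  refine Prod.ext (Prod.ext ?_ ?_) ?_
  · apply LinearMap.pi_ext'
    intro j
    ext
    simp [Prod.fst_sum, Pi.single_apply]
  · ext j
    simp [Prod.fst_sum, Prod.snd_sum, Finset.sum_apply, Pi.single_apply]
  · simp [Prod.snd_sum]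
    field_simp

theorem soToClifford_sigmaMap (h2 : (2 : k) ≠ 0) (x y : OddSpace k l) :
    soToClifford k l (sigmaMap k l x y) = -(1 / 2 : k) • cliffComm k l x y := by
  have hx : ∀ x y : OddSpace k l,
      ∑ i, QuadraticMap.polar (oddForm k l) x (vecV k l i) • cliffComm k l (vecF k l i) y
        + ∑ i, QuadraticMap.polar (oddForm k l) x (vecF k l i) • cliffComm k l (vecV k l i) y
        - (1 / 2 : k) • QuadraticMap.polar (oddForm k l) x (vecU k l) • cliffComm k l (vecU k l) y
        = cliffComm k l x y := by
    intro x y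
    conv_rhs => rw [← dual_expansion k l h2 x]
    simp [LinearMap.sum_apply]
  have hs : cliffComm k l y x = -cliffComm k l x y := by
    simp [cliffComm]
  have h4 : (4 : k) ≠ 0 := by
    have : (4 : k) = 2 * 2 := by norm_num
    rw [this]
    exact mul_ne_zero h2 h2
  have e : ∑ i, cliffComm k l (vecF k l i) (sigmaMap k l x y (vecV k l i))
      + ∑ i, cliffComm k l (vecV k l i) (sigmaMap k l x y (vecF k l i))
      - (1 / 2 : k) • cliffComm k l (vecU k l) (sigmaMap k l x y (vecU k l))
      = cliffComm k l x y - cliffComm k l y x := by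
    rw [← hx x y, ← hx y x]
    simp only [sigmaMap, LinearMap.sub_apply, LinearMap.smulRight_apply,
      QuadraticMap.polarBilin_apply_apply, map_sub, map_smul, Finset.sum_sub_distrib, smul_sub]
    abel
  rw [soToClifford, e, hs, sub_neg_eq_add, ← two_smul k, smul_smul]
  congr 1
  field_simp
  norm_num

/-- The spin representation of `so(W, q)` on `⋀ V`, the composition of the embedding into the even
Clifford algebra of `(W, q)`, of the inverse of the isomorphism
`Ψ : Cl(V* ⊕ V, q) → Cl_0(W, q)`, `x ↦ u · x`, and of `Λ`. -/
def spinRep (φ : soOdd k l) : Module.End k (SpinSpace k l) :=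
  cliffordAction k l ((CliffordAlgebra.equivEven (hypForm k l)).symm (soToClifford k l φ))

/-- The linear form `Φ` on `⋀ V` with `Φ(v_1 ⋯ v_l) = 1` that vanishes on `⋀^r V` for `r ≠ l`. -/
def topForm : SpinSpace k l →ₗ[k] k :=
  ExteriorAlgebra.liftAlternating (Pi.single l Matrix.detRowAlternating)

/-- The bilinear form `b(s, t) = Φ(s̄ t)` on `⋀ V`, where `s ↦ s̄` is the antiautomorphism of `⋀ V`
with `v̄ = -v` for `v ∈ V`. -/
def spinForm (s t : SpinSpace k l) : k :=
  topForm k l (CliffordAlgebra.reverse (CliffordAlgebra.involute s) * t)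

end Spin

end

/-! The proof realises so_11 and its spin module on spaces in which the Tits construction is
visible, compares the two there, and carries the result back to `⋀ V`.

Even part. The space J⁰ is spanned by e⊗e, U⊗e, e⊗U and U⊗U, and inder J has even part sl(U)⊕sl(U)
and odd part U⊕U. Hence the even part of T is der C ⊕ C⁰⊗(e⊗e) ⊕ C⁰⊗(U⊗U) ⊕ (sl(U)⊕sl(U)), of
dimension 14+7+28+6 = 55. On the other side W is the orthogonal sum of C⁰ with the norm and of U⊗U,
the 2×2 matrices with the determinant (`polar_oddForm`). The comparison `phiEven` lets der C act on
C⁰, sends a⊗(e⊗e) to -[a,·] on C⁰, sends a⊗M to σ_{a,M}, and lets sl(U)⊕sl(U) act on U⊗U. It is a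
homomorphism because, in characteristic 5, 2D_{a,b}(c) + [[a,b],c] = n(a,c)b - n(b,c)a on C⁰
(`two_innerDer_apply`), and a similar identity holds on matrices (`pairAct_brMat`). The same
identities show that every σ_{x,y} is reached, and these span so(W). Injectivity comes down to the
fact that [a,·] is a derivation only for a = 0 (`eq_zero_of_algComm_der`).

Odd part. It is C⁰⊗(U⊕U) together with the odd inner derivations U⊕U, that is C⊗(U⊕U), the unit of C
accounting for the inner derivations; its dimension is 32. On this model W acts by Clifford
operators: a in C⁰ by 2L_a and -2L_a on the two copies, a matrix by exchanging the copies. Since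
L_a² = -n(a) and 2² = -1, this squares to q (`gammaMap_swap`). The vector `vacuum` is killed by V*,
so 1 ↦ `vacuum` extends to an equivariant map `thetaMap` from ⋀V to the model; it is onto, and both
sides have dimension 32. It carries b to the model form up to the factor 3 (`modelForm_thetaMap`).

To recognise the action of an even element on the model one needs no explicit formula for spin
operators. An operator commuting with all Clifford operators is a scalar, and a skew scalar is 0. So
the spin operator of φ is the only skew operator A with [A, γ(w)] = γ(φ w) (`eq_modelRep`). The
operators occurring in T are easily checked to have this property; for a⊗(e⊗e) the operator is -(L_a
+ 2R_a), by `leftAddTwoRight_mul`.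

Odd products. For ψ in so(W) one has ½tr(σ_{x,y}ψ) = q(x, ψy), so the condition on the odd product
reads q(x, [s,s']y) = b(ρ(σ_{x,y})s, s'), and it is checked on generators (`formHom_gen`).

Jacobi identity. The comparison maps are injective, so identities may be verified in so(W) and in
the model. With at most two odd arguments they express that the model is a representation and that
its form is invariant. With three odd arguments one needs a cyclic identity (`cyclicSum_gen`), which
reduces to `oddDer_cyclic` and `oddDer_eq_oddMix` in C and to the relation (u|v)w + (v|w)u + (w|u)v
= 0 in the plane U. The structure `SpinPresentation` collects these inputs.

Finally the factor 3 between the forms is removed by rescaling the odd part by a square root of 3;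
this is what algebraic closure is needed for. -/

noncomputable section

set_option linter.unusedSectionVars false

/-! ### Identities of the Cayley algebra in Zorn coordinates. -/

section Cayley

variable {k : Type*} [Field k]

/-- The Zorn matrix with given coordinates. -/
def zorn (a u₀ u₁ u₂ v₀ v₁ v₂ b : k) : Cayley k := ((a, ![u₀, u₁, u₂]), (![v₀, v₁, v₂], b))

theorem exists_zorn (x : Cayley k) : ∃ a u₀ u₁ u₂ v₀ v₁ v₂ b : k,
    x = zorn a u₀ u₁ u₂ v₀ v₁ v₂ b := by
  refine ⟨x.1.1, x.1.2 0, x.1.2 1, x.1.2 2, x.2.1 0, x.2.1 1, x.2.1 2, x.2.2, ?_⟩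
  refine Prod.ext (Prod.ext rfl (funext fun i => ?_)) (Prod.ext (funext fun i => ?_) rfl) <;>
    fin_cases i <;> rfl

section Coordinates

variable (a u₀ u₁ u₂ v₀ v₁ v₂ b a' u₀' u₁' u₂' v₀' v₁' v₂' b' r : k)

theorem zorn_add : zorn a u₀ u₁ u₂ v₀ v₁ v₂ b + zorn a' u₀' u₁' u₂' v₀' v₁' v₂' b' =
    zorn (a + a') (u₀ + u₀') (u₁ + u₁') (u₂ + u₂') (v₀ + v₀') (v₁ + v₁') (v₂ + v₂') (b + b') := by
  simp [zorn]

theorem zorn_sub : zorn a u₀ u₁ u₂ v₀ v₁ v₂ b - zorn a' u₀' u₁' u₂' v₀' v₁' v₂' b' =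
    zorn (a - a') (u₀ - u₀') (u₁ - u₁') (u₂ - u₂') (v₀ - v₀') (v₁ - v₁') (v₂ - v₂') (b - b') := by
  simp [zorn]

theorem zorn_neg : -zorn a u₀ u₁ u₂ v₀ v₁ v₂ b =
    zorn (-a) (-u₀) (-u₁) (-u₂) (-v₀) (-v₁) (-v₂) (-b) := by
  simp [zorn]

theorem zorn_smul : r • zorn a u₀ u₁ u₂ v₀ v₁ v₂ b =
    zorn (r * a) (r * u₀) (r * u₁) (r * u₂) (r * v₀) (r * v₁) (r * v₂) (r * b) := by
  simp [zorn]

theorem zorn_mul : cayleyMul k (zorn a u₀ u₁ u₂ v₀ v₁ v₂ b) (zorn a' u₀' u₁' u₂' v₀' v₁' v₂' b') =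
    zorn (a * a' + (u₀ * v₀' + u₁ * v₁' + u₂ * v₂'))
      (a * u₀' + b' * u₀ - (v₁ * v₂' - v₂ * v₁'))
      (a * u₁' + b' * u₁ - (v₂ * v₀' - v₀ * v₂'))
      (a * u₂' + b' * u₂ - (v₀ * v₁' - v₁ * v₀'))
      (a' * v₀ + b * v₀' + (u₁ * u₂' - u₂ * u₁'))
      (a' * v₁ + b * v₁' + (u₂ * u₀' - u₀ * u₂'))
      (a' * v₂ + b * v₂' + (u₀ * u₁' - u₁ * u₀'))
      (b * b' + (v₀ * u₀' + v₁ * u₁' + v₂ * u₂')) := by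
  simp [zorn, cayleyMul, cross_apply, dotProduct, Fin.sum_univ_three]

theorem zorn_polar : (cayleyNorm k).polarBilin (zorn a u₀ u₁ u₂ v₀ v₁ v₂ b)
      (zorn a' u₀' u₁' u₂' v₀' v₁' v₂' b') =
    a * b' + a' * b - (u₀ * v₀' + u₁ * v₁' + u₂ * v₂') - (u₀' * v₀ + u₁' * v₁ + u₂' * v₂) := by
  simp only [QuadraticMap.polarBilin_apply_apply, QuadraticMap.polar, zorn_add, cayleyNorm_apply]
  simp [zorn, dotProduct, Fin.sum_univ_three]
  ring

theorem zorn_eq_iff : zorn a u₀ u₁ u₂ v₀ v₁ v₂ b = zorn a' u₀' u₁' u₂' v₀' v₁' v₂' b' ↔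
    a = a' ∧ u₀ = u₀' ∧ u₁ = u₁' ∧ u₂ = u₂' ∧ v₀ = v₀' ∧ v₁ = v₁' ∧ v₂ = v₂' ∧ b = b' := by
  simp [zorn]; tauto

end Coordinates

theorem cayleyOne_eq_zorn : cayleyOne k = zorn 1 0 0 0 0 0 0 1 := by
  simp [cayleyOne, zorn, funext_iff, Fin.forall_fin_succ]

theorem algComm_apply_apply (x y : Cayley k) : algComm (cayleyMul k) x y =
  cayleyMul k x y - cayleyMul k y x := rfl


/-- The linearised left alternative law. Together with `assoc_swap_right` it is all that is used of
C in the next identities up to `innerDer_mem_derSpace`, which therefore hold in any alternative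
algebra. -/
theorem assoc_swap_left (a b c : Cayley k) :
    cayleyMul k (cayleyMul k a b) c + cayleyMul k (cayleyMul k b a) c =
      cayleyMul k a (cayleyMul k b c) + cayleyMul k b (cayleyMul k a c) := by
  obtain ⟨a0, a1, a2, a3, a4, a5, a6, a7, rfl⟩ := exists_zorn a
  obtain ⟨b0, b1, b2, b3, b4, b5, b6, b7, rfl⟩ := exists_zorn b
  obtain ⟨c0, c1, c2, c3, c4, c5, c6, c7, rfl⟩ := exists_zorn c
  simp only [zorn_mul, zorn_add, zorn_eq_iff]
  refine ⟨?_, ?_, ?_, ?_, ?_, ?_, ?_, ?_⟩ <;> ring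

theorem assoc_swap_right (a b c : Cayley k) :
    cayleyMul k (cayleyMul k a b) c + cayleyMul k (cayleyMul k a c) b =
      cayleyMul k a (cayleyMul k b c) + cayleyMul k a (cayleyMul k c b) := by
  obtain ⟨a0, a1, a2, a3, a4, a5, a6, a7, rfl⟩ := exists_zorn a
  obtain ⟨b0, b1, b2, b3, b4, b5, b6, b7, rfl⟩ := exists_zorn b
  obtain ⟨c0, c1, c2, c3, c4, c5, c6, c7, rfl⟩ := exists_zorn c
  simp only [zorn_mul, zorn_add, zorn_eq_iff]
  refine ⟨?_, ?_, ?_, ?_, ?_, ?_, ?_, ?_⟩ <;> ring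

/-- The operator `L_a + 2 R_a`. -/
def leftAddTwoRight : Cayley k →ₗ[k] Module.End k (Cayley k) :=
  cayleyMul k + (2 : k) • (cayleyMul k).flip

theorem leftAddTwoRight_apply (a b : Cayley k) :
    leftAddTwoRight a b = cayleyMul k a b + (2 : k) • cayleyMul k b a := rfl

/-- An instance of triality: T_a = L_a + 2R_a behaves like a derivation if the left factor is acted
on by [a,·] instead. It serves twice: here to see that D_{a,b} is a derivation, and later to
identify -T_a as the spin action of a⊗(e⊗e). -/
theorem leftAddTwoRight_mul (a b c : Cayley k) :
    leftAddTwoRight a (cayleyMul k b c) =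
      cayleyMul k b (leftAddTwoRight a c) + cayleyMul k (algComm (cayleyMul k) a b) c := by
  simp only [leftAddTwoRight_apply, algComm_apply_apply, map_add, map_sub, map_smul,
    LinearMap.sub_apply]
  linear_combination (norm := (match_scalars <;> ring))
    (2 : k) • assoc_swap_right b c a + (-1 : k) • assoc_swap_left a b c

/-- The operator 2D_{a,b} has the same expression, [X_a, X_b] + X_{[a,b]}, for X = ad (here) and for
X = L + 2R (next lemma). Having both forms at hand turns `leftAddTwoRight_mul` into the Leibniz
rule. -/
theorem two_smul_innerDer (a b c : Cayley k) : (2 : k) • innerDer (cayleyMul k) a b c =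
    algComm (cayleyMul k) a (algComm (cayleyMul k) b c)
      - algComm (cayleyMul k) b (algComm (cayleyMul k) a c)
      + algComm (cayleyMul k) (algComm (cayleyMul k) a b) c := by
  simp only [innerDer_apply, algComm_apply_apply, map_sub, LinearMap.sub_apply]
  linear_combination (norm := (match_scalars <;> ring)) (-2 : k) • assoc_swap_left a b c
    + (-3 : k) • assoc_swap_right a b c + (2 : k) • assoc_swap_left c a b
    + (1 : k) • assoc_swap_right b c a + (-1 : k) • assoc_swap_right c a b

theorem two_smul_innerDer_eq (a b c : Cayley k) : (2 : k) • innerDer (cayleyMul k) a b c =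
    leftAddTwoRight a (leftAddTwoRight b c) - leftAddTwoRight b (leftAddTwoRight a c)
      + leftAddTwoRight (algComm (cayleyMul k) a b) c := by
  simp only [innerDer_apply, leftAddTwoRight_apply, algComm_apply_apply, map_sub, map_add, map_smul,
    LinearMap.sub_apply]
  linear_combination (norm := (match_scalars <;> ring)) (1 : k) • assoc_swap_left a b c
    + (-6 : k) • assoc_swap_right a b c + (8 : k) • assoc_swap_left c a b
    + (-2 : k) • assoc_swap_right b c a + (-4 : k) • assoc_swap_right c a b

theorem innerDer_mem_derSpace (h2 : (2 : k) ≠ 0) (a b : Cayley k) :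
    innerDer (cayleyMul k) a b ∈ derSpace (cayleyMul k) := by
  intro x y
  have h : (2 : k) • innerDer (cayleyMul k) a b (cayleyMul k x y) =
      cayleyMul k ((2 : k) • innerDer (cayleyMul k) a b x) y +
        cayleyMul k x ((2 : k) • innerDer (cayleyMul k) a b y) := by
    -- The left factor x takes the form with ad, while y and the product xy take the form with L +
    -- 2R, as in `leftAddTwoRight_mul`.
    rw [two_smul_innerDer a b x, two_smul_innerDer_eq a b y, two_smul_innerDer_eq]
    simp only [leftAddTwoRight_mul, map_add, map_sub, LinearMap.add_apply, LinearMap.sub_apply]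
    abel
  rw [map_smul, map_smul, LinearMap.smul_apply, ← smul_add] at h
  exact smul_right_injective _ h2 h

/-- The trace `α + β` of the Cayley algebra. -/
def cayleyTr : Cayley k →ₗ[k] k where
  toFun x := x.1.1 + x.2.2
  map_add' x y := by simp; ring
  map_smul' c x := by simp; ring

theorem cayleyTr_zorn (a u₀ u₁ u₂ v₀ v₁ v₂ b : k) :
    cayleyTr (zorn a u₀ u₁ u₂ v₀ v₁ v₂ b) = a + b := rfl

theorem polar_one_left (x : Cayley k) :
    (cayleyNorm k).polarBilin (cayleyOne k) x = cayleyTr x := by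
  obtain ⟨a0, a1, a2, a3, a4, a5, a6, a7, rfl⟩ := exists_zorn x
  rw [cayleyOne_eq_zorn, zorn_polar, cayleyTr_zorn]
  ring

theorem mem_traceZero {x : Cayley k} :
    x ∈ traceZero (cayleyNorm k) (cayleyOne k) ↔ cayleyTr x = 0 := by
  rw [traceZero, LinearMap.mem_ker, polar_one_left]

theorem exists_zorn_of_tr {x : Cayley k} (hx : cayleyTr x = 0) :
    ∃ a u₀ u₁ u₂ v₀ v₁ v₂ : k, x = zorn a u₀ u₁ u₂ v₀ v₁ v₂ (-a) := by
  obtain ⟨a0, a1, a2, a3, a4, a5, a6, a7, rfl⟩ := exists_zorn x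
  rw [cayleyTr_zorn, add_comm, ← eq_neg_iff_add_eq_zero] at hx
  subst hx
  exact ⟨a0, a1, a2, a3, a4, a5, a6, rfl⟩

theorem polar_comm (a b : Cayley k) :
    (cayleyNorm k).polarBilin a b = (cayleyNorm k).polarBilin b a :=
  QuadraticMap.polar_comm _ _ _

/-- Polarisation of L_a² = -n(a) on trace zero elements: left multiplications form a Clifford
representation for -n. -/
theorem mul_mul_swap {a b : Cayley k} (ha : cayleyTr a = 0) (hb : cayleyTr b = 0) (c : Cayley k) :
    cayleyMul k a (cayleyMul k b c) =
      -cayleyMul k b (cayleyMul k a c) - (cayleyNorm k).polarBilin a b • c := by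
  obtain ⟨a0, a1, a2, a3, a4, a5, a6, rfl⟩ := exists_zorn_of_tr ha
  obtain ⟨b0, b1, b2, b3, b4, b5, b6, rfl⟩ := exists_zorn_of_tr hb
  obtain ⟨c0, c1, c2, c3, c4, c5, c6, c7, rfl⟩ := exists_zorn c
  simp only [zorn_polar, zorn_neg, zorn_mul, zorn_smul, zorn_add, zorn_sub, zorn_eq_iff]
  refine ⟨?_, ?_, ?_, ?_, ?_, ?_, ?_, ?_⟩ <;> ring

theorem polar_mul_left {a : Cayley k} (ha : cayleyTr a = 0) (b c : Cayley k) :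
    (cayleyNorm k).polarBilin (cayleyMul k a b) c =
      -(cayleyNorm k).polarBilin b (cayleyMul k a c) := by
  obtain ⟨a0, a1, a2, a3, a4, a5, a6, rfl⟩ := exists_zorn_of_tr ha
  obtain ⟨b0, b1, b2, b3, b4, b5, b6, b7, rfl⟩ := exists_zorn b
  obtain ⟨c0, c1, c2, c3, c4, c5, c6, c7, rfl⟩ := exists_zorn c
  simp only [zorn_polar, zorn_mul]
  ring

theorem polar_mul_right {a : Cayley k} (ha : cayleyTr a = 0) (b c : Cayley k) :
    (cayleyNorm k).polarBilin (cayleyMul k b a) c =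
      -(cayleyNorm k).polarBilin b (cayleyMul k c a) := by
  obtain ⟨a0, a1, a2, a3, a4, a5, a6, rfl⟩ := exists_zorn_of_tr ha
  obtain ⟨b0, b1, b2, b3, b4, b5, b6, b7, rfl⟩ := exists_zorn b
  obtain ⟨c0, c1, c2, c3, c4, c5, c6, c7, rfl⟩ := exists_zorn c
  simp only [zorn_polar, zorn_mul]
  ring

theorem cayleyMul_self (a : Cayley k) :
    cayleyMul k a a = cayleyTr a • a - cayleyNorm k a • cayleyOne k := by
  obtain ⟨a0, a1, a2, a3, a4, a5, a6, a7, rfl⟩ := exists_zorn a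
  have h : cayleyNorm k (zorn a0 a1 a2 a3 a4 a5 a6 a7) =
      a0 * a7 - (a1 * a4 + a2 * a5 + a3 * a6) := by
    simp [cayleyNorm_apply, zorn, dotProduct, Fin.sum_univ_three]
  simp only [cayleyOne_eq_zorn, h, cayleyTr_zorn, zorn_mul, zorn_smul, zorn_sub, zorn_eq_iff]
  refine ⟨?_, ?_, ?_, ?_, ?_, ?_, ?_, ?_⟩ <;> ring

theorem cayleyMul_add_swap (a b : Cayley k) :
    cayleyMul k a b + cayleyMul k b a = cayleyTr a • b + cayleyTr b • a -
      (cayleyNorm k).polarBilin a b • cayleyOne k := by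
  obtain ⟨a0, a1, a2, a3, a4, a5, a6, a7, rfl⟩ := exists_zorn a
  obtain ⟨b0, b1, b2, b3, b4, b5, b6, b7, rfl⟩ := exists_zorn b
  simp only [cayleyOne_eq_zorn, zorn_polar, cayleyTr_zorn, zorn_mul, zorn_smul, zorn_sub,
    zorn_add, zorn_eq_iff]
  refine ⟨?_, ?_, ?_, ?_, ?_, ?_, ?_, ?_⟩ <;> ring

/-! ### Derivations preserve the trace and are skew for the norm. -/

section Derivation

variable {D : Module.End k (Cayley k)} (hD : D ∈ derSpace (cayleyMul k))
include hD

theorem der_one : D (cayleyOne k) = 0 := by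
  have h := hD (cayleyOne k) (cayleyOne k)
  simpa [cayleyMul_one_left, cayleyMul_one_right] using h

/-- Apply D to the quadratic equation a² = tr(a)a - n(a)1 and expand D(a²) = D(a)a + aD(a) by the
polarised equation; the terms tr(a)D(a) cancel. -/
theorem der_tr_smul (a : Cayley k) :
    cayleyTr (D a) • a = (cayleyNorm k).polarBilin (D a) a • cayleyOne k := by
  have h := hD a a
  rw [cayleyMul_self, cayleyMul_add_swap, map_sub, map_smul, map_smul, der_one hD, smul_zero,
    sub_zero] at h
  have h' : cayleyTr (D a) • a + cayleyTr a • D a -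
    (cayleyNorm k).polarBilin (D a) a • cayleyOne k - cayleyTr a • D a = 0 := by rw [← h]; simp
  rw [← sub_eq_zero, ← h']
  abel

/-- If tr(Da) were nonzero, `der_tr_smul` would make a a multiple of 1, and then Da = 0. -/
theorem der_tr (a : Cayley k) : cayleyTr (D a) = 0 := by
  by_contra h0
  have h := der_tr_smul hD a
  have ha : a = ((cayleyTr (D a))⁻¹ * (cayleyNorm k).polarBilin (D a) a) • cayleyOne k := by
    rw [mul_smul, ← h, smul_smul, inv_mul_cancel₀ h0, one_smul]
  apply h0
  rw [ha, map_smul, der_one hD, smul_zero, map_zero]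

theorem der_polar_self (a : Cayley k) : (cayleyNorm k).polarBilin (D a) a = 0 := by
  have h := der_tr_smul hD a
  rw [der_tr hD, zero_smul] at h
  have h1 : cayleyOne k ≠ 0 := by
    rw [cayleyOne_eq_zorn]
    intro h
    have := congrArg (fun x : Cayley k => x.1.1) h
    simp [zorn] at this
  exact (smul_eq_zero.1 h.symm).resolve_right h1

theorem der_polar (a b : Cayley k) :
    (cayleyNorm k).polarBilin (D a) b = -(cayleyNorm k).polarBilin a (D b) := by
  have h := der_polar_self hD (a + b)
  rw [map_add, map_add, map_add, LinearMap.add_apply, LinearMap.add_apply, der_polar_self hD,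
    der_polar_self hD, polar_comm (D b)] at h
  linear_combination h

end Derivation

theorem polar_leftAddTwoRight {a : Cayley k} (ha : cayleyTr a = 0) (b c : Cayley k) :
    (cayleyNorm k).polarBilin (leftAddTwoRight a b) c =
      -(cayleyNorm k).polarBilin b (leftAddTwoRight a c) := by
  simp only [leftAddTwoRight_apply, map_add, map_smul, LinearMap.add_apply, LinearMap.smul_apply,
    polar_mul_left ha, polar_mul_right ha, smul_eq_mul]
  ring

end Cayley

/-! ### The decomposition of W and the Clifford module C⊗(U⊕U). -/

section Model

variable {k : Type*} [Field k]

/-- The component of a vector of `W` in the trace zero elements of the Cayley algebra. -/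
def toCayley : OddSpace k 5 →ₗ[k] Cayley k where
  toFun w := zorn w.2 (w.1.2 0) (w.1.2 1) (w.1.2 2) (-w.1.1 (Pi.single 0 1))
    (-w.1.1 (Pi.single 1 1)) (-w.1.1 (Pi.single 2 1)) (-w.2)
  map_add' x y := by simp [zorn_add, add_comm]
  map_smul' c x := by simp [zorn_smul]

/-- The component of a vector of `W` in the space of `2 × 2` matrices. -/
def toMat : OddSpace k 5 →ₗ[k] Matrix (Fin 2) (Fin 2) k where
  toFun w := !![w.1.1 (Pi.single 3 1), w.1.1 (Pi.single 4 1); -w.1.2 4, w.1.2 3]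
  map_add' x y := by ext i j; fin_cases i <;> fin_cases j <;> simp [add_comm]
  map_smul' c x := by ext i j; fin_cases i <;> fin_cases j <;> simp

/-- The map from the Cayley algebra to `W` which is isometric on trace zero elements and vanishes at
the unit (in characteristic `5`). -/
def ofCayley : Cayley k →ₗ[k] OddSpace k 5 where
  toFun x := ((-(x.2.1 0 • LinearMap.proj 0 + x.2.1 1 • LinearMap.proj 1
    + x.2.1 2 • LinearMap.proj 2), ![x.1.2 0, x.1.2 1, x.1.2 2, 0, 0]), 3 * (x.1.1 - x.2.2))
  map_add' x y := by
    refine Prod.ext (Prod.ext ?_ ?_) ?_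
    · ext i; simp; ring
    · ext i; fin_cases i <;> simp
    · simp; ring
  map_smul' c x := by
    refine Prod.ext (Prod.ext ?_ ?_) ?_
    · ext i; simp; ring
    · ext i; fin_cases i <;> simp
    · simp; ring

/-- The map from `2 × 2` matrices to `W` which is isometric for the determinant. -/
def ofMat : Matrix (Fin 2) (Fin 2) k →ₗ[k] OddSpace k 5 where
  toFun M := ((M 0 0 • LinearMap.proj 3 + M 0 1 • LinearMap.proj 4,
    ![0, 0, 0, M 1 1, -M 1 0]), 0)
  map_add' x y := by
    refine Prod.ext (Prod.ext ?_ ?_) ?_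
    · ext i; simp; ring
    · ext i; fin_cases i <;> simp [add_comm]
    · simp
  map_smul' c x := by
    refine Prod.ext (Prod.ext ?_ ?_) ?_
    · ext i; simp; ring
    · ext i; fin_cases i <;> simp
    · simp

/-- The polar form of the determinant of `2 × 2` matrices. -/
def detPolar : Matrix (Fin 2) (Fin 2) k →ₗ[k] Matrix (Fin 2) (Fin 2) k →ₗ[k] k :=
  LinearMap.mk₂ k (fun M N => M 0 0 * N 1 1 + M 1 1 * N 0 0 - M 0 1 * N 1 0 - M 1 0 * N 0 1)
    (by intro x x' y; simp; ring) (by intro c x y; simp; ring)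
    (by intro x y y'; simp; ring) (by intro c x y; simp; ring)

theorem detPolar_apply (M N : Matrix (Fin 2) (Fin 2) k) :
    detPolar M N = M 0 0 * N 1 1 + M 1 1 * N 0 0 - M 0 1 * N 1 0 - M 1 0 * N 0 1 := rfl

theorem cayleyTr_toCayley (w : OddSpace k 5) : cayleyTr (toCayley w) = 0 := by
  simp [toCayley, cayleyTr_zorn]

theorem toCayley_ofMat (M : Matrix (Fin 2) (Fin 2) k) : toCayley (ofMat M) = 0 := by
  simp [toCayley, ofMat, zorn, funext_iff, Fin.forall_fin_succ]

theorem toMat_ofCayley (x : Cayley k) : toMat (ofCayley x) = 0 := by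
  ext i j; fin_cases i <;> fin_cases j <;> simp [toMat, ofCayley]

theorem toMat_ofMat (M : Matrix (Fin 2) (Fin 2) k) : toMat (ofMat M) = M := by
  ext i j; fin_cases i <;> fin_cases j <;> simp [toMat, ofMat]

/-- The hyperbolic planes of v₁, v₂, v₃ and the vector u make up C⁰, the diagonal of the Zorn matrix
being (α, -α); the planes of v₄, v₅ make up the 2×2 matrices. The signs in `toCayley` and `toMat`
are chosen so that norm and determinant come out as q. -/
theorem polar_oddForm (x y : OddSpace k 5) : (oddForm k 5).polarBilin x y =
    (cayleyNorm k).polarBilin (toCayley x) (toCayley y) + detPolar (toMat x) (toMat y) := by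
  obtain ⟨⟨f, v⟩, α⟩ := x
  obtain ⟨⟨g, w⟩, β⟩ := y
  have h (f : Module.Dual k (Fin 5 → k)) (v : Fin 5 → k) : f v = ∑ i, v i * f (Pi.single i 1) := by
    conv_lhs => rw [pi_eq_sum_univ' v]
    simp
  rw [QuadraticMap.polarBilin_apply_apply, oddForm_polar, h f w, h g v]
  simp only [toCayley, toMat, LinearMap.coe_mk, AddHom.coe_mk, zorn_polar, detPolar_apply,
    Fin.sum_univ_five]
  simp
  ring

variable [CharP k 5]

theorem half_eq_three : (1 / 2 : k) = 3 := by
  have h2 : (2 : k) ≠ 0 := by grind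
  rw [div_eq_iff h2]
  grind

theorem toCayley_ofCayley {x : Cayley k} (hx : cayleyTr x = 0) : toCayley (ofCayley x) = x := by
  obtain ⟨a0, a1, a2, a3, a4, a5, a6, rfl⟩ := exists_zorn_of_tr hx
  simp only [toCayley, LinearMap.coe_mk, AddHom.coe_mk, zorn_eq_iff]
  simp [ofCayley, zorn]
  grind

theorem ofCayley_toCayley_add (w : OddSpace k 5) :
    ofCayley (toCayley w) + ofMat (toMat w) = w := by
  refine Prod.ext (Prod.ext ?_ ?_) ?_
  · refine LinearMap.pi_ext' fun i => ?_
    ext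
    fin_cases i <;> simp [ofCayley, toCayley, zorn, ofMat, toMat, Pi.single_apply]
  · ext i
    fin_cases i <;> simp [ofCayley, toCayley, zorn, ofMat, toMat]
  · simp [ofCayley, toCayley, zorn, ofMat]
    grind

/-- The model `C ⊗ (U ⊕ U)` of the spin module. -/
def SpinModel (k : Type*) : Type _ := (Fin 2 → Cayley k) × (Fin 2 → Cayley k)

namespace SpinModel

instance : AddCommGroup (SpinModel k) :=
  inferInstanceAs (AddCommGroup ((Fin 2 → Cayley k) × (Fin 2 → Cayley k)))

instance : Module k (SpinModel k) :=
  inferInstanceAs (Module k ((Fin 2 → Cayley k) × (Fin 2 → Cayley k)))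

/-- The linear equivalence of the model with the product of its two halves. -/
def equivProd : SpinModel k ≃ₗ[k] (Fin 2 → Cayley k) × (Fin 2 → Cayley k) :=
  LinearEquiv.refl k _

/-- The element with given components. -/
def mk (s t : Fin 2 → Cayley k) : SpinModel k := (s, t)

theorem ext {x y : SpinModel k} (h1 : ∀ i, x.1 i = y.1 i) (h2 : ∀ i, x.2 i = y.2 i) : x = y :=
  Prod.ext (funext h1) (funext h2)

theorem mk_fst (s t : Fin 2 → Cayley k) : (mk s t).1 = s := rfl
theorem mk_snd (s t : Fin 2 → Cayley k) : (mk s t).2 = t := rfl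
theorem add_fst (x y : SpinModel k) (i : Fin 2) : (x + y).1 i = x.1 i + y.1 i := rfl
theorem add_snd (x y : SpinModel k) (i : Fin 2) : (x + y).2 i = x.2 i + y.2 i := rfl
theorem neg_fst (x : SpinModel k) (i : Fin 2) : (-x).1 i = -x.1 i := rfl
theorem neg_snd (x : SpinModel k) (i : Fin 2) : (-x).2 i = -x.2 i := rfl
theorem sub_fst (x y : SpinModel k) (i : Fin 2) : (x - y).1 i = x.1 i - y.1 i := rfl
theorem sub_snd (x y : SpinModel k) (i : Fin 2) : (x - y).2 i = x.2 i - y.2 i := rfl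
theorem smul_fst (c : k) (x : SpinModel k) (i : Fin 2) : (c • x).1 i = c • x.1 i := rfl
theorem smul_snd (c : k) (x : SpinModel k) (i : Fin 2) : (c • x).2 i = c • x.2 i := rfl
theorem zero_fst (i : Fin 2) : (0 : SpinModel k).1 i = 0 := rfl
theorem zero_snd (i : Fin 2) : (0 : SpinModel k).2 i = 0 := rfl

end SpinModel

/-- The Clifford action of `W` on the model of the spin module. -/
def gammaMap : OddSpace k 5 →ₗ[k] Module.End k (SpinModel k) :=
  LinearMap.mk₂ k (fun w x => SpinModel.mk
    (fun i => (2 : k) • cayleyMul k (toCayley w) (x.1 i)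
        + (toMat w i 0 • x.2 1 - toMat w i 1 • x.2 0))
    (fun i => -((2 : k) • cayleyMul k (toCayley w) (x.2 i))
        - (toMat w 0 i • x.1 1 - toMat w 1 i • x.1 0)))
    (by
      intro w w' x
      refine SpinModel.ext (fun i => ?_) (fun i => ?_) <;>
        simp only [SpinModel.mk_fst, SpinModel.mk_snd, map_add, LinearMap.add_apply, SpinModel.add_fst, SpinModel.add_snd,
          Matrix.add_apply] <;> module)
    (by
      intro c w x
      refine SpinModel.ext (fun i => ?_) (fun i => ?_) <;>
        simp only [SpinModel.mk_fst, SpinModel.mk_snd, map_smul, LinearMap.smul_apply, SpinModel.smul_fst, SpinModel.smul_snd,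
          Matrix.smul_apply, smul_eq_mul] <;> module)
    (by
      intro w x x'
      refine SpinModel.ext (fun i => ?_) (fun i => ?_) <;>
        simp only [SpinModel.mk_fst, SpinModel.mk_snd, map_add, SpinModel.add_fst, SpinModel.add_snd] <;> module)
    (by
      intro c w x
      refine SpinModel.ext (fun i => ?_) (fun i => ?_) <;>
        simp only [SpinModel.mk_fst, SpinModel.mk_snd, map_smul, SpinModel.smul_fst, SpinModel.smul_snd] <;> module)

theorem gammaMap_apply (w : OddSpace k 5) (x : SpinModel k) : gammaMap w x = SpinModel.mk
    (fun i => (2 : k) • cayleyMul k (toCayley w) (x.1 i)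
        + (toMat w i 0 • x.2 1 - toMat w i 1 • x.2 0))
    (fun i => -((2 : k) • cayleyMul k (toCayley w) (x.2 i))
        - (toMat w 0 i • x.1 1 - toMat w 1 i • x.1 0)) := rfl

/-- The factor 2 is a square root of -1, which corrects the sign in L_a² = -n(a). Its opposite signs
on the two copies make the Cayley part anticommute with the matrix part, which exchanges the copies.
The two matrix blocks compose to -MεMᵀε = det M, ε being the matrix of the alternating form. -/
theorem gammaMap_swap (w w' : OddSpace k 5) (x : SpinModel k) :
    gammaMap w (gammaMap w' x) =
      -gammaMap w' (gammaMap w x) + (oddForm k 5).polarBilin w w' • x := by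
  have h := fun c => mul_mul_swap (cayleyTr_toCayley w) (cayleyTr_toCayley w') c
  rw [polar_oddForm]
  refine SpinModel.ext (fun i => ?_) (fun i => ?_) <;>
  simp only [gammaMap_apply, map_add, map_sub, map_smul, map_neg, h, detPolar_apply,
    SpinModel.add_fst, SpinModel.add_snd, SpinModel.neg_fst, SpinModel.neg_snd, SpinModel.smul_fst, SpinModel.smul_snd,
    SpinModel.mk_fst, SpinModel.mk_snd] <;>
  fin_cases i <;> simp only [Fin.zero_eta, Fin.mk_one] <;> match_scalars <;> grind

/-- The form on `C ⊗ U` given by the polar form of the norm and the alternating form. -/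
def wedgeForm : (Fin 2 → Cayley k) →ₗ[k] (Fin 2 → Cayley k) →ₗ[k] k :=
  LinearMap.mk₂ k (fun s t => (cayleyNorm k).polarBilin (s 0) (t 1)
      - (cayleyNorm k).polarBilin (s 1) (t 0))
    (by intro x x' y; simp only [Pi.add_apply, map_add, LinearMap.add_apply]; ring)
    (by intro c x y; simp only [Pi.smul_apply, map_smul, LinearMap.smul_apply, smul_eq_mul]; ring)
    (by intro x y y'; simp only [Pi.add_apply, map_add]; ring)
    (by intro c x y; simp only [Pi.smul_apply, map_smul, smul_eq_mul]; ring)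

theorem wedgeForm_apply (s t : Fin 2 → Cayley k) : wedgeForm s t =
    (cayleyNorm k).polarBilin (s 0) (t 1) - (cayleyNorm k).polarBilin (s 1) (t 0) := rfl

/-- The invariant bilinear form on the model of the spin module. -/
def modelForm : SpinModel k →ₗ[k] SpinModel k →ₗ[k] k :=
  (3 : k) • (wedgeForm.compl₁₂ (LinearMap.fst k _ _ ∘ₗ SpinModel.equivProd.toLinearMap)
      (LinearMap.fst k _ _ ∘ₗ SpinModel.equivProd.toLinearMap)
    - wedgeForm.compl₁₂ (LinearMap.snd k _ _ ∘ₗ SpinModel.equivProd.toLinearMap)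
      (LinearMap.snd k _ _ ∘ₗ SpinModel.equivProd.toLinearMap))

theorem modelForm_apply (x y : SpinModel k) :
    modelForm x y = 3 * (wedgeForm x.1 y.1 - wedgeForm x.2 y.2) := rfl

theorem modelForm_swap (x y : SpinModel k) : modelForm x y = -modelForm y x := by
  simp only [modelForm_apply, wedgeForm_apply, polar_comm (y.1 _), polar_comm (y.2 _)]
  ring

/-- Left multiplication by a trace zero element is skew for the norm; the minus sign between the two
copies in `modelForm` is what makes the exchange of copies skew as well. -/
theorem modelForm_gammaMap (w : OddSpace k 5) (x y : SpinModel k) :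
    modelForm (gammaMap w x) y = -modelForm x (gammaMap w y) := by
  simp only [modelForm_apply, wedgeForm_apply, gammaMap_apply, SpinModel.mk_fst,
    SpinModel.mk_snd, map_add, map_sub, map_smul, map_neg,
    LinearMap.add_apply, LinearMap.sub_apply, LinearMap.smul_apply, LinearMap.neg_apply,
    polar_mul_left (cayleyTr_toCayley w), smul_eq_mul]
  ring

end Model

/-! ### The spin representation of so(W) on the model. -/

section Model

variable {k : Type*} [Field k] [CharP k 5]

/-- The commutator of the Clifford action of two vectors. -/
def gammaComm : OddSpace k 5 →ₗ[k] OddSpace k 5 →ₗ[k] Module.End k (SpinModel k) :=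
  (LinearMap.mul k (Module.End k (SpinModel k))).compl₁₂ gammaMap gammaMap
    - ((LinearMap.mul k (Module.End k (SpinModel k))).compl₁₂ gammaMap gammaMap).flip

theorem gammaComm_apply (x y : OddSpace k 5) (s : SpinModel k) :
    gammaComm x y s = gammaMap x (gammaMap y s) - gammaMap y (gammaMap x s) := rfl

/-- The spin representation on the model, as a function on all endomorphisms of `W`. -/
def modelRepFun (φ : Module.End k (OddSpace k 5)) : Module.End k (SpinModel k) :=
  -(1 / 4 : k) •
    (∑ i, gammaComm (vecF k 5 i) (φ (vecV k 5 i))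
      + ∑ i, gammaComm (vecV k 5 i) (φ (vecF k 5 i))
      - (1 / 2 : k) • gammaComm (vecU k 5) (φ (vecU k 5)))

/-- The spin representation on the model, on all endomorphisms of `W`. -/
def modelRep : Module.End k (OddSpace k 5) →ₗ[k] Module.End k (SpinModel k) where
  toFun φ := modelRepFun φ
  map_add' φ ψ := by
    simp only [modelRepFun, LinearMap.add_apply, map_add, Finset.sum_add_distrib]
    module
  map_smul' c φ := by
    simp only [modelRepFun, LinearMap.smul_apply, map_smul, ← Finset.smul_sum, RingHom.id_apply]
    module

theorem modelRep_apply (φ : Module.End k (OddSpace k 5)) : modelRep φ = -(1 / 4 : k) •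
    (∑ i, gammaComm (vecF k 5 i) (φ (vecV k 5 i))
      + ∑ i, gammaComm (vecV k 5 i) (φ (vecF k 5 i))
      - (1 / 2 : k) • gammaComm (vecU k 5) (φ (vecU k 5))) := by
  rw [modelRep, LinearMap.coe_mk, AddHom.coe_mk, modelRepFun]

theorem sigmaMap_apply (x y w : OddSpace k 5) : sigmaMap k 5 x y w =
    (oddForm k 5).polarBilin x w • y - (oddForm k 5).polarBilin y w • x := rfl

theorem two_ne_zero_of_char_five : (2 : k) ≠ 0 := by grind

theorem polar_so {φ : Module.End k (OddSpace k 5)} (hφ : φ ∈ soOdd k 5) (x y : OddSpace k 5) :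
    (oddForm k 5).polarBilin (φ x) y = -(oddForm k 5).polarBilin x (φ y) := by
  have h := (LinearMap.mem_skewAdjointSubmodule φ).1 hφ x y
  rw [h, Pi.neg_apply, LinearMap.map_neg]

theorem mem_so {φ : Module.End k (OddSpace k 5)}
    (h : ∀ x y, (oddForm k 5).polarBilin (φ x) y = -(oddForm k 5).polarBilin x (φ y)) :
    φ ∈ soOdd k 5 := by
  refine (LinearMap.mem_skewAdjointSubmodule φ).2 fun x y => ?_
  rw [h, Pi.neg_apply, LinearMap.map_neg]

theorem oddPolar_comm (x y : OddSpace k 5) :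
    (oddForm k 5).polarBilin x y = (oddForm k 5).polarBilin y x := QuadraticMap.polar_comm _ _ _

theorem sigmaMap_mem_so (x y : OddSpace k 5) : sigmaMap k 5 x y ∈ soOdd k 5 := by
  refine mem_so fun v w => ?_
  simp only [sigmaMap_apply, map_sub, map_smul, LinearMap.sub_apply, LinearMap.smul_apply,
    smul_eq_mul, oddPolar_comm v]
  ring

/-- The vector φ(w) is expanded in two ways: as a vector, with the coefficients moved to w by
skewness, and as φ applied to the expansion of w. The sum of the two is the formula, so every skew φ
is a combination of maps σ_{x,y}. -/
theorem two_smul_eq_of_expansion {K E ι : Type*} [Field K] [AddCommGroup E] [Module K E]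
    [Fintype ι] (B : E →ₗ[K] E →ₗ[K] K) (hB : ∀ x y, B x y = B y x) (f v : ι → E) (u : E) (c : K)
    (h : ∀ x, ∑ i, B x (v i) • f i + ∑ i, B x (f i) • v i - c • B x u • u = x)
    (φ : Module.End K E) (hφ : ∀ x y, B (φ x) y = -B x (φ y)) (w : E) :
    (2 : K) • φ w = ∑ i, (B (f i) w • φ (v i) - B (φ (v i)) w • f i)
      + ∑ i, (B (v i) w • φ (f i) - B (φ (f i)) w • v i)
      - c • (B u w • φ u - B (φ u) w • u) := by
  have h1 := h (φ w)
  have h2 := congrArg φ (h w)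
  simp only [map_add, map_sub, map_sum, map_smul, hφ w, hB w, neg_smul, Finset.sum_neg_distrib,
    smul_neg] at h1 h2
  rw [two_smul]
  nth_rewrite 1 [← h1]
  rw [← h2]
  simp only [Finset.sum_sub_distrib, smul_sub]
  abel

theorem so_eq_sum {φ : Module.End k (OddSpace k 5)} (hφ : φ ∈ soOdd k 5) :
    (2 : k) • φ = ∑ i, sigmaMap k 5 (vecF k 5 i) (φ (vecV k 5 i))
      + ∑ i, sigmaMap k 5 (vecV k 5 i) (φ (vecF k 5 i))
      - (1 / 2 : k) • sigmaMap k 5 (vecU k 5) (φ (vecU k 5)) := by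
  refine LinearMap.ext fun w => ?_
  have h := two_smul_eq_of_expansion _ oddPolar_comm (vecF k 5) (vecV k 5) (vecU k 5) (1 / 2)
    (dual_expansion k 5 two_ne_zero_of_char_five) φ (polar_so hφ) w
  simpa only [LinearMap.smul_apply, LinearMap.add_apply, LinearMap.sub_apply, LinearMap.sum_apply,
    sigmaMap_apply] using h

/-- Moving γ(w) through the two factors by the Clifford relation leaves only the terms with q(x,w)
and q(y,w), which are those of σ_{x,y}(w). -/
theorem gammaComm_gammaMap (x y w : OddSpace k 5) (s : SpinModel k) :
    gammaComm x y (gammaMap w s) - gammaMap w (gammaComm x y s) =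
      -(2 : k) • gammaMap (sigmaMap k 5 x y w) s := by
  simp only [gammaComm_apply, map_sub, sigmaMap_apply, map_smul, LinearMap.sub_apply,
    LinearMap.smul_apply]
  rw [gammaMap_swap y w, gammaMap_swap x w]
  simp only [map_add, map_neg, map_smul]
  rw [gammaMap_swap x w, gammaMap_swap y w]
  module

/-- The Clifford action is equivariant for so(W). This property and skewness characterise the spin
operators; see `eq_modelRep`. -/
theorem modelRep_gammaMap {φ : Module.End k (OddSpace k 5)} (hφ : φ ∈ soOdd k 5)
    (w : OddSpace k 5) (s : SpinModel k) :
    modelRep φ (gammaMap w s) - gammaMap w (modelRep φ s) = gammaMap (φ w) s := by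
  have h2 := congrArg (fun ψ => gammaMap (ψ w) s) (so_eq_sum hφ)
  have h4 : (1 / 4 : k) * 2 * 2 = 1 := by
    have := two_ne_zero_of_char_five (k := k)
    have h4 : (4 : k) ≠ 0 := by grind
    field_simp
    norm_num
  simp only [LinearMap.smul_apply, LinearMap.add_apply, LinearMap.sub_apply, LinearMap.sum_apply,
    map_add, map_sub, map_sum, map_smul] at h2
  -- Of the two factors 2 that cancel the 1/4 of `modelRep`, one comes from the expansion of 2φ and
  -- the other from `gammaComm_gammaMap`.
  rw [← one_smul k (gammaMap (φ w) s), ← h4, mul_smul, h2]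
  simp only [modelRep_apply, LinearMap.smul_apply, LinearMap.add_apply, LinearMap.sub_apply,
    LinearMap.sum_apply, map_smul, map_add, map_sub, map_sum]
  rw [← smul_sub]
  have e (x y) : gammaComm x y (gammaMap w s) = gammaMap w (gammaComm x y s)
      -(2 : k) • gammaMap (sigmaMap k 5 x y w) s := by
    rw [sub_eq_add_neg, ← neg_smul, ← gammaComm_gammaMap]
    abel
  simp only [e, Finset.sum_sub_distrib, ← Finset.smul_sum]
  module

theorem modelForm_gammaComm (v w : OddSpace k 5) (x y : SpinModel k) :
    modelForm (gammaComm v w x) y = -modelForm x (gammaComm v w y) := by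
  simp only [gammaComm_apply, map_sub, LinearMap.sub_apply, modelForm_gammaMap]
  ring

theorem modelForm_modelRep (φ : Module.End k (OddSpace k 5)) (x y : SpinModel k) :
    modelForm (modelRep φ x) y = -modelForm x (modelRep φ y) := by
  simp only [modelRep_apply, LinearMap.smul_apply, LinearMap.add_apply, LinearMap.sub_apply,
    LinearMap.sum_apply, map_smul, map_add, map_sub, map_sum, modelForm_gammaComm,
    Finset.sum_neg_distrib, smul_eq_mul]
  ring

theorem modelRep_sigmaMap (x y : OddSpace k 5) :
    modelRep (sigmaMap k 5 x y) = -(1 / 2 : k) • gammaComm x y := by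
  have hx (x y : OddSpace k 5) :
      ∑ i, (oddForm k 5).polarBilin x (vecV k 5 i) • gammaComm (vecF k 5 i) y
        + ∑ i, (oddForm k 5).polarBilin x (vecF k 5 i) • gammaComm (vecV k 5 i) y
        - (1 / 2 : k) • (oddForm k 5).polarBilin x (vecU k 5) • gammaComm (vecU k 5) y
        = gammaComm x y := by
    conv_rhs => rw [← dual_expansion k 5 two_ne_zero_of_char_five x]
    simp [LinearMap.sum_apply]
  have hs : gammaComm y x = -gammaComm x y := by simp [gammaComm]
  have e : modelRep (sigmaMap k 5 x y) = -(1 / 4 : k) • (gammaComm x y - gammaComm y x) := by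
    rw [← hx x y, ← hx y x, modelRep_apply]
    simp only [sigmaMap_apply, map_sub, map_smul, Finset.sum_sub_distrib, smul_sub]
    module
  have h4 : (1 / 4 : k) * 2 = 1 / 2 := by
    have := two_ne_zero_of_char_five (k := k)
    have h4 : (4 : k) ≠ 0 := by grind
    field_simp
    norm_num
  rw [e, hs, sub_neg_eq_add, ← two_smul k, smul_smul, neg_mul, h4]

end Model

/-! ### The equivariant map from the exterior algebra to the model. -/

section Theta

variable {k : Type*} [Field k] [CharP k 5]

theorem vecU_polar (m : Module.Dual k (Fin 5 → k) × (Fin 5 → k)) :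
    (oddForm k 5).polarBilin (vecU k 5) (m, 0) = 0 := by
  obtain ⟨f, v⟩ := m
  have e : vecU k 5 = ((0, 0), 1) := rfl
  rw [QuadraticMap.polarBilin_apply_apply, e, oddForm_polar]
  simp

theorem gammaMap_vecU (x : SpinModel k) : gammaMap (vecU k 5) (gammaMap (vecU k 5) x) = -x := by
  have h := gammaMap_swap (vecU k 5) (vecU k 5) x
  have e : vecU k 5 = ((0, 0), 1) := rfl
  have h2 : (oddForm k 5).polarBilin (vecU k 5) (vecU k 5) = -2 := by
    rw [QuadraticMap.polarBilin_apply_apply, e, oddForm_polar]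
    simp
  rw [h2] at h
  have : (2 : k) • (gammaMap (vecU k 5) (gammaMap (vecU k 5) x) + x) = 0 := by
    rw [two_smul]
    nth_rewrite 1 [h]
    module
  exact eq_neg_of_add_eq_zero_left ((smul_eq_zero.1 this).resolve_left two_ne_zero_of_char_five)

/-- The Clifford action of `V* ⊕ V` on the model of the spin module. -/
def lamMap : Module.Dual k (Fin 5 → k) × (Fin 5 → k) →ₗ[k] Module.End k (SpinModel k) :=
  LinearMap.mulLeft k (gammaMap (vecU k 5)) ∘ₗ gammaMap ∘ₗ LinearMap.inl k _ k

theorem lamMap_apply (m : Module.Dual k (Fin 5 → k) × (Fin 5 → k)) (x : SpinModel k) :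
    lamMap m x = gammaMap (vecU k 5) (gammaMap (m, 0) x) := rfl

/-- The operator γ(u) anticommutes with γ(m) and has square -1, so it cancels from the product.
Hence x ↦ γ(u)γ(x) is a Clifford action of V* ⊕ V; it corresponds to the isomorphism x ↦ u·x onto
the even Clifford algebra. -/
theorem lamMap_lamMap (m m' : Module.Dual k (Fin 5 → k) × (Fin 5 → k)) (x : SpinModel k) :
    lamMap m (lamMap m' x) = gammaMap (m, 0) (gammaMap (m', 0) x) := by
  rw [lamMap_apply, lamMap_apply, gammaMap_swap (m, 0), oddPolar_comm, vecU_polar, zero_smul,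
    add_zero, LinearMap.map_neg, gammaMap_vecU, neg_neg]

theorem polar_inl (f g : Module.Dual k (Fin 5 → k)) (v w : Fin 5 → k) :
    (oddForm k 5).polarBilin ((f, v), 0) ((g, w), 0) = f w + g v := by
  rw [QuadraticMap.polarBilin_apply_apply, oddForm_polar]
  simp

theorem lamMap_swap (f g : Module.Dual k (Fin 5 → k)) (v w : Fin 5 → k) (x : SpinModel k) :
    lamMap (f, v) (lamMap (g, w) x) =
      -lamMap (g, w) (lamMap (f, v) x) + (f w + g v) • x := by
  rw [lamMap_lamMap, lamMap_lamMap, gammaMap_swap, polar_inl]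

theorem lamMap_sq (v : Fin 5 → k) (x : SpinModel k) :
    lamMap (0, v) (lamMap (0, v) x) = 0 := by
  have h := lamMap_swap 0 0 v v x
  simp only [LinearMap.zero_apply, add_zero, zero_smul] at h
  have : (2 : k) • lamMap (0, v) (lamMap (0, v) x) = 0 := by
    rw [two_smul]
    nth_rewrite 1 [h]
    abel
  exact (smul_eq_zero.1 this).resolve_left two_ne_zero_of_char_five

/-- The product of two anticommuting skew operators is skew. -/
theorem modelForm_lamMap (m : Module.Dual k (Fin 5 → k) × (Fin 5 → k)) (x y : SpinModel k) :
    modelForm (lamMap m x) y = -modelForm x (lamMap m y) := by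
  rw [lamMap_apply, modelForm_gammaMap, modelForm_gammaMap, lamMap_apply,
    gammaMap_swap (vecU k 5), vecU_polar, zero_smul, add_zero, map_neg]

/-- The restriction of `lamMap` to `V`. -/
def lamVec : (Fin 5 → k) →ₗ[k] Module.End k (SpinModel k) := lamMap ∘ₗ LinearMap.inr k _ _

theorem lamVec_apply (v : Fin 5 → k) : lamVec v = lamMap (0, v) := rfl

theorem lamVec_mul_self (v : Fin 5 → k) : lamVec v * lamVec v = 0 := by
  refine LinearMap.ext fun x => ?_
  rw [Module.End.mul_apply, lamVec_apply, lamMap_sq, LinearMap.zero_apply]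

/-- The action of the exterior algebra on the model of the spin module. -/
def extAction : SpinSpace k 5 →ₐ[k] Module.End k (SpinModel k) :=
  ExteriorAlgebra.lift k ⟨lamVec, lamVec_mul_self⟩

/-- The vacuum vector of the model of the spin module. -/
def vacuum : SpinModel k := SpinModel.mk ![zorn 0 0 0 0 0 0 0 1, 0] 0

/-- The equivariant map from the exterior algebra to the model, that sends `1` to the vacuum. -/
def thetaMap : SpinSpace k 5 →ₗ[k] SpinModel k :=
  (LinearMap.applyₗ vacuum) ∘ₗ extAction.toLinearMap

theorem thetaMap_apply (s : SpinSpace k 5) : thetaMap s = extAction s vacuum := rfl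

theorem thetaMap_one : thetaMap (1 : SpinSpace k 5) = vacuum := by
  rw [thetaMap_apply, map_one, Module.End.one_apply]

theorem thetaMap_ι_mul (v : Fin 5 → k) (s : SpinSpace k 5) :
    thetaMap (ExteriorAlgebra.ι k v * s) = lamMap (0, v) (thetaMap s) := by
  rw [thetaMap_apply, thetaMap_apply, map_mul, Module.End.mul_apply, extAction, ExteriorAlgebra.lift_ι_apply, lamVec_apply]

theorem zorn_zero : zorn 0 0 0 0 0 0 0 0 = (0 : Cayley k) := by
  simp [zorn, funext_iff, Fin.forall_fin_succ]

/-- The functionals f₁, f₂, f₃ act by strictly lower triangular Zorn matrices, which kill the lower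
idempotent from the left. The functionals f₄, f₅ give matrices supported in the first row, and these
only see the second vector of U. -/
theorem lamMap_dual_vacuum (f : Module.Dual k (Fin 5 → k)) : lamMap (f, 0) vacuum = 0 := by
  rw [lamMap_apply]
  have : gammaMap ((f, 0), 0) vacuum = 0 := by
    refine SpinModel.ext (fun i => ?_) (fun i => ?_)
    · fin_cases i <;>
        simp [gammaMap_apply, SpinModel.mk_fst, SpinModel.zero_fst, vacuum, toCayley, toMat,
          zorn_mul, SpinModel.mk_snd, zorn_zero]
    · fin_cases i <;>
        simp [gammaMap_apply, SpinModel.mk_fst, SpinModel.zero_snd, vacuum, toCayley, toMat,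
          SpinModel.mk_snd]
  rw [this, LinearMap.map_zero]

/-- Contraction by f on ⋀V and the operator of f on the model both annihilate the generating vector
and satisfy the same anticommutation relation with the operators of V, so they correspond by
induction on products of vectors. -/
theorem thetaMap_contractLeft (f : Module.Dual k (Fin 5 → k)) (s : SpinSpace k 5) :
    thetaMap (CliffordAlgebra.contractLeft f s) = lamMap (f, 0) (thetaMap s) := by
  induction s using CliffordAlgebra.left_induction with
  | algebraMap r =>
    rw [CliffordAlgebra.contractLeft_algebraMap, map_zero, Algebra.algebraMap_eq_smul_one,
      LinearMap.map_smul, LinearMap.map_smul]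
    erw [thetaMap_one]
    rw [lamMap_dual_vacuum, smul_zero]
  | add x y hx hy => rw [map_add, LinearMap.map_add, hx, hy, LinearMap.map_add, LinearMap.map_add]
  | ι_mul x v hx =>
    rw [CliffordAlgebra.contractLeft_ι_mul, LinearMap.map_sub, LinearMap.map_smul]
    have h := thetaMap_ι_mul v x
    have h' := thetaMap_ι_mul v (CliffordAlgebra.contractLeft f x)
    rw [hx] at h'
    refine Eq.trans (congrArg _ h') ?_
    refine Eq.trans ?_ (congrArg (lamMap (f, 0)) h).symm
    rw [lamMap_swap]
    simp

theorem thetaMap_cliffordAction (m : Module.Dual k (Fin 5 → k) × (Fin 5 → k))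
    (s : SpinSpace k 5) :
    thetaMap (cliffordAction k 5 (CliffordAlgebra.ι _ m) s) = lamMap m (thetaMap s) := by
  obtain ⟨f, v⟩ := m
  rw [cliffordAction_ι, map_add, thetaMap_ι_mul, thetaMap_contractLeft, ← LinearMap.add_apply,
    ← map_add]
  simp

theorem gammaMap_eq_add (x : OddSpace k 5) (s : SpinModel k) :
    gammaMap x s = gammaMap (x.1, 0) s + x.2 • gammaMap (vecU k 5) s := by
  rw [← LinearMap.smul_apply, ← map_smul, ← LinearMap.add_apply, ← map_add]
  simp [vecU]

/-- The inverse isomorphism sends x·y to (x₁ + α)(y₁ - β), where x₁, y₁ are the components in V* ⊕ V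
and α, β the coefficients of u. Expanding γ(x)γ(y) with γ(u)² = -1 gives the same four terms. -/
theorem thetaMap_even (x y : OddSpace k 5) (s : SpinSpace k 5) :
    thetaMap (cliffordAction k 5 ((CliffordAlgebra.equivEven (hypForm k 5)).symm
      ((CliffordAlgebra.even.ι (oddForm k 5)).bilin x y)) s) =
      gammaMap x (gammaMap y (thetaMap s)) := by
  have h : (CliffordAlgebra.equivEven (hypForm k 5)).symm
      ((CliffordAlgebra.even.ι (oddForm k 5)).bilin x y) = _ :=
    CliffordAlgebra.ofEven_ι (hypForm k 5) x y
  rw [h, map_mul, map_add, map_sub, AlgHom.commutes,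
    AlgHom.commutes, Module.End.mul_apply, LinearMap.add_apply, LinearMap.sub_apply, map_add,
    Module.algebraMap_end_apply, Module.algebraMap_end_apply, LinearMap.map_smul,
    thetaMap_cliffordAction, LinearMap.map_sub, LinearMap.map_smul, thetaMap_cliffordAction,
    gammaMap_eq_add x, gammaMap_eq_add y, LinearMap.map_sub, LinearMap.map_smul, lamMap_lamMap,
    LinearMap.map_add, LinearMap.map_add, LinearMap.map_smul, LinearMap.map_smul, gammaMap_vecU,
    lamMap_apply, lamMap_apply, gammaMap_swap (vecU k 5) (x.1, 0), vecU_polar]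
  module

theorem thetaMap_cliffComm (x y : OddSpace k 5) (s : SpinSpace k 5) :
    thetaMap (cliffordAction k 5 ((CliffordAlgebra.equivEven (hypForm k 5)).symm
      (cliffComm k 5 x y)) s) = gammaComm x y (thetaMap s) := by
  rw [gammaComm_apply, ← thetaMap_even, ← thetaMap_even, ← map_sub, ← LinearMap.sub_apply,
    ← map_sub, ← map_sub]
  rfl

theorem thetaMap_spinRep (φ : soOdd k 5) (s : SpinSpace k 5) :
    thetaMap (spinRep k 5 φ s) = modelRep φ.1 (thetaMap s) := by
  simp only [spinRep, soToClifford, modelRep_apply, map_smul, map_add, map_sub, map_sum,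
    LinearMap.smul_apply, LinearMap.add_apply, LinearMap.sub_apply, LinearMap.sum_apply,
    thetaMap_cliffComm]
end Theta

/-! ### Bijectivity, comparison of the forms, and uniqueness of spin operators. -/

section Theta

variable {k : Type*} [Field k] [CharP k 5]

theorem lamMap_mem_range {m : Module.Dual k (Fin 5 → k) × (Fin 5 → k)} {x : SpinModel k}
    (hx : x ∈ LinearMap.range thetaMap) : lamMap m x ∈ LinearMap.range thetaMap := by
  obtain ⟨s, rfl⟩ := hx
  exact ⟨_, thetaMap_cliffordAction m s⟩

theorem lamMap_mk (f : Module.Dual k (Fin 5 → k)) (v : Fin 5 → k) (x : SpinModel k) :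
    lamMap (f, v) x = SpinModel.mk
      (fun i => (2 : k) • cayleyMul k (zorn 1 0 0 0 0 0 0 (-1)) ((gammaMap ((f, v), 0) x).1 i))
      (fun i => -((2 : k) • cayleyMul k (zorn 1 0 0 0 0 0 0 (-1))
        ((gammaMap ((f, v), 0) x).2 i))) := by
  rw [lamMap_apply]
  refine SpinModel.ext (fun i => ?_) (fun i => ?_) <;> rw [gammaMap_apply (vecU k 5)] <;>
    fin_cases i <;> simp [toCayley, toMat, vecU, SpinModel.mk_fst, SpinModel.mk_snd]

/-- The multiplication by an upper triangular trace zero element. -/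
theorem lamMap_upper (v₀ v₁ v₂ : k) (b : Cayley k) :
    lamMap (0, ![v₀, v₁, v₂, 0, 0]) (SpinModel.mk ![b, 0] 0) =
      SpinModel.mk ![-cayleyMul k (zorn 1 0 0 0 0 0 0 (-1))
        (cayleyMul k (zorn 0 v₀ v₁ v₂ 0 0 0 0) b), 0] 0 := by
  rw [lamMap_mk]
  have h4 : (2 : k) * 2 = -1 := by grind
  refine SpinModel.ext (fun i => ?_) (fun i => ?_) <;> rw [gammaMap_apply] <;> fin_cases i <;>
    simp [toCayley, toMat, SpinModel.mk_fst, SpinModel.mk_snd, smul_smul, h4]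

/-- Multiplications by upper triangular Zorn matrices lead from the lower idempotent to the upper
vectors, from two of these to the lower vectors by the cross product, and from a lower vector to the
upper idempotent by the dot product. -/
theorem mk_left_mem_range (b : Cayley k) :
    SpinModel.mk ![b, 0] 0 ∈ LinearMap.range (thetaMap (k := k)) := by
  have h0 : ∀ b c : Cayley k, ∀ r : k, SpinModel.mk ![r • b + c, 0] 0 =
      r • SpinModel.mk ![b, 0] 0 + SpinModel.mk ![c, 0] 0 := by
    intro b c r
    refine SpinModel.ext (fun i => ?_) (fun i => ?_)
    · fin_cases i <;> simp [SpinModel.mk_fst, SpinModel.add_fst, SpinModel.smul_fst]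
    · simp [SpinModel.mk_snd, SpinModel.add_snd, SpinModel.smul_snd]
  have hlin : ∀ b c : Cayley k, ∀ r : k,
      SpinModel.mk ![b, 0] 0 ∈ LinearMap.range (thetaMap (k := k)) →
      SpinModel.mk ![c, 0] 0 ∈ LinearMap.range (thetaMap (k := k)) →
      SpinModel.mk ![r • b + c, 0] 0 ∈ LinearMap.range (thetaMap (k := k)) := by
    intro b c r hb hc
    rw [h0]
    exact add_mem (Submodule.smul_mem _ _ hb) hc
  have hup : ∀ (v₀ v₁ v₂ : k) (b : Cayley k),
      SpinModel.mk ![b, 0] 0 ∈ LinearMap.range (thetaMap (k := k)) →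
      SpinModel.mk ![-cayleyMul k (zorn 1 0 0 0 0 0 0 (-1))
        (cayleyMul k (zorn 0 v₀ v₁ v₂ 0 0 0 0) b), 0] 0 ∈ LinearMap.range (thetaMap (k := k)) := by
    intro v₀ v₁ v₂ b hb
    rw [← lamMap_upper]
    exact lamMap_mem_range hb
  have e2 : SpinModel.mk ![zorn 0 0 0 0 0 0 0 1, 0] 0 ∈ LinearMap.range (thetaMap (k := k)) :=
    ⟨1, thetaMap_one⟩
  have u : ∀ v₀ v₁ v₂ : k, SpinModel.mk ![zorn 0 v₀ v₁ v₂ 0 0 0 0, 0] 0 ∈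
      LinearMap.range (thetaMap (k := k)) := by
    intro v₀ v₁ v₂
    have h := hup (-v₀) (-v₁) (-v₂) _ e2
    simpa [zorn_mul, zorn_neg] using h
  have v0 : SpinModel.mk ![zorn 0 0 0 0 1 0 0 0, 0] 0 ∈ LinearMap.range (thetaMap (k := k)) := by
    have h := hup 0 1 0 _ (u 0 0 1)
    simpa [zorn_mul, zorn_neg] using h
  have v1 : SpinModel.mk ![zorn 0 0 0 0 0 1 0 0, 0] 0 ∈ LinearMap.range (thetaMap (k := k)) := by
    have h := hup 0 0 1 _ (u 1 0 0)
    simpa [zorn_mul, zorn_neg] using h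
  have v2 : SpinModel.mk ![zorn 0 0 0 0 0 0 1 0, 0] 0 ∈ LinearMap.range (thetaMap (k := k)) := by
    have h := hup 1 0 0 _ (u 0 1 0)
    simpa [zorn_mul, zorn_neg] using h
  have e1 : SpinModel.mk ![zorn 1 0 0 0 0 0 0 0, 0] 0 ∈ LinearMap.range (thetaMap (k := k)) := by
    have h := hup (-1) 0 0 _ v0
    simpa [zorn_mul, zorn_neg] using h
  obtain ⟨a0, a1, a2, a3, a4, a5, a6, a7, rfl⟩ := exists_zorn b
  have h := hlin _ _ a0 e1 (hlin _ _ a7 e2 (hlin _ _ a4 v0 (hlin _ _ a5 v1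
    (hlin _ _ a6 v2 (u a1 a2 a3)))))
  simpa [zorn_add, zorn_smul] using h

theorem cayleyMul_zorn_diag (b : Cayley k) : cayleyMul k (zorn 1 0 0 0 0 0 0 (-1))
    (cayleyMul k (zorn 1 0 0 0 0 0 0 (-1)) b) = b := by
  obtain ⟨a0, a1, a2, a3, a4, a5, a6, a7, rfl⟩ := exists_zorn b
  simp [zorn_mul]

theorem thetaMap_surjective : Function.Surjective (thetaMap (k := k)) := by
  have hA := mk_left_mem_range (k := k)
  have hB (b : Cayley k) :
      SpinModel.mk 0 ![b, 0] ∈ LinearMap.range (thetaMap (k := k)) := by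
    -- The effect of γ(u) in `lamMap` is undone in advance: 3 is the inverse of 2, and left
    -- multiplication by diag(1, -1) is an involution.
    have h := lamMap_mem_range (m := (0, ![0, 0, 0, 0, 3]))
      (hA (cayleyMul k (zorn 1 0 0 0 0 0 0 (-1)) b))
    convert h using 1
    rw [lamMap_mk]
    have h4 : (2 : k) * 3 = 1 := by grind
    refine SpinModel.ext (fun i => ?_) (fun i => ?_) <;> rw [gammaMap_apply] <;> fin_cases i <;>
      simp [toCayley, toMat, SpinModel.mk_fst, SpinModel.mk_snd, cayleyMul_zorn_diag, smul_smul, h4,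
        zorn_zero]
  have hC (b : Cayley k) :
      SpinModel.mk 0 ![0, b] ∈ LinearMap.range (thetaMap (k := k)) := by
    have h := lamMap_mem_range (m := (0, ![0, 0, 0, -3, 0]))
      (hA (cayleyMul k (zorn 1 0 0 0 0 0 0 (-1)) b))
    convert h using 1
    rw [lamMap_mk]
    have h4 : (2 : k) * 3 = 1 := by grind
    refine SpinModel.ext (fun i => ?_) (fun i => ?_) <;> rw [gammaMap_apply] <;> fin_cases i <;>
      simp [toCayley, toMat, SpinModel.mk_fst, SpinModel.mk_snd, cayleyMul_zorn_diag, smul_smul, h4,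
        zorn_zero]
  have hD (b : Cayley k) :
      SpinModel.mk ![0, b] 0 ∈ LinearMap.range (thetaMap (k := k)) := by
    have h := lamMap_mem_range (m := (0, ![0, 0, 0, -3, 0]))
      (hB (cayleyMul k (zorn 1 0 0 0 0 0 0 (-1)) b))
    convert h using 1
    rw [lamMap_mk]
    have h4 : (2 : k) * 3 = 1 := by grind
    refine SpinModel.ext (fun i => ?_) (fun i => ?_) <;> rw [gammaMap_apply] <;> fin_cases i <;>
      simp [toCayley, toMat, SpinModel.mk_fst, SpinModel.mk_snd, cayleyMul_zorn_diag, smul_smul, h4,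
        zorn_zero]
  intro x
  have h : x = SpinModel.mk ![x.1 0, 0] 0 + SpinModel.mk ![0, x.1 1] 0 +
      (SpinModel.mk 0 ![x.2 0, 0] + SpinModel.mk 0 ![0, x.2 1]) := by
    refine SpinModel.ext (fun i => ?_) (fun i => ?_) <;> fin_cases i <;>
      simp [SpinModel.add_fst, SpinModel.add_snd, SpinModel.mk_fst, SpinModel.mk_snd]
  rw [h]
  exact add_mem (add_mem (hA _) (hD _)) (add_mem (hB _) (hC _))

theorem finrank_spinSpace : Module.finrank k (SpinSpace k 5) = 32 := by
  rw [Module.finrank_eq_card_basis (Pi.basisFun k (Fin 5)).ExteriorAlgebra]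
  simp

theorem finrank_spinModel : Module.finrank k (SpinModel k) = 32 := by
  rw [LinearEquiv.finrank_eq SpinModel.equivProd, Module.finrank_prod, Module.finrank_pi_fintype, Module.finrank_prod,
    Module.finrank_prod, Module.finrank_prod, Module.finrank_pi, Module.finrank_self]
  simp

instance : Module.Finite k (SpinSpace k 5) :=
  Module.Finite.of_basis (Pi.basisFun k (Fin 5)).ExteriorAlgebra

instance : Module.Finite k (SpinModel k) :=
  Module.Finite.equiv (SpinModel.equivProd (k := k)).symm

theorem thetaMap_bijective : Function.Bijective (thetaMap (k := k)) :=
  ⟨(LinearMap.injective_iff_surjective_of_finrank_eq_finrank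
    (finrank_spinSpace.trans finrank_spinModel.symm)).2 thetaMap_surjective, thetaMap_surjective⟩

/-- The spin module is isomorphic to its model. -/
def thetaEquiv : SpinSpace k 5 ≃ₗ[k] SpinModel k :=
  LinearEquiv.ofBijective thetaMap thetaMap_bijective

theorem thetaEquiv_apply (s : SpinSpace k 5) : thetaEquiv s = thetaMap s := rfl

theorem contractLeft_ιMulti (f : Module.Dual k (Fin 5 → k)) (n : ℕ) (w : Fin n → Fin 5 → k)
    (h : ∀ m, f (w m) = 0) :
    CliffordAlgebra.contractLeft f (ExteriorAlgebra.ιMulti k n w : SpinSpace k 5) = 0 := by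
  induction n with
  | zero =>
    rw [ExteriorAlgebra.ιMulti_zero_apply]
    exact CliffordAlgebra.contractLeft_one (Q := 0) f
  | succ n ih =>
    rw [ExteriorAlgebra.ιMulti_succ_apply]
    refine (CliffordAlgebra.contractLeft_ι_mul f (w 0) _).trans ?_
    rw [h 0, zero_smul, zero_sub, neg_eq_zero]
    have := ih (Matrix.vecTail w) (fun m => h _)
    exact (congrArg _ this).trans (mul_zero _)

/-- Since f kills the vacuum and f(v) = 1, the vacuum is the image under f of its image under v.
Skewness moves the operator of f to the other argument, where it is contraction by f. -/
theorem modelForm_vacuum_eq_zero (f : Module.Dual k (Fin 5 → k)) (v : Fin 5 → k) (hv : f v = 1)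
    (s : SpinSpace k 5) (hs : CliffordAlgebra.contractLeft f s = 0) :
    modelForm vacuum (thetaMap s) = 0 := by
  have h : vacuum = lamMap (f, 0) (lamMap (0, v) vacuum) := by
    rw [lamMap_swap, lamMap_dual_vacuum, LinearMap.map_zero]
    simp [hv]
  rw [h, modelForm_lamMap, ← thetaMap_contractLeft, hs, map_zero, map_zero, neg_zero]

/-- Pairing with the vacuum is a linear form on ⋀V that vanishes on every monomial missing some
basis vector, by `modelForm_vacuum_eq_zero`. Only the top degree remains, so it is a multiple of Φ.
-/
theorem modelForm_vacuum_thetaMap (s : SpinSpace k 5) :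
    modelForm vacuum (thetaMap s) =
      modelForm vacuum (thetaMap (ExteriorAlgebra.ιMulti k 5 fun i => Pi.single i 1)) *
        topForm k 5 s := by
  set c := modelForm vacuum (thetaMap (ExteriorAlgebra.ιMulti k 5 fun i => Pi.single i 1)) with hc
  have key : (modelForm (vacuum (k := k))) ∘ₗ thetaMap = c • topForm k 5 := by
    refine ExteriorAlgebra.lhom_ext fun n => ?_
    by_cases hn : n = 5
    · subst hn
      -- In top degree an alternating form is determined by its value on the basis.
      rw [AlternatingMap.eq_smul_basis_det (Pi.basisFun k (Fin 5))
        ((modelForm (vacuum (k := k)) ∘ₗ thetaMap).compAlternatingMap _),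
        AlternatingMap.eq_smul_basis_det (Pi.basisFun k (Fin 5))
        ((c • topForm k 5).compAlternatingMap _)]
      congr 1
      simp only [LinearMap.compAlternatingMap_apply, LinearMap.comp_apply, LinearMap.smul_apply,
        topForm, ExteriorAlgebra.liftAlternating_apply_ιMulti, Pi.single_eq_same]
      have hb : ⇑(Pi.basisFun k (Fin 5)) = fun i => Pi.single i 1 := by ext i; simp
      have : (Matrix.detRowAlternating fun i : Fin 5 => (Pi.single i 1 : Fin 5 → k)) = 1 :=
        (congrArg Matrix.det (Matrix.ext fun i j => by
          simp [Matrix.one_apply, Pi.single_apply, eq_comm])).trans Matrix.det_one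
      rw [hb, this, smul_eq_mul, mul_one]
    · refine Module.Basis.ext_alternating (Pi.basisFun k (Fin 5)) fun v hv => ?_
      have h0 : (Pi.single 5 Matrix.detRowAlternating : ∀ i, (Fin 5 → k) [⋀^Fin i]→ₗ[k] k) n
          = 0 := Pi.single_eq_of_ne hn _
      simp only [LinearMap.compAlternatingMap_apply, LinearMap.comp_apply, LinearMap.smul_apply,
        topForm, ExteriorAlgebra.liftAlternating_apply_ιMulti, h0, AlternatingMap.zero_apply,
        smul_zero]
      -- An injective family of basis indices that were also surjective would have exactly 5
      -- members; in any other degree some index j is missing.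
      have hsurj : ¬Function.Surjective v := by
        intro hs
        have := Fintype.card_of_bijective ⟨hv, hs⟩
        simp at this
        exact hn this
      obtain ⟨j, hj⟩ := not_forall.1 hsurj
      refine modelForm_vacuum_eq_zero (LinearMap.proj j) (Pi.single j 1) (by simp) _
        (contractLeft_ιMulti _ _ _ fun m => ?_)
      have : j ≠ v m := fun h => hj ⟨m, h.symm⟩
      simp [this]
  exact LinearMap.congr_fun key s

/-- This constant is the ratio of the two invariant forms. It is not a square in the prime field,
whence the passage to a square root of 3 at the end. -/
theorem modelForm_vacuum_top :
    modelForm vacuum (thetaMap (ExteriorAlgebra.ιMulti k 5 fun i => Pi.single i 1)) = (3 : k) := by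
  simp only [ExteriorAlgebra.ιMulti_apply, List.ofFn_succ, List.ofFn_zero, List.prod_cons,
    List.prod_nil, thetaMap_ι_mul, thetaMap_one, lamMap_mk]
  simp [modelForm_apply, wedgeForm_apply, vacuum, SpinModel.mk_fst, SpinModel.mk_snd,
    gammaMap_apply, toCayley, toMat, zorn_mul, zorn_neg, zorn_smul, zorn_add, zorn_sub,
    -QuadraticMap.polarBilin_apply_apply]
  rw [zorn_polar]
  grind

/-- Both forms change sign when a vector of V moves from the front of s to the front of t: on ⋀V by
the definition of the bar, on the model by `modelForm_lamMap`. Induction on s reduces to s a scalar,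
where both are multiples of Φ(t). -/
theorem modelForm_thetaMap (s t : SpinSpace k 5) :
    modelForm (thetaMap s) (thetaMap t) = 3 * spinForm k 5 s t := by
  rw [spinForm]
  induction s using CliffordAlgebra.left_induction generalizing t with
  | algebraMap r =>
    have h : thetaMap (algebraMap k (SpinSpace k 5) r) = r • vacuum := by
      rw [Algebra.algebraMap_eq_smul_one, map_smul, thetaMap_one]
    refine (congrArg (fun x => modelForm x (thetaMap t)) h).trans ?_
    rw [map_smul, LinearMap.smul_apply, modelForm_vacuum_thetaMap, modelForm_vacuum_top,
      AlgHom.commutes, CliffordAlgebra.reverse.commutes]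
    have : (algebraMap k (CliffordAlgebra 0) r : SpinSpace k 5) * t = r • t :=
      (Algebra.smul_def r t).symm
    rw [this, map_smul, smul_eq_mul, smul_eq_mul]
    ring
  | add x y hx hy =>
    rw [LinearMap.map_add, map_add, LinearMap.add_apply, hx, hy, map_add, map_add, add_mul, map_add,
      mul_add]
  | ι_mul x v hx =>
    have h : thetaMap (ExteriorAlgebra.ι k v * x) = _ := thetaMap_ι_mul v x
    refine (congrArg (fun x => modelForm x (thetaMap t)) h).trans ?_
    have h2 : CliffordAlgebra.reverse (CliffordAlgebra.involute
        (CliffordAlgebra.ι (0 : QuadraticForm k (Fin 5 → k)) v * x)) =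
        -(CliffordAlgebra.reverse (CliffordAlgebra.involute x) * CliffordAlgebra.ι 0 v) := by
      rw [map_mul CliffordAlgebra.involute, CliffordAlgebra.involute_ι,
        CliffordAlgebra.reverse.map_mul, map_neg, CliffordAlgebra.reverse_ι, mul_neg]
    rw [modelForm_lamMap, ← thetaMap_ι_mul, hx, h2, neg_mul, mul_assoc, map_neg, mul_neg]

/-- The vectors killed by V* form a line. The functionals f₄, f₅ force three of the four Cayley
components to vanish, and f₁, f₂, f₃ force the remaining one to be a multiple of the lower
idempotent. -/
theorem lamMap_dual_eq_zero {x : SpinModel k} (hx : ∀ f, lamMap (f, 0) x = 0) :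
    ∃ c : k, x = c • vacuum := by
  have h' (f : Module.Dual k (Fin 5 → k)) : gammaMap ((f, 0), 0) x = 0 := by
    rw [← neg_eq_zero, ← gammaMap_vecU, ← lamMap_apply, hx, map_zero]
  have hf (f : Module.Dual k (Fin 5 → k)) (i : Fin 2) := congrArg (fun y : SpinModel k => y.1 i)
    (h' f)
  have hs (f : Module.Dual k (Fin 5 → k)) (i : Fin 2) := congrArg (fun y : SpinModel k => y.2 i)
    (h' f)
  simp only [gammaMap_apply, SpinModel.mk_fst, SpinModel.mk_snd, SpinModel.zero_fst,
    SpinModel.zero_snd] at hf hs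
  have e1 : x.2 1 = 0 := by
    simpa [toCayley, toMat, zorn_zero] using hf (LinearMap.proj 3) 0
  have e2 : x.2 0 = 0 := by
    simpa [toCayley, toMat, zorn_zero] using hf (LinearMap.proj 4) 0
  have e3 : x.1 1 = 0 := by
    simpa [toCayley, toMat, zorn_zero] using hs (LinearMap.proj 3) 0
  obtain ⟨a0, a1, a2, a3, a4, a5, a6, a7, e4⟩ := exists_zorn (x.1 0)
  have h2 : (2 : k) ≠ 0 := two_ne_zero_of_char_five
  have f0 := hf (LinearMap.proj 0) 0
  have f1 := hf (LinearMap.proj 1) 0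
  have f2 := hf (LinearMap.proj 2) 0
  simp [toCayley, toMat, e4, zorn_mul, zorn_zero, h2] at f0 f1 f2
  simp only [← zorn_zero, zorn_eq_iff, neg_eq_zero] at f0 f1 f2
  refine ⟨a7, SpinModel.ext (fun i => ?_) (fun i => ?_)⟩ <;> fin_cases i <;>
    simp [SpinModel.smul_fst, SpinModel.smul_snd, vacuum, SpinModel.mk_fst, SpinModel.mk_snd,
      e1, e2, e3, e4, zorn_smul, zorn_eq_iff, f0, f1, f2]

/-- An operator that is skew for the invariant form and commutes with the Clifford action is `0`. -/
theorem eq_zero_of_commute {Z : Module.End k (SpinModel k)}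
    (hZ : ∀ w x, Z (gammaMap w x) = gammaMap w (Z x))
    (hs : ∀ x y, modelForm (Z x) y = -modelForm x (Z y)) : Z = 0 := by
  have hl (m : Module.Dual k (Fin 5 → k) × (Fin 5 → k)) (x : SpinModel k) :
      Z (lamMap m x) = lamMap m (Z x) := by
    rw [lamMap_apply, hZ, hZ, lamMap_apply]
  -- A commuting operator preserves the line of vectors killed by V*, hence is a scalar c on the
  -- vacuum and so on all that the vacuum generates.
  obtain ⟨c, hc⟩ := lamMap_dual_eq_zero (x := Z vacuum) fun f => by
    rw [← hl, lamMap_dual_vacuum, map_zero]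
  have hcs (s : SpinSpace k 5) : Z (thetaMap s) = c • thetaMap s := by
    induction s using CliffordAlgebra.left_induction with
    | algebraMap r =>
      have h : thetaMap (algebraMap k (SpinSpace k 5) r) = r • vacuum := by
        rw [Algebra.algebraMap_eq_smul_one, map_smul, thetaMap_one]
      refine (congrArg Z h).trans (Eq.trans ?_ (congrArg (c • ·) h).symm)
      rw [map_smul, hc, smul_comm]
    | add x y hx hy => rw [LinearMap.map_add, map_add, hx, hy, smul_add]
    | ι_mul x v hx =>
      have h : thetaMap (ExteriorAlgebra.ι k v * x) = _ := thetaMap_ι_mul v x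
      refine (congrArg Z h).trans (Eq.trans ?_ (congrArg (c • ·) h).symm)
      rw [hl, hx, map_smul]
  have hZc (x : SpinModel k) : Z x = c • x := by
    obtain ⟨s, rfl⟩ := thetaMap_surjective x
    exact hcs s
  -- For a scalar c skewness on this pair, whose product is 3, reads 3c = -3c.
  have h := hs vacuum (thetaMap (ExteriorAlgebra.ιMulti k 5 fun i => Pi.single i 1))
  rw [hZc, hZc, map_smul, map_smul, LinearMap.smul_apply, modelForm_vacuum_top] at h
  have hc0 : c = 0 := by
    simp only [smul_eq_mul] at h
    grind
  refine LinearMap.ext fun x => ?_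
  rw [hZc, hc0, zero_smul, LinearMap.zero_apply]

/-- The difference of two such operators commutes with the Clifford action and is skew, hence
vanishes by `eq_zero_of_commute`. All spin operators of even elements that are not of the form a⊗M
are recognised in this way. -/
theorem eq_modelRep {φ : Module.End k (OddSpace k 5)} (hφ : φ ∈ soOdd k 5)
    {A : Module.End k (SpinModel k)}
    (hA : ∀ w x, A (gammaMap w x) = gammaMap w (A x) + gammaMap (φ w) x)
    (hs : ∀ x y, modelForm (A x) y = -modelForm x (A y)) : A = modelRep φ := by
  rw [← sub_eq_zero]
  refine eq_zero_of_commute (fun w x => ?_) fun x y => ?_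
  · rw [LinearMap.sub_apply, LinearMap.sub_apply, hA, ← modelRep_gammaMap hφ, map_sub]
    abel
  · rw [LinearMap.sub_apply, LinearMap.sub_apply, map_sub, LinearMap.sub_apply, map_sub, hs,
      modelForm_modelRep]
    ring

end Theta

/-! ### The multiplication table of the Kac superalgebra, with 1/2 = 3 and 3/4 = 2. -/

section KacTable

variable {k : Type*} [Field k]

/-- The element `e ⊗ e`. -/
def kacE : Kac k := (0, (1, 0) ⊗ₜ (1, 0))

/-- The map `u ↦ u ⊗ e`. -/
def kacL : (Fin 2 → k) →ₗ[k] Kac k :=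
  LinearMap.inr k k _ ∘ₗ (TensorProduct.mk k (Kaplansky k) (Kaplansky k)).flip (1, 0) ∘ₗ
    LinearMap.inr k k _

/-- The map `u ↦ e ⊗ u`. -/
def kacR : (Fin 2 → k) →ₗ[k] Kac k :=
  LinearMap.inr k k _ ∘ₗ TensorProduct.mk k (Kaplansky k) (Kaplansky k) (1, 0) ∘ₗ
    LinearMap.inr k k _

/-- The map `(u, v) ↦ u ⊗ v`. -/
def kacUU : (Fin 2 → k) →ₗ[k] (Fin 2 → k) →ₗ[k] Kac k :=
  ((TensorProduct.mk k (Kaplansky k) (Kaplansky k)).compl₁₂ (LinearMap.inr k k _)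
    (LinearMap.inr k k _)).compr₂ (LinearMap.inr k k _)

/-- The identification of `U ⊗ U` with the space of `2 × 2` matrices. -/
def kacM : Matrix (Fin 2) (Fin 2) k →ₗ[k] Kac k where
  toFun M := M 0 0 • kacUU ![1, 0] ![1, 0] + M 0 1 • kacUU ![1, 0] ![0, 1]
    + M 1 0 • kacUU ![0, 1] ![1, 0] + M 1 1 • kacUU ![0, 1] ![0, 1]
  map_add' M N := by simp only [Matrix.add_apply]; module
  map_smul' c M := by simp only [Matrix.smul_apply, smul_eq_mul, RingHom.id_apply]; module

theorem kacL_apply (u : Fin 2 → k) : kacL u = (0, (0, u) ⊗ₜ (1, 0)) := rfl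
theorem kacR_apply (u : Fin 2 → k) : kacR u = (0, (1, 0) ⊗ₜ (0, u)) := rfl
theorem kacUU_apply (u v : Fin 2 → k) : kacUU u v = (0, (0, u) ⊗ₜ (0, v)) := rfl

theorem kacM_apply (M : Matrix (Fin 2) (Fin 2) k) :
    kacM M = M 0 0 • kacUU ![1, 0] ![1, 0] + M 0 1 • kacUU ![1, 0] ![0, 1]
    + M 1 0 • kacUU ![0, 1] ![1, 0] + M 1 1 • kacUU ![0, 1] ![0, 1] := rfl

theorem vec_two_eq (f : Fin 2 → k) : f = f 0 • ![1, 0] + f 1 • ![0, 1] := by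
  ext i; fin_cases i <;> simp

theorem kacM_vecMulVec (u v : Fin 2 → k) : kacM (Matrix.vecMulVec u v) = kacUU u v := by
  conv_rhs => rw [vec_two_eq u, vec_two_eq v]
  simp only [map_add, map_smul, LinearMap.add_apply, LinearMap.smul_apply, kacM_apply,
    Matrix.vecMulVec_apply]
  module

theorem kac_decomp (α : k) (a b : Kaplansky k) : ((α, a ⊗ₜ b) : Kac k) =
    α • kacOne k + (a.1 * b.1) • kacE + b.1 • kacL a.2 + a.1 • kacR b.2
      + kacM (Matrix.vecMulVec a.2 b.2) := by
  obtain ⟨a, u⟩ := a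
  obtain ⟨b, v⟩ := b
  have ha : ((a, u) : Kaplansky k) = a • (1, 0) + (0, u) := by ext <;> simp
  have hb : ((b, v) : Kaplansky k) = b • (1, 0) + (0, v) := by ext <;> simp
  rw [kacM_vecMulVec, kacE, kacL_apply, kacR_apply, kacUU_apply, kacOne, ha, hb]
  simp only [TensorProduct.add_tmul, TensorProduct.tmul_add, TensorProduct.tmul_smul]
  ext1
  · simp
  · simp [TensorProduct.smul_tmul', mul_comm b a]
    abel

/-- The five families exhaust 1, e⊗e, U⊗e, e⊗U and U⊗U. Identities between operators on J are
checked on them. -/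
theorem kac_ext {P : Type*} [AddCommGroup P] [Module k P] {f g : Kac k →ₗ[k] P}
    (h1 : f (kacOne k) = g (kacOne k)) (hE : f kacE = g kacE) (hL : ∀ u, f (kacL u) = g (kacL u))
    (hR : ∀ u, f (kacR u) = g (kacR u)) (hM : ∀ M, f (kacM M) = g (kacM M)) : f = g := by
  have key (α : k) (a b : Kaplansky k) : f (α, a ⊗ₜ b) = g (α, a ⊗ₜ b) := by
    rw [kac_decomp]
    simp only [map_add, map_smul, h1, hE, hL, hR, hM]
  refine LinearMap.ext fun ⟨α, z⟩ => ?_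
  have hz : f (0, z) = g (0, z) := by
    induction z with
    | zero => exact (map_zero f).trans (map_zero g).symm
    | tmul a b => exact key 0 a b
    | add x y hx hy =>
      have : ((0, x + y) : Kac k) = (0, x) + (0, y) := by simp
      rw [this, map_add, map_add, hx, hy]
  have : ((α, z) : Kac k) = α • kacOne k + (0, z) := by simp [kacOne]
  rw [this, map_add, map_add, map_smul, map_smul, h1, hz]

/-- The operation `(M, w) ↦ M ε w`, where `(u | v) = uᵀ ε v`. -/
def matL (M : Matrix (Fin 2) (Fin 2) k) (w : Fin 2 → k) : Fin 2 → k :=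
  fun i => M i 0 * w 1 - M i 1 * w 0

/-- The operation `(M, w) ↦ Mᵀ ε w`, where `(u | v) = uᵀ ε v`. -/
def matR (M : Matrix (Fin 2) (Fin 2) k) (w : Fin 2 → k) : Fin 2 → k :=
  fun i => M 0 i * w 1 - M 1 i * w 0

/-- The alternating form `(u | v)` on `k²`. -/
def altForm (u v : Fin 2 → k) : k := u 0 * v 1 - u 1 * v 0

theorem kapForm_zero (u v : Fin 2 → k) : kapForm k (0, u) (0, v) = altForm u v := by
  simp [kapForm, altForm]
theorem kapForm_e_u (v : Fin 2 → k) : kapForm k (1, 0) (0, v) = 0 := by simp [kapForm]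
theorem kapForm_u_e (v : Fin 2 → k) : kapForm k (0, v) (1, 0) = 0 := by simp [kapForm]
theorem kapMul_u_u (u v : Fin 2 → k) :
    kapMul k (0, u) (0, v) = altForm u v • (1, 0) := by
  ext <;> simp [kapMul, altForm]
theorem kapMul_e_e : kapMul k (1, 0) (1, 0) = (1, 0) := by
  ext <;> simp [kapMul]
theorem e_mem_kapGr : ((1, 0) : Kaplansky k) ∈ kapGr k 0 := ⟨(1, 0), by simp [kapProj]⟩
theorem u_mem_kapGr (u : Fin 2 → k) : ((0, u) : Kaplansky k) ∈ kapGr k 1 :=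
  ⟨(0, u), by simp [kapProj]⟩

theorem kacMul_one_left (x : Kac k) : kacMul k (kacOne k) x = x := by
  ext1 <;> simp [kacMul, kacOne]

theorem kacMul_one_right (x : Kac k) : kacMul k x (kacOne k) = x := by
  ext1 <;> simp [kacMul, kacOne]

variable [CharP k 5]

theorem kapForm_e_e : kapForm k (1, 0) (1, 0) = 3 := by
  simp [kapForm, ← half_eq_three]
theorem kapMul_e_u (v : Fin 2 → k) : kapMul k (1, 0) (0, v) = (3 : k) • (0, v) := by
  ext <;> simp [kapMul, ← half_eq_three]
theorem kapMul_u_e (v : Fin 2 → k) : kapMul k (0, v) (1, 0) = (3 : k) • (0, v) := by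
  ext <;> simp [kapMul, ← half_eq_three]

theorem three_quarters : (3 / 4 : k) = 2 := by
  have h4 : (4 : k) ≠ 0 := by grind
  rw [div_eq_iff h4]
  grind

theorem koszulSign_zero_left (i : ZMod 2) : koszulSign 0 i = 1 := by simp [koszulSign]
theorem koszulSign_zero_right (i : ZMod 2) : koszulSign i 0 = 1 := by simp [koszulSign]
theorem koszulSign_one_one : koszulSign 1 1 = -1 := by simp [koszulSign]

theorem kacMul_of_even {j : ZMod 2} (a : Kaplansky k) {b c : Kaplansky k} (d : Kaplansky k)
    (hb : b ∈ kapGr k 0) (hc : c ∈ kapGr k j) :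
    kacMul k (0, a ⊗ₜ b) (0, c ⊗ₜ d) = (0, kapMul k a c ⊗ₜ[k] kapMul k b d) -
          ((2 : k) * (kapForm k a c * kapForm k b d)) • kacOne k := by
  rw [kacMul_tmul k a d hb hc, koszulSign_zero_left, one_smul, three_quarters, kacOne]

theorem kacMul_of_even' {j : ZMod 2} (a : Kaplansky k) {b c : Kaplansky k} (d : Kaplansky k)
    (hb : b ∈ kapGr k j) (hc : c ∈ kapGr k 0) :
    kacMul k (0, a ⊗ₜ b) (0, c ⊗ₜ d) = (0, kapMul k a c ⊗ₜ[k] kapMul k b d) -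
          ((2 : k) * (kapForm k a c * kapForm k b d)) • kacOne k := by
  rw [kacMul_tmul k a d hb hc, koszulSign_zero_right, one_smul, three_quarters, kacOne]

theorem kacMul_of_odd (a : Kaplansky k) {b c : Kaplansky k} (d : Kaplansky k)
    (hb : b ∈ kapGr k 1) (hc : c ∈ kapGr k 1) :
    kacMul k (0, a ⊗ₜ b) (0, c ⊗ₜ d) = -((0, kapMul k a c ⊗ₜ[k] kapMul k b d) -
          ((2 : k) * (kapForm k a c * kapForm k b d)) • kacOne k) := by
  rw [kacMul_tmul k a d hb hc, koszulSign_one_one, neg_smul, one_smul, three_quarters, kacOne]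

theorem kac_smul_mk (c : k) (z : Kaplansky k ⊗[k] Kaplansky k) :
    ((0, c • z) : Kac k) = c • (0, z) := by simp

/-- The coefficient of 1 is -(3/4)(e|e)² = -2·9 = 2. It is this value of t that later produces the
term 2D_{a,b} in the product of a⊗(e⊗e) and b⊗(e⊗e). -/
theorem kacMul_E_E : kacMul k kacE kacE = kacE + (2 : k) • kacOne k := by
  rw [kacE, kacMul_of_even _ _ e_mem_kapGr e_mem_kapGr, kapMul_e_e, kapForm_e_e, ← kacE]
  match_scalars <;> grind

theorem kacMul_E_L (u : Fin 2 → k) : kacMul k kacE (kacL u) = (3 : k) • kacL u := by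
  rw [kacE, kacL_apply, kacMul_of_even _ _ e_mem_kapGr (u_mem_kapGr u), kapMul_e_e, kapForm_e_e,
    kapMul_e_u, kapForm_e_u, zero_mul, mul_zero, zero_smul, sub_zero, ← TensorProduct.smul_tmul',
    kac_smul_mk]

theorem kacMul_L_E (u : Fin 2 → k) : kacMul k (kacL u) kacE = (3 : k) • kacL u := by
  rw [kacE, kacL_apply, kacMul_of_even _ _ e_mem_kapGr e_mem_kapGr, kapMul_e_e, kapForm_e_e,
    kapMul_u_e, kapForm_u_e, zero_mul, mul_zero, zero_smul, sub_zero, ← TensorProduct.smul_tmul',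
    kac_smul_mk]

theorem kacMul_E_R (u : Fin 2 → k) : kacMul k kacE (kacR u) = (3 : k) • kacR u := by
  rw [kacE, kacR_apply, kacMul_of_even _ _ e_mem_kapGr e_mem_kapGr, kapMul_e_e, kapForm_e_e,
    kapMul_e_u, kapForm_e_u, mul_zero, mul_zero, zero_smul, sub_zero, TensorProduct.tmul_smul,
    kac_smul_mk]

theorem kacMul_R_E (u : Fin 2 → k) : kacMul k (kacR u) kacE = (3 : k) • kacR u := by
  rw [kacE, kacR_apply, kacMul_of_even' _ _ (u_mem_kapGr u) e_mem_kapGr, kapMul_e_e, kapForm_e_e,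
    kapMul_u_e, kapForm_u_e, mul_zero, mul_zero, zero_smul, sub_zero, TensorProduct.tmul_smul,
    kac_smul_mk]

theorem kacMul_L_L (u v : Fin 2 → k) :
    kacMul k (kacL u) (kacL v) = altForm u v • (kacE - kacOne k) := by
  rw [kacL_apply, kacL_apply, kacMul_of_even _ _ e_mem_kapGr (u_mem_kapGr v), kapMul_u_u,
    kapMul_e_e, kapForm_zero, kapForm_e_e, ← TensorProduct.smul_tmul', kac_smul_mk, ← kacE]
  match_scalars <;> grind

theorem kacMul_R_R (u v : Fin 2 → k) :
    kacMul k (kacR u) (kacR v) = altForm u v • (kacE - kacOne k) := by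
  rw [kacR_apply, kacR_apply, kacMul_of_even' _ _ (u_mem_kapGr u) e_mem_kapGr, kapMul_u_u,
    kapMul_e_e, kapForm_zero, kapForm_e_e, TensorProduct.tmul_smul, kac_smul_mk, ← kacE]
  match_scalars <;> grind

theorem kacMul_L_R (u v : Fin 2 → k) :
    kacMul k (kacL u) (kacR v) = -kacM (Matrix.vecMulVec u v) := by
  rw [kacL_apply, kacR_apply, kacMul_of_even _ _ e_mem_kapGr e_mem_kapGr, kapMul_u_e,
    kapMul_e_u, kapForm_u_e, zero_mul, mul_zero, zero_smul, sub_zero, ← TensorProduct.smul_tmul',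
    TensorProduct.tmul_smul, kac_smul_mk, kac_smul_mk, kacM_vecMulVec, ← kacUU_apply]
  match_scalars
  grind

theorem kacMul_R_L (u v : Fin 2 → k) :
    kacMul k (kacR u) (kacL v) = kacM (Matrix.vecMulVec v u) := by
  rw [kacL_apply, kacR_apply, kacMul_of_odd _ _ (u_mem_kapGr u) (u_mem_kapGr v), kapMul_u_e,
    kapMul_e_u, kapForm_u_e, mul_zero, mul_zero, zero_smul, sub_zero, ← TensorProduct.smul_tmul',
    TensorProduct.tmul_smul, kac_smul_mk, kac_smul_mk, kacM_vecMulVec, ← kacUU_apply]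
  match_scalars
  grind

/-- Each tensor factor contributes eu = u/2 = 3u, and 3² = -1. -/
theorem kacMul_E_UU (u v : Fin 2 → k) : kacMul k kacE (kacUU u v) = -kacUU u v := by
  rw [kacE, kacUU_apply, kacMul_of_even _ _ e_mem_kapGr (u_mem_kapGr u), kapMul_e_u,
    kapMul_e_u, kapForm_e_u, zero_mul, mul_zero, zero_smul, sub_zero, ← TensorProduct.smul_tmul',
    TensorProduct.tmul_smul, kac_smul_mk, kac_smul_mk]
  match_scalars
  grind

theorem kacMul_UU_E (u v : Fin 2 → k) : kacMul k (kacUU u v) kacE = -kacUU u v := by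
  rw [kacE, kacUU_apply, kacMul_of_even' _ _ (u_mem_kapGr v) e_mem_kapGr, kapMul_u_e,
    kapMul_u_e, kapForm_u_e, zero_mul, mul_zero, zero_smul, sub_zero, ← TensorProduct.smul_tmul',
    TensorProduct.tmul_smul, kac_smul_mk, kac_smul_mk]
  match_scalars
  grind

theorem kacMul_UU_L (u v w : Fin 2 → k) :
    kacMul k (kacUU u v) (kacL w) = (2 * altForm u w) • kacR v := by
  rw [kacL_apply, kacUU_apply, kacMul_of_odd _ _ (u_mem_kapGr v) (u_mem_kapGr w), kapMul_u_u,
    kapMul_u_e, kapForm_u_e, mul_zero, mul_zero, zero_smul, sub_zero, ← TensorProduct.smul_tmul',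
    TensorProduct.tmul_smul, kac_smul_mk, kac_smul_mk, ← kacR_apply]
  match_scalars
  grind

theorem kacMul_L_UU (u v w : Fin 2 → k) :
    kacMul k (kacL w) (kacUU u v) = (3 * altForm w u) • kacR v := by
  rw [kacL_apply, kacUU_apply, kacMul_of_even _ _ e_mem_kapGr (u_mem_kapGr u), kapMul_u_u,
    kapMul_e_u, kapForm_e_u, mul_zero, mul_zero, zero_smul, sub_zero, ← TensorProduct.smul_tmul',
    TensorProduct.tmul_smul, kac_smul_mk, kac_smul_mk, ← kacR_apply]
  match_scalars
  grind

theorem kacMul_UU_R (u v w : Fin 2 → k) :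
    kacMul k (kacUU u v) (kacR w) = (3 * altForm v w) • kacL u := by
  rw [kacR_apply, kacUU_apply, kacMul_of_even' _ _ (u_mem_kapGr v) e_mem_kapGr, kapMul_u_u,
    kapMul_u_e, kapForm_u_e, zero_mul, mul_zero, zero_smul, sub_zero, ← TensorProduct.smul_tmul',
    TensorProduct.tmul_smul, kac_smul_mk, kac_smul_mk, ← kacL_apply]
  match_scalars
  grind

theorem kacMul_R_UU (u v w : Fin 2 → k) :
    kacMul k (kacR w) (kacUU u v) = (2 * altForm w v) • kacL u := by
  rw [kacR_apply, kacUU_apply, kacMul_of_odd _ _ (u_mem_kapGr w) (u_mem_kapGr u), kapMul_u_u,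
    kapMul_e_u, kapForm_e_u, zero_mul, mul_zero, zero_smul, sub_zero, ← TensorProduct.smul_tmul',
    TensorProduct.tmul_smul, kac_smul_mk, kac_smul_mk, ← kacL_apply]
  match_scalars
  grind

theorem kacMul_UU_UU (u v u' v' : Fin 2 → k) : kacMul k (kacUU u v) (kacUU u' v') =
    (altForm u u' * altForm v v') • ((2 : k) • kacOne k - kacE) := by
  rw [kacUU_apply, kacUU_apply, kacMul_of_odd _ _ (u_mem_kapGr v) (u_mem_kapGr u'), kapMul_u_u,
    kapMul_u_u, kapForm_zero, kapForm_zero, ← TensorProduct.smul_tmul',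
    TensorProduct.tmul_smul, kac_smul_mk, kac_smul_mk, ← kacE]
  module

theorem kacMul_E_M (M : Matrix (Fin 2) (Fin 2) k) : kacMul k kacE (kacM M) = -kacM M := by
  simp only [kacM_apply, map_add, map_smul, kacMul_E_UU]
  module

theorem kacMul_M_E (M : Matrix (Fin 2) (Fin 2) k) : kacMul k (kacM M) kacE = -kacM M := by
  simp only [kacM_apply, map_add, map_smul, LinearMap.add_apply, LinearMap.smul_apply, kacMul_UU_E]
  module

theorem kacMul_M_L (M : Matrix (Fin 2) (Fin 2) k) (w : Fin 2 → k) :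
    kacMul k (kacM M) (kacL w) = (2 : k) • kacR (matR M w) := by
  rw [vec_two_eq (matR M w)]
  simp only [kacM_apply, map_add, map_smul, LinearMap.add_apply, LinearMap.smul_apply, kacMul_UU_L,
    altForm, matR]
  simp
  module

theorem kacMul_L_M (M : Matrix (Fin 2) (Fin 2) k) (w : Fin 2 → k) :
    kacMul k (kacL w) (kacM M) = (2 : k) • kacR (matR M w) := by
  rw [vec_two_eq (matR M w)]
  simp only [kacM_apply, map_add, map_smul, kacMul_L_UU,
    altForm, matR]
  simp
  match_scalars <;> grind

theorem kacMul_M_R (M : Matrix (Fin 2) (Fin 2) k) (w : Fin 2 → k) :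
    kacMul k (kacM M) (kacR w) = (3 : k) • kacL (matL M w) := by
  rw [vec_two_eq (matL M w)]
  simp only [kacM_apply, map_add, map_smul, LinearMap.add_apply, LinearMap.smul_apply, kacMul_UU_R,
    altForm, matL]
  simp
  module

theorem kacMul_R_M (M : Matrix (Fin 2) (Fin 2) k) (w : Fin 2 → k) :
    kacMul k (kacR w) (kacM M) = (3 : k) • kacL (matL M w) := by
  rw [vec_two_eq (matL M w)]
  simp only [kacM_apply, map_add, map_smul, kacMul_R_UU,
    altForm, matL]
  simp
  match_scalars <;> grind

theorem kacMul_M_M (M N : Matrix (Fin 2) (Fin 2) k) :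
    kacMul k (kacM M) (kacM N) = detPolar M N • ((2 : k) • kacOne k - kacE) := by
  simp only [kacM_apply, map_add, map_smul, LinearMap.add_apply, LinearMap.smul_apply, kacMul_UU_UU,
    altForm, detPolar_apply]
  simp
  module

end KacTable

/-! ### Inner derivations of the Kac superalgebra and their commutators. -/

section KacDer

variable {k : Type*} [Field k]

/-- The even derivation of the Kaplansky superalgebra given by a trace zero matrix. -/
def kapEven : Matrix (Fin 2) (Fin 2) k →ₗ[k] Module.End k (Kaplansky k) :=
  LinearMap.mk₂ k (fun A x => (0, A.mulVec x.2))
    (by intro A B x; simp [Matrix.add_mulVec])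
    (by intro c A x; simp [Matrix.smul_mulVec])
    (by intro A x y; simp [Matrix.mulVec_add])
    (by intro c A x; simp [Matrix.mulVec_smul])

/-- The odd derivation of the Kaplansky superalgebra given by an odd vector. -/
def kapOdd : (Fin 2 → k) →ₗ[k] Module.End k (Kaplansky k) :=
  LinearMap.mk₂ k (fun p x => (-(2 * altForm p x.2), x.1 • p))
    (by intro p q x; ext <;> simp [altForm] <;> ring)
    (by intro c p x; ext <;> simp [altForm] <;> ring)
    (by intro p x y; ext <;> simp [altForm] <;> ring)
    (by intro c p x; ext <;> simp [altForm] <;> ring)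

/-- The parity operator of the Kaplansky superalgebra. -/
def kapParity : Module.End k (Kaplansky k) := kapProj k 0 - kapProj k 1

/-- The extension by `0` on the unit of an endomorphism of `K ⊗ K`. -/
def kacExtend : Module.End k (Kaplansky k ⊗[k] Kaplansky k) →ₗ[k] Module.End k (Kac k) where
  toFun f := LinearMap.inr k k _ ∘ₗ f ∘ₗ LinearMap.snd k k _
  map_add' f g := by ext1 <;> ext <;> simp
  map_smul' c f := by ext1 <;> ext <;> simp

theorem kacExtend_apply (f : Module.End k (Kaplansky k ⊗[k] Kaplansky k)) (x : Kac k) :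
    kacExtend f x = (0, f x.2) := rfl

/-- The even inner derivation `A ⊗ 1 + 1 ⊗ B` of the Kac superalgebra. -/
def kacEven (A B : Matrix (Fin 2) (Fin 2) k) : Module.End k (Kac k) :=
  kacExtend (LinearMap.rTensor _ (kapEven A) + LinearMap.lTensor _ (kapEven B))

/-- The odd inner derivation of the Kac superalgebra given by two odd vectors. -/
def kacOdd (p q : Fin 2 → k) : Module.End k (Kac k) :=
  kacExtend (LinearMap.rTensor _ (kapOdd p) + TensorProduct.map kapParity (kapOdd q))

theorem kapEven_apply (A : Matrix (Fin 2) (Fin 2) k) (x : Kaplansky k) :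
    kapEven A x = (0, A.mulVec x.2) := rfl

theorem kapOdd_apply (p : Fin 2 → k) (x : Kaplansky k) :
    kapOdd p x = (-(2 * altForm p x.2), x.1 • p) := rfl

theorem kapParity_apply (x : Kaplansky k) : kapParity x = (x.1, -x.2) := by
  simp [kapParity, kapProj]

theorem kac_mk_tmul (a b : Kaplansky k) : ((0, a ⊗ₜ b) : Kac k) =
    (a.1 * b.1) • kacE + b.1 • kacL a.2 + a.1 • kacR b.2
      + kacM (Matrix.vecMulVec a.2 b.2) := by
  rw [kac_decomp, zero_smul, zero_add]

theorem kac_mk_add (x y : Kaplansky k ⊗[k] Kaplansky k) :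
    ((0, x + y) : Kac k) = (0, x) + (0, y) := by simp

theorem kacE_snd : (kacE : Kac k).2 = (1, 0) ⊗ₜ (1, 0) := rfl
theorem kacL_snd (u : Fin 2 → k) : (kacL u : Kac k).2 = (0, u) ⊗ₜ (1, 0) := rfl
theorem kacR_snd (u : Fin 2 → k) : (kacR u : Kac k).2 = (1, 0) ⊗ₜ (0, u) := rfl
theorem kacUU_snd (u v : Fin 2 → k) : (kacUU u v : Kac k).2 = (0, u) ⊗ₜ (0, v) := rfl

theorem vecMulVec_zero_left (v : Fin 2 → k) :
    Matrix.vecMulVec (0 : Fin 2 → k) v = 0 := by ext; simp [Matrix.vecMulVec_apply]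
theorem vecMulVec_zero_right (v : Fin 2 → k) :
    Matrix.vecMulVec v (0 : Fin 2 → k) = 0 := by ext; simp [Matrix.vecMulVec_apply]

theorem kacEven_one (A B : Matrix (Fin 2) (Fin 2) k) : kacEven A B (kacOne k) = 0 := by
  simp [kacEven, kacExtend_apply, kacOne]

theorem kacOdd_one (p q : Fin 2 → k) : kacOdd p q (kacOne k) = 0 := by
  simp [kacOdd, kacExtend_apply, kacOne]

theorem kaplansky_mk_zero : ((0, 0) : Kaplansky k) = 0 := rfl

theorem kacEven_E (A B : Matrix (Fin 2) (Fin 2) k) : kacEven A B kacE = 0 := by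
  rw [kacEven, kacExtend_apply, kacE_snd, LinearMap.add_apply, LinearMap.rTensor_tmul,
    LinearMap.lTensor_tmul, kapEven_apply, kapEven_apply]
  simp [kaplansky_mk_zero]

theorem kacEven_L (A B : Matrix (Fin 2) (Fin 2) k) (u : Fin 2 → k) :
    kacEven A B (kacL u) = kacL (A.mulVec u) := by
  rw [kacEven, kacExtend_apply, kacL_snd, LinearMap.add_apply, LinearMap.rTensor_tmul,
    LinearMap.lTensor_tmul, kapEven_apply, kapEven_apply]
  simp [kacL_apply, kaplansky_mk_zero]

theorem kacEven_R (A B : Matrix (Fin 2) (Fin 2) k) (u : Fin 2 → k) :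
    kacEven A B (kacR u) = kacR (B.mulVec u) := by
  rw [kacEven, kacExtend_apply, kacR_snd, LinearMap.add_apply, LinearMap.rTensor_tmul,
    LinearMap.lTensor_tmul, kapEven_apply, kapEven_apply]
  simp [kacR_apply, kaplansky_mk_zero]

theorem kacEven_UU (A B : Matrix (Fin 2) (Fin 2) k) (u v : Fin 2 → k) :
    kacEven A B (kacUU u v) = kacUU (A.mulVec u) v + kacUU u (B.mulVec v) := by
  rw [kacEven, kacExtend_apply, kacUU_snd, LinearMap.add_apply, LinearMap.rTensor_tmul,
    LinearMap.lTensor_tmul, kapEven_apply, kapEven_apply, kacUU_apply, kacUU_apply, kac_mk_add]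

theorem mat_two_ext {M N : Matrix (Fin 2) (Fin 2) k} (h00 : M 0 0 = N 0 0) (h01 : M 0 1 = N 0 1)
    (h10 : M 1 0 = N 1 0) (h11 : M 1 1 = N 1 1) : M = N := by
  ext i j; fin_cases i <;> fin_cases j <;> assumption

theorem mulVec_two (A : Matrix (Fin 2) (Fin 2) k) (u : Fin 2 → k) (i : Fin 2) :
    A.mulVec u i = A i 0 * u 0 + A i 1 * u 1 := by
  simp [Matrix.mulVec, dotProduct, Fin.sum_univ_two]

/-- The action of a pair of matrices on `U ⊗ U`. -/
def pairAct (A B M : Matrix (Fin 2) (Fin 2) k) : Matrix (Fin 2) (Fin 2) k :=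
  Matrix.of fun i j => A i 0 * M 0 j + A i 1 * M 1 j + (M i 0 * B j 0 + M i 1 * B j 1)

theorem pairAct_apply (A B M : Matrix (Fin 2) (Fin 2) k) (i j : Fin 2) : pairAct A B M i j =
    A i 0 * M 0 j + A i 1 * M 1 j + (M i 0 * B j 0 + M i 1 * B j 1) := rfl

theorem kacM_congr {M N : Matrix (Fin 2) (Fin 2) k} (h00 : M 0 0 = N 0 0) (h01 : M 0 1 = N 0 1)
    (h10 : M 1 0 = N 1 0) (h11 : M 1 1 = N 1 1) : kacM M = kacM N := by
  rw [mat_two_ext h00 h01 h10 h11]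

theorem kacEven_M (A B M : Matrix (Fin 2) (Fin 2) k) :
    kacEven A B (kacM M) = kacM (pairAct A B M) := by
  rw [kacM_apply]
  simp only [map_add, map_smul, kacEven_UU]
  simp only [← kacM_vecMulVec, ← map_add, ← map_smul]
  apply kacM_congr <;> simp [Matrix.vecMulVec_apply, mulVec_two, pairAct_apply] <;> ring

theorem kacOdd_E (p q : Fin 2 → k) : kacOdd p q kacE = kacL p + kacR q := by
  rw [kacOdd, kacExtend_apply, kacE_snd, LinearMap.add_apply, LinearMap.rTensor_tmul,
    TensorProduct.map_tmul, kapOdd_apply, kapOdd_apply, kapParity_apply, kac_mk_add]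
  simp [altForm, kacL_apply, kacR_apply]

theorem kacOdd_L (p q u : Fin 2 → k) :
    kacOdd p q (kacL u) = -((2 * altForm p u) • kacE) - kacM (Matrix.vecMulVec u q) := by
  rw [kacOdd, kacExtend_apply, kacL_snd, LinearMap.add_apply, LinearMap.rTensor_tmul,
    TensorProduct.map_tmul, kapOdd_apply, kapOdd_apply, kapParity_apply, kac_mk_add, kac_mk_tmul,
    kac_mk_tmul]
  simp [altForm, vecMulVec_zero_left, Matrix.neg_vecMulVec]
  module

theorem kacOdd_R (p q u : Fin 2 → k) :
    kacOdd p q (kacR u) = -((2 * altForm q u) • kacE) + kacM (Matrix.vecMulVec p u) := by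
  rw [kacOdd, kacExtend_apply, kacR_snd, LinearMap.add_apply, LinearMap.rTensor_tmul,
    TensorProduct.map_tmul, kapOdd_apply, kapOdd_apply, kapParity_apply, kac_mk_add, kac_mk_tmul,
    kac_mk_tmul]
  simp [altForm, vecMulVec_zero_left]
  module

theorem kacOdd_UU (p q u v : Fin 2 → k) : kacOdd p q (kacUU u v) =
    -((2 * altForm p u) • kacR v) + (2 * altForm q v) • kacL u := by
  rw [kacOdd, kacExtend_apply, kacUU_snd, LinearMap.add_apply, LinearMap.rTensor_tmul,
    TensorProduct.map_tmul, kapOdd_apply, kapOdd_apply, kapParity_apply, kac_mk_add, kac_mk_tmul,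
    kac_mk_tmul]
  simp [altForm, vecMulVec_zero_left, vecMulVec_zero_right]
  module

theorem kacOdd_M (p q : Fin 2 → k) (M : Matrix (Fin 2) (Fin 2) k) :
    kacOdd p q (kacM M) = (2 : k) • kacR (matR M p) - (2 : k) • kacL (matL M q) := by
  rw [vec_two_eq (matL M q), vec_two_eq (matR M p)]
  simp only [kacM_apply, map_add, map_smul, kacOdd_UU, altForm, matL, matR]
  simp
  module

/-- The symmetric square of `U`, acting on `U` by `w ↦ (u | w) v + (v | w) u`. -/
def symMat (u v : Fin 2 → k) : Matrix (Fin 2) (Fin 2) k :=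
  !![-(u 1 * v 0 + v 1 * u 0), u 0 * v 0 + v 0 * u 0;
    -(u 1 * v 1 + v 1 * u 1), u 0 * v 1 + v 0 * u 1]

/-- The first component of the bracket of two elements of `U ⊗ U`. -/
def brMat (M N : Matrix (Fin 2) (Fin 2) k) : Matrix (Fin 2) (Fin 2) k :=
  !![-(M 0 0 * N 1 1 - M 0 1 * N 1 0 + (M 1 0 * N 0 1 - M 1 1 * N 0 0)),
      2 * (M 0 0 * N 0 1 - M 0 1 * N 0 0);
    -(2 * (M 1 0 * N 1 1 - M 1 1 * N 1 0)),
      M 0 0 * N 1 1 - M 0 1 * N 1 0 + (M 1 0 * N 0 1 - M 1 1 * N 0 0)]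

theorem vec_two_ext {u v : Fin 2 → k} (h0 : u 0 = v 0) (h1 : u 1 = v 1) : u = v := by
  ext i; fin_cases i <;> assumption

theorem kacEven_add (A B A' B' : Matrix (Fin 2) (Fin 2) k) :
    kacEven (A + A') (B + B') = kacEven A B + kacEven A' B' := by
  simp only [kacEven, map_add, LinearMap.rTensor_add, LinearMap.lTensor_add]
  abel

theorem kacEven_smul (c : k) (A B : Matrix (Fin 2) (Fin 2) k) :
    kacEven (c • A) (c • B) = c • kacEven A B := by
  simp only [kacEven, map_smul, LinearMap.rTensor_smul, LinearMap.lTensor_smul, ← smul_add]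

theorem kacOdd_add (p q p' q' : Fin 2 → k) :
    kacOdd (p + p') (q + q') = kacOdd p q + kacOdd p' q' := by
  simp only [kacOdd, map_add, LinearMap.rTensor_add, TensorProduct.map_add_right]
  abel

theorem kacOdd_smul (c : k) (p q : Fin 2 → k) : kacOdd (c • p) (c • q) = c • kacOdd p q := by
  simp only [kacOdd, map_smul, LinearMap.rTensor_smul, TensorProduct.map_smul_right, ← smul_add]

theorem kacOdd_neg_left (p : Fin 2 → k) : kacOdd (-p) 0 = (-1 : k) • kacOdd p 0 := by
  rw [← kacOdd_smul, smul_zero, neg_one_smul]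

theorem kacOdd_neg_right (q : Fin 2 → k) : kacOdd 0 (-q) = (-1 : k) • kacOdd 0 q := by
  rw [← kacOdd_smul, smul_zero, neg_one_smul]

theorem leftComm_swap {J : Type*} [AddCommGroup J] [Module k J] (p : J →ₗ[k] J →ₗ[k] J) (x y : J) :
    leftComm p 1 x y = (-1 : k) • leftComm p 1 y x := by
  refine LinearMap.ext fun z => ?_
  simp [leftComm_apply]

theorem leftComm_neg_swap {J : Type*} [AddCommGroup J] [Module k J] (p : J →ₗ[k] J →ₗ[k] J)
    (x y : J) : leftComm p (-1) x y = leftComm p (-1) y x := by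
  refine LinearMap.ext fun z => ?_
  simp [leftComm_apply, add_comm]

variable [CharP k 5]

theorem leftComm_E_E : leftComm (kacMul k) 1 kacE kacE = 0 := by
  refine LinearMap.ext fun z => ?_
  rw [leftComm_apply, one_smul, sub_self, LinearMap.zero_apply]

theorem leftComm_E_M (M : Matrix (Fin 2) (Fin 2) k) :
    leftComm (kacMul k) 1 kacE (kacM M) = 0 := by
  apply kac_ext <;> intros <;>
    simp only [leftComm_apply, one_smul, LinearMap.zero_apply, kacMul_one_right, kacMul_E_E,
      kacMul_E_M, kacMul_M_E, kacMul_M_M, kacMul_E_L, kacMul_E_R, kacMul_M_L, kacMul_M_R, map_add,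
      map_sub, map_smul, map_neg] <;> match_scalars <;> grind

/-- The second component is the first with both matrices transposed, because transposition exchanges
the two tensor factors of U⊗U. -/
theorem leftComm_M_M (M N : Matrix (Fin 2) (Fin 2) k) :
    leftComm (kacMul k) 1 (kacM M) (kacM N) = kacEven (brMat M N) (brMat M.transpose N.transpose) := by
  apply kac_ext <;> intros <;>
    simp only [leftComm_apply, one_smul, kacEven_one, kacEven_E, kacEven_L, kacEven_R, kacEven_M,
      kacMul_one_right, kacMul_E_E,
      kacMul_E_M, kacMul_M_E, kacMul_M_M, kacMul_E_L, kacMul_E_R, kacMul_M_L, kacMul_M_R, map_add,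
      map_sub, map_smul, map_neg]
  · rw [detPolar_apply, detPolar_apply]
    match_scalars <;> grind
  · rw [detPolar_apply, detPolar_apply]
    match_scalars <;> grind
  · simp only [← map_smul, ← map_sub]
    congr 1
    apply vec_two_ext <;> simp [mulVec_two, brMat, matL, matR] <;> grind
  · simp only [← map_smul, ← map_sub]
    congr 1
    apply vec_two_ext <;> simp [mulVec_two, brMat, matL, matR] <;> grind
  · simp only [← map_smul, ← map_sub, ← map_neg]
    apply kacM_congr <;> simp [pairAct_apply, brMat, detPolar_apply] <;> grind

theorem altForm_zero_left (u : Fin 2 → k) : altForm 0 u = 0 := by simp [altForm]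
theorem matL_zero (M : Matrix (Fin 2) (Fin 2) k) : matL M 0 = 0 := by ext; simp [matL]
theorem matR_zero (M : Matrix (Fin 2) (Fin 2) k) : matR M 0 = 0 := by ext; simp [matR]

/-- Commutators with L_{e⊗e} already give all odd inner derivations; compare `kacOdd_mem`. -/
theorem leftComm_E_L (u : Fin 2 → k) :
    leftComm (kacMul k) 1 kacE (kacL u) = kacOdd (-u) 0 := by
  rw [kacOdd_neg_left]
  apply kac_ext <;> intros <;>
    simp only [leftComm_apply, one_smul, LinearMap.smul_apply, kacOdd_one, kacOdd_E, kacOdd_L,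
      kacOdd_R, kacOdd_M, kacMul_one_right, kacMul_E_E, kacMul_E_L, kacMul_L_E, kacMul_E_M,
      kacMul_L_L, kacMul_L_R, kacMul_L_M, kacMul_E_R, map_add, map_sub, map_smul, map_neg,
      altForm_zero_left, matL_zero, map_zero, vecMulVec_zero_right, mul_zero, zero_smul] <;>
    match_scalars <;> grind

theorem leftComm_E_R (u : Fin 2 → k) :
    leftComm (kacMul k) 1 kacE (kacR u) = kacOdd 0 (-u) := by
  rw [kacOdd_neg_right]
  apply kac_ext <;> intros <;>
    simp only [leftComm_apply, one_smul, LinearMap.smul_apply, kacOdd_one, kacOdd_E, kacOdd_L,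
      kacOdd_R, kacOdd_M, kacMul_one_right, kacMul_E_E, kacMul_E_L, kacMul_R_E, kacMul_E_M,
      kacMul_R_L, kacMul_R_R, kacMul_R_M, kacMul_E_R, map_add, map_sub, map_smul, map_neg,
      altForm_zero_left, matR_zero, map_zero, vecMulVec_zero_left, mul_zero, zero_smul] <;>
    match_scalars <;> grind

theorem leftComm_M_L (M : Matrix (Fin 2) (Fin 2) k) (u : Fin 2 → k) :
    leftComm (kacMul k) 1 (kacM M) (kacL u) = (3 : k) • kacOdd 0 (matR M u) := by
  apply kac_ext <;> intros <;>
    simp only [leftComm_apply, one_smul, LinearMap.smul_apply, kacOdd_one, kacOdd_E, kacOdd_L,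
      kacOdd_R, kacOdd_M, kacMul_one_right, kacMul_M_E, kacMul_M_M, kacMul_M_L, kacMul_M_R,
      kacMul_L_L, kacMul_L_R, kacMul_L_M, kacMul_L_E, map_add, map_sub, map_smul, map_neg,
      altForm_zero_left, matR_zero, map_zero, vecMulVec_zero_left, mul_zero, zero_smul]
  · match_scalars <;> grind
  · match_scalars <;> grind
  · simp only [← map_smul, ← map_sub, ← map_neg, zero_sub, sub_zero, add_zero, zero_add, smul_zero,
      neg_zero]
    apply kacM_congr <;> simp [Matrix.vecMulVec_apply, detPolar_apply, matR, matL, altForm] <;> grind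
  · simp only [← map_smul, ← map_sub, ← map_neg, zero_sub, sub_zero, add_zero, zero_add, smul_zero,
      neg_zero]
    simp [Matrix.vecMulVec_apply, detPolar_apply, matR, matL, altForm]
    match_scalars <;> grind
  · simp only [← map_smul, ← map_sub, ← map_neg, zero_sub, sub_zero, add_zero, zero_add, smul_zero,
      neg_zero]
    congr 1
    apply vec_two_ext <;> simp [matL, matR, detPolar_apply] <;> grind

theorem leftComm_M_R (M : Matrix (Fin 2) (Fin 2) k) (u : Fin 2 → k) :
    leftComm (kacMul k) 1 (kacM M) (kacR u) = (2 : k) • kacOdd (matL M u) 0 := by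
  apply kac_ext <;> intros <;>
    simp only [leftComm_apply, one_smul, LinearMap.smul_apply, kacOdd_one, kacOdd_E, kacOdd_L,
      kacOdd_R, kacOdd_M, kacMul_one_right, kacMul_M_E, kacMul_M_M, kacMul_M_L, kacMul_M_R,
      kacMul_R_L, kacMul_R_R, kacMul_R_M, kacMul_R_E, map_add, map_sub, map_smul, map_neg,
      altForm_zero_left, matL_zero, map_zero, vecMulVec_zero_right, mul_zero, zero_smul]
  · match_scalars <;> grind
  · match_scalars <;> grind
  · simp [Matrix.vecMulVec_apply, detPolar_apply, matR, matL, altForm]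
    match_scalars <;> grind
  · simp only [← map_smul, ← map_sub, ← map_neg, zero_sub, sub_zero, add_zero, zero_add, smul_zero,
      neg_zero]
    apply kacM_congr <;> simp [Matrix.vecMulVec_apply, detPolar_apply, matR, matL, altForm] <;> grind
  · simp only [← map_smul, ← map_sub, ← map_neg, zero_sub, sub_zero, add_zero, zero_add, smul_zero,
      neg_zero]
    congr 1
    apply vec_two_ext <;> simp [matL, matR, detPolar_apply] <;> grind

/-- The commutators from the first copy of U give the action of S²U = sl(U) on the first tensor
factor, those from the second copy the action on the second, and mixed ones vanish (`leftComm_L_R`).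
-/
theorem leftComm_L_L (u v : Fin 2 → k) :
    leftComm (kacMul k) (-1) (kacL u) (kacL v) = kacEven ((2 : k) • symMat u v) 0 := by
  apply kac_ext <;> intros <;>
    simp only [leftComm_apply, neg_smul, one_smul, sub_neg_eq_add, kacEven_one, kacEven_E,
      kacEven_L, kacEven_R, kacEven_M, kacMul_one_right, kacMul_L_E, kacMul_L_L, kacMul_L_R,
      kacMul_L_M, map_add, map_sub, map_smul, map_neg]
  · simp only [altForm]
    match_scalars <;> grind
  · simp only [altForm]
    match_scalars <;> grind
  · simp only [← map_smul, ← map_sub, ← map_neg, ← map_add]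
    congr 1
    apply vec_two_ext <;> simp [Matrix.vecMulVec_apply, symMat, mulVec_two, matL, matR, altForm] <;> grind
  · simp only [← map_smul, ← map_sub, ← map_neg, ← map_add]
    congr 1
    apply vec_two_ext <;> simp [Matrix.vecMulVec_apply, symMat, mulVec_two, matL, matR, altForm] <;> grind
  · simp only [← map_smul, ← map_sub, ← map_neg, ← map_add]
    apply kacM_congr <;> simp [Matrix.vecMulVec_apply, pairAct_apply, symMat, matL, matR] <;> grind

theorem leftComm_R_R (u v : Fin 2 → k) :
    leftComm (kacMul k) (-1) (kacR u) (kacR v) = kacEven 0 ((2 : k) • symMat u v) := by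
  apply kac_ext <;> intros <;>
    simp only [leftComm_apply, neg_smul, one_smul, sub_neg_eq_add, kacEven_one, kacEven_E,
      kacEven_L, kacEven_R, kacEven_M, kacMul_one_right, kacMul_R_E, kacMul_R_L, kacMul_R_R,
      kacMul_R_M, map_add, map_sub, map_smul, map_neg]
  · simp only [altForm]
    match_scalars <;> grind
  · simp only [altForm]
    match_scalars <;> grind
  · simp only [← map_smul, ← map_sub, ← map_neg, ← map_add]
    congr 1
    apply vec_two_ext <;> simp [Matrix.vecMulVec_apply, symMat, mulVec_two, matL, matR, altForm] <;> grind
  · simp only [← map_smul, ← map_sub, ← map_neg, ← map_add]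
    congr 1
    apply vec_two_ext <;> simp [Matrix.vecMulVec_apply, symMat, mulVec_two, matL, matR, altForm] <;> grind
  · simp only [← map_smul, ← map_sub, ← map_neg, ← map_add]
    apply kacM_congr <;> simp [Matrix.vecMulVec_apply, pairAct_apply, symMat, matL, matR] <;> grind

/-- Fixed vectors in which all families have scalar coordinates: with them an identity in J becomes
one polynomial identity for each vector. -/
theorem exists_coord :
    ∃ l₀ l₁ r₀ r₁ m₀ m₁ m₂ m₃ : Kac k, (∀ u : Fin 2 → k, kacL u = u 0 • l₀ + u 1 • l₁) ∧
      (∀ u : Fin 2 → k, kacR u = u 0 • r₀ + u 1 • r₁) ∧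
      (∀ M : Matrix (Fin 2) (Fin 2) k, kacM M = M 0 0 • m₀ + M 0 1 • m₁ + M 1 0 • m₂ + M 1 1 • m₃) := by
  refine ⟨kacL ![1, 0], kacL ![0, 1], kacR ![1, 0], kacR ![0, 1], _, _, _, _,
    fun u => ?_, fun u => ?_, kacM_apply⟩
  · rw [← map_smul, ← map_smul, ← map_add, ← vec_two_eq]
  · rw [← map_smul, ← map_smul, ← map_add, ← vec_two_eq]

theorem leftComm_L_R (u v : Fin 2 → k) :
    leftComm (kacMul k) (-1) (kacL u) (kacR v) = 0 := by
  apply kac_ext <;> intros <;>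
    simp only [leftComm_apply, neg_smul, one_smul, sub_neg_eq_add, LinearMap.zero_apply,
      kacMul_one_right, kacMul_R_E, kacMul_R_L, kacMul_R_R, kacMul_L_E, kacMul_L_L, kacMul_L_R,
      kacMul_L_M,
      kacMul_R_M, map_add, map_sub, map_smul, map_neg]
  · rw [← map_neg, ← map_add, neg_add_cancel, map_zero]
  · module
  all_goals
    obtain ⟨l₀, l₁, r₀, r₁, m₀, m₁, m₂, m₃, hL, hR, hM⟩ := exists_coord (k := k)
    simp only [hL, hR, hM, pairAct_apply, mulVec_two, Matrix.vecMulVec_apply, altForm, matL, matR]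
    match_scalars <;> grind

theorem kacEven_comm (A B A' B' : Matrix (Fin 2) (Fin 2) k) :
    kacEven A B * kacEven A' B' + (-1 : k) • (kacEven A' B' * kacEven A B) =
      kacEven (A * A' - A' * A) (B * B' - B' * B) := by
  apply kac_ext <;> intros <;>
    simp only [LinearMap.add_apply, LinearMap.smul_apply, neg_one_smul, ← sub_eq_add_neg,
      Module.End.mul_apply, kacEven_one, kacEven_E, kacEven_L,
      kacEven_R, kacEven_M, map_zero, sub_zero, Matrix.sub_mulVec, Matrix.mulVec_mulVec, map_sub]
  rw [← map_sub]
  apply kacM_congr <;> simp [pairAct_apply, Matrix.mul_apply, Fin.sum_univ_two] <;> ring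

/-- Odd derivations involve the alternating form of U, which is invariant exactly under matrices of
trace zero. -/
theorem kacEven_kacOdd_comm {A B : Matrix (Fin 2) (Fin 2) k} (hA : A.trace = 0) (hB : B.trace = 0)
    (p q : Fin 2 → k) : kacEven A B * kacOdd p q + (-1 : k) • (kacOdd p q * kacEven A B) =
      kacOdd (A.mulVec p) (B.mulVec q) := by
  rw [Matrix.trace_fin_two] at hA hB
  apply kac_ext <;> intros <;>
    simp only [LinearMap.add_apply, LinearMap.smul_apply, neg_one_smul, ← sub_eq_add_neg,
      Module.End.mul_apply, kacEven_one, kacEven_E, kacEven_L,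
      kacEven_R, kacEven_M, kacOdd_one, kacOdd_E, kacOdd_L, kacOdd_R, kacOdd_M, map_zero, sub_zero,
      map_sub, map_add, map_neg, map_smul, smul_zero, neg_zero, zero_sub, zero_add]
  all_goals
    obtain ⟨l₀, l₁, r₀, r₁, m₀, m₁, m₂, m₃, hL, hR, hM⟩ := exists_coord (k := k)
    simp only [hL, hR, hM, pairAct_apply, mulVec_two, Matrix.vecMulVec_apply, altForm, matL, matR]
    match_scalars <;> grind

/-- The bracket of osp(1|2) in each factor. The mixed terms cancel because of the parity operator in
`kacOdd`. -/
theorem kacOdd_comm (p q p' q' : Fin 2 → k) :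
    kacOdd p q * kacOdd p' q' + kacOdd p' q' * kacOdd p q =
      kacEven ((-2 : k) • symMat p p') ((-2 : k) • symMat q q') := by
  apply kac_ext <;> intros <;>
    simp only [LinearMap.add_apply, Module.End.mul_apply, kacEven_one, kacEven_E, kacEven_L,
      kacEven_R, kacEven_M, kacOdd_one, kacOdd_E, kacOdd_L, kacOdd_R, kacOdd_M, map_zero, sub_zero,
      map_sub, map_add, map_neg, map_smul, smul_zero, neg_zero, zero_sub, zero_add]
  all_goals
    obtain ⟨l₀, l₁, r₀, r₁, m₀, m₁, m₂, m₃, hL, hR, hM⟩ := exists_coord (k := k)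
    simp only [hL, hR, hM, pairAct_apply, mulVec_two, Matrix.vecMulVec_apply, altForm, matL, matR,
      Matrix.smul_apply, symMat]
    try simp
    match_scalars <;> ring

end KacDer

/-! ### Homogeneous components of J and of inder J. -/

section KacSpaces

variable {k : Type*} [Field k]

theorem kapGr_zero_eq {x : Kaplansky k} (hx : x ∈ kapGr k 0) : x = x.1 • (1, 0) := by
  obtain ⟨y, rfl⟩ := hx
  ext <;> simp [kapProj]

theorem kapGr_one_eq {x : Kaplansky k} (hx : x ∈ kapGr k 1) : x = (0, x.2) := by
  obtain ⟨y, rfl⟩ := hx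
  ext <;> simp [kapProj]

theorem kacE_mem : (kacE : Kac k) ∈ kacGr k 0 := by
  refine ⟨by simp, ?_⟩
  exact Submodule.mem_iSup_of_mem 0 (Submodule.apply_mem_map₂ _ e_mem_kapGr e_mem_kapGr)

theorem kacL_mem (u : Fin 2 → k) : kacL u ∈ kacGr k 1 := by
  refine ⟨by simp [kacL_apply], ?_⟩
  exact Submodule.mem_iSup_of_mem 1 (Submodule.apply_mem_map₂ _ (u_mem_kapGr u) e_mem_kapGr)

theorem kacR_mem (u : Fin 2 → k) : kacR u ∈ kacGr k 1 := by
  refine ⟨by simp [kacR_apply], ?_⟩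
  exact Submodule.mem_iSup_of_mem 0 (Submodule.apply_mem_map₂ _ e_mem_kapGr (u_mem_kapGr u))

theorem kacUU_mem (u v : Fin 2 → k) : kacUU u v ∈ kacGr k 0 := by
  refine ⟨by simp, ?_⟩
  exact Submodule.mem_iSup_of_mem 1 (Submodule.apply_mem_map₂ _ (u_mem_kapGr u) (u_mem_kapGr v))

theorem kacM_mem (M : Matrix (Fin 2) (Fin 2) k) : kacM M ∈ kacGr k 0 := by
  rw [kacM_apply]
  exact add_mem (add_mem (add_mem (Submodule.smul_mem _ _ (kacUU_mem _ _))
    (Submodule.smul_mem _ _ (kacUU_mem _ _))) (Submodule.smul_mem _ _ (kacUU_mem _ _)))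
    (Submodule.smul_mem _ _ (kacUU_mem _ _))

theorem kacTrace_E : kacTrace k kacE = 0 := rfl
theorem kacTrace_one : kacTrace k (kacOne k) = 1 := rfl
theorem kacTrace_L (u : Fin 2 → k) : kacTrace k (kacL u) = 0 := rfl
theorem kacTrace_R (u : Fin 2 → k) : kacTrace k (kacR u) = 0 := rfl
theorem kacTrace_M (M : Matrix (Fin 2) (Fin 2) k) : kacTrace k (kacM M) = 0 := by
  simp [kacTrace, kacM_apply, kacUU_apply]

theorem parity_cases (i : ZMod 2) : i = 0 ∨ i = 1 := by
  revert i; decide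

theorem kacGr_zero_cases {x : Kac k} (hx : x ∈ kacGr k 0) :
    ∃ (α c : k) (M : Matrix (Fin 2) (Fin 2) k), x = α • kacOne k + c • kacE + kacM M := by
  obtain ⟨α, z⟩ := x
  obtain ⟨-, hz⟩ := hx
  let f : (k × Matrix (Fin 2) (Fin 2) k) →ₗ[k] Kac k :=
    (LinearMap.toSpanSingleton k _ kacE).coprod kacM
  have key : (⨆ q : ZMod 2, Submodule.map₂ (TensorProduct.mk k (Kaplansky k) (Kaplansky k))
      (kapGr k q) (kapGr k (0 - q))) ≤
      (LinearMap.range f).comap (LinearMap.inr k k (Kaplansky k ⊗[k] Kaplansky k)) := by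
    refine iSup_le fun q => Submodule.map₂_le.2 fun a ha b hb => ?_
    rcases parity_cases q with rfl | rfl
    · rw [kapGr_zero_eq ha, kapGr_zero_eq hb]
      refine ⟨(a.1 * b.1, 0), ?_⟩
      simp [f, kacE, mul_smul, -Prod.smul_mk]
      rw [smul_comm]
    · rw [kapGr_one_eq ha, kapGr_one_eq hb]
      refine ⟨(0, Matrix.vecMulVec a.2 b.2), ?_⟩
      simp [f, kacM_vecMulVec, kacUU_apply]
  obtain ⟨⟨c, M⟩, h⟩ := key hz
  refine ⟨α, c, M, ?_⟩
  have h' : c • kacE + kacM M = ((0, z) : Kac k) := by simpa [f] using h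
  rw [add_assoc, h']
  simp [kacOne]

theorem kacGr_one_cases {x : Kac k} (hx : x ∈ kacGr k 1) :
    ∃ u v : Fin 2 → k, x = kacL u + kacR v := by
  obtain ⟨α, z⟩ := x
  obtain ⟨h0, hz⟩ := hx
  have h0 : α = 0 := by simpa using h0
  subst h0
  let f : ((Fin 2 → k) × (Fin 2 → k)) →ₗ[k] Kac k := kacL.coprod kacR
  have key : (⨆ q : ZMod 2, Submodule.map₂ (TensorProduct.mk k (Kaplansky k) (Kaplansky k))
      (kapGr k q) (kapGr k (1 - q))) ≤
      (LinearMap.range f).comap (LinearMap.inr k k (Kaplansky k ⊗[k] Kaplansky k)) := by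
    refine iSup_le fun q => Submodule.map₂_le.2 fun a ha b hb => ?_
    rcases parity_cases q with rfl | rfl
    · rw [kapGr_zero_eq ha, kapGr_one_eq hb]
      refine ⟨(0, a.1 • b.2), ?_⟩
      simp [f, kacR_apply, TensorProduct.smul_tmul']
    · rw [kapGr_one_eq ha, kapGr_zero_eq (x := b) (by simpa using hb)]
      refine ⟨(b.1 • a.2, 0), ?_⟩
      simp [f, kacL_apply, -Prod.smul_mk]
  obtain ⟨⟨u, v⟩, h⟩ := key hz
  exact ⟨u, v, by simpa [f] using h.symm⟩

variable [CharP k 5]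

theorem leftComm_one_left (x : Kac k) : leftComm (kacMul k) 1 (kacOne k) x = 0 := by
  refine LinearMap.ext fun z => ?_
  simp [leftComm_apply, kacMul_one_left]

theorem leftComm_one_right (x : Kac k) : leftComm (kacMul k) 1 x (kacOne k) = 0 := by
  rw [leftComm_swap, leftComm_one_left, smul_zero]

/-- The even inner derivations come from pairs of even and pairs of odd elements; by the table of
commutators both kinds have components of trace zero. With `kacEven_mem` this gives inder J in
degree 0 as sl(U)⊕sl(U). -/
theorem innerDerSuper_zero_cases {d : Module.End k (Kac k)}
    (hd : d ∈ innerDerSuper (kacMul k) (kacGr k) 0) :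
    ∃ A B : Matrix (Fin 2) (Fin 2) k, A.trace = 0 ∧ B.trace = 0 ∧ d = kacEven A B := by
  let S : Submodule k (Module.End k (Kac k)) :=
    { carrier := {d | ∃ A B : Matrix (Fin 2) (Fin 2) k,
        A.trace = 0 ∧ B.trace = 0 ∧ d = kacEven A B}
      add_mem' := by
        rintro _ _ ⟨A, B, hA, hB, rfl⟩ ⟨A', B', hA', hB', rfl⟩
        exact ⟨A + A', B + B', by simp [hA, hA'], by simp [hB, hB'], (kacEven_add _ _ _ _).symm⟩
      zero_mem' := ⟨0, 0, by simp, by simp, by simp [kacEven]⟩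
      smul_mem' := by
        rintro c _ ⟨A, B, hA, hB, rfl⟩
        exact ⟨c • A, c • B, by simp [hA], by simp [hB], (kacEven_smul _ _ _).symm⟩ }
  have hS (A B : Matrix (Fin 2) (Fin 2) k) (hA : A.trace = 0) (hB : B.trace = 0) :
    kacEven A B ∈ S := ⟨A, B, hA, hB, rfl⟩
  suffices innerDerSuper (kacMul k) (kacGr k) 0 ≤ S from this hd
  refine iSup_le fun q => Submodule.map₂_le.2 fun x hx y hy => ?_
  rcases parity_cases q with rfl | rfl
  · obtain ⟨α, c, M, rfl⟩ := kacGr_zero_cases hx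
    obtain ⟨β, d, N, rfl⟩ := kacGr_zero_cases (by simpa using hy)
    rw [koszulSign_zero_left]
    simp only [map_add, map_smul, LinearMap.add_apply, LinearMap.smul_apply, leftComm_one_left,
      leftComm_one_right, leftComm_E_E, leftComm_E_M, leftComm_swap _ (kacM _) kacE, leftComm_M_M,
      smul_zero, zero_add, add_zero]
    refine hS _ _ ?_ ?_ <;> simp [Matrix.trace_fin_two, brMat] <;> ring
  · obtain ⟨u, v, rfl⟩ := kacGr_one_cases hx
    obtain ⟨u', v', rfl⟩ := kacGr_one_cases (x := y) (by simpa using hy)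
    have h1 : (0 - 1 : ZMod 2) = 1 := by decide
    rw [h1, koszulSign_one_one]
    simp only [map_add, LinearMap.add_apply, leftComm_L_L, leftComm_L_R,
      leftComm_neg_swap _ (kacR _) (kacL _), leftComm_R_R, zero_add, add_zero]
    refine add_mem (hS _ _ ?_ ?_) (hS _ _ ?_ ?_) <;> simp [Matrix.trace_fin_two, symMat] <;> ring

theorem innerDerSuper_one_cases {d : Module.End k (Kac k)}
    (hd : d ∈ innerDerSuper (kacMul k) (kacGr k) 1) : ∃ p q : Fin 2 → k, d = kacOdd p q := by
  let S : Submodule k (Module.End k (Kac k)) :=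
    { carrier := {d | ∃ p q : Fin 2 → k, d = kacOdd p q}
      add_mem' := by
        rintro _ _ ⟨p, q, rfl⟩ ⟨p', q', rfl⟩
        exact ⟨p + p', q + q', (kacOdd_add _ _ _ _).symm⟩
      zero_mem' := ⟨0, 0, by simp [kacOdd]⟩
      smul_mem' := by
        rintro c _ ⟨p, q, rfl⟩
        exact ⟨c • p, c • q, (kacOdd_smul _ _ _).symm⟩ }
  have hS (p q : Fin 2 → k) : kacOdd p q ∈ S := ⟨p, q, rfl⟩
  have key (x : Kac k) (hx : x ∈ kacGr k 0) (y : Kac k) (hy : y ∈ kacGr k 1) :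
      leftComm (kacMul k) 1 x y ∈ S := by
    obtain ⟨α, c, M, rfl⟩ := kacGr_zero_cases hx
    obtain ⟨u, v, rfl⟩ := kacGr_one_cases hy
    simp only [map_add, map_smul, LinearMap.add_apply, LinearMap.smul_apply, leftComm_one_left,
      leftComm_E_L, leftComm_E_R, leftComm_M_L, leftComm_M_R, smul_zero, zero_add]
    exact add_mem (add_mem (S.smul_mem _ (hS _ _)) (S.smul_mem _ (hS _ _)))
      (add_mem (S.smul_mem _ (hS _ _)) (S.smul_mem _ (hS _ _)))
  suffices innerDerSuper (kacMul k) (kacGr k) 1 ≤ S from this hd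
  refine iSup_le fun q => Submodule.map₂_le.2 fun x hx y hy => ?_
  rcases parity_cases q with rfl | rfl
  · rw [koszulSign_zero_left]
    exact key x hx y (by simpa using hy)
  · rw [sub_self, koszulSign_zero_right, leftComm_swap]
    exact S.smul_mem _ (key y (by simpa using hy) x hx)

theorem kacOdd_mem (p q : Fin 2 → k) : kacOdd p q ∈ innerDerSuper (kacMul k) (kacGr k) 1 := by
  have key (y : Kac k) (hy : y ∈ kacGr k 1) :
      leftComm (kacMul k) 1 kacE y ∈ innerDerSuper (kacMul k) (kacGr k) 1 :=
    Submodule.mem_iSup_of_mem 0 (Submodule.apply_mem_map₂ _ kacE_mem (by simpa using hy))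
  have h : kacOdd p q = leftComm (kacMul k) 1 kacE (kacL (-p) + kacR (-q)) := by
    rw [map_add, leftComm_E_L, leftComm_E_R, neg_neg, neg_neg, ← kacOdd_add, zero_add, add_zero]
  rw [h]
  exact key _ (add_mem (kacL_mem _) (kacR_mem _))

/-- Symmetric squares span sl(U), so commutators of odd left multiplications suffice. -/
theorem kacEven_mem {A B : Matrix (Fin 2) (Fin 2) k} (hA : A.trace = 0) (hB : B.trace = 0) :
    kacEven A B ∈ innerDerSuper (kacMul k) (kacGr k) 0 := by
  have h1 : (0 - 1 : ZMod 2) = 1 := by decide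
  have key (x y : Kac k) (hx : x ∈ kacGr k 1) (hy : y ∈ kacGr k 1) :
      leftComm (kacMul k) (-1) x y ∈ innerDerSuper (kacMul k) (kacGr k) 0 := by
    refine Submodule.mem_iSup_of_mem 1 ?_
    rw [h1, koszulSign_one_one]
    exact Submodule.apply_mem_map₂ _ hx hy
  -- The doubled matrices `symMat` on the basis have the nonzero entries 4, -4 = 1 and ∓2, ±2; the
  -- coefficients 4, 1 and 3 invert 4, 1 and 2 modulo 5.
  have hmat {A : Matrix (Fin 2) (Fin 2) k} (hA : A.trace = 0) :
      A = (4 * A 0 1) • (2 : k) • symMat ![1, 0] ![1, 0]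
        + (A 1 0) • (2 : k) • symMat ![0, 1] ![0, 1]
        + (3 * A 1 1) • (2 : k) • symMat ![1, 0] ![0, 1] := by
    rw [Matrix.trace_fin_two] at hA
    apply mat_two_ext <;> simp [symMat] <;> grind
  have hL (u v : Fin 2 → k) : kacEven ((2 : k) • symMat u v) 0 ∈
      innerDerSuper (kacMul k) (kacGr k) 0 := by
    rw [← leftComm_L_L]
    exact key _ _ (kacL_mem u) (kacL_mem v)
  have hR (u v : Fin 2 → k) : kacEven 0 ((2 : k) • symMat u v) ∈
      innerDerSuper (kacMul k) (kacGr k) 0 := by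
    rw [← leftComm_R_R]
    exact key _ _ (kacR_mem u) (kacR_mem v)
  have h : kacEven A B = kacEven A 0 + kacEven 0 B := by
    rw [← kacEven_add, zero_add, add_zero]
  have hl (A A' : Matrix (Fin 2) (Fin 2) k) : kacEven (A + A') 0 = kacEven A 0 + kacEven A' 0 := by
    rw [← kacEven_add, add_zero]
  have hr (A A' : Matrix (Fin 2) (Fin 2) k) : kacEven 0 (A + A') = kacEven 0 A + kacEven 0 A' := by
    rw [← kacEven_add, add_zero]
  have hls (c : k) (A : Matrix (Fin 2) (Fin 2) k) : kacEven (c • A) 0 = c • kacEven A 0 := by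
    rw [← kacEven_smul, smul_zero]
  have hrs (c : k) (A : Matrix (Fin 2) (Fin 2) k) : kacEven 0 (c • A) = c • kacEven 0 A := by
    rw [← kacEven_smul, smul_zero]
  rw [h]
  refine add_mem ?_ ?_
  · rw [hmat hA, hl, hl, hls, hls (A 1 0), hls (3 * _)]
    exact add_mem (add_mem (Submodule.smul_mem _ _ (hL _ _)) (Submodule.smul_mem _ _ (hL _ _)))
      (Submodule.smul_mem _ _ (hL _ _))
  · rw [hmat hB, hr, hr, hrs, hrs (B 1 0), hrs (3 * _)]
    exact add_mem (add_mem (Submodule.smul_mem _ _ (hR _ _)) (Submodule.smul_mem _ _ (hR _ _)))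
      (Submodule.smul_mem _ _ (hR _ _))

end KacSpaces

/-! ### Bilinearity and superanticommutativity of the Tits product. -/

section TitsGeneral

variable {k C J : Type*} [Field k] [AddCommGroup C] [Module k C] [AddCommGroup J] [Module k J]

/-- The product of the Tits construction as a bilinear map. -/
def titsBilin (m : C →ₗ[k] C →ₗ[k] C) (n : QuadraticForm k C) (p : J →ₗ[k] J →ₗ[k] J) (u : J)
    (t : J →ₗ[k] k) (i j : ZMod 2) :
    TitsAmbient k C J →ₗ[k] TitsAmbient k C J →ₗ[k] TitsAmbient k C J :=
  LinearMap.mk₂ k (titsBracket m n p u t i j)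
    (by
      intro x x' y
      refine Prod.ext ?_ (Prod.ext ?_ ?_) <;> simp [titsBracket, add_mul, mul_add] <;> abel)
    (by
      intro c x y
      refine Prod.ext ?_ (Prod.ext ?_ ?_) <;>
        simp [titsBracket, smul_sub, smul_add, smul_comm c])
    (by
      intro x y y'
      refine Prod.ext ?_ (Prod.ext ?_ ?_) <;> simp [titsBracket, add_mul, mul_add] <;> abel)
    (by
      intro c x y
      refine Prod.ext ?_ (Prod.ext ?_ ?_) <;>
        simp [titsBracket, smul_sub, smul_add, smul_comm c])

theorem titsBilin_apply (m : C →ₗ[k] C →ₗ[k] C) (n : QuadraticForm k C) (p : J →ₗ[k] J →ₗ[k] J)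
    (u : J) (t : J →ₗ[k] k) (i j : ZMod 2) (X Y : TitsAmbient k C J) :
    titsBilin m n p u t i j X Y = titsBracket m n p u t i j X Y := rfl

theorem titsBilin_pure (m : C →ₗ[k] C →ₗ[k] C) (n : QuadraticForm k C) (p : J →ₗ[k] J →ₗ[k] J)
    (u : J) (t : J →ₗ[k] k) (i j : ZMod 2) (D D' : Module.End k C) (a b : C) (x y : J)
    (d d' : Module.End k J) :
    titsBilin m n p u t i j (D, a ⊗ₜ x, d) (D', b ⊗ₜ y, d') =
      (D * D' - D' * D + t (p x y) • innerDer m a b,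
        D b ⊗ₜ y - D' a ⊗ₜ x + b ⊗ₜ d y - koszulSign i j • (a ⊗ₜ d' x)
          + algComm m a b ⊗ₜ (p x y - t (p x y) • u),
        d * d' - koszulSign i j • (d' * d) -
          (2 * n.polarBilin a b) • leftComm p (koszulSign i j) x y) := by
  simp [titsBilin_apply, titsBracket, starMul_apply, mul_smul]

/-- In the second summand [a,b] is skew and xy supersymmetric, and the third is a supercommutator
times a symmetric form. The condition for sign -1 reflects that derivations of C are even; without
it the commutator in the first component would have the wrong symmetry. -/
theorem titsBilin_pure_swap (m : C →ₗ[k] C →ₗ[k] C) (n : QuadraticForm k C)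
    (p : J →ₗ[k] J →ₗ[k] J) (u : J) (t : J →ₗ[k] k) (i j : ZMod 2) (D D' : Module.End k C) (a b : C)
    (x y : J) (d d' : Module.End k J) (hD : innerDer m a b = -innerDer m b a)
    (hxy : p x y = koszulSign i j • p y x) (hz : koszulSign i j = -1 → D = 0 ∧ D' = 0)
   :
    titsBilin m n p u t i j (D, a ⊗ₜ x, d) (D', b ⊗ₜ y, d') =
      -(koszulSign i j • titsBilin m n p u t j i (D', b ⊗ₜ y, d') (D, a ⊗ₜ x, d)) := by
  have hc : algComm m b a = -algComm m a b := by simp [algComm]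
  have hs : koszulSign j i = koszulSign i j := by simp [koszulSign, and_comm]
  have hn : n.polarBilin b a = n.polarBilin a b := QuadraticMap.polar_comm _ _ _
  rw [titsBilin_pure, titsBilin_pure, hs, hc, hn, hD]
  have hk : koszulSign i j = 1 ∨ koszulSign i j = -1 := by
    unfold koszulSign; split_ifs <;> simp
  rcases hk with h | h
  · rw [h] at hxy ⊢
    refine Prod.ext ?_ (Prod.ext ?_ ?_)
    · simp [hxy]; abel
    · simp [hxy, TensorProduct.neg_tmul]; abel
    · rw [leftComm_swap p x y]
      simp; abel
  · obtain ⟨rfl, rfl⟩ := hz h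
    rw [h, neg_one_zsmul] at hxy
    rw [h]
    refine Prod.ext ?_ (Prod.ext ?_ ?_)
    · simp [hxy]
    · simp [hxy, TensorProduct.neg_tmul, TensorProduct.tmul_add, TensorProduct.tmul_neg,
        TensorProduct.tmul_sub]
      abel
    · rw [leftComm_neg_swap p x y]
      simp; abel

end TitsGeneral

theorem tmul_sum_smul {k C J : Type*} [Field k] [AddCommGroup C] [Module k C] [AddCommGroup J]
    [Module k J] (a : C) (r r₀ r₁ r₂ r₃ : k) (x x₀ x₁ x₂ x₃ : J) :
    TensorProduct.mk k C J a (r • x + (r₀ • x₀ + r₁ • x₁ + r₂ • x₂ + r₃ • x₃)) =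
      (r • a) ⊗ₜ x + ((r₀ • a) ⊗ₜ x₀ + (r₁ • a) ⊗ₜ x₁ + (r₂ • a) ⊗ₜ x₂ + (r₃ • a) ⊗ₜ x₃) := by
  simp [TensorProduct.tmul_add, TensorProduct.smul_tmul']

/-! ### Coordinate functions on the Kac superalgebra. -/

section Coordinates

variable {k : Type*} [Field k]

/-- The linear map on the Kac superalgebra given by a bilinear map on the Kaplansky superalgebra. -/
def kacLift {P : Type*} [AddCommGroup P] [Module k P]
    (f : Kaplansky k →ₗ[k] Kaplansky k →ₗ[k] P) : Kac k →ₗ[k] P :=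
  TensorProduct.lift f ∘ₗ LinearMap.snd k k _

theorem kacLift_E {P : Type*} [AddCommGroup P] [Module k P]
    (f : Kaplansky k →ₗ[k] Kaplansky k →ₗ[k] P) : kacLift f kacE = f (1, 0) (1, 0) := by
  simp [kacLift, kacE]

theorem kacLift_L {P : Type*} [AddCommGroup P] [Module k P]
    (f : Kaplansky k →ₗ[k] Kaplansky k →ₗ[k] P) (u : Fin 2 → k) :
    kacLift f (kacL u) = f (0, u) (1, 0) := by
  simp [kacLift, kacL_apply]

theorem kacLift_R {P : Type*} [AddCommGroup P] [Module k P]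
    (f : Kaplansky k →ₗ[k] Kaplansky k →ₗ[k] P) (u : Fin 2 → k) :
    kacLift f (kacR u) = f (1, 0) (0, u) := by
  simp [kacLift, kacR_apply]

theorem kacLift_UU {P : Type*} [AddCommGroup P] [Module k P]
    (f : Kaplansky k →ₗ[k] Kaplansky k →ₗ[k] P) (u v : Fin 2 → k) :
    kacLift f (kacUU u v) = f (0, u) (0, v) := by
  simp [kacLift, kacUU_apply]

/-- The coefficient of `e ⊗ e`. -/
def coordE : Kac k →ₗ[k] k :=
  kacLift (LinearMap.mk₂ k (fun a b => a.1 * b.1) (by intros; simp [add_mul])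
    (by intros; simp [mul_assoc]) (by intros; simp [mul_add]) (by intros; simp; ring))

/-- The component in `U ⊗ e`. -/
def coordL : Kac k →ₗ[k] (Fin 2 → k) :=
  kacLift (LinearMap.mk₂ k (fun a b => b.1 • a.2) (by intros; simp)
    (by intro c a b; simp [smul_comm c]) (by intros; simp [add_smul]) (by intros; simp [mul_smul]))

/-- The component in `e ⊗ U`. -/
def coordR : Kac k →ₗ[k] (Fin 2 → k) :=
  kacLift (LinearMap.mk₂ k (fun a b => a.1 • b.2) (by intros; simp [add_smul])
    (by intros; simp [mul_smul]) (by intros; simp) (by intro c a b; simp [smul_comm c]))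

/-- The component in `U ⊗ U`. -/
def coordM : Kac k →ₗ[k] Matrix (Fin 2) (Fin 2) k :=
  kacLift (LinearMap.mk₂ k (fun a b => Matrix.vecMulVec a.2 b.2)
    (by intros; simp [Matrix.add_vecMulVec]) (by intros; simp [Matrix.smul_vecMulVec])
    (by intros; simp [Matrix.vecMulVec_add]) (by intros; simp [Matrix.vecMulVec_smul]))

theorem coordE_E : coordE (kacE : Kac k) = 1 := by simp [coordE, kacLift_E]
theorem coordE_M (M : Matrix (Fin 2) (Fin 2) k) : coordE (kacM M) = 0 := by
  simp [coordE, kacM_apply, kacLift_UU]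
theorem coordM_E : coordM (kacE : Kac k) = 0 := by simp [coordM, kacLift_E]
theorem coordM_M (M : Matrix (Fin 2) (Fin 2) k) : coordM (kacM M) = M := by
  apply mat_two_ext <;> simp [coordM, kacM_apply, kacLift_UU, Matrix.vecMulVec_apply]
theorem coordL_L (u : Fin 2 → k) : coordL (kacL u) = u := by simp [coordL, kacLift_L]
theorem coordL_R (u : Fin 2 → k) : coordL (kacR u) = 0 := by simp [coordL, kacLift_R]
theorem coordR_L (u : Fin 2 → k) : coordR (kacL u) = 0 := by simp [coordR, kacLift_L]
theorem coordR_R (u : Fin 2 → k) : coordR (kacR u) = u := by simp [coordR, kacLift_R]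

end Coordinates

/-! ### Generators of the Tits construction. -/

section TitsSpaces

variable {k : Type*} [Field k]

/-- The space in which the Tits construction of the Cayley and Kac algebras lives. -/
abbrev TitsCK (k : Type*) [Field k] : Type _ := TitsAmbient k (Cayley k) (Kac k)

/-- The element `D` of `der C`. -/
def evD (D : Module.End k (Cayley k)) : TitsCK k := (D, 0 ⊗ₜ 0, 0)

/-- The element `a ⊗ (e ⊗ e)`. -/
def evA (a : Cayley k) : TitsCK k := (0, a ⊗ₜ kacE, 0)

/-- The element `a ⊗ M`, where `M` is in `U ⊗ U`. -/
def evM (a : Cayley k) (M : Matrix (Fin 2) (Fin 2) k) : TitsCK k := (0, a ⊗ₜ kacM M, 0)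

/-- The inner derivation `A ⊗ 1 + 1 ⊗ B`. -/
def evK (A B : Matrix (Fin 2) (Fin 2) k) : TitsCK k := (0, 0 ⊗ₜ 0, kacEven A B)

/-- Three times the trace zero component, in characteristic `5`, of an element of the Cayley algebra
is three times this element. -/
def imPart : Cayley k →ₗ[k] Cayley k :=
  LinearMap.id + (2 : k) • cayleyTr.smulRight (cayleyOne k)

theorem imPart_apply (a : Cayley k) : imPart a = a + (2 * cayleyTr a) • cayleyOne k := by
  simp [imPart, mul_smul]

/-- The odd elements corresponding to `C ⊗ U`, for the first copy of `U`. -/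
def odL (a : Cayley k) (u : Fin 2 → k) : TitsCK k :=
  (0, imPart a ⊗ₜ kacL u, kacOdd (-(cayleyTr a • u)) 0)

/-- The odd elements corresponding to `C ⊗ U`, for the second copy of `U`. -/
def odR (a : Cayley k) (u : Fin 2 → k) : TitsCK k :=
  (0, ((3 : k) • imPart a) ⊗ₜ kacR u, kacOdd 0 (-((3 * cayleyTr a) • u)))

/-- The generators of the even part. -/
inductive EvenGen : TitsCK k → Prop
  | D {D : Module.End k (Cayley k)} (hD : D ∈ derSpace (cayleyMul k)) : EvenGen (evD D)
  | A {a : Cayley k} (ha : cayleyTr a = 0) : EvenGen (evA a)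
  | M {a : Cayley k} (ha : cayleyTr a = 0) (M : Matrix (Fin 2) (Fin 2) k) : EvenGen (evM a M)
  | K {A B : Matrix (Fin 2) (Fin 2) k} (hA : A.trace = 0) (hB : B.trace = 0) : EvenGen (evK A B)

/-- The generators of the odd part. -/
inductive OddGen : TitsCK k → Prop
  | L (a : Cayley k) (u : Fin 2 → k) : OddGen (odL a u)
  | R (a : Cayley k) (u : Fin 2 → k) : OddGen (odR a u)

theorem mem_even {X : TitsCK k} : X ∈ titsCayleyKac k 0 ↔ X.1 ∈ derSpace (cayleyMul k) ∧
    X.2.1 ∈ Submodule.map₂ (TensorProduct.mk k (Cayley k) (Kac k))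
      (traceZero (cayleyNorm k) (cayleyOne k)) (kacGr k 0 ⊓ LinearMap.ker (kacTrace k)) ∧
    X.2.2 ∈ innerDerSuper (kacMul k) (kacGr k) 0 := Iff.rfl

theorem mem_odd {X : TitsCK k} : X ∈ titsCayleyKac k 1 ↔ X.1 = 0 ∧
    X.2.1 ∈ Submodule.map₂ (TensorProduct.mk k (Cayley k) (Kac k))
      (traceZero (cayleyNorm k) (cayleyOne k)) (kacGr k 1 ⊓ LinearMap.ker (kacTrace k)) ∧
    X.2.2 ∈ innerDerSuper (kacMul k) (kacGr k) 1 := Iff.rfl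

theorem tmul_mem {i : ZMod 2} {a : Cayley k} (ha : cayleyTr a = 0) {x : Kac k}
    (hx : x ∈ kacGr k i) (ht : kacTrace k x = 0) :
    a ⊗ₜ[k] x ∈ Submodule.map₂ (TensorProduct.mk k (Cayley k) (Kac k))
      (traceZero (cayleyNorm k) (cayleyOne k)) (kacGr k i ⊓ LinearMap.ker (kacTrace k)) :=
  Submodule.apply_mem_map₂ _ (mem_traceZero.2 ha) ⟨hx, ht⟩

variable [CharP k 5]

theorem cayleyTr_one : cayleyTr (cayleyOne k) = 2 := by
  rw [cayleyOne_eq_zorn, cayleyTr_zorn]; norm_num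

theorem cayleyTr_imPart (a : Cayley k) : cayleyTr (imPart a) = 0 := by
  rw [imPart_apply, map_add, map_smul, cayleyTr_one, smul_eq_mul]
  grind

theorem imPart_of_tr {a : Cayley k} (ha : cayleyTr a = 0) : imPart a = a := by
  rw [imPart_apply, ha, mul_zero, zero_smul, add_zero]

theorem imPart_one : imPart (cayleyOne k) = 0 := by
  rw [imPart_apply, cayleyTr_one]
  match_scalars
  grind

theorem EvenGen.mem {X : TitsCK k} (h : EvenGen X) : X ∈ titsCayleyKac k 0 := by
  rcases h with hD | ha | ⟨ha, M⟩ | ⟨hA, hB⟩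
  · exact mem_even.2 ⟨hD, by simp [evD], Submodule.zero_mem _⟩
  · exact mem_even.2 ⟨Submodule.zero_mem _, tmul_mem ha kacE_mem kacTrace_E, Submodule.zero_mem _⟩
  · exact mem_even.2
      ⟨Submodule.zero_mem _, tmul_mem ha (kacM_mem M) (kacTrace_M M), Submodule.zero_mem _⟩
  · exact mem_even.2 ⟨Submodule.zero_mem _, by simp [evK], kacEven_mem hA hB⟩

theorem OddGen.mem {X : TitsCK k} (h : OddGen X) : X ∈ titsCayleyKac k 1 := by
  rcases h with ⟨a, u⟩ | ⟨a, u⟩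
  · exact mem_odd.2 ⟨rfl, tmul_mem (cayleyTr_imPart a) (kacL_mem u) (kacTrace_L u), kacOdd_mem _ _⟩
  · refine mem_odd.2 ⟨rfl, tmul_mem ?_ (kacR_mem u) (kacTrace_R u), kacOdd_mem _ _⟩
    rw [map_smul, cayleyTr_imPart, smul_zero]

theorem kacM_eq_sum (M : Matrix (Fin 2) (Fin 2) k) :
    kacM M = M 0 0 • kacM !![1, 0; 0, 0] + M 0 1 • kacM !![0, 1; 0, 0] + M 1 0 • kacM !![0, 0; 1, 0]
      + M 1 1 • kacM !![0, 0; 0, 1] := by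
  simp only [← map_smul, ← map_add]
  apply kacM_congr <;> simp

/-- A normal form with one Cayley coefficient for each matrix unit. It gives the spanning statement
at once and is what the proof of injectivity starts from. -/
theorem even_decomp {X : TitsCK k} (hX : X ∈ titsCayleyKac k 0) :
    ∃ (D : Module.End k (Cayley k)) (a c₀ c₁ c₂ c₃ : Cayley k) (A B : Matrix (Fin 2) (Fin 2) k),
      D ∈ derSpace (cayleyMul k) ∧ cayleyTr a = 0 ∧ cayleyTr c₀ = 0 ∧ cayleyTr c₁ = 0 ∧
      cayleyTr c₂ = 0 ∧ cayleyTr c₃ = 0 ∧ A.trace = 0 ∧ B.trace = 0 ∧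
      X = evD D + evA a + (evM c₀ !![1, 0; 0, 0] + evM c₁ !![0, 1; 0, 0] + evM c₂ !![0, 0; 1, 0]
        + evM c₃ !![0, 0; 0, 1]) + evK A B := by
  obtain ⟨D, z, d⟩ := X
  obtain ⟨hD, hz, hd⟩ := mem_even.1 hX
  obtain ⟨A, B, hA, hB, hAB⟩ := innerDerSuper_zero_cases hd
  have hz' : ∃ a c₀ c₁ c₂ c₃ : Cayley k, cayleyTr a = 0 ∧ cayleyTr c₀ = 0 ∧ cayleyTr c₁ = 0 ∧
      cayleyTr c₂ = 0 ∧ cayleyTr c₃ = 0 ∧ z = a ⊗ₜ kacE + (c₀ ⊗ₜ kacM !![1, 0; 0, 0] +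
        c₁ ⊗ₜ kacM !![0, 1; 0, 0] + c₂ ⊗ₜ kacM !![0, 0; 1, 0] + c₃ ⊗ₜ kacM !![0, 0; 0, 1]) := by
    let S : Submodule k (Cayley k ⊗[k] Kac k) :=
      { carrier := {z | ∃ a c₀ c₁ c₂ c₃ : Cayley k, cayleyTr a = 0 ∧ cayleyTr c₀ = 0 ∧
          cayleyTr c₁ = 0 ∧ cayleyTr c₂ = 0 ∧ cayleyTr c₃ = 0 ∧ z = a ⊗ₜ kacE +
          (c₀ ⊗ₜ kacM !![1, 0; 0, 0] + c₁ ⊗ₜ kacM !![0, 1; 0, 0] + c₂ ⊗ₜ kacM !![0, 0; 1, 0]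
            + c₃ ⊗ₜ kacM !![0, 0; 0, 1])}
        add_mem' := by
          rintro _ _ ⟨a, c₀, c₁, c₂, c₃, ha, h0, h1, h2, h3, rfl⟩
            ⟨a', c₀', c₁', c₂', c₃', ha', h0', h1', h2', h3', rfl⟩
          refine ⟨a + a', c₀ + c₀', c₁ + c₁', c₂ + c₂', c₃ + c₃', by rw [map_add, ha, ha', add_zero],
            by rw [map_add, h0, h0', add_zero], by rw [map_add, h1, h1', add_zero],
            by rw [map_add, h2, h2', add_zero], by rw [map_add, h3, h3', add_zero], ?_⟩
          simp only [TensorProduct.add_tmul]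
          abel
        zero_mem' := ⟨0, 0, 0, 0, 0, map_zero _, map_zero _, map_zero _, map_zero _, map_zero _,
          by simp⟩
        smul_mem' := by
          rintro c _ ⟨a, c₀, c₁, c₂, c₃, ha, h0, h1, h2, h3, rfl⟩
          refine ⟨c • a, c • c₀, c • c₁, c • c₂, c • c₃, by rw [map_smul, ha, smul_zero],
            by rw [map_smul, h0, smul_zero], by rw [map_smul, h1, smul_zero],
            by rw [map_smul, h2, smul_zero], by rw [map_smul, h3, smul_zero], ?_⟩
          simp only [smul_add, TensorProduct.smul_tmul'] }
    suffices hle : Submodule.map₂ (TensorProduct.mk k (Cayley k) (Kac k))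
        (traceZero (cayleyNorm k) (cayleyOne k)) (kacGr k 0 ⊓ LinearMap.ker (kacTrace k)) ≤ S from
      hle hz
    refine Submodule.map₂_le.2 fun a ha x hx => ?_
    obtain ⟨α, c, M, rfl⟩ := kacGr_zero_cases hx.1
    have hα : α = 0 := by
      have := hx.2
      simpa [kacTrace_E, kacTrace_M, kacTrace_one] using this
    subst hα
    rw [mem_traceZero] at ha
    have hs (r : k) : cayleyTr (r • a) = 0 := by rw [map_smul, ha, smul_zero]
    refine ⟨c • a, M 0 0 • a, M 0 1 • a, M 1 0 • a, M 1 1 • a, hs _, hs _, hs _, hs _, hs _, ?_⟩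
    rw [zero_smul, zero_add, kacM_eq_sum M]
    exact tmul_sum_smul a c (M 0 0) (M 0 1) (M 1 0) (M 1 1) kacE _ _ _ _
  obtain ⟨a, c₀, c₁, c₂, c₃, ha, h0, h1, h2, h3, rfl⟩ := hz'
  refine ⟨D, a, c₀, c₁, c₂, c₃, A, B, hD, ha, h0, h1, h2, h3, hA, hB, ?_⟩
  refine Prod.ext ?_ (Prod.ext ?_ ?_)
  · simp [evD, evA, evM, evK]
  · simp [evD, evA, evM, evK]
  · simp [evD, evA, evM, evK, ← hAB]

theorem even_le_span : titsCayleyKac k 0 ≤ Submodule.span k {X | EvenGen X} := by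
  intro X hX
  obtain ⟨D, a, c₀, c₁, c₂, c₃, A, B, hD, ha, h0, h1, h2, h3, hA, hB, rfl⟩ := even_decomp hX
  have hs {X : TitsCK k} (h : EvenGen X) : X ∈ Submodule.span k {X | EvenGen X} :=
    Submodule.subset_span h
  exact add_mem (add_mem (add_mem (hs (.D hD)) (hs (.A ha))) (add_mem (add_mem (add_mem
    (hs (.M h0 _)) (hs (.M h1 _))) (hs (.M h2 _))) (hs (.M h3 _)))) (hs (.K hA hB))

end TitsSpaces

/-! ### The products of the generators. -/

section TitsTable

variable {k : Type*} [Field k]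

/-- The product of the Tits construction of the Cayley and Kac algebras, as a bilinear map. -/
def ckBracket (i j : ZMod 2) : TitsCK k →ₗ[k] TitsCK k →ₗ[k] TitsCK k :=
  titsBilin (cayleyMul k) (cayleyNorm k) (kacMul k) (kacOne k) (kacTrace k) i j

theorem ckBracket_apply (i j : ZMod 2) (X Y : TitsCK k) :
    ckBracket (k := k) i j X Y = titsCayleyKacBracket k i j X Y := rfl

theorem titsBilin_pure_even {C J : Type*} [AddCommGroup C] [Module k C] [AddCommGroup J]
    [Module k J] (m : C →ₗ[k] C →ₗ[k] C) (n : QuadraticForm k C) (p : J →ₗ[k] J →ₗ[k] J)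
    (u : J) (t : J →ₗ[k] k) {i j : ZMod 2} (hij : koszulSign i j = 1) (D D' : Module.End k C)
    (a b : C) (x y : J) (d d' : Module.End k J) :
    titsBilin m n p u t i j (D, a ⊗ₜ x, d) (D', b ⊗ₜ y, d') =
      (D * D' - D' * D + t (p x y) • innerDer m a b,
        D b ⊗ₜ y - D' a ⊗ₜ x + b ⊗ₜ d y - a ⊗ₜ d' x
          + algComm m a b ⊗ₜ (p x y - t (p x y) • u),
        d * d' + (-1 : k) • (d' * d) + (-(2 * n.polarBilin a b)) • leftComm p 1 x y) := by
  rw [titsBilin_pure, hij, one_smul, one_smul, neg_smul, one_smul, neg_smul, sub_eq_add_neg (d * d'),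
    sub_eq_add_neg (d * d' + _)]

theorem titsBilin_pure_odd {C J : Type*} [AddCommGroup C] [Module k C] [AddCommGroup J]
    [Module k J] (m : C →ₗ[k] C →ₗ[k] C) (n : QuadraticForm k C) (p : J →ₗ[k] J →ₗ[k] J)
    (u : J) (t : J →ₗ[k] k) (a b : C) (x y : J) (d d' : Module.End k J) :
    titsBilin m n p u t 1 1 (0, a ⊗ₜ x, d) (0, b ⊗ₜ y, d') =
      (t (p x y) • innerDer m a b,
        b ⊗ₜ d y + a ⊗ₜ d' x + algComm m a b ⊗ₜ (p x y - t (p x y) • u),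
        d * d' + d' * d + (-(2 * n.polarBilin a b)) • leftComm p (-1) x y) := by
  rw [titsBilin_pure, koszulSign_one_one]
  simp [sub_eq_add_neg]

theorem ckBracket_pure {i j : ZMod 2} (hij : koszulSign i j = 1) (D D' : Module.End k (Cayley k))
    (a b : Cayley k) (x y : Kac k) (d d' : Module.End k (Kac k)) :
    ckBracket (k := k) i j (D, a ⊗ₜ x, d) (D', b ⊗ₜ y, d') =
      (D * D' - D' * D + kacTrace k (kacMul k x y) • innerDer (cayleyMul k) a b,
        D b ⊗ₜ y - D' a ⊗ₜ x + b ⊗ₜ d y - a ⊗ₜ d' x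
          + algComm (cayleyMul k) a b ⊗ₜ (kacMul k x y - kacTrace k (kacMul k x y) • kacOne k),
        d * d' + (-1 : k) • (d' * d) +
          (-(2 * (cayleyNorm k).polarBilin a b)) • leftComm (kacMul k) 1 x y) :=
  titsBilin_pure_even _ _ _ _ _ hij _ _ _ _ _ _ _ _

theorem ckBracket_pure_odd (a b : Cayley k) (x y : Kac k) (d d' : Module.End k (Kac k)) :
    ckBracket (k := k) 1 1 (0, a ⊗ₜ x, d) (0, b ⊗ₜ y, d') =
      (kacTrace k (kacMul k x y) • innerDer (cayleyMul k) a b,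
        b ⊗ₜ d y + a ⊗ₜ d' x
          + algComm (cayleyMul k) a b ⊗ₜ (kacMul k x y - kacTrace k (kacMul k x y) • kacOne k),
        d * d' + d' * d +
          (-(2 * (cayleyNorm k).polarBilin a b)) • leftComm (kacMul k) (-1) x y) :=
  titsBilin_pure_odd _ _ _ _ _ _ _ _ _ _ _

variable [CharP k 5]

theorem bracket_D_D (D D' : Module.End k (Cayley k)) :
    ckBracket (k := k) 0 0 (evD D) (evD D') = evD (D * D' - D' * D) := by
  rw [evD, evD, ckBracket_pure (koszulSign_zero_left 0)]
  refine Prod.ext ?_ (Prod.ext ?_ ?_) <;> simp [evD]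

theorem bracket_D_A (D : Module.End k (Cayley k)) (a : Cayley k) :
    ckBracket (k := k) 0 0 (evD D) (evA a) = evA (D a) := by
  rw [evD, evA, ckBracket_pure (koszulSign_zero_left 0)]
  refine Prod.ext ?_ (Prod.ext ?_ ?_) <;> simp [evA]

theorem bracket_D_M (D : Module.End k (Cayley k)) (a : Cayley k) (M : Matrix (Fin 2) (Fin 2) k) :
    ckBracket (k := k) 0 0 (evD D) (evM a M) = evM (D a) M := by
  rw [evD, evM, ckBracket_pure (koszulSign_zero_left 0)]
  refine Prod.ext ?_ (Prod.ext ?_ ?_) <;> simp [evM]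

theorem bracket_D_K (D : Module.End k (Cayley k)) (A B : Matrix (Fin 2) (Fin 2) k) :
    ckBracket (k := k) 0 0 (evD D) (evK A B) = 0 := by
  rw [evD, evK, ckBracket_pure (koszulSign_zero_left 0)]
  refine Prod.ext ?_ (Prod.ext ?_ ?_) <;> simp

theorem bracket_A_A (a b : Cayley k) : ckBracket (k := k) 0 0 (evA a) (evA b) =
    evD ((2 : k) • innerDer (cayleyMul k) a b) + evA (algComm (cayleyMul k) a b) := by
  rw [evA, evA, ckBracket_pure (koszulSign_zero_left 0), leftComm_E_E]
  refine Prod.ext ?_ (Prod.ext ?_ ?_) <;>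
    simp [evD, evA, kacMul_E_E, kacTrace_E, kacTrace_one]

theorem bracket_A_M (a b : Cayley k) (M : Matrix (Fin 2) (Fin 2) k) :
    ckBracket (k := k) 0 0 (evA a) (evM b M) = evM (-algComm (cayleyMul k) a b) M := by
  rw [evA, evM, ckBracket_pure (koszulSign_zero_left 0), leftComm_E_M]
  refine Prod.ext ?_ (Prod.ext ?_ ?_) <;>
    simp [evM, kacMul_E_M, kacTrace_M, TensorProduct.neg_tmul, TensorProduct.tmul_neg]

theorem bracket_A_K (a : Cayley k) (A B : Matrix (Fin 2) (Fin 2) k) :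
    ckBracket (k := k) 0 0 (evA a) (evK A B) = 0 := by
  rw [evA, evK, ckBracket_pure (koszulSign_zero_left 0)]
  refine Prod.ext ?_ (Prod.ext ?_ ?_) <;> simp [kacEven_E]

theorem tmul_smul_neg {C J : Type*} [AddCommGroup C] [Module k C] [AddCommGroup J] [Module k J]
    (c : k) (a : C) (x : J) : a ⊗ₜ[k] (-(c • x)) = (-(c • a)) ⊗ₜ x := by
  rw [TensorProduct.tmul_neg, TensorProduct.tmul_smul, TensorProduct.neg_tmul,
    TensorProduct.smul_tmul']

theorem bracket_M_M (a b : Cayley k) (M N : Matrix (Fin 2) (Fin 2) k) :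
    ckBracket (k := k) 0 0 (evM a M) (evM b N) =
      evD ((2 * detPolar M N) • innerDer (cayleyMul k) a b)
        + evA (-(detPolar M N • algComm (cayleyMul k) a b))
        + evK ((-(2 * (cayleyNorm k).polarBilin a b)) • brMat M N)
          ((-(2 * (cayleyNorm k).polarBilin a b)) • brMat M.transpose N.transpose) := by
  rw [evM, evM, ckBracket_pure (koszulSign_zero_left 0), leftComm_M_M, kacMul_M_M]
  refine Prod.ext ?_ (Prod.ext ?_ ?_)
  · simp [evD, evA, evK, kacTrace_E, kacTrace_one, mul_comm]
  · simp [evD, evA, evK, kacTrace_E, kacTrace_one]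
    rw [← tmul_smul_neg]
    congr 1
    module
  · simp [evD, evA, evK, -neg_smul, kacEven_smul]

theorem bracket_M_K (a : Cayley k) (M A B : Matrix (Fin 2) (Fin 2) k) :
    ckBracket (k := k) 0 0 (evM a M) (evK A B) = evM (-a) (pairAct A B M) := by
  rw [evM, evK, ckBracket_pure (koszulSign_zero_left 0)]
  refine Prod.ext ?_ (Prod.ext ?_ ?_) <;> simp [evM, kacEven_M, TensorProduct.neg_tmul]

theorem bracket_K_K (A B A' B' : Matrix (Fin 2) (Fin 2) k) :
    ckBracket (k := k) 0 0 (evK A B) (evK A' B') = evK (A * A' - A' * A) (B * B' - B' * B) := by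
  rw [evK, evK, ckBracket_pure (koszulSign_zero_left 0)]
  refine Prod.ext ?_ (Prod.ext ?_ ?_)
  · simp [evK]
  · simp [evK]
  · simp [evK, -neg_smul, ← kacEven_comm]

theorem bracket_D_L {D : Module.End k (Cayley k)} (hD : D ∈ derSpace (cayleyMul k)) (b : Cayley k)
    (u : Fin 2 → k) : ckBracket (k := k) 0 1 (evD D) (odL b u) = odL (D b) u := by
  rw [evD, odL, ckBracket_pure (koszulSign_zero_left 1), odL, der_tr hD, imPart_of_tr (der_tr hD b)]
  refine Prod.ext ?_ (Prod.ext ?_ ?_) <;> simp [imPart_apply, der_one hD, kacOdd]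

theorem bracket_D_R {D : Module.End k (Cayley k)} (hD : D ∈ derSpace (cayleyMul k)) (b : Cayley k)
    (u : Fin 2 → k) : ckBracket (k := k) 0 1 (evD D) (odR b u) = odR (D b) u := by
  rw [evD, odR, ckBracket_pure (koszulSign_zero_left 1), odR, der_tr hD, imPart_of_tr (der_tr hD b)]
  refine Prod.ext ?_ (Prod.ext ?_ ?_) <;> simp [imPart_apply, der_one hD, kacOdd]

theorem bracket_K_L {A B : Matrix (Fin 2) (Fin 2) k} (hA : A.trace = 0) (hB : B.trace = 0)
    (b : Cayley k) (u : Fin 2 → k) : ckBracket (k := k) 0 1 (evK A B) (odL b u) = odL b (A.mulVec u) := by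
  rw [evK, odL, ckBracket_pure (koszulSign_zero_left 1), odL, kacEven_kacOdd_comm hA hB]
  refine Prod.ext ?_ (Prod.ext ?_ ?_) <;> simp [kacEven_L, Matrix.mulVec_neg, Matrix.mulVec_smul]

theorem bracket_K_R {A B : Matrix (Fin 2) (Fin 2) k} (hA : A.trace = 0) (hB : B.trace = 0)
    (b : Cayley k) (u : Fin 2 → k) : ckBracket (k := k) 0 1 (evK A B) (odR b u) = odR b (B.mulVec u) := by
  rw [evK, odR, ckBracket_pure (koszulSign_zero_left 1), odR, kacEven_kacOdd_comm hA hB]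
  refine Prod.ext ?_ (Prod.ext ?_ ?_) <;> simp [kacEven_R, Matrix.mulVec_neg, Matrix.mulVec_smul]

theorem tr_leftAddTwoRight {a : Cayley k} (ha : cayleyTr a = 0) (b : Cayley k) :
    cayleyTr (leftAddTwoRight a b) = 2 * (cayleyNorm k).polarBilin a b := by
  obtain ⟨a0, a1, a2, a3, a4, a5, a6, rfl⟩ := exists_zorn_of_tr ha
  obtain ⟨b0, b1, b2, b3, b4, b5, b6, b7, rfl⟩ := exists_zorn b
  simp only [leftAddTwoRight_apply, zorn_mul, zorn_smul, zorn_add, cayleyTr_zorn, zorn_polar]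
  grind

/-- With `tr_leftAddTwoRight` this gives the two components of (L_a + 2R_a)b in C = C⁰ ⊕ k1. Modulo
5 they are the coefficients that the Tits product produces in C⁰⊗U and in the odd inner derivations.
-/
theorem imPart_leftAddTwoRight {a : Cayley k} (ha : cayleyTr a = 0) (b : Cayley k) :
    imPart (leftAddTwoRight a b) =
      (2 : k) • algComm (cayleyMul k) a b - cayleyTr b • a := by
  obtain ⟨a0, a1, a2, a3, a4, a5, a6, rfl⟩ := exists_zorn_of_tr ha
  obtain ⟨b0, b1, b2, b3, b4, b5, b6, b7, rfl⟩ := exists_zorn b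
  simp only [imPart_apply, cayleyOne_eq_zorn, algComm_apply_apply, leftAddTwoRight_apply, zorn_mul,
    zorn_smul, zorn_add, zorn_sub, cayleyTr_zorn, zorn_eq_iff]
  refine ⟨?_, ?_, ?_, ?_, ?_, ?_, ?_, ?_⟩ <;> grind

theorem algComm_imPart (a b : Cayley k) :
    algComm (cayleyMul k) a (imPart b) = algComm (cayleyMul k) a b := by
  rw [imPart_apply, algComm_apply_apply, algComm_apply_apply, map_add, map_add, map_smul, map_smul,
    LinearMap.add_apply, LinearMap.smul_apply, cayleyMul_one_left, cayleyMul_one_right]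
  abel

theorem polar_imPart {a : Cayley k} (ha : cayleyTr a = 0) (b : Cayley k) :
    (cayleyNorm k).polarBilin a (imPart b) = (cayleyNorm k).polarBilin a b := by
  rw [imPart_apply, map_add, map_smul, polar_comm a (cayleyOne k), polar_one_left, ha, smul_zero,
    add_zero]

theorem matR_neg (M : Matrix (Fin 2) (Fin 2) k) (u : Fin 2 → k) : matR M (-u) = -matR M u := by
  ext; simp [matR]; ring

theorem matL_neg (M : Matrix (Fin 2) (Fin 2) k) (u : Fin 2 → k) : matL M (-u) = -matL M u := by
  ext; simp [matL]; ring

theorem matR_smul (M : Matrix (Fin 2) (Fin 2) k) (c : k) (u : Fin 2 → k) :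
    matR M (c • u) = c • matR M u := by
  ext; simp [matR]; ring

theorem matL_smul (M : Matrix (Fin 2) (Fin 2) k) (c : k) (u : Fin 2 → k) :
    matL M (c • u) = c • matL M u := by
  ext; simp [matL]; ring

/-- Here C⁰⊗U and the odd inner derivations fuse into C⊗U: neither is stable under a⊗(e⊗e), but
together they carry the operator -(L_a + 2R_a) on C. -/
theorem bracket_A_L {a : Cayley k} (ha : cayleyTr a = 0) (b : Cayley k) (u : Fin 2 → k) :
    ckBracket (k := k) 0 1 (evA a) (odL b u) = odL (-leftAddTwoRight a b) u := by
  rw [evA, odL, ckBracket_pure (koszulSign_zero_left 1), odL, map_neg, map_neg,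
    tr_leftAddTwoRight ha, imPart_leftAddTwoRight ha, leftComm_E_L, algComm_imPart, polar_imPart ha,
    kacMul_E_L]
  refine Prod.ext ?_ (Prod.ext ?_ ?_)
  · simp [kacTrace_L]
  · simp only [kacTrace_L, kacOdd_E, map_neg, map_smul, map_zero, smul_zero, neg_zero, zero_smul,
      sub_zero, neg_neg, LinearMap.zero_apply, TensorProduct.zero_tmul, TensorProduct.tmul_zero, add_zero, zero_sub,
      zero_add, TensorProduct.tmul_smul, TensorProduct.tmul_neg, TensorProduct.smul_tmul',
      ← TensorProduct.add_tmul, ← TensorProduct.neg_tmul]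
    congr 1
    match_scalars <;> grind
  · simp only [zero_mul, smul_eq_mul, mul_zero, smul_zero, add_zero, zero_add, ← kacOdd_smul]
    congr 1
    match_scalars
    grind

theorem bracket_A_R {a : Cayley k} (ha : cayleyTr a = 0) (b : Cayley k) (u : Fin 2 → k) :
    ckBracket (k := k) 0 1 (evA a) (odR b u) = odR (-leftAddTwoRight a b) u := by
  rw [evA, odR, ckBracket_pure (koszulSign_zero_left 1), odR, map_neg, map_neg,
    tr_leftAddTwoRight ha, imPart_leftAddTwoRight ha, leftComm_E_R, (algComm _ _).map_smul, algComm_imPart,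
    LinearMap.map_smul (_ : Cayley k →ₗ[k] k), polar_imPart ha, kacMul_E_R]
  refine Prod.ext ?_ (Prod.ext ?_ ?_)
  · simp [kacTrace_R]
  · simp only [kacTrace_R, kacOdd_E, map_neg, map_smul, map_zero, smul_zero, neg_zero, zero_smul,
      sub_zero, neg_neg, LinearMap.zero_apply, TensorProduct.zero_tmul, TensorProduct.tmul_zero, add_zero, zero_sub,
      zero_add, TensorProduct.tmul_smul, TensorProduct.tmul_neg, TensorProduct.smul_tmul',
      ← TensorProduct.add_tmul, ← TensorProduct.neg_tmul]
    congr 1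
    match_scalars <;> grind
  · simp only [zero_mul, smul_eq_mul, mul_zero, smul_zero, add_zero, zero_add, ← kacOdd_smul]
    congr 1
    match_scalars
    grind

theorem imPart_mul {a : Cayley k} (ha : cayleyTr a = 0) (b : Cayley k) :
    imPart (cayleyMul k a b) =
      (3 : k) • algComm (cayleyMul k) a b + (3 * cayleyTr b) • a := by
  obtain ⟨a0, a1, a2, a3, a4, a5, a6, rfl⟩ := exists_zorn_of_tr ha
  obtain ⟨b0, b1, b2, b3, b4, b5, b6, b7, rfl⟩ := exists_zorn b
  simp only [imPart_apply, cayleyOne_eq_zorn, algComm_apply_apply, zorn_mul,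
    zorn_smul, zorn_add, zorn_sub, cayleyTr_zorn, zorn_eq_iff]
  refine ⟨?_, ?_, ?_, ?_, ?_, ?_, ?_, ?_⟩ <;> grind

theorem tr_mul {a : Cayley k} (ha : cayleyTr a = 0) (b : Cayley k) :
    cayleyTr (cayleyMul k a b) = -(cayleyNorm k).polarBilin a b := by
  rw [← polar_one_left, polar_comm, polar_mul_left ha, cayleyMul_one_right, polar_comm]

/-- The trace zero part of ab is ([a,b] + tr(b)a)/2 and its trace is -n(a,b). These are the
coefficients occurring in the two summands, so a⊗M acts by left multiplication and passes to the
other copy of U. -/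
theorem bracket_M_L {a : Cayley k} (ha : cayleyTr a = 0) (M : Matrix (Fin 2) (Fin 2) k)
    (b : Cayley k) (u : Fin 2 → k) : ckBracket (k := k) 0 1 (evM a M) (odL b u) =
      odR ((-2 : k) • cayleyMul k a b) (matR M u) := by
  rw [evM, odL, ckBracket_pure (koszulSign_zero_left 1), odR, imPart.map_smul, cayleyTr.map_smul,
    tr_mul ha, imPart_mul ha, leftComm_M_L, algComm_imPart, polar_imPart ha, kacMul_M_L]
  refine Prod.ext ?_ (Prod.ext ?_ ?_)
  · simp [kacTrace_R]
  · simp only [kacTrace_R, kacOdd_M, matL_zero, matR_neg, matR_smul, map_neg, map_smul, map_zero, smul_zero, neg_zero, zero_smul,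
      sub_zero, neg_neg, LinearMap.zero_apply, TensorProduct.zero_tmul, TensorProduct.tmul_zero, add_zero, zero_sub,
      zero_add, TensorProduct.tmul_smul, TensorProduct.tmul_neg, TensorProduct.smul_tmul',
      ← TensorProduct.add_tmul, ← TensorProduct.neg_tmul]
    congr 1
    match_scalars <;> grind
  · simp only [zero_mul, smul_eq_mul, mul_zero, smul_zero, add_zero, zero_add, ← kacOdd_smul]
    congr 1
    match_scalars
    grind

theorem bracket_M_R {a : Cayley k} (ha : cayleyTr a = 0) (M : Matrix (Fin 2) (Fin 2) k)
    (b : Cayley k) (u : Fin 2 → k) : ckBracket (k := k) 0 1 (evM a M) (odR b u) =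
      odL ((-2 : k) • cayleyMul k a b) (matL M u) := by
  rw [evM, odR, ckBracket_pure (koszulSign_zero_left 1), odL, imPart.map_smul, cayleyTr.map_smul,
    tr_mul ha, imPart_mul ha, leftComm_M_R, (algComm _ _).map_smul, algComm_imPart,
    LinearMap.map_smul (_ : Cayley k →ₗ[k] k), polar_imPart ha, kacMul_M_R]
  refine Prod.ext ?_ (Prod.ext ?_ ?_)
  · simp [kacTrace_L]
  · simp only [kacTrace_L, kacOdd_M, matR_zero, matL_neg, matL_smul, map_neg, map_smul, map_zero, smul_zero, neg_zero, zero_smul,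
      sub_zero, neg_neg, LinearMap.zero_apply, TensorProduct.zero_tmul, TensorProduct.tmul_zero, add_zero, zero_sub,
      zero_add, TensorProduct.tmul_smul, TensorProduct.tmul_neg, TensorProduct.smul_tmul',
      ← TensorProduct.add_tmul, ← TensorProduct.neg_tmul]
    congr 1
    match_scalars <;> grind
  · simp only [zero_mul, smul_eq_mul, mul_zero, smul_zero, add_zero, zero_add, ← kacOdd_smul]
    congr 1
    match_scalars
    grind

theorem symMat_smul_smul (c d : k) (u v : Fin 2 → k) :
    symMat (c • u) (d • v) = (c * d) • symMat u v := by
  apply mat_two_ext <;> simp [symMat] <;> ring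

theorem symMat_zero_left (v : Fin 2 → k) : symMat 0 v = 0 := by
  apply mat_two_ext <;> simp [symMat]

theorem symMat_zero_right (v : Fin 2 → k) : symMat v 0 = 0 := by
  apply mat_two_ext <;> simp [symMat]

theorem altForm_smul_left (c : k) (u v : Fin 2 → k) : altForm (c • u) v = c * altForm u v := by
  simp [altForm]; ring

theorem altForm_swap (u v : Fin 2 → k) : altForm u v = -altForm v u := by
  simp [altForm]; ring

theorem innerDer_imPart (a b : Cayley k) :
    innerDer (cayleyMul k) (imPart a) (imPart b) = innerDer (cayleyMul k) a b := by
  refine LinearMap.ext fun c => ?_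
  simp only [innerDer_apply, algComm_apply_apply, imPart_apply, map_add, map_smul, map_sub,
    LinearMap.add_apply, LinearMap.smul_apply, LinearMap.sub_apply, cayleyMul_one_left,
    cayleyMul_one_right]
  module

theorem algComm_imPart_imPart (a b : Cayley k) :
    algComm (cayleyMul k) (imPart a) (imPart b) = algComm (cayleyMul k) a b := by
  simp only [algComm_apply_apply, imPart_apply, map_add, map_smul,
    LinearMap.add_apply, LinearMap.smul_apply, cayleyMul_one_left, cayleyMul_one_right]
  module

theorem kacEven_zero : kacEven (0 : Matrix (Fin 2) (Fin 2) k) 0 = 0 := by simp [kacEven]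

theorem kac_star (c : k) : c • (kacE - kacOne k) - kacTrace k (c • (kacE - kacOne k)) • kacOne k =
    c • kacE := by
  rw [map_smul, map_sub, kacTrace_E, kacTrace_one]
  match_scalars <;> ring

/-- The coefficient of `symMat u v` has two sources: -2tr(a)tr(b) from the bracket of the two odd
derivations, and -4n from the term -2n(a,b)[L_x, L_y]. They combine into the full norm by
`two_tr_mul_add_polar`. -/
theorem bracket_L_L (a b : Cayley k) (u v : Fin 2 → k) : ckBracket (k := k) 1 1 (odL a u) (odL b v) =
    evD ((-altForm u v) • innerDer (cayleyMul k) a b)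
      + evA (altForm u v • (algComm (cayleyMul k) a b + (2 * cayleyTr a) • imPart b
        - (2 * cayleyTr b) • imPart a))
      + evK ((-(2 * cayleyTr a * cayleyTr b) - 4 * (cayleyNorm k).polarBilin (imPart a) (imPart b))
          • symMat u v) 0 := by
  rw [odL, odL, ckBracket_pure_odd, leftComm_L_L, kacOdd_comm, kacMul_L_L, innerDer_imPart,
    algComm_imPart_imPart, ← neg_smul, ← neg_smul, kacOdd_L, kacOdd_L, symMat_smul_smul,
    symMat_zero_left, vecMulVec_zero_right, vecMulVec_zero_right, map_zero, altForm_smul_left,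
    altForm_smul_left, altForm_swap v u]
  refine Prod.ext ?_ (Prod.ext ?_ ?_)
  · simp [evD, evA, evK, kacTrace_E, kacTrace_one]
  · simp only [evD, evA, evK, Prod.snd_add, Prod.fst_add, sub_zero, add_zero, zero_add, kac_star,
      TensorProduct.tmul_zero,
      TensorProduct.tmul_smul, TensorProduct.tmul_neg, TensorProduct.smul_tmul',
      ← TensorProduct.add_tmul, ← TensorProduct.neg_tmul]
    congr 1
    match_scalars <;> grind
  · simp only [evD, evA, evK, Prod.snd_add, zero_add, smul_zero, ← kacEven_smul, ← kacEven_add]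
    congr 1
    module

theorem bracket_R_R (a b : Cayley k) (u v : Fin 2 → k) : ckBracket (k := k) 1 1 (odR a u) (odR b v) =
    evD (altForm u v • innerDer (cayleyMul k) a b)
      + evA ((-altForm u v) • (algComm (cayleyMul k) a b + (2 * cayleyTr a) • imPart b
        - (2 * cayleyTr b) • imPart a))
      + evK 0 ((2 * cayleyTr a * cayleyTr b + 4 * (cayleyNorm k).polarBilin (imPart a) (imPart b))
          • symMat u v) := by
  rw [odR, odR, ckBracket_pure_odd, leftComm_R_R, kacOdd_comm, kacMul_R_R, ← neg_smul, ← neg_smul,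
    kacOdd_R, kacOdd_R, symMat_smul_smul,
    symMat_zero_left, vecMulVec_zero_left, vecMulVec_zero_left, map_zero, altForm_smul_left,
    altForm_smul_left, altForm_swap v u]
  simp only [(innerDer _).map_smul, (innerDer _ _).map_smul, LinearMap.smul_apply, innerDer_imPart,
    (algComm _).map_smul, (algComm _ _).map_smul, algComm_imPart_imPart,
    LinearMap.map_smul (_ : Cayley k →ₗ[k] k), LinearMap.map_smul (_ : Cayley k →ₗ[k] Cayley k →ₗ[k] k),
    smul_eq_mul]
  refine Prod.ext ?_ (Prod.ext ?_ ?_)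
  · simp only [evD, evA, evK, map_smul, map_sub, kacTrace_E, kacTrace_one, Prod.fst_add, add_zero,
      smul_eq_mul]
    match_scalars
    grind
  · simp only [evD, evA, evK, Prod.snd_add, Prod.fst_add, sub_zero, add_zero, zero_add, kac_star,
      TensorProduct.tmul_zero,
      TensorProduct.tmul_smul, TensorProduct.tmul_neg, TensorProduct.smul_tmul',
      ← TensorProduct.add_tmul, ← TensorProduct.neg_tmul]
    congr 1
    match_scalars <;> grind
  · simp only [evD, evA, evK, Prod.snd_add, zero_add, smul_zero, ← kacEven_smul, ← kacEven_add]
    congr 1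
    match_scalars
    grind

theorem bracket_L_R (a b : Cayley k) (u v : Fin 2 → k) : ckBracket (k := k) 1 1 (odL a u) (odR b v) =
    evM ((2 : k) • (algComm (cayleyMul k) a b + cayleyTr a • imPart b - cayleyTr b • imPart a))
      (Matrix.vecMulVec u v) := by
  rw [odL, odR, ckBracket_pure_odd, leftComm_L_R, kacOdd_comm, kacMul_L_R, ← neg_smul, ← neg_smul,
    kacOdd_R, kacOdd_L, symMat_zero_right, symMat_zero_left]
  simp only [(algComm _ _).map_smul, algComm_imPart_imPart]
  refine Prod.ext ?_ (Prod.ext ?_ ?_)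
  · simp [evM, kacTrace_M]
  · simp only [evM, altForm_zero_left, mul_zero, zero_smul, neg_zero, zero_add, zero_sub,
      Matrix.smul_vecMulVec, Matrix.vecMulVec_smul, map_neg, map_smul, kacTrace_M, sub_zero,
      TensorProduct.tmul_smul, TensorProduct.tmul_neg, TensorProduct.smul_tmul',
      ← TensorProduct.add_tmul, ← TensorProduct.neg_tmul]
    congr 1
    match_scalars <;> grind
  · simp only [evM, smul_zero, kacEven_zero, add_zero]

end TitsTable

/-! ### Auxiliary bilinear maps. -/

section Bilinear

variable {k C J P : Type*} [Field k] [AddCommGroup C] [Module k C] [AddCommGroup J] [Module k J]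
  [AddCommMonoid P] [Module k P]

/-- The bilinear map with values `B(x, ·) y - B(y, ·) x`. -/
def wedgeEnd (B : C →ₗ[k] C →ₗ[k] k) : C →ₗ[k] C →ₗ[k] Module.End k C :=
  LinearMap.mk₂ k (fun x y => (B x).smulRight y - (B y).smulRight x)
    (by intro x x' y; ext w; simp [add_smul]; abel)
    (by intro c x y; ext w; simp [smul_sub, mul_smul, smul_comm c])
    (by intro x y y'; ext w; simp [add_smul]; abel)
    (by intro c x y; ext w; simp [smul_sub, mul_smul, smul_comm c])

/-- The bilinear map `(a, x) ↦ f(x) g(a)`. -/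
def smulBilin (f : J →ₗ[k] k) (g : C →ₗ[k] P) : C →ₗ[k] J →ₗ[k] P :=
  LinearMap.mk₂ k (fun a x => f x • g a) (by intros; simp) (by intro c a x; simp [smul_comm c])
    (by intros; simp [add_smul]) (by intros; simp [mul_smul])

end Bilinear

/-! ### The comparison maps to so(W) and to the model of the spin module. -/

section Comparison

variable {k : Type*} [Field k] [CharP k 5]

/-- The bilinear map `(x, y) ↦ σ_{x,y}`. -/
def sigmaBilin : OddSpace k 5 →ₗ[k] OddSpace k 5 →ₗ[k] Module.End k (OddSpace k 5) :=
  wedgeEnd (oddForm k 5).polarBilin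

theorem sigmaBilin_apply (x y : OddSpace k 5) : sigmaBilin x y = sigmaMap k 5 x y := rfl

/-- The extension to `W` of an endomorphism of the Cayley algebra that preserves trace zero
elements. -/
def conjCayley : Module.End k (Cayley k) →ₗ[k] Module.End k (OddSpace k 5) where
  toFun D := ofCayley ∘ₗ D ∘ₗ toCayley
  map_add' D E := by rw [LinearMap.add_comp, LinearMap.comp_add]
  map_smul' c D := by rw [LinearMap.smul_comp, LinearMap.comp_smul]; rfl

theorem conjCayley_apply (D : Module.End k (Cayley k)) (w : OddSpace k 5) :
    conjCayley D w = ofCayley (D (toCayley w)) := rfl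

/-- The extension to `W` of an endomorphism of `U ⊗ U`. -/
def conjMat : Module.End k (Kac k) →ₗ[k] Module.End k (OddSpace k 5) where
  toFun d := ofMat ∘ₗ coordM ∘ₗ d ∘ₗ kacM ∘ₗ toMat
  map_add' D E := by simp only [LinearMap.add_comp, LinearMap.comp_add]
  map_smul' c D := by simp only [LinearMap.smul_comp, LinearMap.comp_smul]; rfl

theorem conjMat_apply (d : Module.End k (Kac k)) (w : OddSpace k 5) :
    conjMat d w = ofMat (coordM (d (kacM (toMat w)))) := rfl

/-- The comparison map on `C ⊗ J`, as a bilinear map. -/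
def phiMiddle : Cayley k →ₗ[k] Kac k →ₗ[k] Module.End k (OddSpace k 5) :=
  sigmaBilin.compl₁₂ ofCayley (ofMat ∘ₗ coordM)
    + smulBilin coordE ((-1 : k) • conjCayley ∘ₗ algComm (cayleyMul k))

theorem phiMiddle_apply (a : Cayley k) (x : Kac k) : phiMiddle a x =
    sigmaMap k 5 (ofCayley a) (ofMat (coordM x))
      + coordE x • (-1 : k) • conjCayley (algComm (cayleyMul k) a) := rfl

/-- The comparison map from the even part of the Tits construction to `so(W)`. -/
def phiEven : TitsCK k →ₗ[k] Module.End k (OddSpace k 5) :=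
  conjCayley.coprod ((TensorProduct.lift phiMiddle).coprod conjMat)

theorem phiEven_apply (D : Module.End k (Cayley k)) (a : Cayley k) (x : Kac k)
    (d : Module.End k (Kac k)) :
    phiEven (k := k) (D, a ⊗ₜ x, d) = conjCayley D + (phiMiddle a x + conjMat d) := by
  rw [phiEven, LinearMap.coprod_apply, LinearMap.coprod_apply, TensorProduct.lift.tmul]

/-- The comparison map on `C ⊗ J` for the odd part, as a bilinear map. -/
def phiOddMiddle : Cayley k →ₗ[k] Kac k →ₗ[k] SpinModel k :=
  LinearMap.mk₂ k (fun a x => SpinModel.mk (fun i => coordL x i • a)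
      (fun i => (2 * coordR x i) • a))
    (by intros; refine SpinModel.ext (fun i => ?_) (fun i => ?_) <;>
          simp only [SpinModel.add_fst, SpinModel.add_snd, SpinModel.mk_fst, SpinModel.mk_snd] <;>
          module)
    (by intros; refine SpinModel.ext (fun i => ?_) (fun i => ?_) <;>
          simp only [SpinModel.smul_fst, SpinModel.smul_snd, SpinModel.mk_fst, SpinModel.mk_snd] <;>
          module)
    (by intros; refine SpinModel.ext (fun i => ?_) (fun i => ?_) <;>
          simp only [SpinModel.add_fst, SpinModel.add_snd, SpinModel.mk_fst, SpinModel.mk_snd,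
            map_add, Pi.add_apply] <;>
          module)
    (by intros; refine SpinModel.ext (fun i => ?_) (fun i => ?_) <;>
          simp only [SpinModel.smul_fst, SpinModel.smul_snd, SpinModel.mk_fst, SpinModel.mk_snd,
            map_smul, Pi.smul_apply, smul_eq_mul] <;>
          module)

/-- The comparison map on the odd inner derivations. -/
def phiOddDer : Module.End k (Kac k) →ₗ[k] SpinModel k where
  toFun d := phiOddMiddle ((2 : k) • cayleyOne k) (d kacE)
  map_add' d d' := by rw [LinearMap.add_apply, map_add]
  map_smul' c d := by rw [LinearMap.smul_apply, map_smul]; rfl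

theorem phiOddDer_apply (d : Module.End k (Kac k)) :
    phiOddDer d = phiOddMiddle ((2 : k) • cayleyOne k) (d kacE) := rfl

/-- The comparison map from the odd part of the Tits construction to the model of the spin
module. -/
def phiOdd : TitsCK k →ₗ[k] SpinModel k :=
  (LinearMap.coprod (TensorProduct.lift phiOddMiddle) phiOddDer) ∘ₗ LinearMap.snd k _ _

theorem phiOdd_apply (D : Module.End k (Cayley k)) (a : Cayley k) (x : Kac k)
    (d : Module.End k (Kac k)) : phiOdd (k := k) (D, a ⊗ₜ x, d) = phiOddMiddle a x + phiOddDer d := by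
  rw [phiOdd, LinearMap.comp_apply, LinearMap.snd_apply, LinearMap.coprod_apply,
    TensorProduct.lift.tmul]

/-- The element `a ⊗ u` of the first half of the model. -/
def modL (a : Cayley k) (u : Fin 2 → k) : SpinModel k := SpinModel.mk (fun i => u i • a) (fun _ => 0)

/-- The element `a ⊗ u` of the second half of the model. -/
def modR (a : Cayley k) (u : Fin 2 → k) : SpinModel k := SpinModel.mk (fun _ => 0) (fun i => u i • a)

/-- An odd inner derivation is read off from its value at e⊗e. The constants are fitted so that the
derivation contributes the scalar part -2tr(a)1 which `imPart` has added. -/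
theorem phiOdd_L (a : Cayley k) (u : Fin 2 → k) : phiOdd (k := k) (odL a u) = modL a u := by
  rw [odL, phiOdd_apply, phiOddDer_apply, kacOdd_E, map_zero, add_zero]
  refine SpinModel.ext (fun i => ?_) (fun i => ?_) <;>
    simp only [phiOddMiddle, LinearMap.mk₂_apply, SpinModel.add_fst, SpinModel.add_snd,
      SpinModel.mk_fst, SpinModel.mk_snd, coordL_L, coordR_L, modL, Pi.neg_apply, Pi.smul_apply,
      smul_eq_mul, Pi.zero_apply, imPart_apply] <;> module

theorem phiOdd_R (a : Cayley k) (u : Fin 2 → k) : phiOdd (k := k) (odR a u) = modR a u := by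
  rw [odR, phiOdd_apply, phiOddDer_apply, kacOdd_E, map_zero, zero_add]
  refine SpinModel.ext (fun i => ?_) (fun i => ?_) <;>
    simp only [phiOddMiddle, LinearMap.mk₂_apply, SpinModel.add_fst, SpinModel.add_snd,
      SpinModel.mk_fst, SpinModel.mk_snd, coordL_R, coordR_R, modR, Pi.neg_apply, Pi.smul_apply,
      smul_eq_mul, Pi.zero_apply, imPart_apply] <;> match_scalars <;> grind

theorem phiEven_D (D : Module.End k (Cayley k)) : phiEven (k := k) (evD D) = conjCayley D := by
  rw [evD, phiEven_apply, map_zero, map_zero, add_zero, add_zero]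

theorem phiEven_A (a : Cayley k) :
    phiEven (k := k) (evA a) = (-1 : k) • conjCayley (algComm (cayleyMul k) a) := by
  rw [evA, phiEven_apply, map_zero, map_zero, phiMiddle_apply, coordE_E, coordM_E, map_zero,
    ← sigmaBilin_apply, map_zero, add_zero, zero_add, one_smul, zero_add]

theorem phiEven_M (a : Cayley k) (M : Matrix (Fin 2) (Fin 2) k) :
    phiEven (k := k) (evM a M) = sigmaMap k 5 (ofCayley a) (ofMat M) := by
  rw [evM, phiEven_apply, map_zero, map_zero, phiMiddle_apply, coordE_M, coordM_M, add_zero,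
    zero_add, zero_smul, add_zero]

theorem phiEven_K (A B : Matrix (Fin 2) (Fin 2) k) (w : OddSpace k 5) :
    phiEven (k := k) (evK A B) w = ofMat (pairAct A B (toMat w)) := by
  rw [evK, phiEven_apply, map_zero, map_zero, zero_add, zero_add,
    conjMat_apply, kacEven_M, coordM_M]

theorem oddSpace_ext {P : Type*} [AddCommGroup P] [Module k P] {f g : OddSpace k 5 →ₗ[k] P}
    (hC : ∀ a, cayleyTr a = 0 → f (ofCayley a) = g (ofCayley a))
    (hM : ∀ M, f (ofMat M) = g (ofMat M)) : f = g := by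
  refine LinearMap.ext fun w => ?_
  rw [← ofCayley_toCayley_add w, map_add, map_add, hC _ (cayleyTr_toCayley w), hM]

theorem polar_ofCayley {a b : Cayley k} (ha : cayleyTr a = 0) (hb : cayleyTr b = 0) :
    (oddForm k 5).polarBilin (ofCayley a) (ofCayley b) = (cayleyNorm k).polarBilin a b := by
  rw [polar_oddForm, toCayley_ofCayley ha, toCayley_ofCayley hb, toMat_ofCayley, map_zero,
    LinearMap.zero_apply, add_zero]

theorem polar_ofCayley_ofMat (a : Cayley k) (M : Matrix (Fin 2) (Fin 2) k) :
    (oddForm k 5).polarBilin (ofCayley a) (ofMat M) = 0 := by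
  rw [polar_oddForm, toCayley_ofMat, toMat_ofCayley, map_zero, map_zero, LinearMap.zero_apply,
    add_zero]

theorem polar_ofMat_ofCayley (a : Cayley k) (M : Matrix (Fin 2) (Fin 2) k) :
    (oddForm k 5).polarBilin (ofMat M) (ofCayley a) = 0 := by
  rw [oddPolar_comm, polar_ofCayley_ofMat]

theorem polar_ofMat (M N : Matrix (Fin 2) (Fin 2) k) :
    (oddForm k 5).polarBilin (ofMat M) (ofMat N) = detPolar M N := by
  rw [polar_oddForm, toCayley_ofMat, toMat_ofMat, toMat_ofMat, map_zero,
    LinearMap.zero_apply, zero_add]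

theorem tr_algComm (a b : Cayley k) : cayleyTr (algComm (cayleyMul k) a b) = 0 := by
  obtain ⟨a0, a1, a2, a3, a4, a5, a6, a7, rfl⟩ := exists_zorn a
  obtain ⟨b0, b1, b2, b3, b4, b5, b6, b7, rfl⟩ := exists_zorn b
  simp only [algComm_apply_apply, zorn_mul, zorn_sub, cayleyTr_zorn]
  ring

section Values

variable (D : Module.End k (Cayley k)) (a : Cayley k) {b : Cayley k}
  (A B M N : Matrix (Fin 2) (Fin 2) k)

theorem phiEven_D_ofCayley (hb : cayleyTr b = 0) : phiEven (k := k) (evD D) (ofCayley b) = ofCayley (D b) := by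
  rw [phiEven_D, conjCayley_apply, toCayley_ofCayley hb]

theorem phiEven_D_ofMat : phiEven (k := k) (evD D) (ofMat N) = 0 := by
  rw [phiEven_D, conjCayley_apply, toCayley_ofMat, map_zero, map_zero]

theorem phiEven_A_ofCayley (hb : cayleyTr b = 0) :
    phiEven (k := k) (evA a) (ofCayley b) = ofCayley (algComm (cayleyMul k) b a) := by
  rw [phiEven_A, LinearMap.smul_apply, conjCayley_apply, toCayley_ofCayley hb, ← map_smul]
  congr 1
  simp only [algComm_apply_apply]
  module

theorem phiEven_A_ofMat : phiEven (k := k) (evA a) (ofMat N) = 0 := by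
  rw [phiEven_A, LinearMap.smul_apply, conjCayley_apply, toCayley_ofMat, map_zero, map_zero,
    smul_zero]

theorem phiEven_M_ofCayley (ha : cayleyTr a = 0) (hb : cayleyTr b = 0) :
    phiEven (k := k) (evM a M) (ofCayley b) = ofMat ((cayleyNorm k).polarBilin a b • M) := by
  rw [phiEven_M, sigmaMap_apply, polar_ofCayley ha hb, polar_ofMat_ofCayley, zero_smul, sub_zero,
    map_smul]

theorem phiEven_M_ofMat :
    phiEven (k := k) (evM a M) (ofMat N) = ofCayley ((-detPolar M N) • a) := by
  rw [phiEven_M, sigmaMap_apply, polar_ofCayley_ofMat, polar_ofMat, zero_smul, zero_sub,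
    ← LinearMap.map_smul, ← LinearMap.map_neg, neg_smul]

theorem phiEven_K_ofCayley : phiEven (k := k) (evK A B) (ofCayley b) = 0 := by
  have h : pairAct A B 0 = 0 := by apply mat_two_ext <;> simp [pairAct_apply]
  rw [phiEven_K, toMat_ofCayley, h, map_zero]

theorem phiEven_K_ofMat : phiEven (k := k) (evK A B) (ofMat N) = ofMat (pairAct A B N) := by
  rw [phiEven_K, toMat_ofMat]

end Values

theorem phiEven_mem_D {D : Module.End k (Cayley k)} (hD : D ∈ derSpace (cayleyMul k)) :
    phiEven (k := k) (evD D) ∈ soOdd k 5 := by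
  refine mem_so fun x y => ?_
  rw [phiEven_D, conjCayley_apply, conjCayley_apply, polar_oddForm, polar_oddForm,
    toCayley_ofCayley (der_tr hD _), toCayley_ofCayley (der_tr hD _), toMat_ofCayley,
    toMat_ofCayley, der_polar hD, map_zero, map_zero, LinearMap.zero_apply, add_zero, add_zero]

theorem polar_algComm (a b c : Cayley k) :
    (cayleyNorm k).polarBilin (algComm (cayleyMul k) a b) c =
      -(cayleyNorm k).polarBilin b (algComm (cayleyMul k) a c) := by
  obtain ⟨a0, a1, a2, a3, a4, a5, a6, a7, rfl⟩ := exists_zorn a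
  obtain ⟨b0, b1, b2, b3, b4, b5, b6, b7, rfl⟩ := exists_zorn b
  obtain ⟨c0, c1, c2, c3, c4, c5, c6, c7, rfl⟩ := exists_zorn c
  simp only [algComm_apply_apply, zorn_mul, zorn_sub, zorn_polar]
  ring

theorem phiEven_mem_A (a : Cayley k) : phiEven (k := k) (evA a) ∈ soOdd k 5 := by
  rw [phiEven_A]
  refine Submodule.smul_mem _ _ (mem_so fun x y => ?_)
  rw [conjCayley_apply, conjCayley_apply, polar_oddForm, polar_oddForm,
    toCayley_ofCayley (tr_algComm _ _), toCayley_ofCayley (tr_algComm _ _), toMat_ofCayley,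
    toMat_ofCayley, polar_algComm, map_zero, map_zero, LinearMap.zero_apply, add_zero, add_zero]

theorem phiEven_mem_M (a : Cayley k) (M : Matrix (Fin 2) (Fin 2) k) :
    phiEven (k := k) (evM a M) ∈ soOdd k 5 := by
  rw [phiEven_M]
  exact sigmaMap_mem_so _ _

theorem detPolar_pairAct {A B : Matrix (Fin 2) (Fin 2) k} (hA : A.trace = 0) (hB : B.trace = 0)
    (M N : Matrix (Fin 2) (Fin 2) k) :
    detPolar (pairAct A B M) N = -detPolar M (pairAct A B N) := by
  rw [Matrix.trace_fin_two] at hA hB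
  simp only [detPolar_apply, pairAct_apply]
  grind

theorem phiEven_mem_K {A B : Matrix (Fin 2) (Fin 2) k} (hA : A.trace = 0) (hB : B.trace = 0) :
    phiEven (k := k) (evK A B) ∈ soOdd k 5 := by
  refine mem_so fun x y => ?_
  rw [phiEven_K, phiEven_K, polar_oddForm, polar_oddForm, toCayley_ofMat, toCayley_ofMat,
    toMat_ofMat, toMat_ofMat, detPolar_pairAct hA hB, map_zero, map_zero, LinearMap.zero_apply,
    zero_add, zero_add]

theorem EvenGen.phi_mem {X : TitsCK k} (h : EvenGen X) : phiEven X ∈ soOdd k 5 := by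
  rcases h with hD | @⟨a, -⟩ | @⟨a, -, M⟩ | ⟨hA, hB⟩
  · exact phiEven_mem_D hD
  · exact phiEven_mem_A a
  · exact phiEven_mem_M a M
  · exact phiEven_mem_K hA hB

theorem phiEven_mem {X : TitsCK k} (hX : X ∈ titsCayleyKac k 0) : phiEven X ∈ soOdd k 5 := by
  suffices h : Submodule.span k {X | EvenGen X} ≤ (soOdd k 5).toSubmodule.comap phiEven from
    h (even_le_span hX)
  exact Submodule.span_le.2 fun X h => EvenGen.phi_mem h

end Comparison

/-! ### Superanticommutativity on generators. -/

section Skew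

variable {k : Type*} [Field k] [CharP k 5]

theorem innerDer_swap (a b : Cayley k) :
    innerDer (cayleyMul k) a b = -innerDer (cayleyMul k) b a := by
  refine LinearMap.ext fun c => ?_
  obtain ⟨a0, a1, a2, a3, a4, a5, a6, a7, rfl⟩ := exists_zorn a
  obtain ⟨b0, b1, b2, b3, b4, b5, b6, b7, rfl⟩ := exists_zorn b
  obtain ⟨c0, c1, c2, c3, c4, c5, c6, c7, rfl⟩ := exists_zorn c
  simp only [LinearMap.neg_apply, innerDer_apply, algComm_apply_apply, zorn_mul, zorn_smul,
    zorn_sub, zorn_neg, zorn_eq_iff]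
  refine ⟨?_, ?_, ?_, ?_, ?_, ?_, ?_, ?_⟩ <;> ring

theorem detPolar_comm (M N : Matrix (Fin 2) (Fin 2) k) : detPolar M N = detPolar N M := by
  simp only [detPolar_apply]; ring

theorem neg_koszulSign_smul {V : Type*} [AddCommGroup V] [Module k V] (i j : ZMod 2) (x : V) :
    -(koszulSign i j • x) = (-(koszulSign i j : k)) • x := by
  rw [neg_smul, Int.cast_smul_eq_zsmul]

theorem titsBilin_pure_swap_smul {C J : Type*} [AddCommGroup C] [Module k C] [AddCommGroup J]
    [Module k J] (m : C →ₗ[k] C →ₗ[k] C) (n : QuadraticForm k C)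
    (p : J →ₗ[k] J →ₗ[k] J) (u : J) (t : J →ₗ[k] k) (i j : ZMod 2) (D D' : Module.End k C) (a b : C)
    (x y : J) (d d' : Module.End k J) (hD : innerDer m a b = -innerDer m b a)
    (hxy : p x y = koszulSign i j • p y x) (hz : koszulSign i j = -1 → D = 0 ∧ D' = 0) :
    titsBilin m n p u t i j (D, a ⊗ₜ x, d) (D', b ⊗ₜ y, d') =
      (-(koszulSign i j : k)) • titsBilin m n p u t j i (D', b ⊗ₜ y, d') (D, a ⊗ₜ x, d) :=
  (titsBilin_pure_swap m n p u t i j D D' a b x y d d' hD hxy hz).trans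
    (neg_koszulSign_smul _ _ _)

theorem ckBracket_pure_swap (i j : ZMod 2) (D D' : Module.End k (Cayley k)) (a b : Cayley k)
    (x y : Kac k) (d d' : Module.End k (Kac k))
    (hxy : kacMul k x y = koszulSign i j • kacMul k y x)
    (hz : koszulSign i j = -1 → D = 0 ∧ D' = 0) :
    ckBracket (k := k) i j (D, a ⊗ₜ x, d) (D', b ⊗ₜ y, d') =
      (-(koszulSign i j : k)) • ckBracket (k := k) j i (D', b ⊗ₜ y, d') (D, a ⊗ₜ x, d) :=
  titsBilin_pure_swap_smul _ _ _ _ _ _ _ _ _ _ _ _ _ _ _ (innerDer_swap a b) hxy hz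

theorem EvenGen.exists_pure {X : TitsCK k} (h : EvenGen X) :
    ∃ (D : Module.End k (Cayley k)) (a : Cayley k) (c : k) (M : Matrix (Fin 2) (Fin 2) k)
      (d : Module.End k (Kac k)), X = (D, a ⊗ₜ (c • kacE + kacM M), d) := by
  rcases h with @⟨D, hD⟩ | @⟨a, -⟩ | @⟨a, -, M⟩ | @⟨A, B, -, -⟩
  · exact ⟨D, 0, 0, 0, 0, by simp [evD]⟩
  · exact ⟨0, a, 1, 0, 0, by simp [evA]⟩
  · exact ⟨0, a, 0, M, 0, by simp [evM]⟩
  · exact ⟨0, 0, 0, 0, _, by simp [evK]; rfl⟩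

theorem OddGen.exists_pure {X : TitsCK k} (h : OddGen X) :
    ∃ (a : Cayley k) (u v : Fin 2 → k) (d : Module.End k (Kac k)),
      X = (0, a ⊗ₜ (kacL u + kacR v), d) := by
  rcases h with ⟨a, u⟩ | ⟨a, u⟩
  · exact ⟨_, u, 0, _, by rw [map_zero, add_zero]; rfl⟩
  · exact ⟨_, 0, u, _, by rw [map_zero, zero_add]; rfl⟩

theorem bracket_swap_even {X Y : TitsCK k} (hX : EvenGen X) (hY : EvenGen Y) :
    ckBracket (k := k) 0 0 X Y = (-1 : k) • ckBracket (k := k) 0 0 Y X := by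
  obtain ⟨D, a, c, M, d, rfl⟩ := hX.exists_pure
  obtain ⟨D', a', c', M', d', rfl⟩ := hY.exists_pure
  rw [ckBracket_pure_swap, koszulSign_zero_left, Int.cast_one]
  · rw [koszulSign_zero_left, one_smul]
    simp only [map_add, map_smul, LinearMap.add_apply, LinearMap.smul_apply, kacMul_E_E, kacMul_E_M,
      kacMul_M_E, kacMul_M_M, detPolar_comm M M']
    module
  · rw [koszulSign_zero_left]; exact fun h => absurd h (by decide)

theorem bracket_swap_even_odd {X Y : TitsCK k} (hX : EvenGen X) (hY : OddGen Y) :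
    ckBracket (k := k) 1 0 Y X = (-1 : k) • ckBracket (k := k) 0 1 X Y := by
  obtain ⟨D, a, c, M, d, rfl⟩ := hX.exists_pure
  obtain ⟨b, u, v, d', rfl⟩ := hY.exists_pure
  rw [ckBracket_pure_swap, koszulSign_zero_right, Int.cast_one]
  · rw [koszulSign_zero_right, one_smul]
    simp only [map_add, map_smul, LinearMap.add_apply, LinearMap.smul_apply, kacMul_E_L, kacMul_E_R,
      kacMul_L_E, kacMul_R_E, kacMul_M_L, kacMul_L_M, kacMul_R_M, kacMul_M_R]
    module
  · rw [koszulSign_zero_right]; exact fun h => absurd h (by decide)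

theorem bracket_swap_odd {X Y : TitsCK k} (hX : OddGen X) (hY : OddGen Y) :
    ckBracket (k := k) 1 1 X Y = ckBracket (k := k) 1 1 Y X := by
  obtain ⟨a, u, v, d, rfl⟩ := hX.exists_pure
  obtain ⟨b, u', v', d', rfl⟩ := hY.exists_pure
  rw [ckBracket_pure_swap, koszulSign_one_one]
  · simp only [Int.cast_neg, Int.cast_one, neg_neg]
    exact one_smul k _
  · rw [koszulSign_one_one, neg_one_zsmul]
    simp only [map_add, LinearMap.add_apply, kacMul_L_L, kacMul_R_R, kacMul_L_R, kacMul_R_L,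
      altForm_swap u u', altForm_swap v v']
    module
  · exact fun _ => ⟨rfl, rfl⟩

end Skew

/-! ### The comparison map is a homomorphism on the even part. -/

section EvenHom

variable {k : Type*} [Field k] [CharP k 5]

theorem algComm_swap (a b : Cayley k) :
    algComm (cayleyMul k) a b = -algComm (cayleyMul k) b a := by
  simp only [algComm_apply_apply, neg_sub]

theorem polar_smul_right (a b : Cayley k) (r : k) : (cayleyNorm k).polarBilin a (r • b) =
    r * (cayleyNorm k).polarBilin a b := LinearMap.map_smul _ _ _

theorem polar_neg_left (a b : Cayley k) : (cayleyNorm k).polarBilin (-a) b =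
    -(cayleyNorm k).polarBilin a b := by
  rw [polar_comm, polar_comm a]; exact LinearMap.map_neg _ _

/-- The comparison map is compatible with the product of two given elements. -/
def PhiHom (X Y : TitsCK k) : Prop :=
  ∀ w, phiEven (k := k) (ckBracket (k := k) 0 0 X Y) w = phiEven X (phiEven Y w) - phiEven Y (phiEven X w)

theorem PhiHom.swap {X Y : TitsCK k} (hX : EvenGen X) (hY : EvenGen Y) (h : PhiHom X Y) :
    PhiHom Y X := by
  intro w
  rw [bracket_swap_even hY hX, map_smul, LinearMap.smul_apply, h w, neg_one_smul, neg_sub]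

theorem PhiHom.of_ext {X Y : TitsCK k}
    (hC : ∀ b, cayleyTr b = 0 → phiEven (k := k) (ckBracket (k := k) 0 0 X Y) (ofCayley b) =
      phiEven X (phiEven Y (ofCayley b)) - phiEven Y (phiEven X (ofCayley b)))
    (hM : ∀ N, phiEven (k := k) (ckBracket (k := k) 0 0 X Y) (ofMat N) =
      phiEven X (phiEven Y (ofMat N)) - phiEven Y (phiEven X (ofMat N))) : PhiHom X Y := by
  intro w
  rw [← ofCayley_toCayley_add w]
  simp only [map_add, hC _ (cayleyTr_toCayley w), hM]
  abel

theorem ofCayley_sub (a b : Cayley k) : ofCayley a - ofCayley b = ofCayley (a - b) := by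
  rw [sub_eq_iff_eq_add, ← map_add, sub_add_cancel]

theorem ofMat_sub (M N : Matrix (Fin 2) (Fin 2) k) : ofMat M - ofMat N = ofMat (M - N) := by
  rw [sub_eq_iff_eq_add, ← map_add, sub_add_cancel]

theorem ofMat_zero_sub (N : Matrix (Fin 2) (Fin 2) k) : 0 - ofMat N = ofMat (-N) := by
  rw [zero_sub]; exact (LinearMap.map_neg ofMat N).symm

theorem phiHom_D_D {D D' : Module.End k (Cayley k)} (hD : D ∈ derSpace (cayleyMul k))
    (hD' : D' ∈ derSpace (cayleyMul k)) : PhiHom (evD D) (evD D') := by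
  apply PhiHom.of_ext
  · intro b hb
    rw [bracket_D_D, phiEven_D_ofCayley _ hb, phiEven_D_ofCayley _ hb, phiEven_D_ofCayley _ hb,
      phiEven_D_ofCayley _ (der_tr hD _), phiEven_D_ofCayley _ (der_tr hD' _), ofCayley_sub]
    rfl
  · intro N
    rw [bracket_D_D]
    simp only [phiEven_D_ofMat, map_zero, sub_zero]

theorem phiHom_D_A {D : Module.End k (Cayley k)} (hD : D ∈ derSpace (cayleyMul k)) (a : Cayley k) :
    PhiHom (evD D) (evA a) := by
  apply PhiHom.of_ext
  · intro b hb
    rw [bracket_D_A, phiEven_D_ofCayley _ hb, phiEven_A_ofCayley _ hb, phiEven_A_ofCayley _ hb,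
      phiEven_A_ofCayley _ (der_tr hD _), phiEven_D_ofCayley _ (tr_algComm _ _), ofCayley_sub]
    congr 1
    simp only [algComm_apply_apply, map_sub, hD a b, hD b a]
    abel
  · intro N
    rw [bracket_D_A]
    simp only [phiEven_D_ofMat, phiEven_A_ofMat, map_zero, sub_zero]

theorem phiHom_D_M {D : Module.End k (Cayley k)} (hD : D ∈ derSpace (cayleyMul k)) {a : Cayley k}
    (ha : cayleyTr a = 0) (M : Matrix (Fin 2) (Fin 2) k) : PhiHom (evD D) (evM a M) := by
  apply PhiHom.of_ext
  · intro b hb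
    rw [bracket_D_M, phiEven_D_ofCayley _ hb, phiEven_M_ofCayley _ _ (der_tr hD a) hb,
      phiEven_M_ofCayley _ _ ha hb, phiEven_M_ofCayley _ _ ha (der_tr hD b), phiEven_D_ofMat,
      der_polar hD, ofMat_zero_sub, neg_smul]
  · intro N
    rw [bracket_D_M, phiEven_D_ofMat, map_zero, sub_zero, phiEven_M_ofMat, phiEven_M_ofMat,
      phiEven_D_ofCayley _ (by rw [map_smul, ha, smul_zero]), LinearMap.map_smul D]

theorem phiHom_D_K (D : Module.End k (Cayley k)) (A B : Matrix (Fin 2) (Fin 2) k) :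
    PhiHom (evD D) (evK A B) := by
  apply PhiHom.of_ext
  · intro b hb
    rw [bracket_D_K, phiEven_D_ofCayley _ hb, phiEven_K_ofCayley, phiEven_K_ofCayley, map_zero,
      map_zero, sub_zero, LinearMap.zero_apply]
  · intro N
    rw [bracket_D_K, phiEven_K_ofMat, phiEven_D_ofMat, phiEven_D_ofMat, map_zero, map_zero,
      sub_zero, LinearMap.zero_apply]

/-- On C⁰ the assertion is 2D_{a,c} - ad_{[a,c]} = [ad_a, ad_c], which is `two_smul_innerDer`. -/
theorem phiHom_A_A (a c : Cayley k) (ha : cayleyTr a = 0) (hc : cayleyTr c = 0) :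
    PhiHom (evA a) (evA c) := by
  apply PhiHom.of_ext
  · intro b hb
    rw [bracket_A_A, map_add, LinearMap.add_apply, phiEven_D_ofCayley _ hb, phiEven_A_ofCayley _ hb,
      phiEven_A_ofCayley _ hb, phiEven_A_ofCayley _ hb, phiEven_A_ofCayley _ (tr_algComm _ _),
      phiEven_A_ofCayley _ (tr_algComm _ _), ofCayley_sub, ← map_add]
    congr 1
    obtain ⟨a0, a1, a2, a3, a4, a5, a6, rfl⟩ := exists_zorn_of_tr ha
    obtain ⟨b0, b1, b2, b3, b4, b5, b6, rfl⟩ := exists_zorn_of_tr hb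
    obtain ⟨c0, c1, c2, c3, c4, c5, c6, rfl⟩ := exists_zorn_of_tr hc
    simp only [LinearMap.smul_apply, innerDer_apply, algComm_apply_apply, zorn_mul, zorn_smul,
      zorn_add, zorn_sub, zorn_eq_iff]
    refine ⟨?_, ?_, ?_, ?_, ?_, ?_, ?_, ?_⟩ <;> ring
  · intro N
    rw [bracket_A_A, map_add, LinearMap.add_apply]
    simp only [phiEven_D_ofMat, phiEven_A_ofMat, map_zero, sub_zero, add_zero]

theorem phiHom_A_M {a b : Cayley k} (hb : cayleyTr b = 0) (M : Matrix (Fin 2) (Fin 2) k) :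
    PhiHom (evA a) (evM b M) := by
  apply PhiHom.of_ext
  · intro c hc
    rw [bracket_A_M, phiEven_A_ofCayley _ hc, phiEven_M_ofCayley _ _ hb hc, phiEven_A_ofMat,
      phiEven_M_ofCayley _ _ hb (tr_algComm _ _),
      phiEven_M_ofCayley _ _ (by rw [map_neg, tr_algComm, neg_zero]) hc, ofMat_zero_sub, ← neg_smul,
      algComm_swap c a, LinearMap.map_neg, LinearMap.map_neg, LinearMap.neg_apply, polar_algComm]
  · intro N
    rw [bracket_A_M, phiEven_A_ofMat, map_zero, sub_zero, phiEven_M_ofMat, phiEven_M_ofMat,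
      phiEven_A_ofCayley _ (by rw [map_smul, hb, smul_zero])]
    congr 1
    simp only [algComm_apply_apply, map_smul, LinearMap.smul_apply]
    module

theorem phiHom_A_K (a : Cayley k) (A B : Matrix (Fin 2) (Fin 2) k) : PhiHom (evA a) (evK A B) := by
  apply PhiHom.of_ext
  · intro b hb
    rw [bracket_A_K, phiEven_A_ofCayley _ hb, phiEven_K_ofCayley, phiEven_K_ofCayley, map_zero,
      map_zero, sub_zero, LinearMap.zero_apply]
  · intro N
    rw [bracket_A_K, phiEven_K_ofMat, phiEven_A_ofMat, phiEven_A_ofMat, map_zero, map_zero,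
      sub_zero, LinearMap.zero_apply]

/-- The decisive use of characteristic 5. For anticommuting a = c and b in a quaternion subalgebra
the left side is 12n(a)b and the right side 2n(a)b. The identity writes the rotation σ_{a,b} of C⁰
as a derivation plus a commutator. -/
theorem two_innerDer_apply {a b c : Cayley k} (ha : cayleyTr a = 0) (hb : cayleyTr b = 0)
    (hc : cayleyTr c = 0) : (2 : k) • innerDer (cayleyMul k) a b c
      + algComm (cayleyMul k) (algComm (cayleyMul k) a b) c =
    (cayleyNorm k).polarBilin a c • b - (cayleyNorm k).polarBilin b c • a := by
  obtain ⟨a0, a1, a2, a3, a4, a5, a6, rfl⟩ := exists_zorn_of_tr ha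
  obtain ⟨b0, b1, b2, b3, b4, b5, b6, rfl⟩ := exists_zorn_of_tr hb
  obtain ⟨c0, c1, c2, c3, c4, c5, c6, rfl⟩ := exists_zorn_of_tr hc
  simp only [innerDer_apply, algComm_apply_apply, zorn_mul, zorn_smul, zorn_polar,
    zorn_add, zorn_sub, zorn_eq_iff]
  refine ⟨?_, ?_, ?_, ?_, ?_, ?_, ?_, ?_⟩ <;> grind

/-- The counterpart of `two_innerDer_apply` on the 4-dimensional summand of W: the inner derivation
in the product of a⊗M and b⊗N is n(a,b)σ_{M,N}. It too holds because of 5 = 0. -/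
theorem pairAct_brMat (M N P : Matrix (Fin 2) (Fin 2) k) (r : k) :
    pairAct (-(2 * r) • brMat M N) (-(2 * r) • brMat M.transpose N.transpose) P =
      r • (detPolar M P • N - detPolar N P • M) := by
  apply mat_two_ext <;> simp [pairAct_apply, brMat, detPolar_apply] <;> grind

/-- For orthogonal summands, [σ_{a,M}, σ_{b,N}] is det(M,N)σ_{a,b} on C⁰ and n(a,b)σ_{M,N} on
matrices; the two preceding identities supply the two blocks. -/
theorem phiHom_M_M {a b : Cayley k} (ha : cayleyTr a = 0) (hb : cayleyTr b = 0)
    (M N : Matrix (Fin 2) (Fin 2) k) : PhiHom (evM a M) (evM b N) := by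
  apply PhiHom.of_ext
  · intro c hc
    rw [bracket_M_M, map_add, map_add, LinearMap.add_apply, LinearMap.add_apply,
      phiEven_D_ofCayley _ hc, phiEven_A_ofCayley _ hc, phiEven_K_ofCayley, add_zero,
      phiEven_M_ofCayley _ _ ha hc, phiEven_M_ofCayley _ _ hb hc, phiEven_M_ofMat, phiEven_M_ofMat,
      ofCayley_sub, ← map_add, detPolar_comm N]
    congr 1
    have h := two_innerDer_apply ha hb hc
    simp only [map_smul, map_neg, LinearMap.smul_apply, LinearMap.neg_apply, smul_eq_mul,
      algComm_swap c]
    linear_combination (norm := module) (detPolar M N) • h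
  · intro P
    rw [bracket_M_M, map_add, map_add, LinearMap.add_apply, LinearMap.add_apply,
      phiEven_D_ofMat, phiEven_A_ofMat, phiEven_K_ofMat, zero_add, zero_add, phiEven_M_ofMat,
      phiEven_M_ofMat, phiEven_M_ofCayley _ _ ha (by rw [map_smul, hb, smul_zero]),
      phiEven_M_ofCayley _ _ hb (by rw [map_smul, ha, smul_zero]), ofMat_sub, pairAct_brMat]
    congr 1
    rw [polar_smul_right, polar_smul_right, polar_comm b a]
    module

theorem phiHom_M_K {a : Cayley k} (ha : cayleyTr a = 0) (M : Matrix (Fin 2) (Fin 2) k)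
    {A B : Matrix (Fin 2) (Fin 2) k} (hA : A.trace = 0) (hB : B.trace = 0) :
    PhiHom (evM a M) (evK A B) := by
  apply PhiHom.of_ext
  · intro b hb
    rw [bracket_M_K, phiEven_K_ofCayley, map_zero, phiEven_M_ofCayley _ _ ha hb,
      phiEven_M_ofCayley _ _ (by rw [map_neg, ha, neg_zero]) hb, phiEven_K_ofMat, ofMat_zero_sub]
    congr 1
    rw [polar_neg_left]
    apply mat_two_ext <;> simp [pairAct_apply] <;> ring
  · intro N
    rw [bracket_M_K, phiEven_M_ofMat, phiEven_K_ofMat, phiEven_M_ofMat, phiEven_M_ofMat,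
      phiEven_K_ofCayley, sub_zero, detPolar_pairAct hA hB, smul_neg, neg_neg, neg_smul]

theorem phiHom_K_K (A B A' B' : Matrix (Fin 2) (Fin 2) k) : PhiHom (evK A B) (evK A' B') := by
  apply PhiHom.of_ext
  · intro b hb
    rw [bracket_K_K, phiEven_K_ofCayley, phiEven_K_ofCayley, phiEven_K_ofCayley, map_zero,
      map_zero, sub_zero]
  · intro N
    simp only [bracket_K_K, phiEven_K_ofMat, ofMat_sub]
    congr 1
    apply mat_two_ext <;> simp [pairAct_apply, Matrix.mul_apply, Fin.sum_univ_two] <;> ring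

theorem EvenGen.phiHom {X Y : TitsCK k} (hX : EvenGen X) (hY : EvenGen Y) : PhiHom X Y := by
  have hX' := hX
  have hY' := hY
  rcases hX with @⟨D, hD⟩ | @⟨a, ha⟩ | @⟨a, ha, M⟩ | @⟨A, B, hA, hB⟩ <;>
    rcases hY with @⟨D', hD'⟩ | @⟨a', ha'⟩ | @⟨a', ha', M'⟩ | @⟨A', B', hA', hB'⟩
  · exact phiHom_D_D hD hD'
  · exact phiHom_D_A hD a'
  · exact phiHom_D_M hD ha' M'
  · exact phiHom_D_K D A' B'
  · exact (phiHom_D_A hD' a).swap hY' hX'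
  · exact phiHom_A_A a a' ha ha'
  · exact phiHom_A_M ha' M'
  · exact phiHom_A_K a A' B'
  · exact (phiHom_D_M hD' ha M).swap hY' hX'
  · exact (phiHom_A_M ha M).swap hY' hX'
  · exact phiHom_M_M ha ha' M M'
  · exact phiHom_M_K ha M hA' hB'
  · exact (phiHom_D_K D' A B).swap hY' hX'
  · exact (phiHom_A_K a' A B).swap hY' hX'
  · exact (phiHom_M_K ha' M' hA hB).swap hY' hX'
  · exact phiHom_K_K A B A' B'

end EvenHom

/-! ### The even part acts on the odd part by the spin representation. -/

section SpinAction

variable {k : Type*} [Field k] [CharP k 5]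

/-- The endomorphism of the model given by an endomorphism of the Cayley algebra. -/
def compEnd (T : Module.End k (Cayley k)) : Module.End k (SpinModel k) where
  toFun x := SpinModel.mk (fun i => T (x.1 i)) (fun i => T (x.2 i))
  map_add' x y := by
    refine SpinModel.ext (fun i => ?_) (fun i => ?_) <;>
      simp only [SpinModel.mk_fst, SpinModel.mk_snd, map_add, SpinModel.add_fst, SpinModel.add_snd]
  map_smul' c x := by
    refine SpinModel.ext (fun i => ?_) (fun i => ?_) <;>
      simp only [SpinModel.mk_fst, SpinModel.mk_snd, map_smul, SpinModel.smul_fst,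
        SpinModel.smul_snd, RingHom.id_apply]

theorem compEnd_apply (T : Module.End k (Cayley k)) (x : SpinModel k) :
    compEnd T x = SpinModel.mk (fun i => T (x.1 i)) (fun i => T (x.2 i)) := rfl

/-- The endomorphism of the model given by endomorphisms of the two copies of `U`. -/
def blockEnd (A B : Matrix (Fin 2) (Fin 2) k) : Module.End k (SpinModel k) where
  toFun x := SpinModel.mk (fun i => A i 0 • x.1 0 + A i 1 • x.1 1)
    (fun i => B i 0 • x.2 0 + B i 1 • x.2 1)
  map_add' x y := by
    refine SpinModel.ext (fun i => ?_) (fun i => ?_) <;>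
      simp only [SpinModel.mk_fst, SpinModel.mk_snd, SpinModel.add_fst, SpinModel.add_snd] <;>
      module
  map_smul' c x := by
    refine SpinModel.ext (fun i => ?_) (fun i => ?_) <;>
      simp only [SpinModel.mk_fst, SpinModel.mk_snd, SpinModel.smul_fst,
        SpinModel.smul_snd, RingHom.id_apply] <;>
      module

theorem blockEnd_apply (A B : Matrix (Fin 2) (Fin 2) k) (x : SpinModel k) :
    blockEnd A B x = SpinModel.mk (fun i => A i 0 • x.1 0 + A i 1 • x.1 1)
      (fun i => B i 0 • x.2 0 + B i 1 • x.2 1) := rfl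

theorem modelForm_compEnd {T : Module.End k (Cayley k)}
    (hT : ∀ x y, (cayleyNorm k).polarBilin (T x) y = -(cayleyNorm k).polarBilin x (T y))
    (x y : SpinModel k) : modelForm (compEnd T x) y = -modelForm x (compEnd T y) := by
  simp only [modelForm_apply, wedgeForm_apply, compEnd_apply, SpinModel.mk_fst, SpinModel.mk_snd, hT]
  ring

theorem modelForm_blockEnd {A B : Matrix (Fin 2) (Fin 2) k} (hA : A.trace = 0) (hB : B.trace = 0)
    (x y : SpinModel k) : modelForm (blockEnd A B x) y = -modelForm x (blockEnd A B y) := by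
  rw [Matrix.trace_fin_two] at hA hB
  have hA' : A 1 1 = -A 0 0 := by grind
  have hB' : B 1 1 = -B 0 0 := by grind
  simp only [modelForm_apply, wedgeForm_apply, blockEnd_apply, SpinModel.mk_fst, SpinModel.mk_snd,
    hA', hB', map_add, LinearMap.add_apply, map_smul, LinearMap.smul_apply, smul_eq_mul]
  ring

/-- An operator T on C that satisfies the Leibniz rule with d on the left factor acts on the model
compatibly with the action of d on C⁰. It is applied to T = d = D and to T = -(L_a + 2R_a), d =
-ad_a. -/
theorem compEnd_gammaMap {T d : Module.End k (Cayley k)}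
    (hT : ∀ c, cayleyTr c = 0 → ∀ x, T (cayleyMul k c x) = cayleyMul k c (T x) + cayleyMul k (d c) x)
    (hd : ∀ c, cayleyTr c = 0 → cayleyTr (d c) = 0) (w : OddSpace k 5) (x : SpinModel k) :
    compEnd T (gammaMap w x) = gammaMap w (compEnd T x) + gammaMap (ofCayley (d (toCayley w))) x := by
  have htr := cayleyTr_toCayley w
  refine SpinModel.ext (fun i => ?_) (fun i => ?_) <;>
    simp only [gammaMap_apply, compEnd_apply, SpinModel.mk_fst, SpinModel.mk_snd,
      SpinModel.add_fst, SpinModel.add_snd, map_add, map_sub, map_neg, map_smul, hT _ htr,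
      toCayley_ofCayley (hd _ htr), toMat_ofCayley, Matrix.zero_apply, zero_smul] <;>
    module

theorem modelRep_phiEven_D {D : Module.End k (Cayley k)} (hD : D ∈ derSpace (cayleyMul k)) :
    modelRep (k := k) (phiEven (k := k) (evD D)) = compEnd D := by
  refine (eq_modelRep (phiEven_mem_D hD) (fun w x => ?_) (modelForm_compEnd (der_polar hD))).symm
  rw [phiEven_D, conjCayley_apply]
  refine compEnd_gammaMap (fun c _ x => ?_) (fun c _ => der_tr hD c) w x
  rw [hD, add_comm]

theorem modelRep_phiEven_A {a : Cayley k} (ha : cayleyTr a = 0) :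
    modelRep (k := k) (phiEven (k := k) (evA a)) = compEnd (-leftAddTwoRight a) := by
  refine (eq_modelRep (phiEven_mem_A a) (fun w x => ?_) (modelForm_compEnd ?_)).symm
  · rw [phiEven_A, LinearMap.smul_apply, conjCayley_apply, ← map_smul]
    refine compEnd_gammaMap (d := (-1 : k) • algComm (cayleyMul k) a) (fun c hc x => ?_)
      (fun c _ => ?_) w x
    · rw [LinearMap.neg_apply, leftAddTwoRight_mul]
      simp only [LinearMap.smul_apply, LinearMap.neg_apply, map_smul, map_neg]
      module
    · rw [LinearMap.smul_apply, map_smul, tr_algComm, smul_zero]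
  · intro x y
    rw [LinearMap.neg_apply, LinearMap.neg_apply, polar_neg_left, polar_leftAddTwoRight ha, map_neg]

theorem modelRep_phiEven_K {A B : Matrix (Fin 2) (Fin 2) k} (hA : A.trace = 0) (hB : B.trace = 0) :
    modelRep (k := k) (phiEven (k := k) (evK A B)) = blockEnd A B := by
  refine (eq_modelRep (phiEven_mem_K hA hB) (fun w x => ?_) (modelForm_blockEnd hA hB)).symm
  rw [phiEven_K]
  rw [Matrix.trace_fin_two] at hA hB
  have hA' : A 1 1 = -A 0 0 := by grind
  have hB' : B 1 1 = -B 0 0 := by grind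
  refine SpinModel.ext (fun i => ?_) (fun i => ?_) <;>
    simp only [gammaMap_apply, blockEnd_apply, SpinModel.mk_fst, SpinModel.mk_snd,
      SpinModel.add_fst, SpinModel.add_snd, map_add, map_smul, toCayley_ofMat, toMat_ofMat, map_zero,
      LinearMap.zero_apply, pairAct_apply] <;>
    fin_cases i <;> simp only [Fin.zero_eta, Fin.mk_one, hA', hB'] <;> module

/-- Vectors of C⁰ and matrices are orthogonal, so their Clifford operators anticommute and the half
commutator is a single product. -/
theorem modelRep_phiEven_M (a : Cayley k) (M : Matrix (Fin 2) (Fin 2) k) (s : SpinModel k) :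
    modelRep (k := k) (phiEven (k := k) (evM a M)) s = -gammaMap (ofCayley a) (gammaMap (ofMat M) s) := by
  have h2 : (1 / 2 : k) * 2 = 1 := by
    have := two_ne_zero_of_char_five (k := k)
    field_simp
  rw [phiEven_M, modelRep_sigmaMap, LinearMap.smul_apply, gammaComm_apply, gammaMap_swap (ofMat M),
    polar_ofMat_ofCayley, zero_smul, add_zero, sub_neg_eq_add, ← two_smul k, smul_smul, neg_mul, h2,
    neg_one_smul]

/-- The comparison maps are compatible with the product of an even and an odd element. -/
def SpinHom (X Y : TitsCK k) : Prop :=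
  phiOdd (k := k) (ckBracket (k := k) 0 1 X Y) = modelRep (k := k) (phiEven X) (phiOdd Y)

theorem compEnd_modL (T : Module.End k (Cayley k)) (b : Cayley k) (u : Fin 2 → k) :
    compEnd T (modL b u) = modL (T b) u := by
  refine SpinModel.ext (fun i => ?_) (fun i => ?_) <;>
    simp only [compEnd_apply, modL, SpinModel.mk_fst, SpinModel.mk_snd, map_smul, map_zero]

theorem compEnd_modR (T : Module.End k (Cayley k)) (b : Cayley k) (u : Fin 2 → k) :
    compEnd T (modR b u) = modR (T b) u := by
  refine SpinModel.ext (fun i => ?_) (fun i => ?_) <;>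
    simp only [compEnd_apply, modR, SpinModel.mk_fst, SpinModel.mk_snd, map_smul, map_zero]

theorem blockEnd_modL (A B : Matrix (Fin 2) (Fin 2) k) (b : Cayley k) (u : Fin 2 → k) :
    blockEnd A B (modL b u) = modL b (A.mulVec u) := by
  refine SpinModel.ext (fun i => ?_) (fun i => ?_) <;>
    simp only [blockEnd_apply, modL, SpinModel.mk_fst, SpinModel.mk_snd, smul_zero, add_zero,
      mulVec_two]
  fin_cases i <;> simp <;> module

theorem blockEnd_modR (A B : Matrix (Fin 2) (Fin 2) k) (b : Cayley k) (u : Fin 2 → k) :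
    blockEnd A B (modR b u) = modR b (B.mulVec u) := by
  refine SpinModel.ext (fun i => ?_) (fun i => ?_) <;>
    simp only [blockEnd_apply, modR, SpinModel.mk_fst, SpinModel.mk_snd, smul_zero, add_zero,
      mulVec_two]
  fin_cases i <;> simp <;> module

theorem gammaMap_ofCayley_modL {a : Cayley k} (ha : cayleyTr a = 0) (b : Cayley k) (u : Fin 2 → k) :
    gammaMap (ofCayley a) (modL b u) = modL ((2 : k) • cayleyMul k a b) u := by
  refine SpinModel.ext (fun i => ?_) (fun i => ?_) <;>
    simp only [gammaMap_apply, modL, SpinModel.mk_fst, SpinModel.mk_snd, toCayley_ofCayley ha,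
      toMat_ofCayley, Matrix.zero_apply, map_smul, map_zero] <;> module

theorem gammaMap_ofCayley_modR {a : Cayley k} (ha : cayleyTr a = 0) (b : Cayley k) (u : Fin 2 → k) :
    gammaMap (ofCayley a) (modR b u) = modR ((-2 : k) • cayleyMul k a b) u := by
  refine SpinModel.ext (fun i => ?_) (fun i => ?_) <;>
    simp only [gammaMap_apply, modR, SpinModel.mk_fst, SpinModel.mk_snd, toCayley_ofCayley ha,
      toMat_ofCayley, Matrix.zero_apply, map_smul, map_zero] <;> module

theorem gammaMap_ofMat_modL (M : Matrix (Fin 2) (Fin 2) k) (b : Cayley k) (u : Fin 2 → k) :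
    gammaMap (ofMat M) (modL b u) = modR b (-matR M u) := by
  refine SpinModel.ext (fun i => ?_) (fun i => ?_) <;>
    simp only [gammaMap_apply, modL, modR, SpinModel.mk_fst, SpinModel.mk_snd, toCayley_ofMat,
      toMat_ofMat, map_zero, LinearMap.zero_apply, matR, Pi.neg_apply] 
  · module
  fin_cases i <;> simp <;> module

theorem gammaMap_ofMat_modR (M : Matrix (Fin 2) (Fin 2) k) (b : Cayley k) (u : Fin 2 → k) :
    gammaMap (ofMat M) (modR b u) = modL b (matL M u) := by
  refine SpinModel.ext (fun i => ?_) (fun i => ?_) <;>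
    simp only [gammaMap_apply, modL, modR, SpinModel.mk_fst, SpinModel.mk_snd, toCayley_ofMat,
      toMat_ofMat, map_zero, LinearMap.zero_apply, matL, Pi.neg_apply] 
  · fin_cases i <;> simp <;> module
  · module

theorem neg_modL (b : Cayley k) (u : Fin 2 → k) : -modL b u = modL b (-u) := by
  refine SpinModel.ext (fun i => ?_) (fun i => ?_) <;>
    simp only [modL, SpinModel.neg_fst, SpinModel.neg_snd, SpinModel.mk_fst, SpinModel.mk_snd,
      Pi.neg_apply] <;> module

theorem neg_modR (b : Cayley k) (u : Fin 2 → k) : -modR b u = modR b (-u) := by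
  refine SpinModel.ext (fun i => ?_) (fun i => ?_) <;>
    simp only [modR, SpinModel.neg_fst, SpinModel.neg_snd, SpinModel.mk_fst, SpinModel.mk_snd,
      Pi.neg_apply] <;> module

theorem modL_smul_neg (b : Cayley k) (u : Fin 2 → k) :
    modL ((2 : k) • b) (-u) = modL ((-2 : k) • b) u := by
  refine SpinModel.ext (fun i => ?_) (fun i => ?_) <;>
    simp only [modL, SpinModel.mk_fst, SpinModel.mk_snd, Pi.neg_apply] <;> module

theorem spinHom_gen {X Y : TitsCK k} (hX : EvenGen X) (hY : OddGen Y) : SpinHom X Y := by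
  unfold SpinHom
  rcases hX with @⟨D, hD⟩ | @⟨a, ha⟩ | @⟨a, ha, M⟩ | @⟨A, B, hA, hB⟩ <;>
    rcases hY with ⟨b, u⟩ | ⟨b, u⟩
  · rw [bracket_D_L hD, modelRep_phiEven_D hD, phiOdd_L, phiOdd_L, compEnd_modL]
  · rw [bracket_D_R hD, modelRep_phiEven_D hD, phiOdd_R, phiOdd_R, compEnd_modR]
  · rw [bracket_A_L ha, modelRep_phiEven_A ha, phiOdd_L, phiOdd_L, compEnd_modL, LinearMap.neg_apply]
  · rw [bracket_A_R ha, modelRep_phiEven_A ha, phiOdd_R, phiOdd_R, compEnd_modR, LinearMap.neg_apply]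
  · rw [bracket_M_L ha, modelRep_phiEven_M, phiOdd_L, phiOdd_R, gammaMap_ofMat_modL,
      gammaMap_ofCayley_modR ha, neg_modR, neg_neg]
  · rw [bracket_M_R ha, modelRep_phiEven_M, phiOdd_L, phiOdd_R, gammaMap_ofMat_modR,
      gammaMap_ofCayley_modL ha, neg_modL, modL_smul_neg]
  · rw [bracket_K_L hA hB, modelRep_phiEven_K hA hB, phiOdd_L, phiOdd_L, blockEnd_modL]
  · rw [bracket_K_R hA hB, modelRep_phiEven_K hA hB, phiOdd_R, phiOdd_R, blockEnd_modR]

end SpinAction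

/-! ### The odd product is determined by the invariant form. -/

section FormCompatibility

variable {k : Type*} [Field k] [CharP k 5]

theorem modelForm_L_L (a b : Cayley k) (u v : Fin 2 → k) :
    modelForm (modL a u) (modL b v) = 3 * (altForm u v * (cayleyNorm k).polarBilin a b) := by
  simp only [modelForm_apply, wedgeForm_apply, modL, SpinModel.mk_fst, SpinModel.mk_snd, map_smul,
    LinearMap.smul_apply, smul_eq_mul, map_zero, altForm]
  ring

theorem modelForm_R_R (a b : Cayley k) (u v : Fin 2 → k) :
    modelForm (modR a u) (modR b v) = -(3 * (altForm u v * (cayleyNorm k).polarBilin a b)) := by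
  simp only [modelForm_apply, wedgeForm_apply, modR, SpinModel.mk_fst, SpinModel.mk_snd, map_smul,
    LinearMap.smul_apply, smul_eq_mul, map_zero, altForm]
  ring

theorem modelForm_L_R (a b : Cayley k) (u v : Fin 2 → k) : modelForm (modL a u) (modR b v) = 0 := by
  simp only [modelForm_apply, wedgeForm_apply, modL, modR, SpinModel.mk_fst, SpinModel.mk_snd,
    map_zero, LinearMap.zero_apply]
  ring

theorem modelForm_R_L (a b : Cayley k) (u v : Fin 2 → k) : modelForm (modR a u) (modL b v) = 0 := by
  rw [modelForm_swap, modelForm_L_R, neg_zero]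

/-- In C = k1 ⊥ C⁰ one has n(a,b) = tr(a)tr(b)/2 + n(a₀,b₀), a₀ and b₀ being the trace zero parts.
Multiply by -1 = 4 and use 1/2 = 3. -/
theorem two_tr_mul_add_polar (a b : Cayley k) :
    2 * cayleyTr a * cayleyTr b + 4 * (cayleyNorm k).polarBilin (imPart a) (imPart b) =
      -(cayleyNorm k).polarBilin a b := by
  obtain ⟨a0, a1, a2, a3, a4, a5, a6, a7, rfl⟩ := exists_zorn a
  obtain ⟨b0, b1, b2, b3, b4, b5, b6, b7, rfl⟩ := exists_zorn b
  simp only [imPart_apply, cayleyOne_eq_zorn, zorn_smul, zorn_add, cayleyTr_zorn, zorn_polar]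
  grind

theorem modelRep_sigma_M_M_L (M N : Matrix (Fin 2) (Fin 2) k) (a : Cayley k) (u : Fin 2 → k) :
    modelRep (k := k) (sigmaMap k 5 (ofMat M) (ofMat N)) (modL a u) =
      modL a ((2 : k) • (matL N (matR M u) - matL M (matR N u))) := by
  rw [modelRep_sigmaMap, half_eq_three, LinearMap.smul_apply, gammaComm_apply, gammaMap_ofMat_modL,
    gammaMap_ofMat_modL, gammaMap_ofMat_modR, gammaMap_ofMat_modR]
  refine SpinModel.ext (fun i => ?_) (fun i => ?_) <;>
    simp only [modL, SpinModel.smul_fst, SpinModel.smul_snd, SpinModel.sub_fst, SpinModel.sub_snd,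
      SpinModel.mk_fst, SpinModel.mk_snd, matL_neg, Pi.neg_apply, Pi.smul_apply, Pi.sub_apply,
      smul_eq_mul] <;>
    match_scalars <;> grind

theorem modelRep_sigma_M_M_R (M N : Matrix (Fin 2) (Fin 2) k) (a : Cayley k) (u : Fin 2 → k) :
    modelRep (k := k) (sigmaMap k 5 (ofMat M) (ofMat N)) (modR a u) =
      modR a ((2 : k) • (matR N (matL M u) - matR M (matL N u))) := by
  rw [modelRep_sigmaMap, half_eq_three, LinearMap.smul_apply, gammaComm_apply, gammaMap_ofMat_modR,
    gammaMap_ofMat_modR, gammaMap_ofMat_modL, gammaMap_ofMat_modL]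
  refine SpinModel.ext (fun i => ?_) (fun i => ?_) <;>
    simp only [modR, SpinModel.smul_fst, SpinModel.smul_snd, SpinModel.sub_fst, SpinModel.sub_snd,
      SpinModel.mk_fst, SpinModel.mk_snd, Pi.neg_apply, Pi.smul_apply, Pi.sub_apply,
      smul_eq_mul] <;>
    match_scalars <;> grind

theorem modelRep_sigma_C_C_L {c d : Cayley k} (hc : cayleyTr c = 0) (hd : cayleyTr d = 0)
    (a : Cayley k) (u : Fin 2 → k) : modelRep (k := k) (sigmaMap k 5 (ofCayley c) (ofCayley d)) (modL a u) =
      modL ((2 : k) • (cayleyMul k d (cayleyMul k c a) - cayleyMul k c (cayleyMul k d a))) u := by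
  rw [modelRep_sigmaMap, half_eq_three, LinearMap.smul_apply, gammaComm_apply,
    gammaMap_ofCayley_modL hd, gammaMap_ofCayley_modL hc, gammaMap_ofCayley_modL hc,
    gammaMap_ofCayley_modL hd]
  refine SpinModel.ext (fun i => ?_) (fun i => ?_) <;>
    simp only [modL, SpinModel.smul_fst, SpinModel.smul_snd, SpinModel.sub_fst, SpinModel.sub_snd,
      SpinModel.mk_fst, SpinModel.mk_snd, map_smul] <;>
    match_scalars <;> grind

theorem modelRep_sigma_C_C_R {c d : Cayley k} (hc : cayleyTr c = 0) (hd : cayleyTr d = 0)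
    (a : Cayley k) (u : Fin 2 → k) : modelRep (k := k) (sigmaMap k 5 (ofCayley c) (ofCayley d)) (modR a u) =
      modR ((2 : k) • (cayleyMul k d (cayleyMul k c a) - cayleyMul k c (cayleyMul k d a))) u := by
  rw [modelRep_sigmaMap, half_eq_three, LinearMap.smul_apply, gammaComm_apply,
    gammaMap_ofCayley_modR hd, gammaMap_ofCayley_modR hc, gammaMap_ofCayley_modR hc,
    gammaMap_ofCayley_modR hd]
  refine SpinModel.ext (fun i => ?_) (fun i => ?_) <;>
    simp only [modR, SpinModel.smul_fst, SpinModel.smul_snd, SpinModel.sub_fst, SpinModel.sub_snd,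
      SpinModel.mk_fst, SpinModel.mk_snd, map_smul] <;>
    match_scalars <;> grind

theorem modelRep_sigma_C_M_L {c : Cayley k} (hc : cayleyTr c = 0) (M : Matrix (Fin 2) (Fin 2) k)
    (a : Cayley k) (u : Fin 2 → k) : modelRep (k := k) (sigmaMap k 5 (ofCayley c) (ofMat M)) (modL a u) =
      modR ((-2 : k) • cayleyMul k c a) (matR M u) := by
  rw [← phiEven_M, modelRep_phiEven_M, gammaMap_ofMat_modL, gammaMap_ofCayley_modR hc, neg_modR,
    neg_neg]

theorem modelRep_sigma_C_M_R {c : Cayley k} (hc : cayleyTr c = 0) (M : Matrix (Fin 2) (Fin 2) k)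
    (a : Cayley k) (u : Fin 2 → k) : modelRep (k := k) (sigmaMap k 5 (ofCayley c) (ofMat M)) (modR a u) =
      modL ((-2 : k) • cayleyMul k c a) (matL M u) := by
  rw [← phiEven_M, modelRep_phiEven_M, gammaMap_ofMat_modR, gammaMap_ofCayley_modL hc, neg_modL,
    modL_smul_neg]

theorem sigmaMap_swap (x y : OddSpace k 5) : sigmaMap k 5 x y = (-1 : k) • sigmaMap k 5 y x :=
  LinearMap.ext fun w => by
    rw [LinearMap.smul_apply, neg_one_smul, sigmaMap_apply, sigmaMap_apply, neg_sub]

/-- The bilinear form `(x, y) ↦ q(x, φ(y))`. -/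
def soForm (φ : Module.End k (OddSpace k 5)) : OddSpace k 5 →ₗ[k] OddSpace k 5 →ₗ[k] k :=
  (oddForm k 5).polarBilin.compl₂ φ

theorem soForm_apply (φ : Module.End k (OddSpace k 5)) (x y : OddSpace k 5) :
    soForm φ x y = (oddForm k 5).polarBilin x (φ y) := by
  rw [soForm, LinearMap.compl₂_apply]

/-- The bilinear form `(x, y) ↦ b(σ_{x,y} s, t)`. -/
def spinMoment (s t : SpinModel k) : OddSpace k 5 →ₗ[k] OddSpace k 5 →ₗ[k] k :=
  sigmaBilin.compr₂ (modelForm.flip t ∘ₗ modelRep.flip s)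

theorem spinMoment_apply (s t : SpinModel k) (x y : OddSpace k 5) :
    spinMoment s t x y = modelForm (modelRep (k := k) (sigmaMap k 5 x y) s) t := by
  rw [spinMoment, LinearMap.compr₂_apply, LinearMap.comp_apply, LinearMap.flip_apply,
    LinearMap.flip_apply, sigmaBilin_apply]

theorem soForm_swap {φ : Module.End k (OddSpace k 5)} (hφ : φ ∈ soOdd k 5) (x y : OddSpace k 5) :
    soForm φ x y = -soForm φ y x := by
  rw [soForm_apply, soForm_apply, oddPolar_comm, polar_so hφ]

theorem spinMoment_swap (s t : SpinModel k) (x y : OddSpace k 5) :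
    spinMoment s t x y = -spinMoment s t y x := by
  rw [spinMoment_apply, spinMoment_apply, sigmaMap_swap, modelRep.map_smul, LinearMap.smul_apply,
    modelForm.map_smul, LinearMap.smul_apply, neg_one_smul]

/-- Spin operators are skew for an alternating form, so the two signs cancel; this is the symmetry
of the odd product. -/
theorem spinMoment_comm (s t : SpinModel k) : spinMoment s t = spinMoment t s := by
  refine LinearMap.ext fun x => LinearMap.ext fun y => ?_
  rw [spinMoment_apply, spinMoment_apply, modelForm_modelRep, modelForm_swap, neg_neg]

theorem bilin_ext_of_skew {F G : OddSpace k 5 →ₗ[k] OddSpace k 5 →ₗ[k] k}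
    (hF : ∀ x y, F x y = -F y x) (hG : ∀ x y, G x y = -G y x)
    (hC : ∀ c d, cayleyTr c = 0 → cayleyTr d = 0 →
      F (ofCayley c) (ofCayley d) = G (ofCayley c) (ofCayley d))
    (hM : ∀ M N, F (ofMat M) (ofMat N) = G (ofMat M) (ofMat N))
    (hCM : ∀ c N, cayleyTr c = 0 → F (ofCayley c) (ofMat N) = G (ofCayley c) (ofMat N)) : F = G := by
  refine oddSpace_ext (fun c hc => oddSpace_ext (fun d hd => hC c d hc hd) fun N => hCM c N hc)
    fun M => oddSpace_ext (fun d hd => ?_) fun N => hM M N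
  rw [hF, hCM _ _ hd, ← hG]

/-- The comparison maps are compatible with the product of two odd elements. -/
def FormHom (X Y : TitsCK k) : Prop :=
  soForm (phiEven (k := k) (ckBracket (k := k) 1 1 X Y)) = spinMoment (phiOdd X) (phiOdd Y)

theorem FormHom.swap {X Y : TitsCK k} (hX : OddGen X) (hY : OddGen Y) (h : FormHom X Y) :
    FormHom Y X := by
  unfold FormHom at h ⊢
  rw [bracket_swap_odd hY hX, h, spinMoment_comm]

theorem FormHom.of_ext {X Y : TitsCK k} (hso : phiEven (k := k) (ckBracket (k := k) 1 1 X Y) ∈ soOdd k 5)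
    (hC : ∀ c d, cayleyTr c = 0 → cayleyTr d = 0 →
      (oddForm k 5).polarBilin (ofCayley c) (phiEven (k := k) (ckBracket (k := k) 1 1 X Y) (ofCayley d)) =
        modelForm (modelRep (k := k) (sigmaMap k 5 (ofCayley c) (ofCayley d)) (phiOdd X)) (phiOdd Y))
    (hM : ∀ M N,
      (oddForm k 5).polarBilin (ofMat M) (phiEven (k := k) (ckBracket (k := k) 1 1 X Y) (ofMat N)) =
        modelForm (modelRep (k := k) (sigmaMap k 5 (ofMat M) (ofMat N)) (phiOdd X)) (phiOdd Y))
    (hCM : ∀ c N, cayleyTr c = 0 →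
      (oddForm k 5).polarBilin (ofCayley c) (phiEven (k := k) (ckBracket (k := k) 1 1 X Y) (ofMat N)) =
        modelForm (modelRep (k := k) (sigmaMap k 5 (ofCayley c) (ofMat N)) (phiOdd X)) (phiOdd Y)) :
    FormHom X Y := by
  refine bilin_ext_of_skew (soForm_swap hso) (spinMoment_swap _ _) (fun c d hc hd => ?_)
    (fun M N => ?_) (fun c N hc => ?_)
  · rw [soForm_apply, spinMoment_apply, hC c d hc hd]
  · rw [soForm_apply, spinMoment_apply, hM]
  · rw [soForm_apply, spinMoment_apply, hCM c N hc]

theorem innerDer_mem_smul (r : k) (a b : Cayley k) :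
    r • innerDer (cayleyMul k) a b ∈ derSpace (cayleyMul k) :=
  Submodule.smul_mem _ _ (innerDer_mem_derSpace two_ne_zero_of_char_five a b)

theorem tr_algComm_add (a b : Cayley k) (r s : k) :
    cayleyTr (algComm (cayleyMul k) a b + r • imPart b - s • imPart a) = 0 := by
  rw [map_sub, map_add, map_smul, map_smul, tr_algComm, cayleyTr_imPart, cayleyTr_imPart, smul_zero,
    smul_zero, add_zero, sub_zero]

theorem symMat_trace (r : k) (u v : Fin 2 → k) : (r • symMat u v).trace = 0 := by
  simp [Matrix.trace_fin_two, symMat]; ring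

/-- The block of the compatibility with the form in which x and y are both in C⁰: the left side is
the action of the odd product on C⁰ and the right side comes from the commutator of L_c and L_d,
both after removal of the scalar (u|v). -/
theorem polar_innerDer {a b c d : Cayley k} (hc : cayleyTr c = 0) (hd : cayleyTr d = 0) :
    -(cayleyNorm k).polarBilin c (innerDer (cayleyMul k) a b d) +
      (cayleyNorm k).polarBilin c (algComm (cayleyMul k) d (algComm (cayleyMul k) a b
        + (2 * cayleyTr a) • imPart b - (2 * cayleyTr b) • imPart a)) =
    (cayleyNorm k).polarBilin (cayleyMul k d (cayleyMul k c a) - cayleyMul k c (cayleyMul k d a)) b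
     := by
  obtain ⟨c0, c1, c2, c3, c4, c5, c6, rfl⟩ := exists_zorn_of_tr hc
  obtain ⟨d0, d1, d2, d3, d4, d5, d6, rfl⟩ := exists_zorn_of_tr hd
  obtain ⟨a0, a1, a2, a3, a4, a5, a6, a7, rfl⟩ := exists_zorn a
  obtain ⟨b0, b1, b2, b3, b4, b5, b6, b7, rfl⟩ := exists_zorn b
  simp only [imPart_apply, cayleyOne_eq_zorn, innerDer_apply, algComm_apply_apply, zorn_mul,
    zorn_smul, zorn_add, zorn_sub, cayleyTr_zorn, zorn_polar]
  grind

theorem polar_smul_left (a b : Cayley k) (r : k) : (cayleyNorm k).polarBilin (r • a) b =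
    r * (cayleyNorm k).polarBilin a b := by
  rw [polar_comm, polar_smul_right, polar_comm]

theorem detPolar_pairAct_symMat (M N : Matrix (Fin 2) (Fin 2) k) (r : k) (u v : Fin 2 → k) :
    detPolar M (pairAct (r • symMat u v) 0 N) =
      r * altForm (matL N (matR M u) - matL M (matR N u)) v := by
  simp [pairAct_apply, detPolar_apply, symMat, altForm, matL, matR]
  grind

theorem detPolar_pairAct_symMat' (M N : Matrix (Fin 2) (Fin 2) k) (r : k) (u v : Fin 2 → k) :
    detPolar M (pairAct 0 (r • symMat u v) N) =
      r * altForm (matR N (matL M u) - matR M (matL N u)) v := by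
  simp [pairAct_apply, detPolar_apply, symMat, altForm, matL, matR]
  grind

theorem formHom_L_L (a b : Cayley k) (u v : Fin 2 → k) : FormHom (odL a u) (odL b v) := by
  have hD := innerDer_mem_smul (-altForm u v) a b
  apply FormHom.of_ext
  · rw [bracket_L_L, map_add, map_add]
    exact add_mem (add_mem (phiEven_mem_D hD) (phiEven_mem_A _))
      (phiEven_mem_K (symMat_trace _ _ _) (Matrix.trace_zero _ _))
  · intro c d hc hd
    rw [bracket_L_L, phiOdd_L, phiOdd_L, modelRep_sigma_C_C_L hc hd, modelForm_L_L, map_add, map_add,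
      LinearMap.add_apply, LinearMap.add_apply, phiEven_D_ofCayley _ hd, phiEven_A_ofCayley _ hd,
      phiEven_K_ofCayley, add_zero, ← map_add, polar_ofCayley hc
        (by rw [map_add, der_tr hD, tr_algComm, add_zero]), LinearMap.smul_apply, map_smul, map_add,
      polar_smul_right, polar_smul_right, polar_smul_left, ← polar_innerDer hc hd]
    clear * -
    grind
  · intro M N
    rw [bracket_L_L, phiOdd_L, phiOdd_L, modelRep_sigma_M_M_L, modelForm_L_L, map_add, map_add,
      LinearMap.add_apply, LinearMap.add_apply, phiEven_D_ofMat, phiEven_A_ofMat, phiEven_K_ofMat,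
      add_zero, zero_add, polar_ofMat, detPolar_pairAct_symMat, altForm_smul_left]
    have h := two_tr_mul_add_polar a b
    clear * - h
    grind
  · intro c N hc
    rw [bracket_L_L, phiOdd_L, phiOdd_L, modelRep_sigma_C_M_L hc, modelForm_R_L, map_add, map_add,
      LinearMap.add_apply, LinearMap.add_apply, phiEven_D_ofMat, phiEven_A_ofMat, phiEven_K_ofMat,
      add_zero, zero_add, polar_ofCayley_ofMat]

theorem formHom_R_R (a b : Cayley k) (u v : Fin 2 → k) : FormHom (odR a u) (odR b v) := by
  have hD := innerDer_mem_smul (altForm u v) a b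
  apply FormHom.of_ext
  · rw [bracket_R_R, map_add, map_add]
    exact add_mem (add_mem (phiEven_mem_D hD) (phiEven_mem_A _))
      (phiEven_mem_K (Matrix.trace_zero _ _) (symMat_trace _ _ _))
  · intro c d hc hd
    rw [bracket_R_R, phiOdd_R, phiOdd_R, modelRep_sigma_C_C_R hc hd, modelForm_R_R, map_add, map_add,
      LinearMap.add_apply, LinearMap.add_apply, phiEven_D_ofCayley _ hd, phiEven_A_ofCayley _ hd,
      phiEven_K_ofCayley, add_zero, ← map_add, polar_ofCayley hc
        (by rw [map_add, der_tr hD, tr_algComm, add_zero]), LinearMap.smul_apply, map_smul, map_add,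
      polar_smul_right, polar_smul_right, polar_smul_left, ← polar_innerDer hc hd]
    clear * -
    grind
  · intro M N
    rw [bracket_R_R, phiOdd_R, phiOdd_R, modelRep_sigma_M_M_R, modelForm_R_R, map_add, map_add,
      LinearMap.add_apply, LinearMap.add_apply, phiEven_D_ofMat, phiEven_A_ofMat, phiEven_K_ofMat,
      add_zero, zero_add, polar_ofMat, detPolar_pairAct_symMat', altForm_smul_left]
    have h := two_tr_mul_add_polar a b
    clear * - h
    grind
  · intro c N hc
    rw [bracket_R_R, phiOdd_R, phiOdd_R, modelRep_sigma_C_M_R hc, modelForm_L_R, map_add, map_add,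
      LinearMap.add_apply, LinearMap.add_apply, phiEven_D_ofMat, phiEven_A_ofMat, phiEven_K_ofMat,
      add_zero, zero_add, polar_ofCayley_ofMat]

/-- The block in which x is in C⁰ and y is a matrix; it is the only one that survives for odd
elements from different copies of U. -/
theorem polar_algComm_add {a b c : Cayley k} (hc : cayleyTr c = 0) :
    (cayleyNorm k).polarBilin c (algComm (cayleyMul k) a b + cayleyTr a • imPart b
      - cayleyTr b • imPart a) = 2 * (cayleyNorm k).polarBilin (cayleyMul k c a) b := by
  obtain ⟨c0, c1, c2, c3, c4, c5, c6, rfl⟩ := exists_zorn_of_tr hc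
  obtain ⟨a0, a1, a2, a3, a4, a5, a6, a7, rfl⟩ := exists_zorn a
  obtain ⟨b0, b1, b2, b3, b4, b5, b6, b7, rfl⟩ := exists_zorn b
  simp only [imPart_apply, cayleyOne_eq_zorn, algComm_apply_apply, zorn_mul,
    zorn_smul, zorn_add, zorn_sub, cayleyTr_zorn, zorn_polar]
  grind

theorem detPolar_vecMulVec (N : Matrix (Fin 2) (Fin 2) k) (u v : Fin 2 → k) :
    detPolar (Matrix.vecMulVec u v) N = altForm (matR N u) v := by
  simp [detPolar_apply, Matrix.vecMulVec_apply, altForm, matR]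
  ring

theorem formHom_L_R (a b : Cayley k) (u v : Fin 2 → k) : FormHom (odL a u) (odR b v) := by
  have htr : cayleyTr ((2 : k) • (algComm (cayleyMul k) a b + cayleyTr a • imPart b
      - cayleyTr b • imPart a)) = 0 := by rw [map_smul, tr_algComm_add, smul_zero]
  apply FormHom.of_ext
  · rw [bracket_L_R]
    exact phiEven_mem_M _ _
  · intro c d hc hd
    rw [bracket_L_R, phiOdd_L, phiOdd_R, modelRep_sigma_C_C_L hc hd, modelForm_L_R,
      phiEven_M_ofCayley _ _ htr hd, polar_ofCayley_ofMat]
  · intro M N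
    rw [bracket_L_R, phiOdd_L, phiOdd_R, modelRep_sigma_M_M_L, modelForm_L_R,
      phiEven_M_ofMat, polar_ofMat_ofCayley]
  · intro c N hc
    rw [bracket_L_R, phiOdd_L, phiOdd_R, modelRep_sigma_C_M_L hc, modelForm_R_R,
      phiEven_M_ofMat, polar_ofCayley hc (by rw [map_smul, htr, smul_zero]), polar_smul_right,
      polar_smul_right, polar_algComm_add hc, detPolar_vecMulVec, polar_smul_left]
    grind

theorem formHom_gen {X Y : TitsCK k} (hX : OddGen X) (hY : OddGen Y) : FormHom X Y := by
  have hX' := hX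
  have hY' := hY
  rcases hX with ⟨a, u⟩ | ⟨a, u⟩ <;> rcases hY with ⟨b, v⟩ | ⟨b, v⟩
  · exact formHom_L_L a b u v
  · exact formHom_L_R a b u v
  · exact (formHom_L_R b a v u).swap hY' hX'
  · exact formHom_R_R a b u v

end FormCompatibility

/-! ### The odd part is C⊗(U⊕U). -/

section OddDecomposition

variable {k : Type*} [Field k] [CharP k 5]

theorem eq_smul_add_smul (u : Fin 2 → k) : u = u 0 • ![1, 0] + u 1 • ![0, 1] := by
  apply vec_two_ext <;> simp

theorem tmul_map_two {C J : Type*} [AddCommGroup C] [Module k C] [AddCommGroup J] [Module k J]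
    (f g : (Fin 2 → k) →ₗ[k] J) (a : C) (u v : Fin 2 → k) :
    a ⊗ₜ[k] (f u + g v) = (u 0 • a) ⊗ₜ f ![1, 0] + (u 1 • a) ⊗ₜ f ![0, 1]
      + ((v 0 • a) ⊗ₜ g ![1, 0] + (v 1 • a) ⊗ₜ g ![0, 1]) := by
  conv_lhs => rw [eq_smul_add_smul u, eq_smul_add_smul v]
  simp only [map_add, map_smul, TensorProduct.tmul_add, TensorProduct.tmul_smul,
    TensorProduct.smul_tmul']

/-- The tensors `c₀ ⊗ x₀ + c₁ ⊗ x₁ + (d₀ ⊗ y₀ + d₁ ⊗ y₁)` with coefficients in a subspace. -/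
def tensorSpan {C J : Type*} [AddCommGroup C] [Module k C] [AddCommGroup J] [Module k J]
    (T : C →ₗ[k] k) (x₀ x₁ y₀ y₁ : J) : Submodule k (C ⊗[k] J) where
  carrier := {z | ∃ c₀ c₁ d₀ d₁ : C, T c₀ = 0 ∧ T c₁ = 0 ∧ T d₀ = 0 ∧ T d₁ = 0 ∧
    z = c₀ ⊗ₜ x₀ + c₁ ⊗ₜ x₁ + (d₀ ⊗ₜ y₀ + d₁ ⊗ₜ y₁)}
  add_mem' := by
    rintro _ _ ⟨c₀, c₁, d₀, d₁, h0, h1, h2, h3, rfl⟩ ⟨c₀', c₁', d₀', d₁', h0', h1', h2', h3', rfl⟩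
    refine ⟨c₀ + c₀', c₁ + c₁', d₀ + d₀', d₁ + d₁', by rw [map_add, h0, h0', add_zero],
      by rw [map_add, h1, h1', add_zero], by rw [map_add, h2, h2', add_zero],
      by rw [map_add, h3, h3', add_zero], ?_⟩
    simp only [TensorProduct.add_tmul]
    abel
  zero_mem' := ⟨0, 0, 0, 0, map_zero _, map_zero _, map_zero _, map_zero _, by simp⟩
  smul_mem' := by
    rintro c _ ⟨c₀, c₁, d₀, d₁, h0, h1, h2, h3, rfl⟩
    refine ⟨c • c₀, c • c₁, c • d₀, c • d₁, by rw [map_smul, h0, smul_zero],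
      by rw [map_smul, h1, smul_zero], by rw [map_smul, h2, smul_zero],
      by rw [map_smul, h3, smul_zero], ?_⟩
    simp only [smul_add, TensorProduct.smul_tmul']

theorem imPart_add_one (c : Cayley k) (hc : cayleyTr c = 0) (r : k) :
    imPart (c + r • cayleyOne k) = c := by
  rw [map_add, map_smul, imPart_of_tr hc, imPart_one, smul_zero, add_zero]

theorem tr_add_one (c : Cayley k) (hc : cayleyTr c = 0) (r : k) :
    cayleyTr (c + r • cayleyOne k) = 2 * r := by
  rw [map_add, map_smul, hc, cayleyTr_one, zero_add, smul_eq_mul, mul_comm]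

theorem three_smul_two_smul {C : Type*} [AddCommGroup C] [Module k C] (c : C) :
    (3 : k) • (2 : k) • c = c := by
  match_scalars
  grind

theorem kacOdd_eq_add {p q : Fin 2 → k} {r₀ r₁ s₀ s₁ : k} (h0 : -r₀ = p 0) (h1 : -r₁ = p 1)
    (h2 : -s₀ = q 0) (h3 : -s₁ = q 1) : kacOdd p q =
      kacOdd (-(r₀ • ![1, 0])) 0 + kacOdd (-(r₁ • ![0, 1])) 0 +
        (kacOdd 0 (-(s₀ • ![1, 0])) + kacOdd 0 (-(s₁ • ![0, 1]))) := by
  have hp : p = -(r₀ • ![1, 0]) + -(r₁ • ![0, 1]) + (0 + 0) := by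
    apply vec_two_ext <;> simp [h0, h1]
  have hq : q = 0 + 0 + (-(s₀ • ![1, 0]) + -(s₁ • ![0, 1])) := by
    apply vec_two_ext <;> simp [h2, h3]
  rw [← kacOdd_add, ← kacOdd_add, ← kacOdd_add, ← hp, ← hq]

theorem neg_two_mul_two_mul (x : k) : -(2 * (2 * x)) = x := by grind

theorem neg_three_mul_two_mul_neg (x : k) : -(3 * (2 * -x)) = x := by grind

theorem odd_decomp {X : TitsCK k} (hX : X ∈ titsCayleyKac k 1) :
    ∃ a₀ a₁ b₀ b₁ : Cayley k,
      X = odL a₀ ![1, 0] + odL a₁ ![0, 1] + (odR b₀ ![1, 0] + odR b₁ ![0, 1]) := by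
  obtain ⟨D, z, d⟩ := X
  obtain ⟨hD, hz, hd⟩ := mem_odd.1 hX
  have hD : D = 0 := hD
  obtain ⟨p, q, hpq⟩ := innerDerSuper_one_cases hd
  have hle : Submodule.map₂ (TensorProduct.mk k (Cayley k) (Kac k))
      (traceZero (cayleyNorm k) (cayleyOne k)) (kacGr k 1 ⊓ LinearMap.ker (kacTrace k)) ≤
      tensorSpan cayleyTr (kacL ![1, 0]) (kacL ![0, 1]) (kacR ![1, 0]) (kacR ![0, 1]) := by
    refine Submodule.map₂_le.2 fun a ha x hx => ?_
    obtain ⟨u, v, rfl⟩ := kacGr_one_cases hx.1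
    rw [mem_traceZero] at ha
    have hs (r : k) : cayleyTr (r • a) = 0 := by rw [map_smul, ha, smul_zero]
    exact ⟨u 0 • a, u 1 • a, v 0 • a, v 1 • a, hs _, hs _, hs _, hs _, tmul_map_two _ _ _ _ _⟩
  obtain ⟨c₀, c₁, d₀, d₁, h0, h1, h2, h3, hz'⟩ := hle hz
  have h2' : cayleyTr ((2 : k) • d₀) = 0 := by rw [map_smul, h2, smul_zero]
  have h3' : cayleyTr ((2 : k) • d₁) = 0 := by rw [map_smul, h3, smul_zero]
  -- The unit components solve -2r = p in the first copy and -3·2r = q in the second, so r = 2p and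
  -- r = -q; the factor 2 on d₀ and d₁ undoes the 3 in `odR`.
  refine ⟨c₀ + (2 * p 0) • cayleyOne k, c₁ + (2 * p 1) • cayleyOne k,
    (2 : k) • d₀ + (-q 0) • cayleyOne k, (2 : k) • d₁ + (-q 1) • cayleyOne k, ?_⟩
  rw [odL, odL, odR, odR, imPart_add_one _ h0, imPart_add_one _ h1, imPart_add_one _ h2',
    imPart_add_one _ h3', tr_add_one _ h0, tr_add_one _ h1, tr_add_one _ h2', tr_add_one _ h3',
    three_smul_two_smul, three_smul_two_smul]
  refine Prod.ext ?_ (Prod.ext ?_ ?_)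
  · exact hD.trans (by simp only [Prod.fst_add, add_zero])
  · exact hz'
  · refine hpq.trans ?_
    exact kacOdd_eq_add (neg_two_mul_two_mul _) (neg_two_mul_two_mul _)
      (neg_three_mul_two_mul_neg _) (neg_three_mul_two_mul_neg _)

theorem odd_le_span : titsCayleyKac k 1 ≤ Submodule.span k {X | OddGen X} := by
  intro X hX
  obtain ⟨a₀, a₁, b₀, b₁, rfl⟩ := odd_decomp hX
  have hs {X : TitsCK k} (h : OddGen X) : X ∈ Submodule.span k {X | OddGen X} :=
    Submodule.subset_span h
  exact add_mem (add_mem (hs (.L _ _)) (hs (.L _ _))) (add_mem (hs (.R _ _)) (hs (.R _ _)))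

theorem phiOdd_sum (a₀ a₁ b₀ b₁ : Cayley k) :
    phiOdd (k := k) (odL a₀ ![1, 0] + odL a₁ ![0, 1] + (odR b₀ ![1, 0] + odR b₁ ![0, 1])) =
      SpinModel.mk ![a₀, a₁] ![b₀, b₁] := by
  rw [map_add, map_add, map_add, phiOdd_L, phiOdd_L, phiOdd_R, phiOdd_R]
  refine SpinModel.ext (fun i => ?_) (fun i => ?_) <;>
    simp only [modL, modR, SpinModel.add_fst, SpinModel.add_snd, SpinModel.mk_fst, SpinModel.mk_snd] <;>
    fin_cases i <;> simp

theorem odL_zero (u : Fin 2 → k) : odL 0 u = 0 := by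
  rw [odL, map_zero, map_zero, zero_smul, neg_zero, TensorProduct.zero_tmul]
  simp [kacOdd]

theorem odR_zero (u : Fin 2 → k) : odR 0 u = 0 := by
  rw [odR, map_zero, map_zero, mul_zero, zero_smul, neg_zero, smul_zero, TensorProduct.zero_tmul]
  simp [kacOdd]

theorem phiOdd_injective {X : TitsCK k} (hX : X ∈ titsCayleyKac k 1) (h : phiOdd X = 0) : X = 0 := by
  obtain ⟨a₀, a₁, b₀, b₁, rfl⟩ := odd_decomp hX
  rw [phiOdd_sum] at h
  have h1 : a₀ = 0 := congrArg (fun s : SpinModel k => s.1 0) h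
  have h2 : a₁ = 0 := congrArg (fun s : SpinModel k => s.1 1) h
  have h3 : b₀ = 0 := congrArg (fun s : SpinModel k => s.2 0) h
  have h4 : b₁ = 0 := congrArg (fun s : SpinModel k => s.2 1) h
  rw [h1, h2, h3, h4, odL_zero, odL_zero, odR_zero, odR_zero, add_zero, add_zero]

theorem phiOdd_surjective (s : SpinModel k) : ∃ X ∈ titsCayleyKac k 1, phiOdd X = s := by
  refine ⟨_, add_mem (add_mem (OddGen.L (s.1 0) _).mem (OddGen.L (s.1 1) _).mem)
    (add_mem (OddGen.R (s.2 0) _).mem (OddGen.R (s.2 1) _).mem), (phiOdd_sum _ _ _ _).trans ?_⟩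
  refine SpinModel.ext (fun i => ?_) (fun i => ?_) <;> fin_cases i <;> rfl

end OddDecomposition

/-! ### The comparison map is bijective from the even part onto so(W). -/

section EvenBijective

variable {k : Type*} [Field k] [CharP k 5]

theorem brMat_trace (M N : Matrix (Fin 2) (Fin 2) k) (r : k) : (r • brMat M N).trace = 0 := by
  simp [Matrix.trace_fin_two, brMat]
  ring

/-- `two_innerDer_apply` read backwards: so(C⁰) is covered by derivations and commutators. The
factor -1 offsets the sign in the image of a⊗(e⊗e). -/
theorem phiEven_eq_sigma_C_C {c d : Cayley k} (hc : cayleyTr c = 0) (hd : cayleyTr d = 0) :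
    phiEven (k := k) (evD ((2 : k) • innerDer (cayleyMul k) c d)
      + evA ((-1 : k) • algComm (cayleyMul k) c d)) = sigmaMap k 5 (ofCayley c) (ofCayley d) := by
  refine oddSpace_ext (fun b hb => ?_) fun N => ?_
  · rw [map_add, LinearMap.add_apply, phiEven_D_ofCayley _ hb, phiEven_A_ofCayley _ hb, ← map_add,
      sigmaMap_apply, polar_ofCayley hc hb, polar_ofCayley hd hb, ← ofCayley.map_smul,
      ← ofCayley.map_smul, ofCayley_sub, ← two_innerDer_apply hc hd hb, algComm_swap _ b]
    congr 1
    simp only [map_smul, LinearMap.smul_apply]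
    module
  · rw [map_add, LinearMap.add_apply, phiEven_D_ofMat, phiEven_A_ofMat, sigmaMap_apply,
      polar_ofCayley_ofMat, polar_ofCayley_ofMat, zero_smul, zero_smul, sub_zero, add_zero]

theorem phiEven_eq_sigma_M_M (M N : Matrix (Fin 2) (Fin 2) k) :
    phiEven (k := k) (evK (-(2 * 1 : k) • brMat M N) (-(2 * 1 : k) • brMat M.transpose N.transpose)) =
      sigmaMap k 5 (ofMat M) (ofMat N) := by
  refine oddSpace_ext (fun b hb => ?_) fun P => ?_
  · rw [phiEven_K_ofCayley, sigmaMap_apply, polar_ofMat_ofCayley, polar_ofMat_ofCayley, zero_smul,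
      zero_smul, sub_zero]
  · rw [phiEven_K_ofMat, pairAct_brMat, sigmaMap_apply, polar_ofMat, polar_ofMat, one_smul,
      ← map_smul, ← map_smul, ofMat_sub]

theorem sigmaMap_mem_map (x y : OddSpace k 5) :
    sigmaMap k 5 x y ∈ (titsCayleyKac k 0).map phiEven := by
  have key : ∀ x y : OddSpace k 5, sigmaBilin x y ∈ (titsCayleyKac k 0).map phiEven := by
    have hCM {c : Cayley k} (hc : cayleyTr c = 0) (M) :
        sigmaBilin (ofCayley c) (ofMat M) ∈ (titsCayleyKac k 0).map phiEven :=
      ⟨_, (EvenGen.M hc M).mem, phiEven_M c M⟩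
    have hMC {c : Cayley k} (hc : cayleyTr c = 0) (M) :
        sigmaBilin (ofMat M) (ofCayley c) ∈ (titsCayleyKac k 0).map phiEven := by
      rw [sigmaBilin_apply, sigmaMap_swap]
      exact Submodule.smul_mem _ _ (hCM hc M)
    have hCC {c d : Cayley k} (hc : cayleyTr c = 0) (hd : cayleyTr d = 0) :
        sigmaBilin (ofCayley c) (ofCayley d) ∈ (titsCayleyKac k 0).map phiEven :=
      ⟨_, add_mem (EvenGen.D (innerDer_mem_smul 2 c d)).mem
        (EvenGen.A (by rw [map_smul, tr_algComm, smul_zero])).mem, phiEven_eq_sigma_C_C hc hd⟩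
    have hMM (M N) : sigmaBilin (ofMat M) (ofMat N) ∈ (titsCayleyKac k 0).map phiEven :=
      ⟨_, (EvenGen.K (brMat_trace _ _ _) (brMat_trace _ _ _)).mem, phiEven_eq_sigma_M_M M N⟩
    intro x y
    have hx := cayleyTr_toCayley x
    have hy := cayleyTr_toCayley y
    rw [← ofCayley_toCayley_add x, ← ofCayley_toCayley_add y, map_add, map_add, LinearMap.add_apply,
      LinearMap.add_apply]
    exact add_mem (add_mem (hCC hx hy) (hMC hy _)) (add_mem (hCM hx _) (hMM _ _))
  exact key x y

/-- By `so_eq_sum` twice a skew map is a combination of maps σ_{x,y}, and 2 is invertible; so linear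
statements about so(W) need only be checked on the σ_{x,y}. -/
theorem so_le_of_sigmaMap_mem {N : Submodule k (Module.End k (OddSpace k 5))}
    (hm : ∀ x y, sigmaMap k 5 x y ∈ N) {φ : Module.End k (OddSpace k 5)} (hφ : φ ∈ soOdd k 5) :
    φ ∈ N := by
  have h : φ = (3 : k) • (2 : k) • φ := by match_scalars; grind
  have h2 : (2 : k) • φ = ∑ i, sigmaMap k 5 (vecF k 5 i) (φ (vecV k 5 i))
      + ∑ i, sigmaMap k 5 (vecV k 5 i) (φ (vecF k 5 i))
      + (-(1 / 2) : k) • sigmaMap k 5 (vecU k 5) (φ (vecU k 5)) := by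
    refine LinearMap.ext fun w => ?_
    rw [so_eq_sum hφ]
    simp only [LinearMap.sub_apply, LinearMap.add_apply, LinearMap.smul_apply]
    rw [neg_smul, sub_eq_add_neg]
  rw [h, h2]
  exact N.smul_mem _ (N.add_mem (N.add_mem (N.sum_mem fun i _ => hm _ _)
    (N.sum_mem fun i _ => hm _ _)) (N.smul_mem _ (hm _ _)))

theorem phiEven_surjective {φ : Module.End k (OddSpace k 5)} (hφ : φ ∈ soOdd k 5) :
    ∃ X ∈ titsCayleyKac k 0, phiEven X = φ :=
  so_le_of_sigmaMap_mem sigmaMap_mem_map hφ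

/-- If A⊗1 + 1⊗B = 0 then A and B are opposite scalars, and trace zero makes them vanish as 2 is
invertible. -/
theorem eq_zero_of_pairAct {A B : Matrix (Fin 2) (Fin 2) k} (hA : A.trace = 0) (hB : B.trace = 0)
    (h : ∀ N, pairAct A B N = 0) : A = 0 ∧ B = 0 := by
  rw [Matrix.trace_fin_two] at hA hB
  have e (N : Matrix (Fin 2) (Fin 2) k) (i j : Fin 2) : A i 0 * N 0 j + A i 1 * N 1 j +
      (N i 0 * B j 0 + N i 1 * B j 1) = 0 := by rw [← pairAct_apply, h, Matrix.zero_apply]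
  have h1 := e !![1, 0; 0, 0] 0 0
  have h2 := e !![1, 0; 0, 0] 0 1
  have h3 := e !![1, 0; 0, 0] 1 0
  have h4 := e !![0, 1; 0, 0] 0 1
  have h5 := e !![0, 1; 0, 0] 0 0
  have h6 := e !![0, 0; 1, 0] 0 0
  simp at h1 h2 h3 h4 h5 h6
  constructor <;> apply mat_two_ext <;> simp <;> grind

theorem eq_zero_of_detPolar {a b c d : Cayley k}
    (h : ∀ N : Matrix (Fin 2) (Fin 2) k, (-detPolar !![1, 0; 0, 0] N) • a
      + (-detPolar !![0, 1; 0, 0] N) • b + (-detPolar !![0, 0; 1, 0] N) • c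
      + (-detPolar !![0, 0; 0, 1] N) • d = 0) : a = 0 ∧ b = 0 ∧ c = 0 ∧ d = 0 := by
  have h1 := h !![1, 0; 0, 0]
  have h2 := h !![0, 1; 0, 0]
  have h3 := h !![0, 0; 1, 0]
  have h4 := h !![0, 0; 0, 1]
  simp [detPolar_apply] at h1 h2 h3 h4
  exact ⟨h4, h3, h2, h1⟩

/-- In an alternative algebra [a,·] fails to be a derivation by -3(a,x,y). As 3 is invertible, a
would associate with everything; three products of basis elements already show a = 0. -/
theorem eq_zero_of_algComm_der {a : Cayley k} (ha : cayleyTr a = 0)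
    (h : algComm (cayleyMul k) a ∈ derSpace (cayleyMul k)) : a = 0 := by
  obtain ⟨a0, a1, a2, a3, a4, a5, a6, rfl⟩ := exists_zorn_of_tr ha
  have h1 := h (zorn 0 1 0 0 0 0 0 0) (zorn 0 0 1 0 0 0 0 0)
  have h2 := h (zorn 0 0 1 0 0 0 0 0) (zorn 0 0 0 1 0 0 0 0)
  have h3 := h (zorn 0 0 0 0 1 0 0 0) (zorn 0 0 0 0 0 1 0 0)
  simp only [algComm_apply_apply, zorn_mul, zorn_sub, zorn_add, zorn_eq_iff, mul_zero, zero_mul,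
    mul_one, one_mul, add_zero, zero_add, sub_zero, zero_sub, neg_neg] at h1 h2 h3
  obtain ⟨g3, g5, g4, -, -, -, g0, -⟩ := h1
  obtain ⟨g1, -, g6, -⟩ := h2
  obtain ⟨-, -, -, -, g2, -⟩ := h3
  have e0 : a0 = 0 := by clear * - g0; grind
  have e1 : a1 = 0 := by clear * - g1; grind
  have e2 : a2 = 0 := by clear * - g2; grind
  have e3 : a3 = 0 := by clear * - g3; grind
  have e4 : a4 = 0 := by clear * - g4; grind
  have e5 : a5 = 0 := by clear * - g5; grind
  have e6 : a6 = 0 := by clear * - g6; grind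
  rw [e0, e1, e2, e3, e4, e5, e6, neg_zero, zorn_zero]

theorem imPart_add_smul_one (b : Cayley k) : imPart b + (3 * cayleyTr b) • cayleyOne k = b := by
  rw [imPart_apply]
  match_scalars <;> grind

/-- The components separate by blocks: matrices to matrices sees only sl(U)⊕sl(U), matrices to C⁰
sees the four Cayley coefficients, and C⁰ to C⁰ leaves D = [a,·]. -/
theorem phiEven_injective {X : TitsCK k} (hX : X ∈ titsCayleyKac k 0) (h : phiEven X = 0) :
    X = 0 := by
  obtain ⟨D, a, c₀, c₁, c₂, c₃, A, B, hD, ha, h0, h1, h2, h3, hA, hB, rfl⟩ := even_decomp hX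
  have hN (N : Matrix (Fin 2) (Fin 2) k) := LinearMap.congr_fun h (ofMat N)
  have hC (b : Cayley k) := LinearMap.congr_fun h (ofCayley b)
  simp only [map_add, LinearMap.add_apply, phiEven_D_ofMat, phiEven_A_ofMat, phiEven_M_ofMat,
    phiEven_K_ofMat, LinearMap.zero_apply, zero_add] at hN
  have hs (r : k) {c : Cayley k} (hc : cayleyTr c = 0) : cayleyTr (r • c) = 0 := by
    rw [map_smul, hc, smul_zero]
  obtain ⟨rfl, rfl⟩ := eq_zero_of_pairAct hA hB fun N => by
    have := congrArg toMat (hN N)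
    simpa only [map_add, toMat_ofCayley, toMat_ofMat, map_zero, zero_add] using this
  obtain ⟨rfl, rfl, rfl, rfl⟩ := eq_zero_of_detPolar fun N => by
    have := congrArg toCayley (hN N)
    simpa only [map_add, toCayley_ofMat, toCayley_ofCayley (hs _ h0), toCayley_ofCayley (hs _ h1),
      toCayley_ofCayley (hs _ h2), toCayley_ofCayley (hs _ h3), map_zero, add_zero] using this
  have hDa (b : Cayley k) (hb : cayleyTr b = 0) : D b = algComm (cayleyMul k) a b := by
    have := congrArg toCayley (hC b)
    simp only [map_add, LinearMap.add_apply, phiEven_D_ofCayley _ hb, phiEven_A_ofCayley _ hb,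
      phiEven_M_ofCayley _ _ h0 hb, phiEven_K_ofCayley, toCayley_ofMat,
      toCayley_ofCayley (der_tr hD b), toCayley_ofCayley (tr_algComm _ _), map_zero, add_zero,
      LinearMap.zero_apply] at this
    rw [eq_neg_of_add_eq_zero_left this, algComm_swap, neg_neg]
  -- So far D and [a,·] agree on C⁰ only; both kill the unit, so they agree on C.
  have hDa' : D = algComm (cayleyMul k) a := by
    refine LinearMap.ext fun b => ?_
    have e1 : algComm (cayleyMul k) a (cayleyOne k) = 0 := by
      rw [algComm_apply_apply, cayleyMul_one_left, cayleyMul_one_right, sub_self]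
    rw [← imPart_add_smul_one b, map_add, map_add, map_smul, map_smul, der_one hD, e1, hDa _ (cayleyTr_imPart b)]
  obtain rfl := eq_zero_of_algComm_der ha (hDa' ▸ hD)
  rw [hDa', map_zero]
  simp [evD, evA, evM, evK, kacEven_zero]

end EvenBijective

/-! ### The cyclic identity for three odd elements. -/

section Cyclic

variable {k : Type*} [Field k] [CharP k 5]

/-- The commutator of two spin operators is skew and acts on Clifford operators through [φ,ψ], so it
is the spin operator of [φ,ψ] by uniqueness. -/
theorem modelRep_comm {φ ψ : Module.End k (OddSpace k 5)} (hφ : φ ∈ soOdd k 5)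
    (hψ : ψ ∈ soOdd k 5) : modelRep (k := k) (φ * ψ - ψ * φ) =
      modelRep φ * modelRep ψ - modelRep ψ * modelRep φ := by
  have hm : φ * ψ - ψ * φ ∈ soOdd k 5 := (soOdd k 5).lie_mem hφ hψ
  have e {χ : Module.End k (OddSpace k 5)} (hχ : χ ∈ soOdd k 5) (w : OddSpace k 5)
      (s : SpinModel k) : modelRep χ (gammaMap w s) = gammaMap w (modelRep χ s) + gammaMap (χ w) s := by
    rw [← modelRep_gammaMap hχ]
    abel
  refine (eq_modelRep hm (fun w s => ?_) fun x y => ?_).symm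
  · simp only [LinearMap.sub_apply, Module.End.mul_apply, e hφ, e hψ, map_add, map_sub]
    abel
  · simp only [LinearMap.sub_apply, Module.End.mul_apply, map_sub, modelForm_modelRep φ,
      modelForm_modelRep ψ, map_neg]
    ring

/-- The derivation part of the product of two odd elements, on the Cayley algebra. -/
def oddDer (a b c : Cayley k) : Cayley k :=
  -(innerDer (cayleyMul k) a b c) - leftAddTwoRight (algComm (cayleyMul k) a b
    + (2 * cayleyTr a) • imPart b - (2 * cayleyTr b) • imPart a) c

/-- The Cayley part of the product of an element of each kind. -/
def oddMix (a b : Cayley k) : Cayley k :=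
  (2 : k) • (algComm (cayleyMul k) a b + cayleyTr a • imPart b - cayleyTr b • imPart a)

/-- Up to the correction by norms the triple product of C given by `oddDer` is invariant under
cyclic permutations. This is what three odd elements from the same copy of U need, by
`cyclic_module`. -/
theorem oddDer_cyclic (a b c : Cayley k) :
    oddDer a b c + (cayleyNorm k).polarBilin c a • b - (cayleyNorm k).polarBilin b c • a =
      oddDer b c a + (cayleyNorm k).polarBilin a b • c - (cayleyNorm k).polarBilin c a • b := by
  obtain ⟨a0, a1, a2, a3, a4, a5, a6, a7, rfl⟩ := exists_zorn a
  obtain ⟨b0, b1, b2, b3, b4, b5, b6, b7, rfl⟩ := exists_zorn b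
  obtain ⟨c0, c1, c2, c3, c4, c5, c6, c7, rfl⟩ := exists_zorn c
  simp only [oddDer, leftAddTwoRight_apply, imPart_apply, cayleyOne_eq_zorn, innerDer_apply,
    algComm_apply_apply, zorn_mul, zorn_smul, zorn_add, zorn_sub, zorn_neg, cayleyTr_zorn, zorn_polar,
    zorn_eq_iff]
  refine ⟨?_, ?_, ?_, ?_, ?_, ?_, ?_, ?_⟩ <;> grind

/-- With two elements from one copy of U and the third from the other, all three terms of the cyclic
sum are multiples of the same tensor, and this is the relation left between their coefficients. -/
theorem oddDer_eq_oddMix (a b c : Cayley k) : oddDer a b c =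
    (2 : k) • cayleyMul k (oddMix a c) b - (2 : k) • cayleyMul k (oddMix b c) a := by
  obtain ⟨a0, a1, a2, a3, a4, a5, a6, a7, rfl⟩ := exists_zorn a
  obtain ⟨b0, b1, b2, b3, b4, b5, b6, b7, rfl⟩ := exists_zorn b
  obtain ⟨c0, c1, c2, c3, c4, c5, c6, c7, rfl⟩ := exists_zorn c
  simp only [oddDer, oddMix, leftAddTwoRight_apply, imPart_apply, cayleyOne_eq_zorn, innerDer_apply,
    algComm_apply_apply, zorn_mul, zorn_smul, zorn_add, zorn_sub, zorn_neg, cayleyTr_zorn, zorn_polar,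
    zorn_eq_iff]
  refine ⟨?_, ?_, ?_, ?_, ?_, ?_, ?_, ?_⟩ <;> grind

theorem oddMix_swap (a b : Cayley k) : oddMix a b = -oddMix b a := by
  rw [oddMix, oddMix, algComm_swap]
  module

theorem compEnd_smul_oddDer (r : k) (a b : Cayley k) {e : Cayley k} (he : e = algComm (cayleyMul k) a b
    + (2 * cayleyTr a) • imPart b - (2 * cayleyTr b) • imPart a) (c : Cayley k) :
    (r • innerDer (cayleyMul k) a b) c + (-leftAddTwoRight (-r • e)) c = -r • oddDer a b c := by
  simp only [oddDer, ← he, map_smul, LinearMap.smul_apply, LinearMap.neg_apply]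
  module

theorem modelRep_phiEven_add_add (X Y Z : TitsCK k) (s : SpinModel k) :
    modelRep (k := k) (phiEven (k := k) (X + Y + Z)) s =
      modelRep (k := k) (phiEven X) s + modelRep (k := k) (phiEven Y) s + modelRep (k := k) (phiEven Z) s := by
  rw [map_add, map_add, map_add, map_add, LinearMap.add_apply, LinearMap.add_apply]

theorem symMat_mulVec (u v w : Fin 2 → k) :
    (symMat u v).mulVec w = altForm v w • u + altForm u w • v := by
  apply vec_two_ext <;> simp [mulVec_two, symMat, altForm] <;> ring

theorem matR_vecMulVec (u v w : Fin 2 → k) : matR (Matrix.vecMulVec u v) w = altForm u w • v := by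
  apply vec_two_ext <;> simp [matR, Matrix.vecMulVec_apply, altForm] <;> ring

theorem matL_vecMulVec (u v w : Fin 2 → k) : matL (Matrix.vecMulVec u v) w = altForm v w • u := by
  apply vec_two_ext <;> simp [matL, Matrix.vecMulVec_apply, altForm] <;> ring

theorem modL_add (a b : Cayley k) (u : Fin 2 → k) : modL (a + b) u = modL a u + modL b u := by
  refine SpinModel.ext (fun i => ?_) (fun i => ?_) <;>
    simp only [modL, SpinModel.mk_fst, SpinModel.mk_snd, SpinModel.add_fst, SpinModel.add_snd] <;>
    module

theorem modR_add (a b : Cayley k) (u : Fin 2 → k) : modR (a + b) u = modR a u + modR b u := by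
  refine SpinModel.ext (fun i => ?_) (fun i => ?_) <;>
    simp only [modR, SpinModel.mk_fst, SpinModel.mk_snd, SpinModel.add_fst, SpinModel.add_snd] <;>
    module

theorem act_L_L {a b : Cayley k} {u v : Fin 2 → k} (c : Cayley k) (w : Fin 2 → k) :
    modelRep (k := k) (phiEven (k := k) (ckBracket (k := k) 1 1 (odL a u) (odL b v))) (modL c w) =
      modL (altForm u v • oddDer a b c) w
        + modL ((cayleyNorm k).polarBilin a b • c) (altForm v w • u + altForm u w • v) := by
  rw [bracket_L_L, modelRep_phiEven_add_add,
    modelRep_phiEven_D (innerDer_mem_smul _ a b),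
    modelRep_phiEven_A (by rw [map_smul, tr_algComm_add, smul_zero]),
    modelRep_phiEven_K (symMat_trace _ _ _) (Matrix.trace_zero _ _), compEnd_modL, compEnd_modL,
    blockEnd_modL, ← modL_add, ← symMat_mulVec]
  have h := compEnd_smul_oddDer (-altForm u v) a b rfl c
  rw [neg_neg] at h
  rw [h, Matrix.smul_mulVec]
  have h2 := two_tr_mul_add_polar a b
  congr 1
  have h3 : -(2 * cayleyTr a * cayleyTr b) - 4 * (cayleyNorm k).polarBilin (imPart a) (imPart b) =
    (cayleyNorm k).polarBilin a b := by grind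
  rw [h3]
  refine SpinModel.ext (fun i => ?_) (fun i => ?_) <;>
    simp only [modL, SpinModel.mk_fst, SpinModel.mk_snd, Pi.smul_apply, smul_eq_mul] <;> module

theorem act_L_L' {a b : Cayley k} {u v : Fin 2 → k} (c : Cayley k) (w : Fin 2 → k) :
    modelRep (k := k) (phiEven (k := k) (ckBracket (k := k) 1 1 (odL a u) (odL b v))) (modR c w) =
      modR (altForm u v • oddDer a b c) w := by
  rw [bracket_L_L, modelRep_phiEven_add_add,
    modelRep_phiEven_D (innerDer_mem_smul _ a b),
    modelRep_phiEven_A (by rw [map_smul, tr_algComm_add, smul_zero]),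
    modelRep_phiEven_K (symMat_trace _ _ _) (Matrix.trace_zero _ _), compEnd_modR, compEnd_modR,
    blockEnd_modR, ← modR_add]
  have h := compEnd_smul_oddDer (-altForm u v) a b rfl c
  rw [neg_neg] at h
  rw [h, Matrix.zero_mulVec]
  refine SpinModel.ext (fun i => ?_) (fun i => ?_) <;>
    simp only [modR, SpinModel.mk_fst, SpinModel.mk_snd, SpinModel.add_fst, SpinModel.add_snd,
      Pi.zero_apply, zero_smul, add_zero]

theorem act_R_R {a b : Cayley k} {u v : Fin 2 → k} (c : Cayley k) (w : Fin 2 → k) :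
    modelRep (k := k) (phiEven (k := k) (ckBracket (k := k) 1 1 (odR a u) (odR b v))) (modR c w) =
      (-1 : k) • (modR (altForm u v • oddDer a b c) w
        + modR ((cayleyNorm k).polarBilin a b • c) (altForm v w • u + altForm u w • v)) := by
  rw [bracket_R_R, modelRep_phiEven_add_add,
    modelRep_phiEven_D (innerDer_mem_smul _ a b),
    modelRep_phiEven_A (by rw [map_smul, tr_algComm_add, smul_zero]),
    modelRep_phiEven_K (Matrix.trace_zero _ _) (symMat_trace _ _ _), compEnd_modR, compEnd_modR,
    blockEnd_modR, ← modR_add, ← symMat_mulVec]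
  have h := compEnd_smul_oddDer (altForm u v) a b rfl c
  rw [h, Matrix.smul_mulVec, two_tr_mul_add_polar]
  refine SpinModel.ext (fun i => ?_) (fun i => ?_) <;>
    simp only [modR, SpinModel.mk_fst, SpinModel.mk_snd, SpinModel.add_fst, SpinModel.add_snd,
      SpinModel.smul_fst, SpinModel.smul_snd, Pi.smul_apply, smul_eq_mul] <;> module

theorem act_R_R' {a b : Cayley k} {u v : Fin 2 → k} (c : Cayley k) (w : Fin 2 → k) :
    modelRep (k := k) (phiEven (k := k) (ckBracket (k := k) 1 1 (odR a u) (odR b v))) (modL c w) =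
      modL (-altForm u v • oddDer a b c) w := by
  rw [bracket_R_R, modelRep_phiEven_add_add,
    modelRep_phiEven_D (innerDer_mem_smul _ a b),
    modelRep_phiEven_A (by rw [map_smul, tr_algComm_add, smul_zero]),
    modelRep_phiEven_K (Matrix.trace_zero _ _) (symMat_trace _ _ _), compEnd_modL, compEnd_modL,
    blockEnd_modL, ← modL_add]
  have h := compEnd_smul_oddDer (altForm u v) a b rfl c
  rw [h, Matrix.zero_mulVec]
  refine SpinModel.ext (fun i => ?_) (fun i => ?_) <;>
    simp only [modL, SpinModel.mk_fst, SpinModel.mk_snd, SpinModel.add_fst, SpinModel.add_snd,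
      Pi.zero_apply, zero_smul, add_zero]

theorem cayleyTr_oddMix (a b : Cayley k) : cayleyTr (oddMix a b) = 0 := by
  rw [oddMix, map_smul, tr_algComm_add, smul_zero]

theorem act_L_R {a b : Cayley k} {u v : Fin 2 → k} (c : Cayley k) (w : Fin 2 → k) :
    modelRep (k := k) (phiEven (k := k) (ckBracket (k := k) 1 1 (odL a u) (odR b v))) (modL c w) =
      modR ((-2 : k) • cayleyMul k (oddMix a b) c) (altForm u w • v) := by
  rw [bracket_L_R, ← oddMix, phiEven_M, modelRep_sigma_C_M_L (cayleyTr_oddMix a b), matR_vecMulVec]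

theorem act_L_R' {a b : Cayley k} {u v : Fin 2 → k} (c : Cayley k) (w : Fin 2 → k) :
    modelRep (k := k) (phiEven (k := k) (ckBracket (k := k) 1 1 (odL a u) (odR b v))) (modR c w) =
      modL ((-2 : k) • cayleyMul k (oddMix a b) c) (altForm v w • u) := by
  rw [bracket_L_R, ← oddMix, phiEven_M, modelRep_sigma_C_M_R (cayleyTr_oddMix a b), matL_vecMulVec]

/-- The cyclic identity for three odd elements. -/
def CyclicSum (X Y Z : TitsCK k) : Prop :=
  modelRep (k := k) (phiEven (k := k) (ckBracket (k := k) 1 1 X Y)) (phiOdd Z) + modelRep (k := k) (phiEven (k := k) (ckBracket (k := k) 1 1 Y Z)) (phiOdd X)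
    + modelRep (k := k) (phiEven (k := k) (ckBracket (k := k) 1 1 Z X)) (phiOdd Y) = 0

theorem CyclicSum.rotate {X Y Z : TitsCK k} (h : CyclicSum X Y Z) : CyclicSum Y Z X := by
  unfold CyclicSum at h ⊢
  rw [← h]
  abel

/-- Let G be the common value in the hypotheses. After substitution the terms with a, b, c cancel in
pairs by skewness of the alternating form, and the coefficient of G is a component of (u|v)w +
(v|w)u + (w|u)v, which is 0 in a plane. -/
theorem cyclic_module {E : Type*} [AddCommGroup E] [Module k E] {g₁ g₂ g₃ a b c : E} {p q r : k}
    (h₁ : g₁ + r • b - q • a = g₂ + p • c - r • b) (h₂ : g₂ + p • c - r • b = g₃ + q • a - p • c)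
    (u v w : Fin 2 → k) (i : Fin 2) :
    w i • altForm u v • g₁ + (altForm v w • u + altForm u w • v) i • p • c
      + (u i • altForm v w • g₂ + (altForm w u • v + altForm v u • w) i • q • a)
      + (v i • altForm w u • g₃ + (altForm u v • w + altForm w v • u) i • r • b) = 0 := by
  have e2 : g₂ = g₁ + r • b - q • a - p • c + r • b := by rw [h₁]; abel
  have e3 : g₃ = g₁ + r • b - q • a - q • a + p • c := by rw [h₁, h₂]; abel
  rw [e2, e3]
  fin_cases i <;> simp [altForm] <;> module

theorem cyclicSum_L_L_L (a b c : Cayley k) (u v w : Fin 2 → k) :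
    CyclicSum (odL a u) (odL b v) (odL c w) := by
  unfold CyclicSum
  rw [phiOdd_L, phiOdd_L, phiOdd_L, act_L_L, act_L_L, act_L_L]
  refine SpinModel.ext (fun i => ?_) (fun i => ?_) <;>
    simp only [modL, SpinModel.mk_fst, SpinModel.mk_snd, SpinModel.add_fst, SpinModel.add_snd,
      SpinModel.zero_fst, SpinModel.zero_snd, add_zero]
  exact cyclic_module (oddDer_cyclic a b c) (oddDer_cyclic b c a) u v w i

theorem cyclicSum_R_R_R (a b c : Cayley k) (u v w : Fin 2 → k) :
    CyclicSum (odR a u) (odR b v) (odR c w) := by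
  unfold CyclicSum
  rw [phiOdd_R, phiOdd_R, phiOdd_R, act_R_R, act_R_R, act_R_R]
  refine SpinModel.ext (fun i => ?_) (fun i => ?_) <;>
    simp only [modR, SpinModel.mk_fst, SpinModel.mk_snd, SpinModel.add_fst, SpinModel.add_snd,
      SpinModel.zero_fst, SpinModel.zero_snd, SpinModel.smul_fst, SpinModel.smul_snd, add_zero,
      smul_zero]
  rw [← smul_add, ← smul_add, cyclic_module (oddDer_cyclic a b c) (oddDer_cyclic b c a) u v w i,
    smul_zero]

theorem cyclicSum_L_L_R (a b c : Cayley k) (u v w : Fin 2 → k) :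
    CyclicSum (odL a u) (odL b v) (odR c w) := by
  unfold CyclicSum
  rw [phiOdd_L, phiOdd_L, phiOdd_R, bracket_swap_odd (.R c w) (.L a u), act_L_L', act_L_R, act_L_R,
    oddDer_eq_oddMix]
  refine SpinModel.ext (fun i => ?_) (fun i => ?_) <;>
    simp only [modR, SpinModel.mk_fst, SpinModel.mk_snd, SpinModel.add_fst, SpinModel.add_snd,
      SpinModel.zero_fst, SpinModel.zero_snd, add_zero, Pi.smul_apply, smul_eq_mul,
      altForm_swap v u]
  module

theorem cyclicSum_R_R_L (a b c : Cayley k) (u v w : Fin 2 → k) :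
    CyclicSum (odR b v) (odR c w) (odL a u) := by
  unfold CyclicSum
  rw [phiOdd_L, phiOdd_R, phiOdd_R, bracket_swap_odd (.R c w) (.L a u), act_R_R', act_L_R', act_L_R',
    oddDer_eq_oddMix, oddMix_swap b a, oddMix_swap c a]
  refine SpinModel.ext (fun i => ?_) (fun i => ?_) <;>
    simp only [modL, SpinModel.mk_fst, SpinModel.mk_snd, SpinModel.add_fst, SpinModel.add_snd,
      SpinModel.zero_fst, SpinModel.zero_snd, add_zero, Pi.smul_apply, smul_eq_mul,
      altForm_swap w v, map_neg, LinearMap.neg_apply]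
  module

theorem cyclicSum_gen {X Y Z : TitsCK k} (hX : OddGen X) (hY : OddGen Y) (hZ : OddGen Z) :
    CyclicSum X Y Z := by
  rcases hX with ⟨a, u⟩ | ⟨a, u⟩ <;> rcases hY with ⟨b, v⟩ | ⟨b, v⟩ <;>
    rcases hZ with ⟨c, w⟩ | ⟨c, w⟩
  · exact cyclicSum_L_L_L a b c u v w
  · exact cyclicSum_L_L_R a b c u v w
  · exact (cyclicSum_L_L_R c a b w u v).rotate
  · exact (cyclicSum_R_R_L a b c u v w).rotate.rotate
  · exact (cyclicSum_L_L_R b c a v w u).rotate.rotate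
  · exact (cyclicSum_R_R_L b c a v w u).rotate
  · exact cyclicSum_R_R_L c a b w u v
  · exact cyclicSum_R_R_R a b c u v w

end Cyclic

/-! ### The super Jacobi identity from a faithful presentation by forms. -/

section AbstractConstruction

variable {k A W S : Type*} [Field k] [AddCommMonoid A] [Module k A] [AddCommMonoid W] [Module k W]
  [AddCommMonoid S] [Module k S]

theorem bilin_eq_of_span {V V' P : Type*} [AddCommMonoid V] [Module k V] [AddCommMonoid V']
    [Module k V'] [AddCommMonoid P] [Module k P] {f g : V →ₗ[k] V' →ₗ[k] P} {G : Set V} {G' : Set V'}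
    (h : ∀ a ∈ G, ∀ b ∈ G', f a b = g a b) {x : V} (hx : x ∈ Submodule.span k G) {y : V'}
    (hy : y ∈ Submodule.span k G') : f x y = g x y := by
  have h1 : ∀ a ∈ G, f a y = g a y := fun a ha =>
    LinearMap.eqOn_span (f := f a) (g := g a) (fun b hb => h a ha b hb) hy
  exact LinearMap.eqOn_span (f := f.flip y) (g := g.flip y) (fun a ha => h1 a ha) hx

theorem bilin_mem_of_span {V V' P : Type*} [AddCommMonoid V] [Module k V] [AddCommMonoid V']
    [Module k V'] [AddCommMonoid P] [Module k P] {f : V →ₗ[k] V' →ₗ[k] P} {G : Set V} {G' : Set V'}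
    {N : Submodule k P} (h : ∀ a ∈ G, ∀ b ∈ G', f a b ∈ N) {x : V} (hx : x ∈ Submodule.span k G)
    {y : V'} (hy : y ∈ Submodule.span k G') : f x y ∈ N := by
  have h1 : ∀ a ∈ G, f a y ∈ N := fun a ha => by
    have : Submodule.span k G' ≤ N.comap (f a) := Submodule.span_le.2 fun b hb => h a ha b hb
    exact this hy
  have : Submodule.span k G ≤ N.comap (f.flip y) := Submodule.span_le.2 fun a ha => h1 a ha
  exact this hx

theorem eq_of_map_eq {P : Type*} [AddCommMonoid P] [Module k P] {f : A →ₗ[k] P} {T : Submodule k A}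
    (h : ∀ x ∈ T, f x = 0 → x = 0) {x y : A} (hx : x ∈ T) (hy : y ∈ T) (hxy : f x = f y) : x = y := by
  have h0 : x + (-1 : k) • y = 0 := by
    refine h _ (T.add_mem hx (T.smul_mem _ hy)) ?_
    rw [map_add, map_smul, hxy]
    match_scalars
    ring
  calc x = (x + (-1 : k) • y) + y := by match_scalars <;> ring
    _ = y := by rw [h0, zero_add]

/-- The data of a superspace `T 0 ⊕ T 1` with a product `B`, together with a representation
`φ` of the even part on a space `W` with a form `q`, a map `ψ` of the odd part to a space `S` with a
form `N`, and a representation `R` of `End W` on `S`, the odd product being determined by the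
forms. -/
structure SpinPresentation (B : ZMod 2 → ZMod 2 → A →ₗ[k] A →ₗ[k] A) (T : ZMod 2 → Submodule k A)
    (φ : A →ₗ[k] Module.End k W) (ψ : A →ₗ[k] S) (R : Module.End k W →ₗ[k] Module.End k S)
    (σ : W → W → Module.End k W) (q : W →ₗ[k] W →ₗ[k] k) (N : S →ₗ[k] S →ₗ[k] k) : Prop where
  even_mem : ∀ X ∈ T 0, ∀ Y ∈ T 0, B 0 0 X Y ∈ T 0
  mixed_mem : ∀ X ∈ T 0, ∀ Y ∈ T 1, B 0 1 X Y ∈ T 1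
  odd_mem : ∀ X ∈ T 1, ∀ Y ∈ T 1, B 1 1 X Y ∈ T 0
  even_swap : ∀ X ∈ T 0, ∀ Y ∈ T 0, B 0 0 X Y = (-1 : k) • B 0 0 Y X
  mixed_swap : ∀ X ∈ T 0, ∀ Y ∈ T 1, B 1 0 Y X = (-1 : k) • B 0 1 X Y
  odd_swap : ∀ X ∈ T 1, ∀ Y ∈ T 1, B 1 1 X Y = B 1 1 Y X
  even_hom : ∀ X ∈ T 0, ∀ Y ∈ T 0, ∀ w, φ (B 0 0 X Y) w = φ X (φ Y w) + (-1 : k) • φ Y (φ X w)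
  mixed_hom : ∀ X ∈ T 0, ∀ Y ∈ T 1, ψ (B 0 1 X Y) = R (φ X) (ψ Y)
  odd_hom : ∀ X ∈ T 1, ∀ Y ∈ T 1, ∀ x y, q x (φ (B 1 1 X Y) y) = N (R (σ x y) (ψ X)) (ψ Y)
  cyclic : ∀ X ∈ T 1, ∀ Y ∈ T 1, ∀ Z ∈ T 1, R (φ (B 1 1 X Y)) (ψ Z) + R (φ (B 1 1 Y Z)) (ψ X) +
    R (φ (B 1 1 Z X)) (ψ Y) = 0
  even_inj : ∀ X ∈ T 0, φ X = 0 → X = 0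
  odd_inj : ∀ X ∈ T 1, ψ X = 0 → X = 0
  skew : ∀ X ∈ T 0, ∀ x w, q x (φ X w) = -q (φ X x) w
  form_skew : ∀ X ∈ T 0, ∀ s t, N s (R (φ X) t) = -N (R (φ X) s) t
  rep : ∀ X ∈ T 0, ∀ Y ∈ T 0, ∀ s, R (φ (B 0 0 X Y)) s = R (φ X) (R (φ Y) s) +
    (-1 : k) • R (φ Y) (R (φ X) s)
  sigma : ∀ X ∈ T 0, ∀ x y s, R (φ X) (R (σ x y) s) = R (σ x y) (R (φ X) s) +
    R (σ (φ X x) y) s + R (σ x (φ X y)) s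
  nondeg : ∀ w w', (∀ x, q x w = q x w') → w = w'

namespace SpinPresentation

variable {B : ZMod 2 → ZMod 2 → A →ₗ[k] A →ₗ[k] A} {T : ZMod 2 → Submodule k A}
    {φ : A →ₗ[k] Module.End k W} {ψ : A →ₗ[k] S} {R : Module.End k W →ₗ[k] Module.End k S}
    {σ : W → W → Module.End k W} {q : W →ₗ[k] W →ₗ[k] k} {N : S →ₗ[k] S →ₗ[k] k}
    (H : SpinPresentation B T φ ψ R σ q N) {X Y Z : A}

include H

theorem mixed_mem' (hX : X ∈ T 1) (hY : Y ∈ T 0) : B 1 0 X Y ∈ T 1 := by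
  rw [H.mixed_swap Y hY X hX]
  exact (T 1).smul_mem _ (H.mixed_mem Y hY X hX)

/-- The even part is faithfully represented on W by commutators. -/
theorem jacobi_000 (hX : X ∈ T 0) (hY : Y ∈ T 0) (hZ : Z ∈ T 0) :
    B 0 0 X (B 0 0 Y Z) = B 0 0 (B 0 0 X Y) Z + B 0 0 Y (B 0 0 X Z) := by
  have hYZ := H.even_mem Y hY Z hZ
  have hXY := H.even_mem X hX Y hY
  have hXZ := H.even_mem X hX Z hZ
  refine eq_of_map_eq H.even_inj (H.even_mem X hX _ hYZ)
    ((T 0).add_mem (H.even_mem _ hXY Z hZ) (H.even_mem Y hY _ hXZ)) (LinearMap.ext fun w => ?_)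
  rw [map_add, LinearMap.add_apply, H.even_hom _ hX _ hYZ, H.even_hom _ hXY _ hZ,
    H.even_hom _ hY _ hXZ, H.even_hom _ hX _ hY, H.even_hom _ hY _ hZ, H.even_hom _ hY _ hZ,
    H.even_hom _ hX _ hY, H.even_hom _ hX _ hZ, H.even_hom _ hX _ hZ]
  simp only [map_add, map_smul]
  match_scalars <;> ring

theorem jacobi_001 (hX : X ∈ T 0) (hY : Y ∈ T 0) (hZ : Z ∈ T 1) :
    B 0 1 X (B 0 1 Y Z) = B 0 1 (B 0 0 X Y) Z + B 0 1 Y (B 0 1 X Z) := by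
  have hYZ := H.mixed_mem Y hY Z hZ
  have hXY := H.even_mem X hX Y hY
  have hXZ := H.mixed_mem X hX Z hZ
  refine eq_of_map_eq H.odd_inj (H.mixed_mem X hX _ hYZ)
    ((T 1).add_mem (H.mixed_mem _ hXY Z hZ) (H.mixed_mem Y hY _ hXZ)) ?_
  rw [map_add, H.mixed_hom _ hX _ hYZ, H.mixed_hom _ hXY _ hZ, H.mixed_hom _ hY _ hXZ,
    H.mixed_hom _ hY _ hZ, H.mixed_hom _ hX _ hZ, H.rep _ hX _ hY]
  match_scalars <;> ring

/-- This and `jacobi_100` are `jacobi_001` with the arguments permuted by superanticommutativity;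
`jacobi_101` and `jacobi_110` follow from `jacobi_011` likewise. -/
theorem jacobi_010 (hX : X ∈ T 0) (hY : Y ∈ T 1) (hZ : Z ∈ T 0) :
    B 0 1 X (B 1 0 Y Z) = B 1 0 (B 0 1 X Y) Z + B 1 0 Y (B 0 0 X Z) := by
  rw [H.mixed_swap Z hZ Y hY, map_smul, H.mixed_swap Z hZ _ (H.mixed_mem X hX Y hY),
    H.mixed_swap _ (H.even_mem X hX Z hZ) Y hY, H.jacobi_001 hX hZ hY]
  match_scalars <;> ring

theorem jacobi_100 (hX : X ∈ T 1) (hY : Y ∈ T 0) (hZ : Z ∈ T 0) :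
    B 1 0 X (B 0 0 Y Z) = B 1 0 (B 1 0 X Y) Z + B 0 1 Y (B 1 0 X Z) := by
  rw [H.mixed_swap _ (H.even_mem Y hY Z hZ) X hX, H.mixed_swap Y hY X hX, map_smul,
    LinearMap.smul_apply, H.mixed_swap Z hZ _ (H.mixed_mem Y hY X hX), H.mixed_swap Z hZ X hX,
    map_smul, H.jacobi_001 hY hZ hX]
  match_scalars <;> ring

/-- The odd product is defined by q, N and σ, all of which are invariant under the even part, so it
is equivariant. The equality is tested against the nondegenerate form q. -/
theorem jacobi_011 (hX : X ∈ T 0) (hY : Y ∈ T 1) (hZ : Z ∈ T 1) :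
    B 0 0 X (B 1 1 Y Z) = B 1 1 (B 0 1 X Y) Z + B 1 1 Y (B 0 1 X Z) := by
  have hYZ := H.odd_mem Y hY Z hZ
  have hXY := H.mixed_mem X hX Y hY
  have hXZ := H.mixed_mem X hX Z hZ
  refine eq_of_map_eq H.even_inj (H.even_mem X hX _ hYZ)
    ((T 0).add_mem (H.odd_mem _ hXY Z hZ) (H.odd_mem Y hY _ hXZ))
    (LinearMap.ext fun y => H.nondeg _ _ fun x => ?_)
  rw [H.even_hom _ hX _ hYZ, map_add, map_add, LinearMap.add_apply, map_add, map_smul, H.skew _ hX,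
    H.odd_hom _ hY _ hZ, H.odd_hom _ hY _ hZ, H.odd_hom _ hXY _ hZ, H.odd_hom _ hY _ hXZ,
    H.mixed_hom _ hX _ hY, H.mixed_hom _ hX _ hZ, H.form_skew _ hX, H.sigma _ hX]
  simp only [map_add, LinearMap.add_apply, smul_eq_mul]
  ring

theorem jacobi_101 (hX : X ∈ T 1) (hY : Y ∈ T 0) (hZ : Z ∈ T 1) :
    B 1 1 X (B 0 1 Y Z) = B 1 1 (B 1 0 X Y) Z + B 0 0 Y (B 1 1 X Z) := by
  rw [H.jacobi_011 hY hX hZ, H.mixed_swap Y hY X hX, map_smul, LinearMap.smul_apply]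
  match_scalars <;> ring

theorem jacobi_110 (hX : X ∈ T 1) (hY : Y ∈ T 1) (hZ : Z ∈ T 0) :
    B 1 1 X (B 1 0 Y Z) = B 0 0 (B 1 1 X Y) Z + (-1 : k) • B 1 1 Y (B 1 0 X Z) := by
  rw [H.mixed_swap Z hZ Y hY, H.mixed_swap Z hZ X hX, map_smul, map_smul,
    H.even_swap _ (H.odd_mem X hX Y hY) Z hZ, H.jacobi_011 hZ hX hY,
    H.odd_swap Y hY _ (H.mixed_mem Z hZ X hX)]
  match_scalars <;> ring

theorem jacobi_111 (hX : X ∈ T 1) (hY : Y ∈ T 1) (hZ : Z ∈ T 1) :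
    B 1 0 X (B 1 1 Y Z) = B 0 1 (B 1 1 X Y) Z + (-1 : k) • B 1 0 Y (B 1 1 X Z) := by
  have hYZ := H.odd_mem Y hY Z hZ
  have hXY := H.odd_mem X hX Y hY
  have hXZ := H.odd_mem X hX Z hZ
  rw [H.mixed_swap _ hYZ X hX, H.mixed_swap _ hXZ Y hY]
  refine eq_of_map_eq H.odd_inj ((T 1).smul_mem _ (H.mixed_mem _ hYZ X hX))
    ((T 1).add_mem (H.mixed_mem _ hXY Z hZ) ((T 1).smul_mem _ ((T 1).smul_mem _
      (H.mixed_mem _ hXZ Y hY)))) ?_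
  have h := H.cyclic X hX Y hY Z hZ
  rw [map_add, map_smul, map_smul, map_smul, H.mixed_hom _ hYZ _ hX, H.mixed_hom _ hXY _ hZ,
    H.mixed_hom _ hXZ _ hY, H.odd_swap X hX Z hZ]
  -- Under the injective map ψ the identity is the cyclic identity; the vanishing cyclic sum is
  -- added to one side.
  calc (-1 : k) • R (φ (B 1 1 Y Z)) (ψ X)
      = (R (φ (B 1 1 X Y)) (ψ Z) + R (φ (B 1 1 Y Z)) (ψ X) + R (φ (B 1 1 Z X)) (ψ Y)) +
          (-1 : k) • R (φ (B 1 1 Y Z)) (ψ X) := by rw [h, zero_add]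
    _ = _ := by match_scalars <;> ring

theorem mem (i j : ZMod 2) (hX : X ∈ T i) (hY : Y ∈ T j) : B i j X Y ∈ T (i + j) := by
  have h11 : (1 + 1 : ZMod 2) = 0 := by decide
  rcases parity_cases i with rfl | rfl <;> rcases parity_cases j with rfl | rfl <;>
    simp only [add_zero, zero_add, h11]
  exacts [H.even_mem _ hX _ hY, H.mixed_mem _ hX _ hY, H.mixed_mem' hX hY, H.odd_mem _ hX _ hY]

theorem swap (i j : ZMod 2) (hX : X ∈ T i) (hY : Y ∈ T j) :
    B i j X Y = ((-koszulSign i j : ℤ) : k) • B j i Y X := by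
  rcases parity_cases i with rfl | rfl <;> rcases parity_cases j with rfl | rfl <;>
    simp only [koszulSign_zero_left, koszulSign_zero_right, koszulSign_one_one, neg_neg, Int.cast_neg,
      Int.cast_one, one_smul]
  · exact H.even_swap _ hX _ hY
  · rw [H.mixed_swap _ hX _ hY, smul_smul, neg_one_mul, neg_neg, one_smul]
  · exact H.mixed_swap _ hY _ hX
  · exact H.odd_swap _ hX _ hY

theorem jacobi (i j l : ZMod 2) (hX : X ∈ T i) (hY : Y ∈ T j) (hZ : Z ∈ T l) :
    B i (j + l) X (B j l Y Z) =
      B (i + j) l (B i j X Y) Z + ((koszulSign i j : ℤ) : k) • B j (i + l) Y (B i l X Z) := by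
  have h11 : (1 + 1 : ZMod 2) = 0 := by decide
  rcases parity_cases i with rfl | rfl <;> rcases parity_cases j with rfl | rfl <;>
    rcases parity_cases l with rfl | rfl <;>
    simp only [add_zero, zero_add, h11, koszulSign_zero_left, koszulSign_zero_right,
      koszulSign_one_one, Int.cast_neg, Int.cast_one, one_smul]
  exacts [H.jacobi_000 hX hY hZ, H.jacobi_001 hX hY hZ, H.jacobi_010 hX hY hZ, H.jacobi_011 hX hY hZ,
    H.jacobi_100 hX hY hZ, H.jacobi_101 hX hY hZ, H.jacobi_110 hX hY hZ, H.jacobi_111 hX hY hZ]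

end SpinPresentation

end AbstractConstruction

/-! ### Products of generators stay in the Tits construction. -/

section Extension

variable {k : Type*} [Field k] [CharP k 5]

theorem evD_mem {D : Module.End k (Cayley k)} (hD : D ∈ derSpace (cayleyMul k)) :
    evD D ∈ titsCayleyKac k 0 := (EvenGen.D hD).mem
theorem evA_mem {a : Cayley k} (ha : cayleyTr a = 0) : evA a ∈ titsCayleyKac k 0 := (EvenGen.A ha).mem
theorem evM_mem {a : Cayley k} (ha : cayleyTr a = 0) (M : Matrix (Fin 2) (Fin 2) k) :
    evM a M ∈ titsCayleyKac k 0 := (EvenGen.M ha M).mem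
theorem evK_mem {A B : Matrix (Fin 2) (Fin 2) k} (hA : A.trace = 0) (hB : B.trace = 0) :
    evK A B ∈ titsCayleyKac k 0 := (EvenGen.K hA hB).mem

theorem comm_mem_derSpace {D E : Module.End k (Cayley k)} (hD : D ∈ derSpace (cayleyMul k))
    (hE : E ∈ derSpace (cayleyMul k)) : D * E - E * D ∈ derSpace (cayleyMul k) := by
  intro a b
  simp only [LinearMap.sub_apply, Module.End.mul_apply, hD _ _, hE _ _, map_add, map_sub]
  abel

theorem trace_comm_two (A B : Matrix (Fin 2) (Fin 2) k) : (A * B - B * A).trace = 0 := by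
  rw [Matrix.trace_sub, Matrix.trace_mul_comm, sub_self]

theorem tr_neg {a : Cayley k} (ha : cayleyTr a = 0) : cayleyTr (-a) = 0 := by
  rw [map_neg, ha, neg_zero]

theorem bracket_gen_even_mem {X Y : TitsCK k} (hX : EvenGen X) (hY : EvenGen Y) :
    ckBracket (k := k) 0 0 X Y ∈ titsCayleyKac k 0 := by
  have hsw {X Y : TitsCK k} (hX : EvenGen X) (hY : EvenGen Y)
      (h : ckBracket (k := k) 0 0 X Y ∈ titsCayleyKac k 0) : ckBracket (k := k) 0 0 Y X ∈ titsCayleyKac k 0 := by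
    rw [bracket_swap_even hY hX]
    exact Submodule.smul_mem _ _ h
  have hDA {D : Module.End k (Cayley k)} (hD : D ∈ derSpace (cayleyMul k)) (a) :
      ckBracket (k := k) 0 0 (evD D) (evA a) ∈ titsCayleyKac k 0 := by
    rw [bracket_D_A]; exact evA_mem (der_tr hD a)
  have hDM {D : Module.End k (Cayley k)} (hD : D ∈ derSpace (cayleyMul k)) (a M) :
      ckBracket (k := k) 0 0 (evD D) (evM a M) ∈ titsCayleyKac k 0 := by
    rw [bracket_D_M]; exact evM_mem (der_tr hD a) M
  have hDK (D : Module.End k (Cayley k)) (A B) :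
      ckBracket (k := k) 0 0 (evD D) (evK A B) ∈ titsCayleyKac k 0 := by
    rw [bracket_D_K]; exact Submodule.zero_mem _
  have hAM (a b : Cayley k) (M) : ckBracket (k := k) 0 0 (evA a) (evM b M) ∈ titsCayleyKac k 0 := by
    rw [bracket_A_M]; exact evM_mem (tr_neg (tr_algComm a b)) M
  have hAK (a : Cayley k) (A B) : ckBracket (k := k) 0 0 (evA a) (evK A B) ∈ titsCayleyKac k 0 := by
    rw [bracket_A_K]; exact Submodule.zero_mem _
  have hMK {a : Cayley k} (ha : cayleyTr a = 0) (M A B) :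
      ckBracket (k := k) 0 0 (evM a M) (evK A B) ∈ titsCayleyKac k 0 := by
    rw [bracket_M_K]; exact evM_mem (tr_neg ha) _
  have hX' := hX
  have hY' := hY
  rcases hX with @⟨D, hD⟩ | @⟨a, ha⟩ | @⟨a, ha, M⟩ | @⟨A, B, hA, hB⟩ <;>
    rcases hY with @⟨D', hD'⟩ | @⟨a', ha'⟩ | @⟨a', ha', M'⟩ | @⟨A', B', hA', hB'⟩
  · rw [bracket_D_D]; exact evD_mem (comm_mem_derSpace hD hD')
  · exact hDA hD a'
  · exact hDM hD a' M'
  · exact hDK D A' B'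
  · exact hsw hY' hX' (hDA hD' a)
  · rw [bracket_A_A]
    exact Submodule.add_mem _ (evD_mem (innerDer_mem_smul _ _ _)) (evA_mem (tr_algComm _ _))
  · exact hAM a a' M'
  · exact hAK a A' B'
  · exact hsw hY' hX' (hDM hD' a M)
  · exact hsw hY' hX' (hAM a' a M)
  · rw [bracket_M_M]
    exact Submodule.add_mem _ (Submodule.add_mem _ (evD_mem (innerDer_mem_smul _ _ _))
      (evA_mem (tr_neg (by rw [map_smul, tr_algComm, smul_zero]))))
      (evK_mem (brMat_trace _ _ _) (brMat_trace _ _ _))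
  · exact hMK ha M A' B'
  · exact hsw hY' hX' (hDK D' A B)
  · exact hsw hY' hX' (hAK a' A B)
  · exact hsw hY' hX' (hMK ha' M' A B)
  · rw [bracket_K_K]; exact evK_mem (trace_comm_two _ _) (trace_comm_two _ _)

theorem bracket_gen_even_odd_mem {X Y : TitsCK k} (hX : EvenGen X) (hY : OddGen Y) :
    ckBracket (k := k) 0 1 X Y ∈ titsCayleyKac k 1 := by
  rcases hX with @⟨D, hD⟩ | @⟨a, ha⟩ | @⟨a, ha, M⟩ | @⟨A, B, hA, hB⟩ <;>
    rcases hY with ⟨b, u⟩ | ⟨b, u⟩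
  · rw [bracket_D_L hD]; exact (OddGen.L _ _).mem
  · rw [bracket_D_R hD]; exact (OddGen.R _ _).mem
  · rw [bracket_A_L ha]; exact (OddGen.L _ _).mem
  · rw [bracket_A_R ha]; exact (OddGen.R _ _).mem
  · rw [bracket_M_L ha]; exact (OddGen.R _ _).mem
  · rw [bracket_M_R ha]; exact (OddGen.L _ _).mem
  · rw [bracket_K_L hA hB]; exact (OddGen.L _ _).mem
  · rw [bracket_K_R hA hB]; exact (OddGen.R _ _).mem

theorem bracket_gen_odd_mem {X Y : TitsCK k} (hX : OddGen X) (hY : OddGen Y) :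
    ckBracket (k := k) 1 1 X Y ∈ titsCayleyKac k 0 := by
  have hLR (a b : Cayley k) (u v : Fin 2 → k) :
      ckBracket (k := k) 1 1 (odL a u) (odR b v) ∈ titsCayleyKac k 0 := by
    rw [bracket_L_R]; exact evM_mem (cayleyTr_oddMix a b) _
  rcases hX with ⟨a, u⟩ | ⟨a, u⟩ <;> rcases hY with ⟨b, v⟩ | ⟨b, v⟩
  · rw [bracket_L_L]
    exact Submodule.add_mem _ (Submodule.add_mem _ (evD_mem (innerDer_mem_smul _ _ _))
      (evA_mem (by rw [map_smul, tr_algComm_add, smul_zero])))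
      (evK_mem (symMat_trace _ _ _) (Matrix.trace_zero _ _))
  · exact hLR a b u v
  · rw [bracket_swap_odd (.R a u) (.L b v)]; exact hLR b a v u
  · rw [bracket_R_R]
    exact Submodule.add_mem _ (Submodule.add_mem _ (evD_mem (innerDer_mem_smul _ _ _))
      (evA_mem (by rw [map_smul, tr_algComm_add, smul_zero])))
      (evK_mem (Matrix.trace_zero _ _) (symMat_trace _ _ _))

end Extension

/-! ### Extension of multilinear identities from generators to spans. -/

section AbstractSpan

variable {k A W S : Type*} [Field k] [AddCommMonoid A] [Module k A] [AddCommMonoid W] [Module k W]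
  [AddCommMonoid S] [Module k S] {B : A →ₗ[k] A →ₗ[k] A} {B' : A →ₗ[k] A →ₗ[k] A} {G G' : Set A}
  {T T' N : Submodule k A} {φ : A →ₗ[k] Module.End k W} {ψ : A →ₗ[k] S}
  {R : Module.End k W →ₗ[k] Module.End k S} {q : W →ₗ[k] W →ₗ[k] k} {n : S →ₗ[k] S →ₗ[k] k}

theorem bracket_mem_of_span (h : ∀ X ∈ G, ∀ Y ∈ G', B X Y ∈ N) (hT : T ≤ Submodule.span k G)
    (hT' : T' ≤ Submodule.span k G') : ∀ X ∈ T, ∀ Y ∈ T', B X Y ∈ N :=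
  fun _ hX _ hY => bilin_mem_of_span h (hT hX) (hT' hY)

theorem bracket_swap_of_span (c : k) (h : ∀ X ∈ G, ∀ Y ∈ G', B X Y = c • B' Y X)
    (hT : T ≤ Submodule.span k G) (hT' : T' ≤ Submodule.span k G') :
    ∀ X ∈ T, ∀ Y ∈ T', B X Y = c • B' Y X :=
  fun _ hX _ hY => bilin_eq_of_span (f := B) (g := c • B'.flip) h (hT hX) (hT' hY)

theorem even_hom_of_span (h : ∀ X ∈ G, ∀ Y ∈ G, ∀ w, φ (B X Y) w =
      φ X (φ Y w) + (-1 : k) • φ Y (φ X w)) (hT : T ≤ Submodule.span k G) :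
    ∀ X ∈ T, ∀ Y ∈ T, ∀ w, φ (B X Y) w = φ X (φ Y w) + (-1 : k) • φ Y (φ X w) := by
  intro X hX Y hY w
  have h1 : ∀ Y ∈ G, φ (B X Y) w = φ X (φ Y w) + (-1 : k) • φ Y (φ X w) := fun Y hY => by
    have hX' := hT hX
    clear hX
    induction hX' using Submodule.span_induction with
    | mem x hx => exact h x hx Y hY w
    | zero => simp only [map_zero, LinearMap.zero_apply, smul_zero, add_zero]
    | add x y _ _ hx hy =>
      simp only [map_add, LinearMap.add_apply, hx, hy, smul_add]; abel
    | smul c x _ hx =>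
      simp only [map_smul, LinearMap.smul_apply, hx]; match_scalars <;> ring
  have hY' := hT hY
  clear hY
  induction hY' using Submodule.span_induction with
  | mem x hx => exact h1 x hx
  | zero => simp only [map_zero, LinearMap.zero_apply, smul_zero, add_zero]
  | add x y _ _ hx hy =>
    simp only [map_add, LinearMap.add_apply, hx, hy, smul_add]; abel
  | smul c x _ hx =>
    simp only [map_smul, LinearMap.smul_apply, hx]; match_scalars <;> ring

theorem mixed_hom_of_span (h : ∀ X ∈ G, ∀ Y ∈ G', ψ (B X Y) = R (φ X) (ψ Y))
    (hT : T ≤ Submodule.span k G) (hT' : T' ≤ Submodule.span k G') :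
    ∀ X ∈ T, ∀ Y ∈ T', ψ (B X Y) = R (φ X) (ψ Y) :=
  fun _ hX _ hY => bilin_eq_of_span (f := B.compr₂ ψ) (g := (R ∘ₗ φ).compl₂ ψ) h (hT hX) (hT' hY)

theorem odd_hom_of_span {σ : Module.End k W} {x y : W}
    (h : ∀ X ∈ G, ∀ Y ∈ G, q x (φ (B X Y) y) = n (R σ (ψ X)) (ψ Y))
    (hT : T ≤ Submodule.span k G) :
    ∀ X ∈ T, ∀ Y ∈ T, q x (φ (B X Y) y) = n (R σ (ψ X)) (ψ Y) :=
  fun _ hX _ hY => bilin_eq_of_span (f := B.compr₂ (q x ∘ₗ φ.flip y)) (g := n.compl₁₂ (R σ ∘ₗ ψ) ψ) h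
    (hT hX) (hT hY)

/-- The cyclic sum of the products of three odd elements. -/
def cyclicSum (B : A →ₗ[k] A →ₗ[k] A) (φ : A →ₗ[k] Module.End k W) (ψ : A →ₗ[k] S)
    (R : Module.End k W →ₗ[k] Module.End k S) (X Y Z : A) : S :=
  R (φ (B X Y)) (ψ Z) + R (φ (B Y Z)) (ψ X) + R (φ (B Z X)) (ψ Y)

theorem cyclicSum_rotate (X Y Z : A) : cyclicSum B φ ψ R Y Z X = cyclicSum B φ ψ R X Y Z := by
  unfold cyclicSum
  abel

theorem cyclicSum_eq_zero_of_span_left {Y Z : A} (h : ∀ X ∈ G, cyclicSum B φ ψ R X Y Z = 0) {X : A}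
    (hX : X ∈ Submodule.span k G) : cyclicSum B φ ψ R X Y Z = 0 := by
  induction hX using Submodule.span_induction with
  | mem x hx => exact h x hx
  | zero => simp only [cyclicSum, map_zero, LinearMap.zero_apply, add_zero]
  | add x y _ _ hx hy =>
    calc cyclicSum B φ ψ R (x + y) Y Z = cyclicSum B φ ψ R x Y Z + cyclicSum B φ ψ R y Y Z := by
          simp only [cyclicSum, map_add, LinearMap.add_apply]; abel
      _ = 0 := by rw [hx, hy, add_zero]
  | smul c x _ hx =>
    calc cyclicSum B φ ψ R (c • x) Y Z = c • cyclicSum B φ ψ R x Y Z := by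
          simp only [cyclicSum, map_smul, LinearMap.smul_apply, smul_add]
      _ = 0 := by rw [hx, smul_zero]

/-- The cyclic sum is invariant under rotation, so linearity in the first argument, used three
times, is enough. -/
theorem cyclicSum_eq_zero_of_span (h : ∀ X ∈ G, ∀ Y ∈ G, ∀ Z ∈ G, cyclicSum B φ ψ R X Y Z = 0)
    (hT : T ≤ Submodule.span k G) : ∀ X ∈ T, ∀ Y ∈ T, ∀ Z ∈ T, cyclicSum B φ ψ R X Y Z = 0 := by
  intro X hX Y hY Z hZ
  refine cyclicSum_eq_zero_of_span_left (fun X hX => ?_) (hT hX)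
  rw [← cyclicSum_rotate]
  refine cyclicSum_eq_zero_of_span_left (fun Y hY => ?_) (hT hY)
  rw [← cyclicSum_rotate]
  refine cyclicSum_eq_zero_of_span_left (fun Z hZ => ?_) (hT hZ)
  rw [← cyclicSum_rotate]
  exact h X hX Y hY Z hZ

theorem add_neg_one_smul {V : Type*} [AddCommGroup V] [Module k V] (x y : V) :
    x + (-1 : k) • y = x - y := by
  rw [neg_one_smul, sub_eq_add_neg]

end AbstractSpan

/-! ### The Tits construction satisfies the abstract hypotheses. -/

section Presentation

attribute [local irreducible] phiEven phiOdd ckBracket modelRep modelForm titsCayleyKac sigmaMap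

variable {k : Type*} [Field k] [CharP k 5]

theorem polarBilin_nondeg {w w' : OddSpace k 5}
    (h : ∀ x, (oddForm k 5).polarBilin x w = (oddForm k 5).polarBilin x w') : w = w' := by
  have h' : ∀ x, QuadraticMap.polar (oddForm k 5) w x = QuadraticMap.polar (oddForm k 5) w' x := by
    intro x
    rw [QuadraticMap.polar_comm _ w, QuadraticMap.polar_comm _ w']
    exact h x
  rw [← dual_expansion k 5 two_ne_zero_of_char_five w, ← dual_expansion k 5 two_ne_zero_of_char_five w']
  simp only [h']

/-- The form q is invariant under φ, hence (x, y) ↦ σ_{x,y} is equivariant; `modelRep_comm` carries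
this over to spin operators. -/
theorem sigmaMap_comm_so {φ : Module.End k (OddSpace k 5)} (hφ : φ ∈ soOdd k 5) (x y : OddSpace k 5) :
    φ * sigmaMap k 5 x y - sigmaMap k 5 x y * φ = sigmaMap k 5 (φ x) y + sigmaMap k 5 x (φ y) := by
  refine LinearMap.ext fun w => ?_
  simp only [LinearMap.sub_apply, LinearMap.add_apply, Module.End.mul_apply, sigmaMap_apply, map_sub,
    map_smul, polar_so hφ]
  match_scalars <;> ring

theorem modelRep_sigmaMap_so {φ : Module.End k (OddSpace k 5)} (hφ : φ ∈ soOdd k 5)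
    (x y : OddSpace k 5) (s : SpinModel k) :
    modelRep φ (modelRep (k := k) (sigmaMap k 5 x y) s) = modelRep (k := k) (sigmaMap k 5 x y) (modelRep φ s) +
      modelRep (k := k) (sigmaMap k 5 (φ x) y) s + modelRep (k := k) (sigmaMap k 5 x (φ y)) s := by
  have h := congrArg (fun f => f s) (modelRep_comm hφ (sigmaMap_mem_so x y))
  rw [sigmaMap_comm_so hφ, map_add] at h
  simp only [LinearMap.add_apply, LinearMap.sub_apply, Module.End.mul_apply] at h
  rw [add_assoc, h]
  abel

theorem ck_even_hom : ∀ X ∈ titsCayleyKac k 0, ∀ Y ∈ titsCayleyKac k 0, ∀ w,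
    phiEven (k := k) (ckBracket (k := k) 0 0 X Y) w = phiEven X (phiEven Y w) + (-1 : k) • phiEven Y (phiEven X w) :=
  even_hom_of_span (G := {X | EvenGen X}) (B := ckBracket (k := k) 0 0) (φ := phiEven)
    (fun X hX Y hY w => by rw [EvenGen.phiHom hX hY w, neg_smul, one_smul, sub_eq_add_neg])
    even_le_span

theorem ck_even_mem : ∀ X ∈ titsCayleyKac k 0, ∀ Y ∈ titsCayleyKac k 0,
    ckBracket (k := k) 0 0 X Y ∈ titsCayleyKac k 0 :=
  bracket_mem_of_span (G := {X | EvenGen X}) (G' := {X | EvenGen X}) (B := ckBracket (k := k) 0 0)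
    (fun _ hX _ hY => bracket_gen_even_mem hX hY) even_le_span even_le_span

theorem ck_mixed_mem : ∀ X ∈ titsCayleyKac k 0, ∀ Y ∈ titsCayleyKac k 1,
    ckBracket (k := k) 0 1 X Y ∈ titsCayleyKac k 1 :=
  bracket_mem_of_span (G := {X | EvenGen X}) (G' := {X | OddGen X}) (B := ckBracket (k := k) 0 1)
    (fun _ hX _ hY => bracket_gen_even_odd_mem hX hY) even_le_span odd_le_span

theorem ck_odd_mem : ∀ X ∈ titsCayleyKac k 1, ∀ Y ∈ titsCayleyKac k 1,
    ckBracket (k := k) 1 1 X Y ∈ titsCayleyKac k 0 :=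
  bracket_mem_of_span (G := {X | OddGen X}) (G' := {X | OddGen X}) (B := ckBracket (k := k) 1 1)
    (fun _ hX _ hY => bracket_gen_odd_mem hX hY) odd_le_span odd_le_span

theorem ck_even_swap : ∀ X ∈ titsCayleyKac k 0, ∀ Y ∈ titsCayleyKac k 0,
    ckBracket (k := k) 0 0 X Y = (-1 : k) • ckBracket (k := k) 0 0 Y X :=
  bracket_swap_of_span (G := {X | EvenGen X}) (G' := {X | EvenGen X}) (B := ckBracket (k := k) 0 0)
    (B' := ckBracket (k := k) 0 0) (-1) (fun _ hX _ hY => bracket_swap_even hX hY) even_le_span even_le_span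

theorem ck_mixed_swap : ∀ X ∈ titsCayleyKac k 0, ∀ Y ∈ titsCayleyKac k 1,
    ckBracket (k := k) 1 0 Y X = (-1 : k) • ckBracket (k := k) 0 1 X Y := fun X hX Y hY =>
  bracket_swap_of_span (G := {X | OddGen X}) (G' := {X | EvenGen X}) (B := ckBracket (k := k) 1 0)
    (B' := ckBracket (k := k) 0 1) (-1) (fun _ hY _ hX => bracket_swap_even_odd hX hY) odd_le_span even_le_span
    Y hY X hX

theorem ck_odd_swap : ∀ X ∈ titsCayleyKac k 1, ∀ Y ∈ titsCayleyKac k 1,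
    ckBracket (k := k) 1 1 X Y = ckBracket (k := k) 1 1 Y X := fun X hX Y hY => by
  have h := bracket_swap_of_span (G := {X | OddGen X}) (G' := {X | OddGen X}) (B := ckBracket (k := k) 1 1)
    (B' := ckBracket (k := k) 1 1) (1 : k) (fun X hX Y hY => by rw [one_smul]; exact bracket_swap_odd hX hY)
    odd_le_span odd_le_span X hX Y hY
  rw [one_smul] at h
  exact h

theorem ck_mixed_hom : ∀ X ∈ titsCayleyKac k 0, ∀ Y ∈ titsCayleyKac k 1,
    phiOdd (k := k) (ckBracket (k := k) 0 1 X Y) = modelRep (k := k) (phiEven X) (phiOdd Y) :=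
  mixed_hom_of_span (G := {X | EvenGen X}) (G' := {X | OddGen X}) (B := ckBracket (k := k) 0 1) (φ := phiEven)
    (ψ := phiOdd) (R := modelRep) (fun X hX Y hY => by
      have h : SpinHom X Y := spinHom_gen hX hY
      unfold SpinHom at h
      rw [h]) even_le_span odd_le_span

theorem ck_odd_hom : ∀ X ∈ titsCayleyKac k 1, ∀ Y ∈ titsCayleyKac k 1, ∀ x y,
    (oddForm k 5).polarBilin x (phiEven (k := k) (ckBracket (k := k) 1 1 X Y) y) =
      modelForm (modelRep (k := k) (sigmaMap k 5 x y) (phiOdd X)) (phiOdd Y) := fun X hX Y hY x y =>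
  odd_hom_of_span (G := {X | OddGen X}) (B := ckBracket (k := k) 1 1) (φ := phiEven)
    (ψ := phiOdd) (R := modelRep) (n := modelForm) (q := (oddForm k 5).polarBilin)
    (σ := sigmaMap k 5 x y) (x := x) (y := y) (fun X hX Y hY => by
      have h : FormHom X Y := formHom_gen hX hY
      unfold FormHom at h
      rw [← soForm_apply, h, spinMoment_apply]) odd_le_span X hX Y hY

theorem ck_cyclic : ∀ X ∈ titsCayleyKac k 1, ∀ Y ∈ titsCayleyKac k 1, ∀ Z ∈ titsCayleyKac k 1,
    cyclicSum (ckBracket (k := k) 1 1) phiEven phiOdd modelRep X Y Z = 0 :=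
  cyclicSum_eq_zero_of_span (G := {X | OddGen X}) (B := ckBracket (k := k) 1 1) (φ := phiEven)
    (ψ := phiOdd) (R := modelRep) (fun X hX Y hY Z hZ => by
      have h : CyclicSum X Y Z := cyclicSum_gen hX hY hZ
      unfold CyclicSum at h
      rw [cyclicSum, h]) odd_le_span

theorem ckPresentation : SpinPresentation (ckBracket (k := k)) (titsCayleyKac k) phiEven phiOdd modelRep
    (sigmaMap k 5) (oddForm k 5).polarBilin modelForm where
  even_mem := ck_even_mem
  mixed_mem := ck_mixed_mem
  odd_mem := ck_odd_mem
  even_swap := ck_even_swap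
  mixed_swap := ck_mixed_swap
  odd_swap := ck_odd_swap
  even_hom := ck_even_hom
  mixed_hom := ck_mixed_hom
  odd_hom := ck_odd_hom
  cyclic := ck_cyclic
  even_inj _ hX h := phiEven_injective hX h
  odd_inj _ hX h := phiOdd_injective hX h
  skew X hX x w := by rw [polar_so (phiEven_mem hX), neg_neg]
  form_skew X hX s t := by rw [modelForm_modelRep, neg_neg]
  rep X hX Y hY s := by
    have h : phiEven (k := k) (ckBracket (k := k) 0 0 X Y) = phiEven X * phiEven Y - phiEven Y * phiEven X :=
      LinearMap.ext fun w => by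
        rw [ck_even_hom X hX Y hY w, LinearMap.sub_apply, Module.End.mul_apply, Module.End.mul_apply]
        exact add_neg_one_smul _ _
    rw [h, modelRep_comm (phiEven_mem hX) (phiEven_mem hY), LinearMap.sub_apply, Module.End.mul_apply,
      Module.End.mul_apply]
    exact (add_neg_one_smul _ _).symm
  sigma X hX x y s := modelRep_sigmaMap_so (phiEven_mem hX) x y s
  nondeg _ _ h := polarBilin_nondeg h

end Presentation

/-! ### From scalar signs to the definition of a Lie superalgebra, and a trace formula. -/

section RestrictEquiv

theorem IsLieSuperalgebra.of_field_smul {k A : Type*} [Field k] [AddCommGroup A] [Module k A]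
    {T : ZMod 2 → Submodule k A} (B : ZMod 2 → ZMod 2 → A →ₗ[k] A →ₗ[k] A)
    {br : ZMod 2 → ZMod 2 → A → A → A} (hB : ∀ i j X Y, B i j X Y = br i j X Y)
    (mem : ∀ i j, ∀ X ∈ T i, ∀ Y ∈ T j, B i j X Y ∈ T (i + j))
    (swap : ∀ i j, ∀ X ∈ T i, ∀ Y ∈ T j, B i j X Y = ((-koszulSign i j : ℤ) : k) • B j i Y X)
    (jacobi : ∀ i j l, ∀ X ∈ T i, ∀ Y ∈ T j, ∀ Z ∈ T l, B i (j + l) X (B j l Y Z) =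
      B (i + j) l (B i j X Y) Z + ((koszulSign i j : ℤ) : k) • B j (i + l) Y (B i l X Z)) :
    IsLieSuperalgebra T br where
  mem i j x hx y hy := by rw [← hB]; exact mem i j x hx y hy
  add_left i j x _ x' _ y _ := by rw [← hB, ← hB, ← hB, map_add, LinearMap.add_apply]
  smul_left i j c x _ y _ := by rw [← hB, ← hB, map_smul, LinearMap.smul_apply]
  skew i j x hx y hy := by rw [← hB, ← hB, swap i j x hx y hy, Int.cast_smul_eq_zsmul, neg_smul]
  jacobi i j l x hx y hy z hz := by
    simp only [← hB]
    rw [jacobi i j l x hx y hy z hz, Int.cast_smul_eq_zsmul]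

theorem trace_smulRight_sub {k V : Type*} [Field k] [AddCommGroup V] [Module k V]
    [FiniteDimensional k V] (f g : V →ₗ[k] k) (x y : V) :
    LinearMap.trace k V (f.smulRight x - g.smulRight y) = f x - g y := by
  rw [map_sub, LinearMap.trace_smulRight, LinearMap.trace_smulRight]

end RestrictEquiv

/-! ### The isomorphisms onto so(W) and onto the spin module. -/

section Main

attribute [local irreducible] phiEven phiOdd ckBracket modelRep modelForm titsCayleyKac sigmaMap thetaMap

variable {k : Type*} [Field k] [CharP k 5]

/-- The composite is a difference of two rank one maps with traces q(x, ψy) and q(y, ψx), which are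
opposite as ψ is skew. -/
theorem trace_sigmaMap_mul {ψ : Module.End k (OddSpace k 5)} (hψ : ψ ∈ soOdd k 5) (x y : OddSpace k 5) :
    LinearMap.trace k (OddSpace k 5) (sigmaMap k 5 x y * ψ) =
      2 * (oddForm k 5).polarBilin x (ψ y) := by
  have h : sigmaMap k 5 x y * ψ = ((oddForm k 5).polarBilin x ∘ₗ ψ).smulRight y -
      ((oddForm k 5).polarBilin y ∘ₗ ψ).smulRight x := LinearMap.ext fun w => by
    simp only [Module.End.mul_apply, sigmaMap_apply, LinearMap.sub_apply, LinearMap.smulRight_apply,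
      LinearMap.comp_apply]
  rw [h, trace_smulRight_sub, LinearMap.comp_apply,
    LinearMap.comp_apply, oddPolar_comm y, polar_so hψ]
  ring

/-- An element of `so(W, q)` with the values of the odd product on the `σ_{x,y}` satisfies the
defining identity of the odd product. -/
theorem half_trace_mul_eq {ψ σ : Module.End k (OddSpace k 5)} (hψ : ψ ∈ soOdd k 5) {s t : SpinModel k}
    (h : ∀ x y, (oddForm k 5).polarBilin x (ψ y) = modelForm (modelRep (k := k) (sigmaMap k 5 x y) s) t)
    (hσ : σ ∈ soOdd k 5) : (1 / 2 : k) * LinearMap.trace k (OddSpace k 5) (σ * ψ) =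
      modelForm (modelRep σ s) t := by
  let f : Module.End k (OddSpace k 5) →ₗ[k] k :=
    (1 / 2 : k) • (LinearMap.trace k (OddSpace k 5) ∘ₗ LinearMap.mulRight k ψ)
  let g : Module.End k (OddSpace k 5) →ₗ[k] k := modelForm.flip t ∘ₗ modelRep.flip s
  have hf : ∀ σ, f σ = (1 / 2 : k) * LinearMap.trace k (OddSpace k 5) (σ * ψ) := fun σ => rfl
  have hg : ∀ σ, g σ = modelForm (modelRep σ s) t := fun σ => rfl
  -- Both sides are linear in σ, so it is enough to take σ = σ_{x,y}, where the trace is 2q(x, ψy).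
  have key : σ ∈ LinearMap.eqLocus f g := so_le_of_sigmaMap_mem (fun x y => by
    rw [LinearMap.mem_eqLocus, hf, hg, trace_sigmaMap_mul hψ, ← h, ← mul_assoc, one_div,
      inv_mul_cancel₀ two_ne_zero_of_char_five, one_mul]) hσ
  rw [LinearMap.mem_eqLocus, hf, hg] at key
  exact key

/-- Rescaling both arguments by r multiplies b by r² = 3, the factor of `modelForm_thetaMap`. So r
times the inverse of `thetaMap` is an isometry from the model to the spin module. -/
theorem spinForm_smul_smul (r : k) (hr : r * r = 3) (s t : SpinSpace k 5) :
    spinForm k 5 (r • s) (r • t) = modelForm (thetaMap s) (thetaMap t) := by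
  rw [modelForm_thetaMap, ← hr]
  simp only [spinForm, map_smul, smul_mul_assoc, mul_smul_comm, smul_eq_mul]
  ring

theorem isLieSuperalgebra_titsCayleyKac :
    IsLieSuperalgebra (titsCayleyKac k) (titsCayleyKacBracket k) :=
  IsLieSuperalgebra.of_field_smul (A := TitsCK k) (B := ckBracket (k := k)) ckBracket_apply
    (fun i j _ hX _ hY => ckPresentation.mem i j hX hY)
    (fun i j _ hX _ hY => ckPresentation.swap i j hX hY)
    (fun i j l _ hX _ hY _ hZ => ckPresentation.jacobi i j l hX hY hZ)



/-- The comparison map from the even part of the Tits construction to `so(W)`. -/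
def phiSo : titsCayleyKac k 0 →ₗ[k] soOdd k 5 where
  toFun x := ⟨phiEven x, phiEven_mem x.2⟩
  map_add' x y := Subtype.ext (phiEven.map_add x.1 y.1)
  map_smul' c x := Subtype.ext (phiEven.map_smul c x.1)

theorem phiSo_apply (x : titsCayleyKac k 0) : (phiSo x).1 = phiEven x := by
  rw [phiSo, LinearMap.coe_mk, AddHom.coe_mk]

theorem phiSo_bijective : Function.Bijective (phiSo (k := k)) := by
  refine ⟨fun x y h => ?_, fun φ => ?_⟩
  · refine Subtype.ext (eq_of_map_eq (fun X hX h => phiEven_injective hX h) x.2 y.2 ?_)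
    rw [← phiSo_apply, ← phiSo_apply, h]
  · obtain ⟨X, hX, h⟩ := phiEven_surjective φ.2
    refine ⟨⟨X, hX⟩, Subtype.ext ?_⟩
    rw [phiSo_apply, h]

/-- The even part of the Tits construction is `so(W)`. -/
def phiSoEquiv : titsCayleyKac k 0 ≃ₗ[k] soOdd k 5 := LinearEquiv.ofBijective phiSo phiSo_bijective

theorem phiSoEquiv_apply (x : titsCayleyKac k 0) : ((phiSoEquiv (k := k)) x).1 = phiEven (k := k) (x : TitsCK k) := by
  rw [phiSoEquiv, LinearEquiv.ofBijective_apply, phiSo_apply]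

/-- The comparison map on the odd part of the Tits construction. -/
def phiOddRestrict : titsCayleyKac k 1 →ₗ[k] SpinModel k := phiOdd.domRestrict (titsCayleyKac k 1)

theorem phiOddRestrict_apply (x : titsCayleyKac k 1) : phiOddRestrict x = phiOdd (k := k) (x : TitsCK k) := by
  rw [phiOddRestrict, LinearMap.domRestrict_apply]

theorem phiOddRestrict_bijective : Function.Bijective (phiOddRestrict (k := k)) := by
  refine ⟨fun x y h => ?_, fun s => ?_⟩
  · refine Subtype.ext (eq_of_map_eq (fun X hX h => phiOdd_injective hX h) x.2 y.2 ?_)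
    rw [← phiOddRestrict_apply, ← phiOddRestrict_apply, h]
  · obtain ⟨X, hX, h⟩ := phiOdd_surjective s
    refine ⟨⟨X, hX⟩, ?_⟩
    rw [phiOddRestrict_apply, h]

theorem thetaMap_symm (s : SpinModel k) : thetaMap (thetaEquiv.symm s) = s := by
  rw [← thetaEquiv_apply, LinearEquiv.apply_symm_apply]

theorem spinRep_thetaEquiv_symm (φ : soOdd k 5) (s : SpinModel k) :
    spinRep k 5 φ (thetaEquiv.symm s) = thetaEquiv.symm (modelRep φ.1 s) := by
  apply thetaEquiv.injective
  rw [thetaEquiv_apply, thetaMap_spinRep, thetaMap_symm, LinearEquiv.apply_symm_apply]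

/-- The isomorphism `s ↦ r θ⁻¹(s)` from the odd part of the Tits construction to the spin module. -/
def phiSpinEquiv (r : k) (hr : r ≠ 0) : titsCayleyKac k 1 ≃ₗ[k] SpinSpace k 5 :=
  (LinearEquiv.ofBijective phiOddRestrict phiOddRestrict_bijective ≪≫ₗ thetaEquiv.symm) ≪≫ₗ
    LinearEquiv.smulOfNeZero k (SpinSpace k 5) r hr

theorem phiSpinEquiv_apply (r : k) (hr : r ≠ 0) (x : titsCayleyKac k 1) :
    phiSpinEquiv r hr x = r • thetaEquiv.symm (phiOdd (k := k) (x : TitsCK k)) := by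
  rw [phiSpinEquiv, LinearEquiv.trans_apply, LinearEquiv.trans_apply, LinearEquiv.ofBijective_apply,
    phiOddRestrict_apply]
  rfl

theorem titsBracket_even_mem (x y : titsCayleyKac k 0) :
    titsCayleyKacBracket k 0 0 x y ∈ titsCayleyKac k 0 := by
  have h := ck_even_mem _ x.2 _ y.2
  rw [ckBracket_apply] at h
  exact h

theorem titsBracket_mixed_mem (x : titsCayleyKac k 0) (s : titsCayleyKac k 1) :
    titsCayleyKacBracket k 0 1 x s ∈ titsCayleyKac k 1 := by
  have h := ck_mixed_mem _ x.2 _ s.2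
  rw [ckBracket_apply] at h
  exact h

theorem titsBracket_odd_mem (s t : titsCayleyKac k 1) :
    titsCayleyKacBracket k 1 1 s t ∈ titsCayleyKac k 0 := by
  have h := ck_odd_mem _ s.2 _ t.2
  rw [ckBracket_apply] at h
  exact h

theorem phiEven_titsBracket (x y : titsCayleyKac k 0) :
    phiEven (k := k) (titsCayleyKacBracket k 0 0 x y) =
      phiEven (k := k) (x : TitsCK k) * phiEven (k := k) (y : TitsCK k) - phiEven (k := k) (y : TitsCK k) * phiEven (k := k) (x : TitsCK k) := by
  refine LinearMap.ext fun w => ?_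
  rw [← ckBracket_apply, ck_even_hom _ x.2 _ y.2, LinearMap.sub_apply, Module.End.mul_apply,
    Module.End.mul_apply]
  exact add_neg_one_smul _ _

theorem phiOdd_titsBracket (x : titsCayleyKac k 0) (s : titsCayleyKac k 1) :
    phiOdd (k := k) (titsCayleyKacBracket k 0 1 x s) =
      modelRep (k := k) (phiEven (k := k) (x : TitsCK k)) (phiOdd (k := k) (s : TitsCK k)) := by
  rw [← ckBracket_apply, ck_mixed_hom _ x.2 _ s.2]

theorem half_trace_phiEven (s t : titsCayleyKac k 1) (σ : soOdd k 5) :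
    (1 / 2 : k) * LinearMap.trace k (OddSpace k 5)
        (σ.1 * phiEven (k := k) (titsCayleyKacBracket k 1 1 s t)) =
      modelForm (modelRep σ.1 (phiOdd (k := k) (s : TitsCK k))) (phiOdd (k := k) (t : TitsCK k)) := by
  rw [← ckBracket_apply]
  exact half_trace_mul_eq (phiEven_mem (ck_odd_mem _ s.2 _ t.2)) (ck_odd_hom _ s.2 _ t.2) σ.2

theorem phiSoEquiv_titsBracket (x y : titsCayleyKac k 0) (h) :
    phiSoEquiv (k := k) ⟨titsCayleyKacBracket k 0 0 x y, h⟩ =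
      ⁅phiSoEquiv (k := k) x, phiSoEquiv (k := k) y⁆ := by
  refine Subtype.ext ?_
  rw [phiSoEquiv_apply, LieSubalgebra.coe_bracket, phiSoEquiv_apply, phiSoEquiv_apply,
    LieRing.of_associative_ring_bracket, phiEven_titsBracket]

theorem phiSpinEquiv_titsBracket (r : k) (hr : r ≠ 0) (x : titsCayleyKac k 0) (s : titsCayleyKac k 1) (h) :
    phiSpinEquiv r hr ⟨titsCayleyKacBracket k 0 1 x s, h⟩ =
      spinRep k 5 (phiSoEquiv (k := k) x) (phiSpinEquiv r hr s) := by
  rw [phiSpinEquiv_apply, phiSpinEquiv_apply, map_smul, spinRep_thetaEquiv_symm, phiSoEquiv_apply,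
    phiOdd_titsBracket]

theorem half_trace_titsBracket (r : k) (hr : r ≠ 0) (hr3 : r * r = 3) (s t : titsCayleyKac k 1) (h)
    (σ : soOdd k 5) : (1 / 2 : k) * LinearMap.trace k (OddSpace k 5)
        (σ.1 * (phiSoEquiv (k := k) ⟨titsCayleyKacBracket k 1 1 s t, h⟩).1) =
      spinForm k 5 (spinRep k 5 σ (phiSpinEquiv r hr s)) (phiSpinEquiv r hr t) := by
  rw [phiSoEquiv_apply, phiSpinEquiv_apply, phiSpinEquiv_apply, map_smul, spinRep_thetaEquiv_symm,
    spinForm_smul_smul r hr3, thetaMap_symm, thetaMap_symm, half_trace_phiEven]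

end Main

/-! ### Conclusion. -/

section MainTheorem

attribute [local irreducible] phiEven phiOdd ckBracket modelRep modelForm titsCayleyKac sigmaMap thetaMap

theorem theorem5p2 (k : Type*) [Field k] [IsAlgClosed k] [CharP k 5] :
    IsLieSuperalgebra (titsCayleyKac k) (titsCayleyKacBracket k) ∧
    ∃ (φ₀ : titsCayleyKac k 0 ≃ₗ[k] soOdd k 5) (φ₁ : titsCayleyKac k 1 ≃ₗ[k] SpinSpace k 5),
      (∀ x y : titsCayleyKac k 0,
        ∃ h : titsCayleyKacBracket k 0 0 x y ∈ titsCayleyKac k 0,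
          φ₀ ⟨titsCayleyKacBracket k 0 0 x y, h⟩ = ⁅φ₀ x, φ₀ y⁆) ∧
      (∀ (x : titsCayleyKac k 0) (s : titsCayleyKac k 1),
        ∃ h : titsCayleyKacBracket k 0 1 x s ∈ titsCayleyKac k 1,
          φ₁ ⟨titsCayleyKacBracket k 0 1 x s, h⟩ = spinRep k 5 (φ₀ x) (φ₁ s)) ∧
      (∀ s t : titsCayleyKac k 1,
        ∃ h : titsCayleyKacBracket k 1 1 s t ∈ titsCayleyKac k 0,
          ∀ σ : soOdd k 5,
            (1 / 2 : k) * LinearMap.trace k (OddSpace k 5)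
                (σ.1 * (φ₀ ⟨titsCayleyKacBracket k 1 1 s t, h⟩).1) =
              spinForm k 5 (spinRep k 5 σ (φ₁ s)) (φ₁ t)) := by
  -- The square root of 3 that turns the comparison on the odd part into an isometry. The first two
  -- properties of the isomorphisms do not depend on it.
  obtain ⟨r, hr⟩ := IsAlgClosed.exists_eq_mul_self (3 : k)
  have hr0 : r ≠ 0 := by
    rintro rfl
    have h3 : (2 : k) * 3 = 1 := by grind
    rw [hr, mul_zero, mul_zero] at h3
    exact zero_ne_one h3
  exact ⟨isLieSuperalgebra_titsCayleyKac, phiSoEquiv, phiSpinEquiv r hr0,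
    fun x y => ⟨titsBracket_even_mem x y, phiSoEquiv_titsBracket x y _⟩,
    fun x s => ⟨titsBracket_mixed_mem x s, phiSpinEquiv_titsBracket r hr0 x s _⟩,
    fun s t => ⟨titsBracket_odd_mem s t, half_trace_titsBracket r hr0 hr.symm s t _⟩⟩

end MainTheorem

end
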